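/- A labeled genus-zero cone spherical surface with angle vector $(\theta_1,\dots,\theta_n)$, $\theta_i>0$, is an oriented surface $\Sigma$ homeomorphic to $S^2$, with distinct labeled points $p_1,\dots,p_n$ and an intrinsic distance induced by a metric of constant curvature $1$ with conical singularities: for the induced complex structure there is, near every point of $\Sigma$, a centred holomorphic coordinate $z$ in which $ds=\dfrac{2\alpha|z|^{\alpha-1}|dz|}{1+|z|^{2\alpha}}$, with $\alpha=\theta_i$ at $p_i$ and $\alpha=1$ at every other point. Let $\mathcal{M}sph_{0,n}(\theta_1,\dots,\theta_n)$ be the set of such surfaces modulo orientation-preserving isometries respecting the labels, with the topology of the Lipschitz distance: $\Sigma,\Sigma'$ are close if there is a label- and orientation-preserving homeomorphism $f:\Sigma\to\Sigma'$ with $f$ and $f^{-1}$ both $e^{\varepsilon}$-Lipschitz, $\varepsilon$ small. The football $S_\theta$ is the unit sphere, with colatitude $\phi$ and longitude $\psi$, endowed with the metric $d\phi^2+\theta^2\sin^2\!\phi\,d\psi^2$; its cone points are the two poles. **Theorem.** 1. If $\theta_1,\theta_2>0$ are different from $1$ and $\theta_1\ne\theta_2$, then $\mathcal{M}sph_{0,2}(\theta_1,\theta_2)$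 is empty. 2. If $\theta>0$ is not an integer, then $\mathcal{M}sph_{0,2}(\theta,\theta)$ is a single point, and every surface in it is isometric to the football $S_\theta$, with $p_1,p_2$ corresponding to the two poles. 3. If $m\ge 2$ is an integer, then there is a homeomorphism $\Phi:(0,\pi/2]\to\mathcal{M}sph_{0,2}(m,m)$ such that every surface $\Sigma$ representing $\Phi(t)$ has the following properties. The distance of its two cone points is $l=2t\in(0,\pi]$. There is an $m$-sheeted covering $D:\Sigma\to S^2$ of the unit sphere, branched exactly at $p_1$ and $p_2$, which is a local isometry elsewhere; $p_1$ and $p_2$ are the only points over $D(p_1)$ and $D(p_2)$, and these two points of $S^2$ are at spherical distance $l$. If $t<\pi/2$, then $\Sigma$ is obtained by cyclically gluing $m$ copies of the unit sphere slit along the same geodesic segment of length $l\in(0,\pi)$, with $p_1,p_2$ the end points of the slits and $D$ the projection of the copies to $S^2$. If $t=\pi/2$, then $\Sigma$ is isometric to the football $S_m$, with $p_1,p_2$ corresponding to the two poles. -/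

import Mathlib

open scoped Manifold ContDiff Topology
open Real

noncomputable section

namespace ConeSpherical

/-- The unit sphere in Euclidean three-space. -/
abbrev S2 : Type := Metric.sphere (0 : EuclideanSpace ℝ (Fin 3)) 1

/-- The point of the unit sphere with longitude `ψ` and colatitude `φ`. -/
def sph (ψ φ : ℝ) : S2 :=
  ⟨!₂[cos ψ * sin φ, sin ψ * sin φ, cos φ], by
    rw [mem_sphere_zero_iff_norm, EuclideanSpace.norm_eq, Real.sqrt_eq_one]
    simp only [Fin.sum_univ_three, Real.norm_eq_abs, sq_abs]
    simp only [Matrix.cons_val_zero, Matrix.cons_val_one, Matrix.cons_val]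
    nlinarith [Real.sin_sq_add_cos_sq ψ, Real.sin_sq_add_cos_sq φ]⟩

/-- The spherical (geodesic) distance on the unit sphere. -/
def sphDist (u v : S2) : ℝ :=
  InnerProductGeometry.angle (u : EuclideanSpace ℝ (Fin 3)) (v : EuclideanSpace ℝ (Fin 3))

/-- The distance function of the metric `dρ² + α² sin² ρ dτ²` (`τ ∈ ℝ / 2πℤ`), the spherical cone
of total angle `2πα`, in geodesic polar coordinates: `ρ₁, ρ₂ ∈ [0, π]` are the distances of two
points to the apex, and `δ ∈ [0, π]` is the distance of their coordinates `τ` on the circle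
`ℝ / 2πℤ`, so that the two rays span the angle `α δ`. A minimizing path passes through an apex when
this angle is at least `π`; otherwise the spherical law of cosines applies. -/
def polarConeDist (α ρ₁ ρ₂ δ : ℝ) : ℝ :=
  arccos (cos ρ₁ * cos ρ₂ + sin ρ₁ * sin ρ₂ * cos (min (α * δ) π))

/-- The distance function, near `0`, of the conformal metric
`ds = 2 α |z| ^ (α - 1) |dz| / (1 + |z| ^ (2 α))` on `ℂ`. In this coordinate the distance to the
apex is `ρ = 2 arctan (|z| ^ α)`, and the metric is `dρ² + α² sin² ρ dτ²` with `τ = arg z`. -/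
def coneDist (α : ℝ) (z w : ℂ) : ℝ :=
  polarConeDist α (2 * arctan (‖z‖ ^ α)) (2 * arctan (‖w‖ ^ α)) (InnerProductGeometry.angle z w)

/-- A point `x` of a Riemann surface carrying a distance is a point of cone angle `2πα` of a
spherical metric (a smooth point if `α = 1`): in some holomorphic coordinate `z` centred at `x` the
distance is, near `x`, that of `ds = 2 α |z| ^ (α - 1) |dz| / (1 + |z| ^ (2 α))`. -/
def HasConeAngle {X : Type} [MetricSpace X] [ChartedSpace ℂ X] (x : X) (α : ℝ) : Prop :=
  ∃ z ∈ IsManifold.maximalAtlas 𝓘(ℂ) ω X, x ∈ z.source ∧ z x = 0 ∧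
    ∃ r > 0, Metric.ball x r ⊆ z.source ∧
      ∀ a ∈ Metric.ball x r, ∀ b ∈ Metric.ball x r, dist a b = coneDist α (z a) (z b)

/-- A labeled cone spherical surface of genus zero with angle vector `θ`: a Riemann surface
homeomorphic to the sphere, with an intrinsic (geodesic) distance and distinct labeled points
`p i`, which is locally a spherical cone of angle `2π θ i` at `p i` and locally spherical
elsewhere. The complex structure is the one induced by the metric and the orientation. -/
structure Surface {n : ℕ} (θ : Fin n → ℝ) : Type 1 where
  carrier : Type
  [metricSpace : MetricSpace carrier]
  [chartedSpace : ChartedSpace ℂ carrier]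
  [isManifold : IsManifold 𝓘(ℂ) ω carrier]
  genus_zero : Nonempty (carrier ≃ₜ S2)
  geodesic : ∀ x y : carrier, ∃ γ : ℝ → carrier, γ 0 = x ∧ γ (dist x y) = y ∧
    ∀ s ∈ Set.Icc 0 (dist x y), ∀ t ∈ Set.Icc 0 (dist x y), dist (γ s) (γ t) = |s - t|
  p : Fin n → carrier
  p_injective : Function.Injective p
  cone : ∀ i, HasConeAngle (p i) (θ i)
  smooth : ∀ x, x ∉ Set.range p → HasConeAngle x 1

attribute [instance] Surface.metricSpace Surface.chartedSpace Surface.isManifold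

/-- Equivalence with label: there is an orientation-preserving (that is, biholomorphic) isometry
respecting the labels. -/
def Surface.Equivalent {n : ℕ} {θ : Fin n → ℝ} (A B : Surface θ) : Prop :=
  ∃ f : A.carrier ≃ᵢ B.carrier, MDifferentiable 𝓘(ℂ) 𝓘(ℂ) f ∧ MDifferentiable 𝓘(ℂ) 𝓘(ℂ) f.symm ∧
    ∀ i, f (A.p i) = B.p i

instance Surface.setoid {n : ℕ} (θ : Fin n → ℝ) : Setoid (Surface θ) where
  r := Surface.Equivalent
  iseqv :=
    { refl := fun A => ⟨IsometryEquiv.refl _, mdifferentiable_id, mdifferentiable_id, fun _ => rfl⟩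
      symm := fun ⟨f, h, h', hp⟩ => ⟨f.symm, h', h, fun i => by rw [← hp i]; simp⟩
      trans := fun ⟨f, h, h', hp⟩ ⟨g, k, k', kp⟩ =>
        ⟨f.trans g, k.comp h, h'.comp k', fun i => by simp [hp i, kp i]⟩ }

/-- The labeled moduli space of genus zero cone spherical surfaces with angle vector `θ`. -/
def Msph {n : ℕ} (θ : Fin n → ℝ) : Type 1 := Quotient (Surface.setoid θ)

/-- The class of a labeled surface. -/
def Surface.cls {n : ℕ} {θ : Fin n → ℝ} (A : Surface θ) : Msph θ := Quotient.mk (Surface.setoid θ) A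

/-- `h` has local degree `+1` at `z`: on every small circle around `z`, traversed once
counterclockwise, `h - h z` does not vanish and has winding number `+1` around `0`. -/
def LocalDegreeOne (h : ℂ → ℂ) (z : ℂ) : Prop :=
  ∀ᶠ ε : ℝ in 𝓝[>] 0, ∃ R ψ : ℝ → ℝ, Continuous R ∧ Continuous ψ ∧ (∀ t, 0 < R t) ∧
    (∀ t, ψ (t + 2 * π) = ψ t + 2 * π) ∧
    ∀ t : ℝ, h (z + ε * Complex.exp (t * Complex.I)) = h z + R t * Complex.exp (ψ t * Complex.I)

/-- Orientation-preserving maps between Riemann surfaces (used for homeomorphisms): the local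
degree, read in holomorphic charts, is `+1` at every point. -/
def OrientationPreserving {X Y : Type} [TopologicalSpace X] [ChartedSpace ℂ X]
    [TopologicalSpace Y] [ChartedSpace ℂ Y] (f : X → Y) : Prop :=
  ∀ x, LocalDegreeOne (fun z => chartAt ℂ (f x) (f ((chartAt ℂ x).symm z))) (chartAt ℂ x x)

/-- The Lipschitz distance of `A` and `B` is at most `ε`, realized by a map: some label-preserving,
orientation-preserving homeomorphism is bi-Lipschitz with constant `exp ε`. -/
def Surface.LipClose {n : ℕ} {θ : Fin n → ℝ} (ε : ℝ) (A B : Surface θ) : Prop :=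
  ∃ f : A.carrier ≃ₜ B.carrier, OrientationPreserving f ∧ (∀ i, f (A.p i) = B.p i) ∧
    ∀ x y, dist (f x) (f y) ≤ exp ε * dist x y ∧ dist x y ≤ exp ε * dist (f x) (f y)

/-- The topology of the Lipschitz distance on the moduli space. -/
instance {n : ℕ} (θ : Fin n → ℝ) : TopologicalSpace (Msph θ) where
  IsOpen U := ∀ A : Surface θ, A.cls ∈ U → ∃ ε > 0, ∀ B : Surface θ, A.LipClose ε B → B.cls ∈ U
  isOpen_univ := fun _ _ => ⟨1, one_pos, fun _ _ => trivial⟩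
  isOpen_inter := by
    intro U V hU hV A hA
    obtain ⟨ε, hε, h⟩ := hU A hA.1
    obtain ⟨δ, hδ, k⟩ := hV A hA.2
    refine ⟨min ε δ, lt_min hε hδ, fun B ⟨f, ho, hp, hd⟩ => ⟨h B ⟨f, ho, hp, fun x y => ?_⟩,
      k B ⟨f, ho, hp, fun x y => ?_⟩⟩⟩
    · have := exp_le_exp.2 (min_le_left ε δ)
      exact ⟨(hd x y).1.trans (by gcongr), (hd x y).2.trans (by gcongr)⟩
    · have := exp_le_exp.2 (min_le_right ε δ)
      exact ⟨(hd x y).1.trans (by gcongr), (hd x y).2.trans (by gcongr)⟩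
  isOpen_sUnion := by
    intro s hs A hA
    obtain ⟨U, hU, hAU⟩ := hA
    obtain ⟨ε, hε, h⟩ := hs U hU A hAU
    exact ⟨ε, hε, fun B hB => ⟨U, hU, h B hB⟩⟩

/-- The distance of the football of angle `2πθ`, that is, of the metric `dφ² + θ² sin² φ dψ²` on
the unit sphere with colatitude `φ` and longitude `ψ`. -/
def footballDist (θ : ℝ) (u v : S2) : ℝ :=
  polarConeDist θ (arccos (u.1 2)) (arccos (v.1 2))
    (InnerProductGeometry.angle (⟨u.1 0, u.1 1⟩ : ℂ) (⟨v.1 0, v.1 1⟩ : ℂ))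

/-- `A` is isometric to the football of angle `2πθ`, its two cone points being the poles. -/
def Surface.IsFootball {θ' : Fin 2 → ℝ} (A : Surface θ') (θ : ℝ) : Prop :=
  ∃ e : A.carrier ≃ₜ S2, e (A.p 0) = sph 0 0 ∧ e (A.p 1) = sph 0 π ∧
    ∀ x y, dist x y = footballDist θ (e x) (e y)

/-- `D` is an `m`-sheeted covering of the unit sphere, branched at the two cone points, which lie
over the north pole and over a point at distance `l` from it, and a local isometry elsewhere. -/
structure Surface.IsBranchedCover {θ : Fin 2 → ℝ} (A : Surface θ) (m : ℕ) (l : ℝ)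
    (D : A.carrier → S2) : Prop where
  continuous : Continuous D
  fiber_zero : D ⁻¹' {sph 0 0} = {A.p 0}
  fiber_one : D ⁻¹' {sph 0 l} = {A.p 1}
  covering : IsCoveringMapOn D ({sph 0 0, sph 0 l}ᶜ)
  sheets : ∀ y ∈ ({sph 0 0, sph 0 l}ᶜ : Set S2), (D ⁻¹' {y}).ncard = m
  isometric : ∀ x, x ∉ Set.range A.p → ∃ r > 0, ∀ a ∈ Metric.ball x r, ∀ b ∈ Metric.ball x r,
    sphDist (D a) (D b) = dist a b

/-- Coordinates `(ψ, φ)` on the unit sphere cut open along the meridian `ψ = 0`. -/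
abbrev CutSphere : Type := Set.Icc (0 : ℝ) (2 * π) × Set.Icc (0 : ℝ) π

/-- The identifications in the cyclic gluing of `m` unit spheres, each of them slit along the
geodesic segment `ψ = 0, φ ∈ [0, l]` from the north pole. -/
inductive SlitStep (m : ℕ) (l : ℝ) : ZMod m × CutSphere → ZMod m × CutSphere → Prop
  /-- the north pole of each copy is one point -/
  | north (k : ZMod m) (x y : CutSphere) (hx : (x.2 : ℝ) = 0) (hy : (y.2 : ℝ) = 0) :
      SlitStep m l (k, x) (k, y)
  /-- the south pole of each copy is one point -/
  | south (k : ZMod m) (x y : CutSphere) (hx : (x.2 : ℝ) = π) (hy : (y.2 : ℝ) = π) :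
      SlitStep m l (k, x) (k, y)
  /-- beyond the slit each copy closes up along the meridian -/
  | close (k : ZMod m) (x y : CutSphere) (hx : (x.1 : ℝ) = 2 * π) (hy : (y.1 : ℝ) = 0)
      (hxy : x.2 = y.2) (hl : l ≤ (x.2 : ℝ)) : SlitStep m l (k, x) (k, y)
  /-- along the slit the last bank of each copy is glued to the first bank of the next copy -/
  | glue (k : ZMod m) (x y : CutSphere) (hx : (x.1 : ℝ) = 2 * π) (hy : (y.1 : ℝ) = 0)
      (hxy : x.2 = y.2) (hl : (x.2 : ℝ) ≤ l) : SlitStep m l (k, x) (k + 1, y)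

/-- `A` is the cyclic gluing of `m` unit spheres with a slit of length `l`, the end points of the
slits being the two cone points; `D` is the projection of the copies to the unit sphere, and it is
a local isometry away from the cone points. -/
def Surface.IsCyclicSlitGluing {θ : Fin 2 → ℝ} (A : Surface θ) (m : ℕ) (l : ℝ)
    (D : A.carrier → S2) : Prop :=
  (∃ F : ZMod m → CutSphere → A.carrier,
    (∀ k, Continuous (F k)) ∧
    (∀ a, ∃ k x, F k x = a) ∧
    (∀ k x k' x', F k x = F k' x' ↔ Relation.EqvGen (SlitStep m l) (k, x) (k', x')) ∧
    (∀ k x, (x.2 : ℝ) = 0 → F k x = A.p 0) ∧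
    (∀ k x, (x.1 : ℝ) = 0 → (x.2 : ℝ) = l → F k x = A.p 1) ∧
    (∀ k x, D (F k x) = sph x.1 x.2)) ∧
  ∀ x, x ∉ Set.range A.p → ∃ r > 0, ∀ a ∈ Metric.ball x r, ∀ b ∈ Metric.ball x r,
    sphDist (D a) (D b) = dist a b

end ConeSpherical

end

noncomputable section

namespace ConeSpherical

/-! ### Spherical trigonometry -/

/-! Every surface is compared with an explicit model. For `ModelPar θ c` the model is the Riemann
sphere with the length metric of `density θ c`, the pull-back of the round metric by u ↦ N(u ^ θ)
with N(ζ) = ζ / (1 + cζ); its cone points are 0 and ∞. If c = 0, only |u| ^ θ matters, every θ > 0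
is allowed, and the model is the football. If c ≠ 0, the power has to be single-valued, so θ is an
integer m, and c = cot(l/2) puts the images of the cone points at distance l.

The core is `Surface.exists_model`: a surface with two cone points has equal angles and is isometric
to a model by a biholomorphic map. On the complement of the cone points, isometric coordinates
differ by rotations (`exists_rot_of_isometric`). This complement is covered by the plane, where the
cocycle of these rotations is a coboundary (`exists_coboundary`); the result is a developing map
with a monodromy rotation g (`Surface.exists_developing`). Near a cone point it is a rotation of a
branch of the θ-th power of the cone coordinate, so it has a well-defined value there, which g fixes
(`ConeNbhd.exists_value`, `ConeNbhd.fix_value`). If the two values differ, a Möbius map M moves them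
to 0 and ∞ and conjugates g to multiplication by a unit (`IsRot.exists_conj`). When the values are
not antipodal, g = 1 and both angles are integers (`ConeNbhd.exists_nat_eq`).

Then d log(M ∘ dev) is a one-form on the surface without zeros and with simple poles: one at each
cone point, with residues θ and −θ', the others with residues ±1. The dual vector field is complete
(`exists_flow`), a single orbit fills the complement of the poles (`flow_range`), and the period of
the flow is determined by any one pole (`IsPole.flow_eq_iff`). Hence two different poles have
opposite residues (`IsPole.eq_neg`). So there is no third pole and θ = θ'; equal values at the cone
points are excluded as well, since they would produce two positive residues. The flow identifies the
surface with the Riemann sphere (`exists_sphere_homeo`) and its distance with that of the model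
(`exists_model_isometry`). This argument takes the place of uniformization and of the residue
theorem.

The length metric is defined dually: `confDist` is the supremum of |f x − f y| over functions of
local dilation at most 1. The triangle inequality and the dependence on the density are then
immediate; near the centre of a cone coordinate it is the cone distance (`IsConf.confDist_eq`), and
midpoints exist (`IsConf.confDist_midpoint`), hence geodesics. Local isometries are globalized along
geodesics by `dist_le_of_local`.

For θ = m the developing map of the model is explicit, which gives the branched covering and the
gluing (`modelSurface_isBranchedCover`, `modelSurface_isCyclicSlitGluing`). The distance l of the
cone points (`ModelPar.confDist_zero_infty`) is a global coordinate of the moduli space: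
Lipschitz-close surfaces have close l, and nearby models are Lipschitz-close by the identity map
(`ModelPar.lipClose`). -/

/-- The third side of a spherical triangle with sides `ρ₁`, `ρ₂` enclosing the angle `A`. -/
def sideOf (ρ₁ ρ₂ A : ℝ) : ℝ := arccos (cos ρ₁ * cos ρ₂ + sin ρ₁ * sin ρ₂ * cos A)

lemma inner_sph (ψ φ ψ' φ' : ℝ) :
    inner ℝ (sph ψ φ : EuclideanSpace ℝ (Fin 3)) (sph ψ' φ' : EuclideanSpace ℝ (Fin 3)) =
      cos φ * cos φ' + sin φ * sin φ' * cos (ψ - ψ') := by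
  rw [cos_sub]
  simp [sph, PiLp.inner_apply, Fin.sum_univ_three]
  ring

lemma norm_sphere (u : S2) : ‖(u : EuclideanSpace ℝ (Fin 3))‖ = 1 := by simp

lemma sphDist_sph (ψ φ ψ' φ' : ℝ) :
    sphDist (sph ψ φ) (sph ψ' φ') = sideOf φ φ' (ψ - ψ') := by
  rw [sphDist, InnerProductGeometry.angle, inner_sph, norm_sphere, norm_sphere, sideOf]
  simp

lemma sphDist_triangle (u v w : S2) : sphDist u w ≤ sphDist u v + sphDist v w :=
  InnerProductGeometry.angle_le_angle_add_angle _ _ _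

lemma sideOf_mem (ρ₁ ρ₂ A : ℝ) :
    cos ρ₁ * cos ρ₂ + sin ρ₁ * sin ρ₂ * cos A ∈ Set.Icc (-1 : ℝ) 1 := by
  have h := inner_sph A ρ₁ 0 ρ₂
  rw [sub_zero] at h
  rw [← h]
  have := abs_real_inner_le_norm (sph A ρ₁ : EuclideanSpace ℝ (Fin 3)) (sph 0 ρ₂)
  rw [norm_sphere, norm_sphere, mul_one, abs_le] at this
  exact this

lemma cos_sideOf (ρ₁ ρ₂ A : ℝ) :
    cos (sideOf ρ₁ ρ₂ A) = cos ρ₁ * cos ρ₂ + sin ρ₁ * sin ρ₂ * cos A :=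
  cos_arccos (sideOf_mem ρ₁ ρ₂ A).1 (sideOf_mem ρ₁ ρ₂ A).2

lemma sideOf_comm (ρ₁ ρ₂ A : ℝ) : sideOf ρ₁ ρ₂ A = sideOf ρ₂ ρ₁ A := by
  unfold sideOf
  congr 1
  ring

lemma sideOf_zero_angle {ρ₁ ρ₂ : ℝ} (h₁ : ρ₁ ∈ Set.Icc 0 π) (h₂ : ρ₂ ∈ Set.Icc 0 π) :
    sideOf ρ₁ ρ₂ 0 = |ρ₁ - ρ₂| := by
  rw [sideOf, cos_zero, mul_one, ← cos_sub, ← cos_abs]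
  refine arccos_cos (abs_nonneg _) (abs_le.2 ⟨?_, ?_⟩) <;> linarith [h₁.1, h₁.2, h₂.1, h₂.2]

lemma sideOf_mono {ρ₁ ρ₂ A B : ℝ} (h₁ : ρ₁ ∈ Set.Icc 0 π) (h₂ : ρ₂ ∈ Set.Icc 0 π)
    (hA : 0 ≤ A) (hAB : A ≤ B) (hB : B ≤ π) : sideOf ρ₁ ρ₂ A ≤ sideOf ρ₁ ρ₂ B := by
  apply arccos_le_arccos
  have := cos_le_cos_of_nonneg_of_le_pi hA hB hAB
  have := mul_nonneg (sin_nonneg_of_mem_Icc h₁) (sin_nonneg_of_mem_Icc h₂)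
  nlinarith

/-- The round sphere gives the inequality when the two angles add up to `C` exactly: the three
points lie on the meridians `C`, `C - min A C` and 0. Enlarging these angles to `A` and `B` only
increases the right-hand side. The slack `C ≤ A + B` is what truncated cone angles satisfy. -/
lemma sideOf_triangle {ρ₁ ρ₂ ρ₃ A B C : ℝ} (h₁ : ρ₁ ∈ Set.Icc 0 π) (h₂ : ρ₂ ∈ Set.Icc 0 π)
    (h₃ : ρ₃ ∈ Set.Icc 0 π) (hA : A ∈ Set.Icc 0 π) (hB : B ∈ Set.Icc 0 π) (hC : C ∈ Set.Icc 0 π)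
    (h : C ≤ A + B) : sideOf ρ₁ ρ₃ C ≤ sideOf ρ₁ ρ₂ A + sideOf ρ₂ ρ₃ B := by
  have key : sideOf ρ₁ ρ₃ C ≤ sideOf ρ₁ ρ₂ (min A C) + sideOf ρ₂ ρ₃ (C - min A C) := by
    have := sphDist_triangle (sph C ρ₁) (sph (C - min A C) ρ₂) (sph 0 ρ₃)
    simpa only [sphDist_sph, sub_zero, sub_sub_cancel] using this
  refine key.trans (add_le_add (sideOf_mono h₁ h₂ (le_min hA.1 hC.1) (min_le_left _ _) hA.2)
    (sideOf_mono h₂ h₃ (sub_nonneg.2 (min_le_right _ _)) ?_ hB.2))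
  rcases min_cases A C with ⟨h', _⟩ | ⟨h', _⟩ <;> rw [h'] <;> linarith [hB.1]

/-- The midpoint of two unit vectors with inner product `c` is their sum divided by its norm √(2 +
2c); the quotient on the left is its inner product with either of them. -/
lemma arccos_half_aux {c : ℝ} (h : 0 < 1 + c) (h1 : c ≤ 1) :
    arccos ((1 + c) / √(2 + 2 * c)) = arccos c / 2 := by
  rw [← arccos_cos (x := arccos c / 2) (by linarith [arccos_nonneg c])
    (by linarith [arccos_le_pi c, pi_pos]),
    cos_half (by linarith [arccos_nonneg c, pi_pos]) (arccos_le_pi c),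
    cos_arccos (by linarith) h1]
  congr 1
  rw [div_eq_iff (sqrt_pos.2 (by linarith)).ne', ← sqrt_mul (by linarith),
    show (1 + c) / 2 * (2 + 2 * c) = (1 + c) ^ 2 by ring, sqrt_sq h.le]

/-- The midpoint is the normalized sum of the two unit vectors; (X, Y, Z) is this sum for points of
longitude 0 and `A`, and `β` is its longitude. The clause about `A = π` is for cones, where an angle
truncated at π stands for a path through an apex: the midpoint then has to lie on one of the two
rays. -/
lemma exists_sideOf_midpoint {ρ₁ ρ₂ A : ℝ} (h₁ : ρ₁ ∈ Set.Icc 0 π) (h₂ : ρ₂ ∈ Set.Icc 0 π)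
    (hA : A ∈ Set.Icc 0 π) :
    ∃ ρ ∈ Set.Icc 0 π, ∃ β ∈ Set.Icc 0 A, (A = π → β = 0 ∨ β = π) ∧
      sideOf ρ₁ ρ β = sideOf ρ₁ ρ₂ A / 2 ∧ sideOf ρ ρ₂ (A - β) = sideOf ρ₁ ρ₂ A / 2 := by
  have hs₁ := sin_nonneg_of_mem_Icc h₁
  have hs₂ := sin_nonneg_of_mem_Icc h₂
  have hsA := sin_nonneg_of_mem_Icc hA
  obtain ⟨hc1, hc2⟩ := sideOf_mem ρ₁ ρ₂ A
  have e₁ := sin_sq_add_cos_sq ρ₁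
  have e₂ := sin_sq_add_cos_sq ρ₂
  have eA := sin_sq_add_cos_sq A
  set c := cos ρ₁ * cos ρ₂ + sin ρ₁ * sin ρ₂ * cos A with hc
  set X := sin ρ₁ + sin ρ₂ * cos A with hX
  set Y := sin ρ₂ * sin A with hY
  set Z := cos ρ₁ + cos ρ₂ with hZ
  have hsum : X ^ 2 + Y ^ 2 + Z ^ 2 = 2 + 2 * c := by
    rw [hX, hY, hZ, hc]; linear_combination e₁ + e₂ + sin ρ₂ ^ 2 * eA
  have hside : sideOf ρ₁ ρ₂ A = arccos c := rfl
  clear_value c X Y Z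
  rcases lt_or_eq_of_le hc1 with hlt | heq
  · have hn0 : 0 < √(2 + 2 * c) := sqrt_pos.2 (by linarith)
    set n := √(2 + 2 * c) with hn
    have hn2 : n ^ 2 = 2 + 2 * c := sq_sqrt (by linarith)
    clear_value n
    set z : ℂ := ⟨X, Y⟩ with hz
    have hzn : ‖z‖ ^ 2 = X ^ 2 + Y ^ 2 := by
      rw [Complex.sq_norm, Complex.normSq_apply]; ring
    have hzc : ‖z‖ * cos z.arg = X := Complex.norm_mul_cos_arg z
    have hzs : ‖z‖ * sin z.arg = Y := Complex.norm_mul_sin_arg z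
    have hZn : |Z| ≤ n := abs_le_of_sq_le_sq (by nlinarith [sq_nonneg X, sq_nonneg Y]) hn0.le
    rw [abs_le] at hZn
    have hcos : cos (arccos (Z / n)) = Z / n :=
      cos_arccos (by rw [le_div_iff₀ hn0]; linarith) (by rw [div_le_iff₀ hn0]; linarith)
    have hsin : sin (arccos (Z / n)) = ‖z‖ / n := by
      have h0 : 1 - (Z / n) ^ 2 = (‖z‖ / n) ^ 2 := by
        field_simp
        linear_combination hn2 - hsum - hzn
      rw [sin_arccos, h0, sqrt_sq (by positivity)]
    have hβ0 : 0 ≤ z.arg := 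
      Complex.arg_nonneg_iff.2 (show 0 ≤ Y by rw [hY]; exact mul_nonneg hs₂ hsA)
    have hβπ := Complex.arg_le_pi z
    refine ⟨arccos (Z / n), ⟨arccos_nonneg _, arccos_le_pi _⟩, z.arg, ⟨hβ0, ?_⟩, ?_, ?_, ?_⟩
    · by_contra! hlt'
      have hz0 : 0 < ‖z‖ := by
        rcases (norm_nonneg z).lt_or_eq with h | h
        · exact h
        · rw [norm_eq_zero.1 h.symm, Complex.arg_zero] at hlt'
          linarith [hA.1]
      -- The sum stays in the sector between the two longitudes: its component transverse to the ray
      -- `A` comes from the first point alone and is not positive.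
      have h3 : ‖z‖ * sin (z.arg - A) = - (sin ρ₁ * sin A) := by
        rw [sin_sub]; linear_combination cos A * hzs - sin A * hzc + cos A * hY - sin A * hX
      rcases lt_or_eq_of_le (show z.arg - A ≤ π by linarith [hA.1]) with h | h
      · have := mul_pos hz0 (sin_pos_of_pos_of_lt_pi (by linarith) h)
        nlinarith
      · have hA0 : A = 0 := by linarith [hA.1]
        have hπ : z.arg = π := by linarith
        rw [hπ, cos_pi] at hzc
        have : 0 ≤ X := by rw [hX, hA0, cos_zero]; linarith
        linarith
    · intro hAπ
      rcases (norm_nonneg z).lt_or_eq with h | h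
      · have hs : sin z.arg = 0 := by
          have : Y = 0 := by rw [hY, hAπ, sin_pi, mul_zero]
          rw [this] at hzs
          exact (mul_eq_zero.1 hzs).resolve_left h.ne'
        rcases hβπ.lt_or_eq with h' | h'
        · rcases hβ0.lt_or_eq with h'' | h''
          · exact absurd hs (sin_pos_of_pos_of_lt_pi h'' h').ne'
          · exact .inl h''.symm
        · exact .inr h'
      · left; rw [norm_eq_zero.1 h.symm, Complex.arg_zero]
    · rw [sideOf, hcos, hsin, hside, ← arccos_half_aux (by linarith) hc2]
      congr 1
      rw [← hn]
      field_simp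
      linear_combination sin ρ₁ * hzc + e₁ + cos ρ₁ * hZ + sin ρ₁ * hX - hc
    · rw [sideOf, hcos, hsin, hside, ← arccos_half_aux (by linarith) hc2, cos_sub]
      congr 1
      rw [← hn]
      field_simp
      linear_combination sin ρ₂ * cos A * hzc + sin ρ₂ * sin A * hzs + sin ρ₂ ^ 2 * eA + e₂ +
        cos ρ₂ * hZ + sin ρ₂ * cos A * hX + sin ρ₂ * sin A * hY - hc
  -- Antipodal points: the sum vanishes, and a midpoint is chosen by hand on a great circle through
  -- both.
  · have hX0 : X = 0 := by nlinarith [sq_nonneg X, sq_nonneg Y, sq_nonneg Z]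
    have hY0 : sin ρ₂ * sin A = 0 := by nlinarith [sq_nonneg X, sq_nonneg Y, sq_nonneg Z]
    have hZ0 : Z = 0 := by nlinarith [sq_nonneg X, sq_nonneg Y, sq_nonneg Z]
    have hhalf : sideOf ρ₁ ρ₂ A / 2 = arccos 0 := by
      rw [hside, ← heq, arccos_neg_one, arccos_zero]
    rw [hhalf]
    by_cases hs : sin ρ₁ = 0
    · have hs2 : sin ρ₂ = 0 := by
        have : sin ρ₂ * cos A = 0 := by linarith
        have : sin ρ₂ ^ 2 = 0 := by
          linear_combination (sin ρ₂ * cos A) * this + sin ρ₂ * sin A * hY0 - sin ρ₂ ^ 2 * eA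
        exact pow_eq_zero_iff two_ne_zero |>.1 this
      refine ⟨π / 2, ⟨by positivity, by linarith [pi_pos]⟩, 0, ⟨le_rfl, hA.1⟩, fun _ => .inl rfl,
        ?_, ?_⟩ <;> simp [sideOf, hs, hs2]
    · have hs2 : sin ρ₂ ≠ 0 := fun h => hs (by rw [hX, h] at hX0; linarith)
      have hsA0 : sin A = 0 := (mul_eq_zero.1 hY0).resolve_left hs2
      have hAπ : A = π := by
        rcases hA.2.lt_or_eq with h | h
        · rcases hA.1.lt_or_eq with h' | h'
          · exact absurd hsA0 (sin_pos_of_pos_of_lt_pi h' h).ne'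
          · rw [← h', cos_zero] at hX
            exact absurd (by linarith) hs
        · exact h
      have hc2 : cos ρ₂ = - cos ρ₁ := by linarith
      have hs2 : sin ρ₂ = sin ρ₁ := by rw [hAπ, cos_pi] at hX; linarith
      rcases le_total (π / 2) ρ₁ with h | h
      · refine ⟨ρ₁ - π / 2, ⟨by linarith, by linarith [h₁.2, pi_pos]⟩, 0, ⟨le_rfl, hA.1⟩,
          fun _ => .inl rfl, ?_, ?_⟩ <;> unfold sideOf <;> congr 1 <;>
          simp only [cos_sub_pi_div_two, sin_sub_pi_div_two, hc2, hs2, hAπ, sub_zero, cos_pi,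
            cos_zero] <;> ring
      · refine ⟨π / 2 - ρ₁, ⟨by linarith, by linarith [h₁.1, pi_pos]⟩, π, ⟨pi_pos.le, hAπ.ge⟩,
          fun _ => .inr rfl, ?_, ?_⟩ <;> unfold sideOf <;> congr 1 <;>
          simp only [cos_pi_div_two_sub, sin_pi_div_two_sub, hc2, hs2, hAπ, sub_self, cos_pi,
            cos_zero] <;> ring

lemma polarConeDist_eq (α ρ₁ ρ₂ δ : ℝ) :
    polarConeDist α ρ₁ ρ₂ δ = sideOf ρ₁ ρ₂ (min (α * δ) π) := rfl

lemma cos_two_arctan (x : ℝ) : cos (2 * arctan x) = (1 - x ^ 2) / (1 + x ^ 2) := by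
  rw [cos_two_mul, cos_sq_arctan]; field_simp; ring

lemma sin_two_arctan (x : ℝ) : sin (2 * arctan x) = 2 * x / (1 + x ^ 2) := by
  rw [sin_two_mul, sin_arctan, cos_arctan]
  have : √(1 + x ^ 2) * √(1 + x ^ 2) = 1 + x ^ 2 := mul_self_sqrt (by positivity)
  field_simp
  linear_combination -x * this

/-- The chordal formula for the spherical distance in a stereographic coordinate. -/
lemma coneDist_one (z w : ℂ) :
    coneDist 1 z w = arccos (1 - 2 * ‖z - w‖ ^ 2 / ((1 + ‖z‖ ^ 2) * (1 + ‖w‖ ^ 2))) := by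
  rw [coneDist, polarConeDist_eq, one_mul, min_eq_left (InnerProductGeometry.angle_le_pi _ _),
    sideOf, rpow_one, rpow_one, cos_two_arctan, cos_two_arctan, sin_two_arctan, sin_two_arctan]
  congr 1
  have h1 := InnerProductGeometry.cos_angle_mul_norm_mul_norm z w
  have h2 := norm_sub_sq_real z w
  field_simp
  linear_combination 4 * h1 + 2 * h2

/-! ### Geodesics and curves -/

section Midpoints

variable {X : Type*} {d : X → X → ℝ}

lemma exists_dyadic_chain (hmid : ∀ x y, ∃ z, d x z = d x y / 2 ∧ d z y = d x y / 2) (x y : X)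
    (n : ℕ) : ∃ c : ℕ → X, c 0 = x ∧ c (2 ^ n) = y ∧
      ∀ i < 2 ^ n, d (c i) (c (i + 1)) = d x y / 2 ^ n := by
  induction n with
  | zero => exact ⟨fun i => if i = 0 then x else y, by simp, by simp, fun i hi => by
      obtain rfl : i = 0 := by simpa using hi
      simp⟩
  | succ n ih =>
    obtain ⟨c, h0, h1, hc⟩ := ih
    choose m hm hm' using hmid
    refine ⟨fun j => if j % 2 = 0 then c (j / 2) else m (c (j / 2)) (c (j / 2 + 1)), by simp [h0],
      ?_, fun i hi => ?_⟩
    · simp [pow_succ, h1]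
    · rcases Nat.even_or_odd' i with ⟨k, rfl | rfl⟩
      · have h2 : (2 * k + 1) / 2 = k := by omega
        simp only [Nat.mul_mod_right, if_true, Nat.mul_div_cancel_left _ two_pos, h2,
          Nat.mul_add_mod, Nat.one_mod, one_ne_zero, if_false]
        rw [hm, hc k (by rw [pow_succ] at hi; omega), pow_succ]
        ring
      · have h2 : (2 * k + 1) / 2 = k := by omega
        have h3 : (2 * k + 1 + 1) / 2 = k + 1 := by omega
        have h4 : (2 * k + 1 + 1) % 2 = 0 := by omega
        simp only [h2, h3, h4, if_true, Nat.mul_add_mod, Nat.one_mod, one_ne_zero, if_false]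
        rw [hm', hc k (by rw [pow_succ] at hi; omega), pow_succ]
        ring

/-- All distances between points of a dyadic chain are exact, because the triangle inequality leaves
no slack. Limits of the chain points next to the times s and t are therefore at distance |s − t|;
chains of different levels need not be compatible. -/
lemma exists_geodesic_of_midpoints [TopologicalSpace X] [CompactSpace X]
    (hd : Continuous fun p : X × X => d p.1 p.2) (h0 : ∀ x, d x x = 0)
    (hsymm : ∀ x y, d x y = d y x) (htri : ∀ x y z, d x z ≤ d x y + d y z)
    (hsep : ∀ x y, d x y = 0 → x = y)
    (hmid : ∀ x y, ∃ z, d x z = d x y / 2 ∧ d z y = d x y / 2) (x y : X) :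
    ∃ γ : ℝ → X, γ 0 = x ∧ γ (d x y) = y ∧
      ∀ s ∈ Set.Icc 0 (d x y), ∀ t ∈ Set.Icc 0 (d x y), d (γ s) (γ t) = |s - t| := by
  have hnn : ∀ x y, 0 ≤ d x y := fun x y => by
    have := htri x y x
    rw [h0, hsymm y x] at this
    linarith
  rcases (hnn x y).eq_or_lt with hL | hL
  · refine ⟨fun _ => x, rfl, hsep x y hL.symm, fun s hs t ht => ?_⟩
    rw [← hL, Set.Icc_self] at hs ht
    rw [hs, ht, h0, sub_self, abs_zero]
  set L := d x y with hLdef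
  choose c hc0 hc1 hc using exists_dyadic_chain hmid x y
  have hle : ∀ n i k, i + k ≤ 2 ^ n → d (c n i) (c n (i + k)) ≤ k * (L / 2 ^ n) := by
    intro n i k
    induction k with
    | zero => intro _; simp [h0]
    | succ k ih =>
      intro hk
      have := htri (c n i) (c n (i + k)) (c n (i + k + 1))
      rw [hc n (i + k) (by omega)] at this
      have h2 := ih (by omega)
      push_cast
      rw [← add_assoc]
      linarith
  have heq : ∀ n i j, i ≤ j → j ≤ 2 ^ n → d (c n i) (c n j) = ((j : ℝ) - i) * (L / 2 ^ n) := by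
    intro n i j hij hj
    have a1 := hle n 0 i (by omega)
    have a2 := hle n i (j - i) (by omega)
    have a3 := hle n j (2 ^ n - j) (by omega)
    rw [zero_add, hc0] at a1
    rw [Nat.add_sub_cancel' hij, Nat.cast_sub hij] at a2
    rw [Nat.add_sub_cancel' hj, Nat.cast_sub hj, hc1] at a3
    have b1 := htri x (c n i) y
    have b2 := htri (c n i) (c n j) y
    have : (2 : ℝ) ^ n * (L / 2 ^ n) = L := by field_simp
    push_cast at a3
    refine le_antisymm a2 ?_
    rw [← hLdef] at b1
    nlinarith
  have heq' : ∀ n i j, i ≤ 2 ^ n → j ≤ 2 ^ n →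
      d (c n i) (c n j) = |((i : ℝ) / 2 ^ n - j / 2 ^ n) * L| := by
    intro n i j hi hj
    have e : ((i : ℝ) / 2 ^ n - j / 2 ^ n) * L = ((i : ℝ) - j) * (L / 2 ^ n) := by
      field_simp
    have hp : 0 ≤ L / 2 ^ n := by positivity
    rw [e, abs_mul, abs_of_nonneg hp]
    rcases le_total i j with h | h
    · rw [heq n i j h hj, abs_sub_comm, abs_of_nonneg (sub_nonneg.2 (Nat.cast_le.2 h))]
    · rw [hsymm, heq n j i h hi, abs_of_nonneg (sub_nonneg.2 (Nat.cast_le.2 h))]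
  -- A single ultrafilter provides the limits for all times at once, in place of subsequences
  -- depending on the time.
  let u : Ultrafilter ℕ := Filter.hyperfilter ℕ
  have hu : (u : Filter ℕ) ≤ Filter.atTop := by
    rw [← Nat.cofinite_eq_atTop]; exact Filter.hyperfilter_le_cofinite
  have hlim : ∀ s : ℝ, ∃ z, Filter.Tendsto (fun n => c n ⌊s / L * 2 ^ n⌋₊) u (𝓝 z) := fun s => by
    obtain ⟨z, -, hz⟩ := isCompact_univ.ultrafilter_le_nhds
      (u.map fun n => c n ⌊s / L * 2 ^ n⌋₊) (by simp)
    exact ⟨z, hz⟩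
  choose γ hγ using hlim
  have hfl : ∀ s ∈ Set.Icc 0 L, ∀ n, ⌊s / L * 2 ^ n⌋₊ ≤ 2 ^ n := fun s hs n => by
    refine Nat.floor_le_of_le ?_
    push_cast
    have : s / L ≤ 1 := (div_le_one hL).2 hs.2
    have h2 : (0 : ℝ) < 2 ^ n := by positivity
    nlinarith
  have hfl' : ∀ s ∈ Set.Icc 0 L, Filter.Tendsto (fun n : ℕ => (⌊s / L * 2 ^ n⌋₊ : ℝ) / 2 ^ n) u
      (𝓝 (s / L)) := fun s hs =>
    ((tendsto_nat_floor_mul_div_atTop (R := ℝ) (div_nonneg hs.1 hL.le)).comp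
      (tendsto_pow_atTop_atTop_of_one_lt one_lt_two)).mono_left hu
  have hγd : ∀ s ∈ Set.Icc 0 L, ∀ t ∈ Set.Icc 0 L, d (γ s) (γ t) = |s - t| := by
    intro s hs t ht
    have t1 : Filter.Tendsto (fun n => d (c n ⌊s / L * 2 ^ n⌋₊) (c n ⌊t / L * 2 ^ n⌋₊)) u
        (𝓝 (d (γ s) (γ t))) :=
      (hd.tendsto (γ s, γ t)).comp ((hγ s).prodMk_nhds (hγ t))
    have t2 := (((hfl' s hs).sub (hfl' t ht)).mul_const L).abs
    have e : (s / L - t / L) * L = s - t := by field_simp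
    rw [e] at t2
    refine tendsto_nhds_unique t1 (t2.congr fun n => ?_)
    rw [heq' n _ _ (hfl s hs n) (hfl t ht n)]
  have hfin : ∀ s z, (∀ n, c n ⌊s / L * 2 ^ n⌋₊ = z) → γ s = z := fun s z h => by
    refine hsep _ _ ?_
    have t1 : Filter.Tendsto (fun n => d (c n ⌊s / L * 2 ^ n⌋₊) z) u (𝓝 (d (γ s) z)) :=
      (hd.tendsto (γ s, z)).comp ((hγ s).prodMk_nhds tendsto_const_nhds)
    simp only [h, h0] at t1
    exact tendsto_nhds_unique t1 tendsto_const_nhds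
  refine ⟨γ, hfin 0 x fun n => by simp [hc0], hfin L y fun n => ?_, hγd⟩
  rw [div_self hL.ne', one_mul]
  have : ((2 : ℝ) ^ n) = ((2 ^ n : ℕ) : ℝ) := by push_cast; rfl
  rw [this, Nat.floor_natCast, hc1]

end Midpoints

/-- Continuous induction: the set of `s` with |g s − g a| ≤ K (s − a) is closed and extends to the
right of each of its points. Then `K` decreases to 1. -/
lemma abs_sub_le_of_local_aux {g : ℝ → ℝ} {a b : ℝ} (hab : a ≤ b)
    (hc : ContinuousOn g (Set.Icc a b))
    (h : ∀ s ∈ Set.Icc a b, ∀ K > 1, ∀ᶠ s' in 𝓝 s, |g s' - g s| ≤ K * |s' - s|) :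
    |g b - g a| ≤ b - a := by
  have key : ∀ K > 1, |g b - g a| ≤ K * (b - a) := by
    intro K hK
    have hsub := IsClosed.Icc_subset_of_forall_exists_gt (a := a) (b := b)
      (s := {s | |g s - g a| ≤ K * (s - a)}) ?_ (by simp) ?_
    · exact hsub ⟨hab, le_rfl⟩
    · rw [Set.inter_comm]
      exact isClosed_Icc.isClosed_le ((hc.sub continuousOn_const).abs) (by fun_prop)
    · intro s hs y hy
      have hsI : s ∈ Set.Icc a b := ⟨hs.2.1, hs.2.2.le⟩
      have h1 : ∀ᶠ s' in 𝓝[>] s, |g s' - g s| ≤ K * |s' - s| :=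
        (h s hsI K hK).filter_mono nhdsWithin_le_nhds
      have h2 : ∀ᶠ s' in 𝓝[>] s, s' ∈ Set.Ioc s y := Ioc_mem_nhdsGT hy
      obtain ⟨s', hs1, hs2⟩ := (h1.and h2).exists
      refine ⟨s', ?_, hs2⟩
      have hs3 := hs.1
      simp only [Set.mem_ofPred_eq] at hs3 ⊢
      rw [abs_of_pos (sub_pos.2 hs2.1)] at hs1
      have := abs_sub_le (g s') (g s) (g a)
      linarith
  refine le_of_forall_pos_le_add fun ε hε => ?_
  have := key (1 + ε / (b - a + 1)) (by
    have : 0 < ε / (b - a + 1) := div_pos hε (by linarith)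
    linarith)
  have h2 : ε / (b - a + 1) * (b - a) ≤ ε := by
    rw [div_mul_eq_mul_div, div_le_iff₀ (by linarith)]
    nlinarith
  linarith

/-- A continuous function on an interval with pointwise dilation at most `1` off a finite set
is `1`-Lipschitz. -/
lemma abs_sub_le_of_local {g : ℝ → ℝ} {F : Set ℝ} (hF : F.Finite) : ∀ {a b : ℝ}, a ≤ b →
    ContinuousOn g (Set.Icc a b) →
    (∀ s ∈ Set.Ioo a b, s ∉ F → ∀ K > 1, ∀ᶠ s' in 𝓝 s, |g s' - g s| ≤ K * |s' - s|) →
    |g b - g a| ≤ b - a := by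
  induction F, hF using Set.Finite.induction_on with
  | empty =>
    intro a b hab hc h
    rcases hab.eq_or_lt with rfl | hlt
    · simp
    -- Nothing is assumed at the end points, so the estimate is proved on the open interval and
    -- extended by continuity.
    have hl : LipschitzOnWith 1 g (Set.Ioo a b) := by
      refine LipschitzOnWith.of_le_add fun x hx y hy => ?_
      rw [Real.dist_eq]
      rcases le_total x y with hxy | hxy
      · have := abs_sub_le_of_local_aux hxy (hc.mono (Set.Icc_subset_Icc hx.1.le hy.2.le))
          fun s hs => h s ⟨hx.1.trans_le hs.1, hs.2.trans_lt hy.2⟩ (by simp)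
        rw [abs_sub_comm x y, abs_of_nonneg (sub_nonneg.2 hxy)]
        linarith [(abs_le.1 this).1]
      · have := abs_sub_le_of_local_aux hxy (hc.mono (Set.Icc_subset_Icc hy.1.le hx.2.le))
          fun s hs => h s ⟨hy.1.trans_le hs.1, hs.2.trans_lt hx.2⟩ (by simp)
        rw [abs_of_nonneg (sub_nonneg.2 hxy)]
        linarith [(abs_le.1 this).2]
    have hcl : closure (Set.Ioo a b) = Set.Icc a b := closure_Ioo hlt.ne
    have := (lipschitzOnWith_closure_iff (hcl ▸ hc)).2 hl
    rw [hcl] at this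
    have := this.dist_le_mul b ⟨hab, le_rfl⟩ a ⟨le_rfl, hab⟩
    simpa [Real.dist_eq, abs_of_nonneg (sub_nonneg.2 hab)] using this
  | @insert x F _ _ ih =>
    intro a b hab hc h
    by_cases hx : x ∈ Set.Ioo a b
    · have h1 := ih hx.1.le (hc.mono (Set.Icc_subset_Icc le_rfl hx.2.le)) fun s hs hsF =>
        h s ⟨hs.1, hs.2.trans hx.2⟩ (by simp [hsF, hs.2.ne])
      have h2 := ih hx.2.le (hc.mono (Set.Icc_subset_Icc hx.1.le le_rfl)) fun s hs hsF =>
        h s ⟨hx.1.trans hs.1, hs.2⟩ (by simp [hsF, hs.1.ne'])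
      have := abs_sub_le (g b) (g x) (g a)
      linarith
    · exact ih hab hc fun s hs hsF => h s hs (by
        simp only [Set.mem_insert_iff, not_or]
        exact ⟨fun e => hx (e ▸ hs), hsF⟩)

/-! ### The football distance on the Riemann sphere -/

/-- The Riemann sphere. -/
abbrev RS : Type := OnePoint ℂ

/-- The affine coordinate, with value `0` at infinity. -/
def toC (x : RS) : ℂ := x.elim 0 id

@[simp] lemma toC_coe (u : ℂ) : toC (u : RS) = u := rfl
@[simp] lemma toC_infty : toC OnePoint.infty = 0 := rfl

/-- The colatitude in the football of angle `2πα`. -/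
def rad (α : ℝ) (x : RS) : ℝ := x.elim π fun u => 2 * arctan (‖u‖ ^ α)

@[simp] lemma rad_coe (α : ℝ) (u : ℂ) : rad α (u : RS) = 2 * arctan (‖u‖ ^ α) := rfl
@[simp] lemma rad_infty (α : ℝ) : rad α OnePoint.infty = π := rfl

/-- The football distance on the Riemann sphere. -/
def fb (α : ℝ) (x y : RS) : ℝ :=
  polarConeDist α (rad α x) (rad α y) (InnerProductGeometry.angle (toC x) (toC y))

lemma fb_coe (α : ℝ) (u v : ℂ) : fb α u v = coneDist α u v := rfl

lemma fb_eq (α : ℝ) (x y : RS) : fb α x y =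
    sideOf (rad α x) (rad α y) (min (α * InnerProductGeometry.angle (toC x) (toC y)) π) := rfl

lemma rad_coe_lt (α : ℝ) (u : ℂ) : rad α (u : RS) < π := by
  rw [rad_coe]; linarith [arctan_lt_pi_div_two (‖u‖ ^ α)]

lemma rad_nonneg (α : ℝ) (x : RS) : 0 ≤ rad α x := by
  induction x using OnePoint.rec with
  | infty => exact pi_pos.le
  | coe u => rw [rad_coe]; have := arctan_nonneg.2 (rpow_nonneg (norm_nonneg u) α); linarith

lemma rad_le_pi (α : ℝ) (x : RS) : rad α x ≤ π := by
  induction x using OnePoint.rec with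
  | infty => exact le_rfl
  | coe u => exact (rad_coe_lt α u).le

lemma rad_mem (α : ℝ) (x : RS) : rad α x ∈ Set.Icc 0 π := ⟨rad_nonneg α x, rad_le_pi α x⟩

lemma rad_zero {α : ℝ} (hα : 0 < α) : rad α ((0 : ℂ) : RS) = 0 := by
  simp [zero_rpow hα.ne']

lemma angle_mem {α : ℝ} (hα : 0 < α) (z w : ℂ) :
    min (α * InnerProductGeometry.angle z w) π ∈ Set.Icc 0 π :=
  ⟨le_min (mul_nonneg hα.le (InnerProductGeometry.angle_nonneg _ _)) pi_pos.le, min_le_right _ _⟩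

lemma fb_nonneg (α : ℝ) (x y : RS) : 0 ≤ fb α x y := arccos_nonneg _

lemma fb_le_pi (α : ℝ) (x y : RS) : fb α x y ≤ π := arccos_le_pi _

lemma fb_comm (α : ℝ) (x y : RS) : fb α x y = fb α y x := by
  rw [fb_eq, fb_eq, sideOf_comm, InnerProductGeometry.angle_comm]

lemma sin_rad_eq_zero {α : ℝ} {x : RS} (h : toC x = 0) (hα : 0 < α) : sin (rad α x) = 0 := by
  induction x using OnePoint.rec with
  | infty => simp
  | coe u => rw [toC_coe] at h; rw [h, rad_zero hα, sin_zero]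

lemma fb_self {α : ℝ} (hα : 0 < α) (x : RS) : fb α x x = 0 := by
  by_cases h : toC x = 0
  · rw [fb_eq, sideOf, sin_rad_eq_zero h hα]
    have := sin_sq_add_cos_sq (rad α x)
    rw [sin_rad_eq_zero h hα] at this
    rw [show cos (rad α x) * cos (rad α x) = 1 by linarith]
    simp
  · rw [fb_eq, InnerProductGeometry.angle_self h, mul_zero, min_eq_left pi_pos.le,
      sideOf_zero_angle (rad_mem _ _) (rad_mem _ _), sub_self, abs_zero]

lemma fb_triangle {α : ℝ} (hα : 0 < α) (x y z : RS) : fb α x z ≤ fb α x y + fb α y z := by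
  refine sideOf_triangle (rad_mem _ _) (rad_mem _ _) (rad_mem _ _) (angle_mem hα _ _)
    (angle_mem hα _ _) (angle_mem hα _ _) ?_
  have h := InnerProductGeometry.angle_le_angle_add_angle (toC x) (toC y) (toC z)
  have h1 := InnerProductGeometry.angle_nonneg (toC x) (toC y)
  have h2 := InnerProductGeometry.angle_nonneg (toC y) (toC z)
  have h3 := mul_le_mul_of_nonneg_left h hα.le
  rw [mul_add] at h3
  have h1' := mul_nonneg hα.le h1
  have h2' := mul_nonneg hα.le h2
  rcases min_cases (α * InnerProductGeometry.angle (toC x) (toC y)) π with h4 | h4 <;>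
  rcases min_cases (α * InnerProductGeometry.angle (toC y) (toC z)) π with h5 | h5 <;>
  rcases min_cases (α * InnerProductGeometry.angle (toC x) (toC z)) π with h6 | h6 <;>
  rw [h4.1, h5.1, h6.1] <;> linarith [pi_pos]

/-! ### Polar coordinates and midpoints on the football -/

/-- The point with polar coordinates `(ρ, τ)` of the football of angle `2πα`. -/
def pol (α ρ τ : ℝ) : RS :=
  open Classical in
  if ρ = π then OnePoint.infty else ((tan (ρ / 2) ^ (1 / α) : ℝ) * Complex.exp (τ * Complex.I) : ℂ)

lemma rad_pol {α ρ : ℝ} (hα : 0 < α) (h : ρ ∈ Set.Icc 0 π) (τ : ℝ) : rad α (pol α ρ τ) = ρ := by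
  unfold pol
  split_ifs with h'
  · simp [h']
  · have hlt := lt_of_le_of_ne h.2 h'
    have ht : 0 ≤ tan (ρ / 2) :=
      tan_nonneg_of_nonneg_of_le_pi_div_two (by linarith [h.1]) (by linarith)
    rw [rad_coe, norm_mul, Complex.norm_exp_ofReal_mul_I, mul_one, Complex.norm_real,
      norm_of_nonneg (rpow_nonneg ht _), ← rpow_mul ht, one_div_mul_cancel hα.ne', rpow_one,
      arctan_tan (by linarith [h.1, pi_pos]) (by linarith)]
    ring

lemma toC_pol {α ρ : ℝ} (h : ρ ∈ Set.Icc 0 π) (τ : ℝ) :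
    ∃ r : ℝ, 0 ≤ r ∧ (0 < ρ → ρ < π → 0 < r) ∧
      toC (pol α ρ τ) = r * Complex.exp (τ * Complex.I) := by
  unfold pol
  split_ifs with h'
  · exact ⟨0, le_rfl, fun _ h2 => absurd h' h2.ne, by simp⟩
  · have hlt := lt_of_le_of_ne h.2 h'
    refine ⟨_, ?_, fun h1 h2 => ?_, rfl⟩
    · exact rpow_nonneg (tan_nonneg_of_nonneg_of_le_pi_div_two (by linarith [h.1]) (by linarith)) _
    · exact rpow_pos_of_pos (tan_pos_of_pos_of_lt_pi_div_two (by linarith) (by linarith)) _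

lemma eq_pol {α τ : ℝ} (hα : 0 < α) {x : RS}
    (h : toC x = ‖toC x‖ * Complex.exp (τ * Complex.I)) : x = pol α (rad α x) τ := by
  induction x using OnePoint.rec with
  | infty => simp [pol]
  | coe u =>
    rw [pol, if_neg (rad_coe_lt α u).ne, rad_coe, mul_div_cancel_left₀ _ two_ne_zero, tan_arctan,
      ← rpow_mul (norm_nonneg u), mul_one_div_cancel hα.ne', rpow_one]
    exact congrArg _ h

lemma angle_exp {τ₁ τ₂ : ℝ} (h : |τ₁ - τ₂| ≤ π) :
    InnerProductGeometry.angle (Complex.exp (τ₁ * Complex.I)) (Complex.exp (τ₂ * Complex.I)) =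
      |τ₁ - τ₂| := by
  rw [InnerProductGeometry.angle, Complex.norm_exp_ofReal_mul_I, Complex.norm_exp_ofReal_mul_I,
    Complex.inner]
  rw [show (Complex.exp (τ₁ * Complex.I) : ℂ) = ⟨cos τ₁, sin τ₁⟩ from Complex.ext (by simp) (by simp),
    show (Complex.exp (τ₂ * Complex.I) : ℂ) = ⟨cos τ₂, sin τ₂⟩ from Complex.ext (by simp) (by simp)]
  simp only [Complex.mul_re, Complex.conj_re, Complex.conj_im, mul_one, div_one]
  rw [show cos τ₂ * cos τ₁ - sin τ₂ * -sin τ₁ = cos |τ₁ - τ₂| by rw [cos_abs, cos_sub]; ring,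
    arccos_cos (abs_nonneg _) h]

/-- At an apex the longitude is meaningless, but there the sine of the colatitude vanishes and the
angle drops out of the law of cosines. -/
lemma fb_pol {α ρ₁ ρ₂ τ₁ τ₂ : ℝ} (hα : 0 < α) (h₁ : ρ₁ ∈ Set.Icc 0 π) (h₂ : ρ₂ ∈ Set.Icc 0 π)
    (h : |τ₁ - τ₂| ≤ π) :
    fb α (pol α ρ₁ τ₁) (pol α ρ₂ τ₂) = sideOf ρ₁ ρ₂ (min (α * |τ₁ - τ₂|) π) := by
  rw [fb_eq, rad_pol hα h₁, rad_pol hα h₂]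
  obtain ⟨r₁, -, hr₁, e₁⟩ := toC_pol (α := α) h₁ τ₁
  obtain ⟨r₂, -, hr₂, e₂⟩ := toC_pol (α := α) h₂ τ₂
  have hs : ∀ {ρ}, ρ ∈ Set.Icc 0 π → sin ρ = 0 ∨ 0 < ρ ∧ ρ < π := fun {ρ} h => by
    rcases h.1.eq_or_lt with h' | h'
    · left; rw [← h', sin_zero]
    · rcases h.2.eq_or_lt with h'' | h''
      · left; rw [h'', sin_pi]
      · exact .inr ⟨h', h''⟩
  rcases hs h₁ with h' | h'
  · simp [sideOf, h']
  rcases hs h₂ with h'' | h''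
  · simp [sideOf, h'']
  rw [e₁, e₂, ← angle_exp h, ← Complex.real_smul (x := r₁), ← Complex.real_smul (x := r₂),
    InnerProductGeometry.angle_smul_left_of_pos _ _ (hr₁ h'.1 h'.2),
    InnerProductGeometry.angle_smul_right_of_pos _ _ (hr₂ h''.1 h''.2)]

/-- If the first point is an apex, its longitude is free and is copied from the second point.
Otherwise the longitudes are made to differ by the argument of the quotient, which is at most π in
absolute value. -/
lemma exists_pol_pair {α : ℝ} (hα : 0 < α) (x y : RS) : ∃ ρ₁ ∈ Set.Icc 0 π, ∃ ρ₂ ∈ Set.Icc 0 π,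
    ∃ τ₁ τ₂ : ℝ, |τ₁ - τ₂| ≤ π ∧ x = pol α ρ₁ τ₁ ∧ y = pol α ρ₂ τ₂ := by
  refine ⟨_, rad_mem α x, _, rad_mem α y, ?_⟩
  have harg : ∀ z : ℂ, z = ‖z‖ * Complex.exp (z.arg * Complex.I) := fun z =>
    (Complex.norm_mul_exp_arg_mul_I z).symm
  by_cases hx : toC x = 0
  · exact ⟨(toC y).arg, (toC y).arg, by simp [pi_pos.le], eq_pol hα (by simp [hx]),
      eq_pol hα (harg _)⟩
  · refine ⟨(toC x).arg, (toC x).arg + (toC y / toC x).arg, ?_, eq_pol hα (harg _), eq_pol hα ?_⟩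
    · rw [sub_add_cancel_left, abs_neg]
      exact Complex.abs_arg_le_pi _
    · have h1 := harg (toC x)
      have h2 := harg (toC y / toC x)
      have hx' : (‖toC x‖ : ℂ) ≠ 0 := by simpa using hx
      calc toC y = toC x * (toC y / toC x) := by field_simp
        _ = (‖toC x‖ * Complex.exp ((toC x).arg * Complex.I)) *
            (‖toC y / toC x‖ * Complex.exp ((toC y / toC x).arg * Complex.I)) := by
          rw [← h1, ← h2]
        _ = _ := by
          push_cast
          rw [add_mul, Complex.exp_add, norm_div, Complex.ofReal_div]
          field_simp

/-- The spherical triangle with angle `A` at the apex is bisected, and the longitudes are divided in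
the ratio β : A. -/
lemma fb_midpoint {α : ℝ} (hα : 0 < α) (x y : RS) :
    ∃ z, fb α x z = fb α x y / 2 ∧ fb α z y = fb α x y / 2 := by
  obtain ⟨ρ₁, h₁, ρ₂, h₂, τ₁, τ₂, hτ, rfl, rfl⟩ := exists_pol_pair hα x y
  rw [fb_pol hα h₁ h₂ hτ]
  set A := min (α * |τ₁ - τ₂|) π with hA
  have hA0 : 0 ≤ A := le_min (by positivity) pi_pos.le
  obtain ⟨ρ, hρ, β, hβ, hβπ, e₁, e₂⟩ := exists_sideOf_midpoint h₁ h₂ ⟨hA0, min_le_right _ _⟩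
  have hq : 0 ≤ β / A ∧ β / A ≤ 1 := ⟨div_nonneg hβ.1 hA0, div_le_one_of_le₀ hβ.2 hA0⟩
  have a1 : |τ₁ - (τ₁ + β / A * (τ₂ - τ₁))| = β / A * |τ₁ - τ₂| := by
    rw [sub_add_cancel_left, abs_neg, abs_mul, abs_of_nonneg hq.1, abs_sub_comm]
  have a2 : |τ₁ + β / A * (τ₂ - τ₁) - τ₂| = (1 - β / A) * |τ₁ - τ₂| := by
    rw [← abs_of_nonneg (sub_nonneg.2 hq.2), ← abs_mul]
    congr 1
    ring
  -- When the angle is truncated to π, `β` is 0 or π, so the new point lies on one of the two given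
  -- rays: one of the new angles is 0, and the other truncates to π again.
  have m1 : min (α * (β / A * |τ₁ - τ₂|)) π = β ∧ min (α * ((1 - β / A) * |τ₁ - τ₂|)) π = A - β := by
    rcases hA0.eq_or_lt with h0 | h0
    · have hβ0 : β = 0 := le_antisymm (hβ.2.trans h0.symm.le) hβ.1
      have : α * |τ₁ - τ₂| = 0 := by
        rcases min_cases (α * |τ₁ - τ₂|) π with h | h
        · rw [← h.1, ← hA, ← h0]
        · exact absurd (h.1.symm.trans (hA.symm.trans h0.symm)) pi_pos.ne'
      rw [← h0, hβ0]
      simp only [div_zero, zero_mul, mul_zero, sub_zero, one_mul, this]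
      exact ⟨min_eq_left pi_pos.le, min_eq_left pi_pos.le⟩
    · rcases min_cases (α * |τ₁ - τ₂|) π with h | h
      · have hAe : A = α * |τ₁ - τ₂| := h.1
        have e1 : α * (β / A * |τ₁ - τ₂|) = β := by
          rw [mul_left_comm, ← hAe]; field_simp
        have e2 : α * ((1 - β / A) * |τ₁ - τ₂|) = A - β := by
          rw [mul_left_comm, ← hAe]; field_simp
        rw [e1, e2]
        have := hβ.1
        have := hβ.2
        have : A ≤ π := min_le_right _ _
        exact ⟨min_eq_left (by linarith), min_eq_left (by linarith)⟩
      · have hAe : A = π := h.1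
        rcases hβπ hAe with hb | hb
        · rw [hb, hAe]
          simp only [zero_div, zero_mul, mul_zero, sub_zero, one_mul]
          exact ⟨min_eq_left pi_pos.le, min_eq_right h.2.le⟩
        · rw [hb, hAe, div_self pi_pos.ne']
          simp only [one_mul, sub_self, zero_mul, mul_zero]
          exact ⟨min_eq_right h.2.le, min_eq_left pi_pos.le⟩
  refine ⟨pol α ρ (τ₁ + β / A * (τ₂ - τ₁)), ?_, ?_⟩
  · rw [fb_pol hα h₁ hρ, a1, m1.1, e₁]
    rw [a1]
    nlinarith [abs_nonneg (τ₁ - τ₂)]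
  · rw [fb_pol hα hρ h₂, a2, m1.2, e₂]
    rw [a2]
    nlinarith [abs_nonneg (τ₁ - τ₂)]

lemma rad_injOn {α : ℝ} (hα : 0 < α) {x y : RS} (h : rad α x = rad α y) :
    ‖toC x‖ = ‖toC y‖ ∧ (x = OnePoint.infty ↔ y = OnePoint.infty) := by
  induction x using OnePoint.rec with
  | infty =>
    induction y using OnePoint.rec with
    | infty => simp
    | coe v => exact absurd h (rad_coe_lt α v).ne'
  | coe u =>
    induction y using OnePoint.rec with
    | infty => exact absurd h (rad_coe_lt α u).ne
    | coe v =>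
      rw [rad_coe, rad_coe, mul_right_inj' two_ne_zero] at h
      have := arctan_injective h
      rw [rpow_left_inj (norm_nonneg _) (norm_nonneg _) hα.ne'] at this
      exact ⟨this, by simp⟩

/-- Already the angle 0 gives |ρ₁ − ρ₂|, so monotonicity in the angle forces equal colatitudes; away
from the apexes the law of cosines then forces the angle to vanish. -/
lemma fb_eq_zero {α : ℝ} (hα : 0 < α) {x y : RS} (h : fb α x y = 0) : x = y := by
  have hrad : rad α x = rad α y := by
    have h1 := sideOf_mono (rad_mem α x) (rad_mem α y) le_rfl (angle_mem hα (toC x) (toC y)).1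
      (angle_mem hα (toC x) (toC y)).2
    rw [← fb_eq, h, sideOf_zero_angle (rad_mem _ _) (rad_mem _ _)] at h1
    exact sub_eq_zero.1 (abs_nonpos_iff.1 h1)
  obtain ⟨hn, hinf⟩ := rad_injOn hα hrad
  by_cases hx : x = OnePoint.infty
  · rw [hx, hinf.1 hx]
  have hy : y ≠ OnePoint.infty := fun h => hx (hinf.2 h)
  obtain ⟨u, rfl⟩ := OnePoint.ne_infty_iff_exists.1 hx
  obtain ⟨v, rfl⟩ := OnePoint.ne_infty_iff_exists.1 hy
  rw [toC_coe, toC_coe] at hn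
  by_cases hu : u = 0
  · rw [hu, norm_zero, eq_comm, norm_eq_zero] at hn
    rw [hu, hn]
  have hc := congrArg cos h
  have hupos : 0 < rad α (u : RS) := by
    rw [rad_coe]
    have := arctan_pos.2 (rpow_pos_of_pos (norm_pos_iff.2 hu) α)
    linarith
  have hs : 0 < sin (rad α (u : RS)) := sin_pos_of_pos_of_lt_pi hupos (rad_coe_lt α u)
  rw [fb_eq, cos_sideOf, cos_zero, ← hrad] at hc
  have h1 : cos (min (α * InnerProductGeometry.angle u v) π) = 1 := by
    have := sin_sq_add_cos_sq (rad α (u : RS))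
    have h2 : sin (rad α (u : RS)) ^ 2 * (cos (min (α * InnerProductGeometry.angle u v) π) - 1) = 0 := by
      simp only [toC_coe] at hc
      linear_combination hc - this
    have := (mul_eq_zero.1 h2).resolve_left (by positivity)
    linarith
  have hm := angle_mem hα u v
  have h2 : min (α * InnerProductGeometry.angle u v) π = 0 := by
    rw [← arccos_cos hm.1 hm.2, h1, arccos_one]
  have h3 : InnerProductGeometry.angle u v = 0 := by
    rcases min_choice (α * InnerProductGeometry.angle u v) π with h | h
    · rw [h] at h2; exact (mul_eq_zero.1 h2).resolve_left hα.ne'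
    · rw [h] at h2; exact absurd h2 pi_pos.ne'
  obtain ⟨-, r, hr, rfl⟩ := InnerProductGeometry.angle_eq_zero_iff.1 h3
  rw [norm_smul, norm_of_nonneg hr.le] at hn
  have : r = 1 := by
    have := norm_pos_iff.2 hu
    exact mul_right_cancel₀ this.ne' (by linarith)
  rw [this, one_smul]

lemma continuous_rad {α : ℝ} (hα : 0 < α) : Continuous (rad α) := by
  rw [OnePoint.continuous_iff]
  constructor
  · rw [Filter.coclosedCompact_eq_cocompact]
    have h1 : Filter.Tendsto (fun u : ℂ => 2 * arctan (‖u‖ ^ α)) (Filter.cocompact ℂ)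
        (𝓝 (2 * (π / 2))) :=
      (((tendsto_arctan_atTop.mono_right nhdsWithin_le_nhds).comp
        ((tendsto_rpow_atTop hα).comp (tendsto_norm_cocompact_atTop (E := ℂ)))).const_mul 2)
    rwa [mul_div_cancel₀ _ two_ne_zero] at h1
  · change Continuous fun u : ℂ => 2 * arctan (‖u‖ ^ α)
    exact continuous_const.mul (continuous_arctan.comp
      ((continuous_norm).rpow_const fun _ => .inr hα.le))

lemma fb_infty (α : ℝ) (x : RS) : fb α x OnePoint.infty = π - rad α x := by
  rw [fb_eq, rad_infty, sideOf, cos_pi, sin_pi, mul_zero, zero_mul, add_zero, mul_neg_one,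
    arccos_neg, arccos_cos (rad_nonneg α x) (rad_le_pi α x)]

lemma fb_zero {α : ℝ} (hα : 0 < α) (x : RS) : fb α x (0 : ℂ) = rad α x := by
  rw [fb_eq, rad_zero hα, sideOf, cos_zero, sin_zero, mul_zero, zero_mul, add_zero, mul_one,
    arccos_cos (rad_nonneg α x) (rad_le_pi α x)]

lemma tendsto_fb_self {α : ℝ} (hα : 0 < α) (x : RS) :
    Filter.Tendsto (fun y => fb α y x) (𝓝 x) (𝓝 0) := by
  rw [← fb_self hα x]
  change ContinuousAt (fun y => fb α y x) x
  induction x using OnePoint.rec with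
  | infty =>
    simp only [fb_infty]
    exact (continuous_const.sub (continuous_rad hα)).continuousAt
  | coe u =>
    by_cases hu : u = 0
    · rw [hu]
      simp only [fb_zero hα]
      exact (continuous_rad hα).continuousAt
    · rw [OnePoint.continuousAt_coe]
      change ContinuousAt (fun v => arccos _) u
      refine continuous_arccos.continuousAt.comp ?_
      have h1 : ContinuousAt (fun v : ℂ => rad α (v : RS)) u :=
        ((continuous_rad hα).comp OnePoint.continuous_coe).continuousAt
      have h2 : ContinuousAt (fun v : ℂ => InnerProductGeometry.angle v u) u :=
        ContinuousAt.comp (f := fun v : ℂ => (v, u))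
          (InnerProductGeometry.continuousAt_angle (x := (u, u)) hu hu)
          (continuousAt_id.prodMk continuousAt_const)
      simp only [toC_coe]
      fun_prop

lemma continuous_of_triangle {X : Type*} [TopologicalSpace X] {d : X → X → ℝ}
    (hsymm : ∀ x y, d x y = d y x) (htri : ∀ x y z, d x z ≤ d x y + d y z)
    (hd : ∀ x, Filter.Tendsto (fun y => d y x) (𝓝 x) (𝓝 0)) :
    Continuous fun p : X × X => d p.1 p.2 := by
  rw [continuous_iff_continuousAt]
  rintro ⟨x, y⟩
  have h1 : Filter.Tendsto (fun p : X × X => d p.1 x + d p.2 y) (𝓝 (x, y)) (𝓝 0) := by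
    simpa using ((hd x).comp (continuous_fst.tendsto (x, y))).add
      ((hd y).comp (continuous_snd.tendsto (x, y)))
  refine tendsto_iff_dist_tendsto_zero.2 (squeeze_zero (fun _ => dist_nonneg) (fun p => ?_) h1)
  rw [Real.dist_eq, abs_le]
  have a1 := htri x p.1 y
  have a2 := htri p.1 p.2 y
  have a3 := htri p.1 x p.2
  have a4 := htri x y p.2
  rw [hsymm x p.1] at a1
  rw [hsymm y p.2] at a4
  constructor <;> linarith

lemma continuous_fb {α : ℝ} (hα : 0 < α) : Continuous fun p : RS × RS => fb α p.1 p.2 :=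
  continuous_of_triangle (fb_comm α) (fb_triangle hα) (tendsto_fb_self hα)

lemma exists_fb_geodesic {α : ℝ} (hα : 0 < α) (x y : RS) :
    ∃ γ : ℝ → RS, γ 0 = x ∧ γ (fb α x y) = y ∧ ∀ s ∈ Set.Icc 0 (fb α x y),
      ∀ t ∈ Set.Icc 0 (fb α x y), fb α (γ s) (γ t) = |s - t| :=
  exists_geodesic_of_midpoints (continuous_fb hα) (fb_self hα) (fb_comm α) (fb_triangle hα)
    (fun _ _ => fb_eq_zero hα) (fb_midpoint hα) x y

/-! ### Asymptotic comparison of distances -/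

/-- Near the diagonal point `(x, x)`, the ratio of `F` to `G` is asymptotically at most `1`. -/
def LeNear {X : Type*} [TopologicalSpace X] (F G : X → X → ℝ) (x : X) : Prop :=
  ∀ K > 1, ∀ᶠ p : X × X in 𝓝 (x, x), F p.1 p.2 ≤ K * G p.1 p.2

namespace LeNear

variable {X Y : Type*} [TopologicalSpace X] [TopologicalSpace Y] {F G H : X → X → ℝ} {x : X}

lemma trans (h : LeNear F G x) (h' : LeNear G H x) : LeNear F H x := fun K hK => by
  have hs : 1 < √K := by rw [lt_sqrt zero_le_one]; simpa using hK
  filter_upwards [h _ hs, h' _ hs] with p h1 h2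
  refine h1.trans ((mul_le_mul_of_nonneg_left h2 (sqrt_nonneg K)).trans_eq ?_)
  rw [← mul_assoc, mul_self_sqrt (by linarith)]

lemma comp {F G : Y → Y → ℝ} {f : X → Y} (h : LeNear F G (f x)) (hf : ContinuousAt f x) :
    LeNear (fun a b => F (f a) (f b)) (fun a b => G (f a) (f b)) x := fun K hK =>
  ((hf.tendsto.comp (continuous_fst.tendsto (x, x))).prodMk_nhds
    (hf.tendsto.comp (continuous_snd.tendsto (x, x)))).eventually (h K hK)

lemma const_mul (h : LeNear F G x) {c : ℝ} (hc : 0 ≤ c) :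
    LeNear (fun a b => c * F a b) (fun a b => c * G a b) x := fun K hK => by
  filter_upwards [h K hK] with p hp
  calc c * F p.1 p.2 ≤ c * (K * G p.1 p.2) := mul_le_mul_of_nonneg_left hp hc
    _ = _ := by ring

lemma congr {F' G' : X → X → ℝ} (h : LeNear F G x)
    (hF : ∀ᶠ p : X × X in 𝓝 (x, x), F p.1 p.2 = F' p.1 p.2)
    (hG : ∀ᶠ p : X × X in 𝓝 (x, x), G p.1 p.2 = G' p.1 p.2) : LeNear F' G' x := fun K hK => by
  filter_upwards [h K hK, hF, hG] with p h1 h2 h3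
  rwa [← h2, ← h3]

lemma of_le (h : ∀ᶠ p : X × X in 𝓝 (x, x), F p.1 p.2 ≤ G p.1 p.2)
    (hG : ∀ᶠ p : X × X in 𝓝 (x, x), 0 ≤ G p.1 p.2) : LeNear F G x := fun K hK => by
  filter_upwards [h, hG] with p h1 h2
  nlinarith

lemma of_tendsto {q : X → X → ℝ} {q₀ : ℝ} (hq₀ : 0 < q₀)
    (hq : Filter.Tendsto (fun p : X × X => q p.1 p.2) (𝓝 (x, x)) (𝓝 q₀))
    (hF : ∀ a b, 0 ≤ F a b) : LeNear (fun a b => q a b * F a b) (fun a b => q₀ * F a b) x ∧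
      LeNear (fun a b => q₀ * F a b) (fun a b => q a b * F a b) x := by
  constructor <;> intro K hK
  · filter_upwards [hq.eventually (gt_mem_nhds (show q₀ < K * q₀ by nlinarith))] with p hp
    nlinarith [hF p.1 p.2]
  · have h1 : q₀ / K < q₀ := by rw [div_lt_iff₀ (by linarith)]; nlinarith
    filter_upwards [hq.eventually (lt_mem_nhds h1)] with p hp
    rw [div_lt_iff₀ (by linarith)] at hp
    nlinarith [hF p.1 p.2]

end LeNear

lemma leNear_of_hasStrictDerivAt {f : ℂ → ℂ} {f' x : ℂ} (h : HasStrictDerivAt f f' x)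
    (h0 : f' ≠ 0) :
    LeNear (fun a b => ‖f a - f b‖) (fun a b => ‖f'‖ * ‖a - b‖) x ∧
      LeNear (fun a b => ‖f'‖ * ‖a - b‖) (fun a b => ‖f a - f b‖) x := by
  have hn := norm_pos_iff.2 h0
  have key : ∀ ε > 0, ∀ᶠ p : ℂ × ℂ in 𝓝 (x, x),
      ‖f p.1 - f p.2 - (p.1 - p.2) * f'‖ ≤ ε * ‖p.1 - p.2‖ := fun ε hε => by
    have := (hasStrictDerivAt_iff_hasStrictFDerivAt.1 h).isLittleO.bound hε
    simpa using this
  constructor <;> intro K hK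
  · filter_upwards [key ((K - 1) * ‖f'‖) (by nlinarith)] with p hp
    have h1 := norm_add_le (f p.1 - f p.2 - (p.1 - p.2) * f') ((p.1 - p.2) * f')
    rw [sub_add_cancel, norm_mul] at h1
    linarith
  · have hK0 : 0 < K := by linarith
    have he : 0 < (1 - 1 / K) * ‖f'‖ := by
      refine mul_pos (sub_pos.2 ?_) hn
      rw [div_lt_one hK0]; exact hK
    filter_upwards [key _ he] with p hp
    have h1 := norm_sub_norm_le ((p.1 - p.2) * f') (f p.1 - f p.2)
    rw [norm_sub_rev _ (f p.1 - f p.2), norm_mul] at h1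
    have h2 : ‖f'‖ * ‖p.1 - p.2‖ / K ≤ ‖f p.1 - f p.2‖ := by
      have : ‖f'‖ * ‖p.1 - p.2‖ / K = ‖p.1 - p.2‖ * ‖f'‖ - (1 - 1 / K) * ‖f'‖ * ‖p.1 - p.2‖ := by
        field_simp; ring
      linarith
    rw [div_le_iff₀ hK0] at h2
    linarith

/-- The conformal factor of the metric of the cone of angle `2πα`. -/
def coneFactor (α : ℝ) (w : ℂ) : ℝ := 2 * α * ‖w‖ ^ (α - 1) / (1 + (‖w‖ ^ α) ^ 2)

/-- Half-angle form of the chordal formula: half the distance is the arcsine of a multiple of |z −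
w|, so that the behaviour near the diagonal can be read off. -/
lemma coneDist_one_arcsin (z w : ℂ) :
    coneDist 1 z w = 2 * arcsin ((√(1 + ‖z‖ ^ 2) * √(1 + ‖w‖ ^ 2))⁻¹ * ‖z - w‖) := by
  set t := (√(1 + ‖z‖ ^ 2) * √(1 + ‖w‖ ^ 2))⁻¹ * ‖z - w‖ with ht
  have ht0 : 0 ≤ t := by positivity
  have ht2 : t ^ 2 = ‖z - w‖ ^ 2 / ((1 + ‖z‖ ^ 2) * (1 + ‖w‖ ^ 2)) := by
    rw [ht, mul_pow, inv_pow, mul_pow, sq_sqrt (by positivity), sq_sqrt (by positivity)]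
    field_simp
  have ht1 : t ≤ 1 := by
    refine (sq_le_one_iff₀ ht0).1 ?_
    rw [ht2, div_le_one (by positivity)]
    have h1 := norm_sub_le z w
    have h2 : ‖z - w‖ ^ 2 ≤ (‖z‖ + ‖w‖) ^ 2 := by gcongr
    nlinarith [sq_nonneg (‖z‖ * ‖w‖ - 1)]
  have h3 : cos (2 * arcsin t) = 1 - 2 * ‖z - w‖ ^ 2 / ((1 + ‖z‖ ^ 2) * (1 + ‖w‖ ^ 2)) := by
    rw [cos_two_mul, cos_arcsin, sq_sqrt (by nlinarith), ht2]
    ring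
  rw [coneDist_one, ← h3, arccos_cos]
  · have := arcsin_nonneg.2 ht0; linarith
  · linarith [arcsin_le_pi_div_two t]

/-- The factor in front of |a − b| is continuous, and arcsin t = t + o(t) at 0. -/
lemma leNear_coneDist_one (w : ℂ) :
    LeNear (coneDist 1) (fun a b => coneFactor 1 w * ‖a - b‖) w ∧
      LeNear (fun a b => coneFactor 1 w * ‖a - b‖) (coneDist 1) w := by
  let q : ℂ → ℂ → ℝ := fun a b => 2 * (√(1 + ‖a‖ ^ 2) * √(1 + ‖b‖ ^ 2))⁻¹
  have hq0 : q w w = coneFactor 1 w := by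
    simp only [q, coneFactor, sub_self, rpow_zero, rpow_one]
    rw [mul_self_sqrt (by positivity)]
    field_simp
  have hqc : Continuous fun p : ℂ × ℂ => q p.1 p.2 := by
    simp only [q]
    refine continuous_const.mul (Continuous.inv₀ (by fun_prop) fun p => ?_)
    positivity
  have hpos : 0 < coneFactor 1 w := by rw [← hq0]; positivity
  have hq : Filter.Tendsto (fun p : ℂ × ℂ => q p.1 p.2) (𝓝 (w, w)) (𝓝 (coneFactor 1 w)) :=
    hq0 ▸ hqc.tendsto (w, w)
  obtain ⟨a1, a2⟩ := LeNear.of_tendsto (F := fun a b : ℂ => ‖a - b‖) hpos hq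
    fun _ _ => norm_nonneg _
  have hT : Filter.Tendsto (fun p : ℂ × ℂ => q p.1 p.2 / 2 * ‖p.1 - p.2‖) (𝓝 (w, w)) (𝓝 0) := by
    have : Continuous fun p : ℂ × ℂ => q p.1 p.2 / 2 * ‖p.1 - p.2‖ := by fun_prop
    simpa using this.tendsto (w, w)
  have hasin : ∀ ε > 0, ∀ᶠ t in 𝓝 (0 : ℝ), |arcsin t - t| ≤ ε * |t| := fun ε hε => by
    have h := (hasDerivAt_iff_isLittleO.1
      (hasDerivAt_arcsin (x := 0) (by norm_num) (by norm_num))).bound hε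
    simpa using h
  have he : ∀ a b : ℂ, coneDist 1 a b = 2 * arcsin (q a b / 2 * ‖a - b‖) := fun a b => by
    rw [coneDist_one_arcsin]; simp [q]
  have hT0 : ∀ a b : ℂ, 0 ≤ q a b / 2 * ‖a - b‖ := fun a b => by positivity
  constructor
  · refine LeNear.trans (fun K hK => ?_) a1
    filter_upwards [hT.eventually (hasin (K - 1) (by linarith))] with p hp
    rw [abs_of_nonneg (hT0 _ _), abs_le] at hp
    rw [he]
    linarith
  · refine LeNear.trans a2 (fun K hK => ?_)
    have hK0 : 0 < K := by linarith
    filter_upwards [hT.eventually (hasin (1 - 1 / K) (sub_pos.2 ((div_lt_one hK0).2 hK)))] with p hp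
    rw [abs_of_nonneg (hT0 _ _), abs_le] at hp
    rw [he]
    have h1 : q p.1 p.2 / 2 * ‖p.1 - p.2‖ / K ≤ arcsin (q p.1 p.2 / 2 * ‖p.1 - p.2‖) := by
      rw [div_eq_mul_inv, ← one_div]
      linarith
    rw [div_le_iff₀ hK0] at h1
    linarith

lemma angle_mul_cexp {κ s t : ℂ} (hκ : κ ≠ 0) (h : |s.im - t.im| ≤ π) :
    InnerProductGeometry.angle (κ * Complex.exp s) (κ * Complex.exp t) = |s.im - t.im| := by
  have key : ∀ s : ℂ, κ * Complex.exp s = rexp s.re • (κ * Complex.exp (s.im * Complex.I)) := by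
    intro s
    conv_lhs => rw [← Complex.re_add_im s, Complex.exp_add]
    rw [Complex.real_smul, Complex.ofReal_exp]
    ring
  rw [key s, key t, InnerProductGeometry.angle_smul_left_of_pos _ _ (exp_pos _),
    InnerProductGeometry.angle_smul_right_of_pos _ _ (exp_pos _), Complex.angle_mul_left hκ,
    angle_exp h]

/-- In the variable log z, multiplication by α unrolls the cone of angle 2πα onto the round sphere:
the distance to the apex depends on |z| ^ α only, and the angle at the apex is multiplied by α. The
bound on `α * |s.im - t.im|` keeps the truncation at π inactive. -/
lemma coneDist_mul_cexp {α : ℝ} (hα : 0 < α) {w κ s t : ℂ} (hw : w ≠ 0) (hκ : ‖κ‖ = ‖w‖ ^ α)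
    (h : |s.im - t.im| ≤ π) (h' : α * |s.im - t.im| ≤ π) :
    coneDist α (w * Complex.exp s) (w * Complex.exp t) =
      coneDist 1 (κ * Complex.exp (α * s)) (κ * Complex.exp (α * t)) := by
  have hκ0 : κ ≠ 0 := by
    rw [← norm_pos_iff, hκ]; exact rpow_pos_of_pos (norm_pos_iff.2 hw) _
  have him : ∀ s : ℂ, ((α : ℂ) * s).im = α * s.im := fun s => by simp
  have hre : ∀ s : ℂ, ((α : ℂ) * s).re = α * s.re := fun s => by simp
  have hn : ∀ s : ℂ, ‖κ * Complex.exp (α * s)‖ = ‖w * Complex.exp s‖ ^ α := fun s => by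
    rw [norm_mul, norm_mul, mul_rpow (norm_nonneg _) (norm_nonneg _), hκ, Complex.norm_exp,
      Complex.norm_exp, ← exp_mul, hre, mul_comm α]
  have h'' : |((α : ℂ) * s).im - ((α : ℂ) * t).im| = α * |s.im - t.im| := by
    rw [him, him, ← mul_sub, abs_mul, abs_of_pos hα]
  rw [coneDist, coneDist, angle_mul_cexp hw h, angle_mul_cexp hκ0 (h''.trans_le h'), h'', hn, hn,
    rpow_one, rpow_one, polarConeDist, polarConeDist, one_mul]

/-- The branch of `κ (a / w) ^ α` near `w`. -/
def branch (α : ℝ) (κ w a : ℂ) : ℂ := κ * Complex.exp (α * Complex.log (a / w))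

lemma branch_self (α : ℝ) (κ : ℂ) {w : ℂ} (hw : w ≠ 0) : branch α κ w w = κ := by
  simp [branch, div_self hw]

lemma hasStrictDerivAt_branch (α : ℝ) (κ : ℂ) {w a : ℂ} (hw : w ≠ 0)
    (ha : a / w ∈ Complex.slitPlane) :
    HasStrictDerivAt (branch α κ w) (α * branch α κ w a / a) a := by
  have h0 : a ≠ 0 := fun h => by simp [h] at ha
  have h1 : HasStrictDerivAt (fun a : ℂ => a / w) (1 / w) a := (hasStrictDerivAt_id a).div_const w
  have h2 := (((h1.clog ha).const_mul (α : ℂ)).cexp).const_mul κ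
  refine h2.congr_deriv ?_
  rw [branch]
  field_simp

lemma tendsto_log_div {w : ℂ} (hw : w ≠ 0) :
    Filter.Tendsto (fun a : ℂ => Complex.log (a / w)) (𝓝 w) (𝓝 0) := by
  have h1 : ContinuousAt (fun a : ℂ => Complex.log (a / w)) w :=
    (continuousAt_id.div_const w).clog (by simp [div_self hw])
  simpa [ContinuousAt, div_self hw] using h1

lemma coneDist_branch {α : ℝ} (hα : 0 < α) {w κ : ℂ} (hw : w ≠ 0) (hκ : ‖κ‖ = ‖w‖ ^ α) :
    ∀ᶠ p : ℂ × ℂ in 𝓝 (w, w),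
      coneDist α p.1 p.2 = coneDist 1 (branch α κ w p.1) (branch α κ w p.2) := by
  have h1 : ∀ᶠ a in 𝓝 w, a ≠ 0 ∧ |(Complex.log (a / w)).im| ≤ π / 2 ∧
      α * |(Complex.log (a / w)).im| ≤ π / 2 := by
    have h2 : Filter.Tendsto (fun a : ℂ => |(Complex.log (a / w)).im|) (𝓝 w) (𝓝 0) := by
      simpa using ((Complex.continuous_im.tendsto 0).comp (tendsto_log_div hw)).abs
    have h3 : Filter.Tendsto (fun a : ℂ => α * |(Complex.log (a / w)).im|) (𝓝 w) (𝓝 0) := by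
      simpa using h2.const_mul α
    filter_upwards [eventually_ne_nhds hw, h2.eventually (ge_mem_nhds pi_div_two_pos),
      h3.eventually (ge_mem_nhds pi_div_two_pos)] with a a1 a2 a3 using ⟨a1, a2, a3⟩
  have h1' := (continuous_fst.tendsto (w, w)).eventually h1
  have h1'' := (continuous_snd.tendsto (w, w)).eventually h1
  filter_upwards [h1', h1''] with p ⟨a0, a1, a2⟩ ⟨b0, b1, b2⟩
  have e : ∀ a : ℂ, a ≠ 0 → w * Complex.exp (Complex.log (a / w)) = a := fun a ha => by
    rw [Complex.exp_log (div_ne_zero ha hw)]; field_simp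
  have habs := abs_sub (Complex.log (p.1 / w)).im (Complex.log (p.2 / w)).im
  have := coneDist_mul_cexp hα hw hκ (s := Complex.log (p.1 / w)) (t := Complex.log (p.2 / w))
    (by linarith) (by nlinarith)
  rwa [e _ a0, e _ b0] at this

/-- Away from the apex a branch of the α-th power is a local isometry to the round sphere, so the
chain rule reduces everything to α = 1. -/
lemma leNear_coneDist {α : ℝ} (hα : 0 < α) {w : ℂ} (hw : w ≠ 0 ∨ α = 1) :
    LeNear (coneDist α) (fun a b => coneFactor α w * ‖a - b‖) w ∧
      LeNear (fun a b => coneFactor α w * ‖a - b‖) (coneDist α) w := by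
  rcases hw with hw | rfl
  swap
  · exact leNear_coneDist_one w
  set κ : ℂ := ((‖w‖ ^ α : ℝ) : ℂ) with hκd
  have hwn := norm_pos_iff.2 hw
  have hκ : ‖κ‖ = ‖w‖ ^ α := by
    rw [hκd, Complex.norm_real, norm_of_nonneg (rpow_nonneg (norm_nonneg w) α)]
  have hκ0 : κ ≠ 0 := by rw [← norm_pos_iff, hκ]; positivity
  have hd := hasStrictDerivAt_branch α κ hw (a := w) (by simp [div_self hw])
  rw [branch_self α κ hw] at hd
  have hd0 : (α : ℂ) * κ / w ≠ 0 :=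
    div_ne_zero (mul_ne_zero (Complex.ofReal_ne_zero.2 hα.ne') hκ0) hw
  have hf : coneFactor 1 κ * ‖(α : ℂ) * κ / w‖ = coneFactor α w := by
    rw [coneFactor, coneFactor, norm_div, norm_mul, hκ, Complex.norm_real, norm_of_nonneg hα.le,
      sub_self, rpow_zero, rpow_one, rpow_sub_one hwn.ne']
    field_simp
  obtain ⟨b1, b2⟩ := leNear_of_hasStrictDerivAt hd hd0
  obtain ⟨c1, c2⟩ := leNear_coneDist_one κ
  rw [← branch_self α κ hw] at c1 c2
  have hpos : 0 ≤ coneFactor 1 κ := by rw [coneFactor]; positivity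
  have heq := coneDist_branch hα hw hκ
  have e : ∀ a b : ℂ, coneFactor 1 κ * (‖(α : ℂ) * κ / w‖ * ‖a - b‖) = coneFactor α w * ‖a - b‖ :=
    fun a b => by rw [← hf, mul_assoc]
  have c1' := c1.comp hd.hasDerivAt.continuousAt
  have c2' := c2.comp hd.hasDerivAt.continuousAt
  rw [branch_self α κ hw] at c1' c2'
  constructor
  · exact (c1'.trans (b1.const_mul hpos)).congr (heq.mono fun p hp => hp.symm)
      (.of_forall fun p => e _ _)
  · exact ((b2.const_mul hpos).trans c2').congr (.of_forall fun p => e _ _)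
      (heq.mono fun p hp => hp.symm)

/-! ### The length metric of a conformal factor on the Riemann sphere -/

/-- Compactness: off an open neighbourhood of `x` the distance to `x` has a positive minimum. -/
lemma tendsto_of_sep {X ι : Type*} [TopologicalSpace X] [CompactSpace X] {d : X → X → ℝ}
    (hd : Continuous fun p : X × X => d p.1 p.2) (hnn : ∀ x y, 0 ≤ d x y)
    (hsep : ∀ x y, d x y = 0 → x = y) {x : X} {g : ι → X} {l : Filter ι}
    (h : Filter.Tendsto (fun i => d (g i) x) l (𝓝 0)) : Filter.Tendsto g l (𝓝 x) := by
  rw [tendsto_nhds]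
  intro U hU hx
  rcases Uᶜ.eq_empty_or_nonempty with he | hne
  · rw [Set.compl_empty_iff.1 he]; simp
  · have hc : IsCompact Uᶜ := hU.isClosed_compl.isCompact
    have hdx : Continuous fun y => d y x := hd.comp (continuous_id.prodMk continuous_const)
    obtain ⟨z, hz, hmin⟩ := hc.exists_isMinOn hne hdx.continuousOn
    have hpos : 0 < d z x := (hnn z x).lt_of_ne fun e => hz (hsep _ _ e.symm ▸ hx)
    filter_upwards [h.eventually (gt_mem_nhds hpos)] with i hi
    by_contra hiU
    exact absurd (hmin hiU) (not_le.2 hi)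

lemma fb_mul_path_continuous {α : ℝ} (hα : 0 < α) {γ : ℝ → RS} {L : ℝ}
    (hγ : ∀ s ∈ Set.Icc 0 L, ∀ t ∈ Set.Icc 0 L, fb α (γ s) (γ t) = |s - t|) :
    ContinuousOn γ (Set.Icc 0 L) := fun s hs => by
  refine tendsto_of_sep (continuous_fb hα) (fb_nonneg α) (fun _ _ => fb_eq_zero hα) ?_
  have h1 : Filter.Tendsto (fun s' : ℝ => |s' - s|) (𝓝[Set.Icc 0 L] s) (𝓝 0) := by
    have : Continuous fun s' : ℝ => |s' - s| := by fun_prop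
    simpa using (this.tendsto s).mono_left nhdsWithin_le_nhds
  refine h1.congr' ?_
  filter_upwards [self_mem_nhdsWithin] with s' hs' using (hγ s' hs' s hs).symm

/-- Continuous functions on the Riemann sphere with pointwise dilation at most `1` for the
conformal metric `ρ(u) |du|` on `ℂ \ {0}`. -/
structure Adm (ρ : ℂ → ℝ) (f : RS → ℝ) : Prop where
  cont : Continuous f
  near : ∀ u : ℂ, u ≠ 0 →
    LeNear (fun a b : ℂ => |f a - f b|) (fun a b : ℂ => ρ u * ‖a - b‖) u

/-- A local coordinate `w` centred at `x` in which the conformal metric `ρ(u) |du|` is that of the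
spherical cone of angle `2πα`. -/
structure ConfChart (ρ : ℂ → ℝ) (x : RS) (α : ℝ) (w : OpenPartialHomeomorph RS ℂ) : Prop where
  pos : 0 < α
  mem : x ∈ w.source
  zero : w x = 0
  fin : ∀ y ∈ w.source, y ≠ x → ∃ u : ℂ, u ≠ 0 ∧ y = u
  conf : ∀ u : ℂ, u ≠ 0 → (u : RS) ∈ w.source → (w u ≠ 0 ∨ α = 1) ∧ ∃ w' : ℂ, w' ≠ 0 ∧
    HasStrictDerivAt (fun v : ℂ => w v) w' u ∧ coneFactor α (w u) * ‖w'‖ = ρ u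

lemma coneFactor_nonneg {α : ℝ} (hα : 0 < α) (w : ℂ) : 0 ≤ coneFactor α w := by
  rw [coneFactor]
  have := rpow_nonneg (norm_nonneg w) (α - 1)
  positivity

namespace ConfChart

variable {ρ : ℂ → ℝ} {x : RS} {α : ℝ} {w : OpenPartialHomeomorph RS ℂ}

lemma leNear (hw : ConfChart ρ x α w) {u : ℂ} (hu : u ≠ 0) (hs : (u : RS) ∈ w.source) :
    LeNear (fun a b : ℂ => ρ u * ‖a - b‖) (fun a b : ℂ => coneDist α (w a) (w b)) u ∧
      LeNear (fun a b : ℂ => coneDist α (w a) (w b)) (fun a b : ℂ => ρ u * ‖a - b‖) u := by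
  obtain ⟨h0, w', hw', hd, hρ⟩ := hw.conf u hu hs
  obtain ⟨b1, b2⟩ := leNear_of_hasStrictDerivAt hd hw'
  obtain ⟨c1, c2⟩ := leNear_coneDist hw.pos h0
  have c1' := LeNear.comp (f := fun v : ℂ => w v) c1 hd.hasDerivAt.continuousAt
  have c2' := LeNear.comp (f := fun v : ℂ => w v) c2 hd.hasDerivAt.continuousAt
  have e : ∀ a b : ℂ, coneFactor α (w u) * (‖w'‖ * ‖a - b‖) = ρ u * ‖a - b‖ := fun a b => by
    rw [← hρ, mul_assoc]
  have hp := coneFactor_nonneg hw.pos (w u)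
  exact ⟨((b2.const_mul hp).trans c2').congr (.of_forall fun p => e _ _) (.of_forall fun p => rfl),
    (c1'.trans (b1.const_mul hp)).congr (.of_forall fun p => rfl) (.of_forall fun p => e _ _)⟩

lemma exists_radius (hw : ConfChart ρ x α w) :
    ∃ R, 0 < R ∧ R ≤ π ∧ ∀ v : ℂ, rad α v < R → v ∈ w.target := by
  have h0 : (0 : ℂ) ∈ w.target := hw.zero ▸ w.map_source hw.mem
  obtain ⟨δ, hδ, hb⟩ := Metric.isOpen_iff.1 w.open_target 0 h0
  have h1 := arctan_pos.2 (rpow_pos_of_pos hδ α)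
  refine ⟨2 * arctan (δ ^ α), by linarith, by linarith [arctan_lt_pi_div_two (δ ^ α)],
    fun v hv => hb ?_⟩
  rw [rad_coe] at hv
  have h2 : ‖v‖ ^ α < δ ^ α := arctan_strictMono.lt_iff_lt.1 (by linarith)
  simpa using (rpow_lt_rpow_iff (norm_nonneg v) hδ.le hw.pos).1 h2

lemma eventually_rad_lt (hw : ConfChart ρ x α w) {r : ℝ} (hr : 0 < r) :
    ∀ᶠ y in 𝓝 x, y ∈ w.source ∧ rad α (w y : RS) < r := by
  have h0 : ∀ᶠ y in 𝓝 x, y ∈ w.source := w.open_source.mem_nhds hw.mem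
  refine h0.and ?_
  have h1 : ContinuousAt (fun y => rad α (w y : RS)) x :=
    ((continuous_rad hw.pos).comp OnePoint.continuous_coe).continuousAt.comp
      (w.continuousAt hw.mem)
  refine h1.eventually (gt_mem_nhds ?_)
  change rad α (w x : RS) < r
  rw [hw.zero, rad_zero hw.pos]
  exact hr

/-- A cone geodesic joins the two images inside the chart. Along it `f` has dilation at most 1
except possibly at the apex, which a geodesic visits at most once; so the one-dimensional estimate
applies. -/
lemma abs_sub_le (hw : ConfChart ρ x α w) {f : RS → ℝ} (hf : Adm ρ f) {R : ℝ} (hR : R ≤ π)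
    (hball : ∀ v : ℂ, rad α v < R → v ∈ w.target) {a b : RS} (ha : a ∈ w.source)
    (hb : b ∈ w.source) (ha' : rad α (w a : RS) < R / 2) (hb' : rad α (w b : RS) < R / 2) :
    |f a - f b| ≤ coneDist α (w a) (w b) := by
  have hα := hw.pos
  obtain ⟨γ, h0, h1, hγ⟩ := exists_fb_geodesic hα (w b : RS) (w a : RS)
  rw [fb_comm, fb_coe] at h1 hγ
  set L := coneDist α (w a) (w b) with hL
  have hL0 : 0 ≤ L := arccos_nonneg _
  -- The distance to the apex is estimated from both ends of the geodesic; the sum of the two bounds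
  -- is `L` plus the two end radii, which is less than 2R.
  have hrad : ∀ s ∈ Set.Icc 0 L, rad α (γ s) < R := fun s hs => by
    have t1 := fb_triangle hα (γ s) (γ 0) (0 : ℂ)
    have t2 := fb_triangle hα (γ s) (γ L) (0 : ℂ)
    have t3 := fb_triangle hα (w a) (0 : ℂ) (w b)
    rw [hγ s hs 0 ⟨le_rfl, hL0⟩, h0, fb_zero hα, fb_zero hα, sub_zero, abs_of_nonneg hs.1] at t1
    rw [hγ s hs L ⟨hL0, le_rfl⟩, h1, fb_zero hα, fb_zero hα, abs_sub_comm,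
      abs_of_nonneg (sub_nonneg.2 hs.2)] at t2
    rw [fb_coe, fb_comm _ _ (w b : RS), fb_zero hα, fb_zero hα] at t3
    linarith
  have hfin : ∀ s ∈ Set.Icc 0 L, γ s = (toC (γ s) : RS) := fun s hs => by
    have : γ s ≠ OnePoint.infty := fun h => by
      have := hrad s hs
      rw [h, rad_infty] at this
      linarith
    obtain ⟨v, hv⟩ := OnePoint.ne_infty_iff_exists.1 this
    rw [← hv]
    rfl
  have htgt : ∀ s ∈ Set.Icc 0 L, toC (γ s) ∈ w.target := fun s hs => hball _ (by
    rw [← hfin s hs]; exact hrad s hs)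
  have hγc := fb_mul_path_continuous hα hγ
  have htoC : ∀ v : ℂ, ContinuousAt toC (v : RS) := fun v =>
    OnePoint.continuousAt_coe.2 continuousAt_id
  have hqc : ContinuousOn (fun s => w.symm (toC (γ s))) (Set.Icc 0 L) := fun s hs => by
    have := htoC (toC (γ s))
    rw [← hfin s hs] at this
    exact (w.continuousAt_symm (htgt s hs)).comp_continuousWithinAt
      (f := fun s => toC (γ s)) (this.comp_continuousWithinAt (hγc s hs))
  have hF : {s ∈ Set.Icc 0 L | γ s = ((0 : ℂ) : RS)}.Finite := by
    refine Set.Subsingleton.finite fun s hs t ht => ?_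
    have := hγ s hs.1 t ht.1
    rw [hs.2, ht.2, fb_self hα] at this
    exact sub_eq_zero.1 (abs_eq_zero.1 this.symm)
  have main := abs_sub_le_of_local hF hL0 (g := fun s => f (w.symm (toC (γ s))))
    (hf.cont.comp_continuousOn hqc) ?_
  · simpa only [h0, h1, toC_coe, w.left_inv ha, w.left_inv hb, sub_zero] using main
  · intro s hs hsF K hK
    have hsI : s ∈ Set.Icc 0 L := ⟨hs.1.le, hs.2.le⟩
    have hv0 : toC (γ s) ≠ 0 := fun h => hsF ⟨hsI, by rw [hfin s hsI, h]⟩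
    obtain ⟨u, hu, hy⟩ := hw.fin (w.symm (toC (γ s))) (w.map_target (htgt s hsI)) fun h => hv0 (by
      rw [← w.right_inv (htgt s hsI), h, hw.zero])
    have hus : (u : RS) ∈ w.source := hy ▸ w.map_target (htgt s hsI)
    have hnear := (hf.near u hu).trans (hw.leNear hu hus).1
    have hIcc : ∀ᶠ s' in 𝓝 s, s' ∈ Set.Icc 0 L := Icc_mem_nhds hs.1 hs.2
    have hqa : ContinuousAt (fun s => w.symm (toC (γ s))) s :=
      (hqc s hsI).continuousAt hIcc
    have hpa : Filter.Tendsto (fun s' => toC (w.symm (toC (γ s')))) (𝓝 s) (𝓝 u) := by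
      have := (htoC u).tendsto.comp (hy ▸ hqa.tendsto)
      exact this
    have hne : ∀ᶠ s' in 𝓝 s, w.symm (toC (γ s')) ≠ OnePoint.infty := by
      refine hqa.eventually (isOpen_ne.mem_nhds ?_)
      change w.symm (toC (γ s)) ≠ OnePoint.infty
      rw [hy]
      exact OnePoint.coe_ne_infty u
    have hpair : Filter.Tendsto (fun s' => (toC (w.symm (toC (γ s'))), u)) (𝓝 s) (𝓝 (u, u)) :=
      hpa.prodMk_nhds tendsto_const_nhds
    filter_upwards [hpair.eventually (hnear K hK), hne, hIcc] with s' h2 h3 h4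
    obtain ⟨u', hu'⟩ := OnePoint.ne_infty_iff_exists.1 h3
    rw [← hu', toC_coe] at h2
    rw [hu', ← hy, w.right_inv (htgt s hsI), w.right_inv (htgt s' h4), ← fb_coe, ← hfin s hsI,
      ← hfin s' h4, hγ s' h4 s hsI] at h2
    exact h2

/-- The truncated cone distance to `a`, extended by a constant outside the chart. -/
def bump (w : OpenPartialHomeomorph RS ℂ) (α R : ℝ) (a y : RS) : ℝ :=
  open Classical in
  if y ∈ w.source ∧ rad α (w y : RS) < R then min (fb α (w a) (w y)) (R / 2) else R / 2

lemma bump_eq_of_mem {R : ℝ} {a y : RS} (hy : y ∈ w.source) (hy' : rad α (w y : RS) < R) :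
    bump w α R a y = min (coneDist α (w a) (w y)) (R / 2) := by
  rw [bump, if_pos ⟨hy, hy'⟩, fb_coe]

/-- Two descriptions of the function hold on open sets that cover the sphere. On `U` it is a
truncated cone distance. Where the distance to the apex exceeds 3R/4 the truncation at R/2 is
active, because `a` is within R/8 of the apex; the remaining set `V` is compact, hence closed. -/
lemma adm_bump (hw : ConfChart ρ x α w) (hρ : ∀ u, 0 ≤ ρ u) {R : ℝ} (hR : 0 < R) (hR' : R ≤ π)
    (hball : ∀ v : ℂ, rad α v < R → v ∈ w.target) {a : RS}
    (ha' : rad α (w a : RS) < R / 8) : Adm ρ (bump w α R a) := by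
  have hα := hw.pos
  have hradw : ContinuousOn (fun y => rad α (w y : RS)) w.source :=
    ((continuous_rad hα).comp OnePoint.continuous_coe).comp_continuousOn w.continuousOn
  set U : Set RS := {y | y ∈ w.source ∧ rad α (w y : RS) < R} with hU
  have hUo : IsOpen U := hradw.isOpen_inter_preimage w.open_source isOpen_Iio
  set C : Set RS := {z | rad α z ≤ 3 * R / 4} with hC
  have hCc : IsCompact C := (isClosed_le (continuous_rad hα) continuous_const).isCompact
  have hCfin : ∀ z ∈ C, z = (toC z : RS) := fun z hz => by
    have : z ≠ OnePoint.infty := fun h => by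
      rw [hC, Set.mem_ofPred_eq, h, rad_infty] at hz
      linarith [pi_pos]
    obtain ⟨v, hv⟩ := OnePoint.ne_infty_iff_exists.1 this
    rw [← hv]
    rfl
  have hCt : ∀ z ∈ C, toC z ∈ w.target := fun z hz => hball _ (by
    rw [← hCfin z hz]; exact lt_of_le_of_lt hz (by linarith))
  set V : Set RS := (fun z => w.symm (toC z)) '' C with hV
  have hVc : IsClosed V := by
    refine (hCc.image_of_continuousOn fun z hz => ?_).isClosed
    have : ContinuousAt toC ((toC z : ℂ) : RS) := OnePoint.continuousAt_coe.2 continuousAt_id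
    rw [← hCfin z hz] at this
    exact (ContinuousAt.comp (g := w.symm) (f := toC)
      (w.continuousAt_symm (hCt z hz)) this).continuousWithinAt
  have hVU : ∀ y ∈ w.source, rad α (w y : RS) ≤ 3 * R / 4 → y ∈ V := fun y hy h =>
    ⟨(w y : RS), h, by simp [w.left_inv hy]⟩
  have hUV : ∀ y, y ∉ U → y ∉ V := by
    rintro y hy ⟨z, hz, rfl⟩
    refine hy ⟨w.map_target (hCt z hz), ?_⟩
    simp only [w.right_inv (hCt z hz)]
    rw [← hCfin z hz]
    exact lt_of_le_of_lt hz (by linarith)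
  have hconst : ∀ y ∉ V, bump w α R a y = R / 2 := fun y hy => by
    rw [bump]
    split_ifs with h
    · have h1 : 3 * R / 4 < rad α (w y : RS) := by
        by_contra! h2
        exact hy (hVU y h.1 h2)
      have h2 := fb_triangle hα (w y) (w a) (0 : ℂ)
      rw [fb_zero hα, fb_zero hα, fb_comm] at h2
      exact min_eq_right (by linarith)
    · rfl
  have hUeq : ∀ y ∈ U, bump w α R a y = min (fb α (w a) (w y)) (R / 2) := fun y hy => if_pos hy
  refine ⟨continuous_iff_continuousAt.2 fun y => ?_, fun u hu => ?_⟩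
  · by_cases hy : y ∈ U
    · have h1 : ContinuousAt (fun y => min (fb α (w a) (w y)) (R / 2)) y := by
        have h2 : Continuous fun z : ℂ => min (fb α (w a) z) (R / 2) :=
          ((continuous_fb hα).comp (continuous_const.prodMk OnePoint.continuous_coe)).min
            continuous_const
        exact ContinuousAt.comp (g := fun z : ℂ => min (fb α (w a) z) (R / 2)) h2.continuousAt
          (w.continuousAt hy.1)
      exact h1.congr ((hUo.mem_nhds hy : U ∈ 𝓝 y) |> fun h => Filter.mem_of_superset h
        fun z hz => (hUeq z hz).symm)
    · have h1 : ContinuousAt (fun _ : RS => R / 2) y := continuousAt_const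
      exact h1.congr (Filter.mem_of_superset (hVc.isOpen_compl.mem_nhds (hUV y hy))
        fun z hz => (hconst z hz).symm)
  · have hcoe : Filter.Tendsto ((↑) : ℂ → RS) (𝓝 u) (𝓝 (u : RS)) :=
      OnePoint.continuous_coe.tendsto u
    have hpair : ∀ {s : Set RS}, s ∈ 𝓝 (u : RS) →
        ∀ᶠ p : ℂ × ℂ in 𝓝 (u, u), (p.1 : RS) ∈ s ∧ (p.2 : RS) ∈ s := fun {s} hs =>
      ((continuous_fst.tendsto (u, u)).eventually (hcoe hs)).and
        ((continuous_snd.tendsto (u, u)).eventually (hcoe hs))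
    have hnn : ∀ᶠ p : ℂ × ℂ in 𝓝 (u, u), 0 ≤ ρ u * ‖p.1 - p.2‖ :=
      .of_forall fun p => mul_nonneg (hρ u) (norm_nonneg _)
    by_cases hy : (u : RS) ∈ U
    · refine LeNear.trans (G := fun a b : ℂ => coneDist α (w a) (w b)) (LeNear.of_le ?_
        (.of_forall fun p => arccos_nonneg _)) (hw.leNear hu hy.1).2
      filter_upwards [hpair (hUo.mem_nhds hy)] with p ⟨h1, h2⟩
      rw [hUeq _ h1, hUeq _ h2]
      refine (abs_min_sub_min_le_max _ _ _ _).trans ?_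
      rw [sub_self, abs_zero, max_eq_left (abs_nonneg _), ← fb_coe, abs_le]
      have a1 := fb_triangle hα (w a) (w p.1) (w p.2)
      have a2 := fb_triangle hα (w a) (w p.2) (w p.1)
      rw [fb_comm α (w p.2)] at a2
      constructor <;> linarith
    · refine LeNear.of_le ?_ hnn
      filter_upwards [hpair (hVc.isOpen_compl.mem_nhds (hUV _ hy)), hnn] with p ⟨h1, h2⟩ h3
      rw [hconst _ h1, hconst _ h2, sub_self, abs_zero]
      exact h3

end ConfChart

/-- The length metric of the conformal metric `ρ(u) |du|`. -/
def confDist (ρ : ℂ → ℝ) (x y : RS) : ℝ := ⨆ f : {f : RS → ℝ // Adm ρ f}, |f.1 x - f.1 y|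

/-- The conformal metric `ρ(u) |du|` has local cone coordinates everywhere. -/
structure IsConf (ρ : ℂ → ℝ) : Prop where
  nonneg : ∀ u, 0 ≤ ρ u
  exists_chart : ∀ x, ∃ α w, ConfChart ρ x α w

namespace IsConf

variable {ρ : ℂ → ℝ} (H : IsConf ρ)
include H

lemma adm_const (c : ℝ) : Adm ρ fun _ => c :=
  ⟨continuous_const, fun u _ => LeNear.of_le
    (.of_forall fun p => by simpa using mul_nonneg (H.nonneg u) (norm_nonneg _))
    (.of_forall fun p => mul_nonneg (H.nonneg u) (norm_nonneg _))⟩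

lemma bddAbove (x y : RS) :
    BddAbove (Set.range fun f : {f : RS → ℝ // Adm ρ f} => |f.1 x - f.1 y|) := by
  have key : ∃ C, ∀ f, Adm ρ f → |f x - f y| ≤ C := by
    -- A bound valid for all admissible functions is a symmetric and transitive relation that holds
    -- near each point, so connectedness of the sphere spreads it to all pairs.
    let P : RS → RS → Prop := fun x y => ∃ C, ∀ f, Adm ρ f → |f x - f y| ≤ C
    have : Std.Symm P := ⟨fun a b ⟨C, hC⟩ => ⟨C, fun f hf => by rw [abs_sub_comm]; exact hC f hf⟩⟩
    have : IsTrans RS P := ⟨fun a b c ⟨C, hC⟩ ⟨D, hD⟩ => ⟨C + D, fun f hf =>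
      (_root_.abs_sub_le _ _ _).trans (add_le_add (hC f hf) (hD f hf))⟩⟩
    refine PreconnectedSpace.induction₂ P (fun x => ?_) inferInstance x y
    obtain ⟨α, w, hw⟩ := H.exists_chart x
    obtain ⟨R, hR, hR', hball⟩ := hw.exists_radius
    filter_upwards [hw.eventually_rad_lt (half_pos hR)] with y hy
    exact ⟨π, fun f hf => (hw.abs_sub_le hf hR' hball hw.mem hy.1
      (by rw [hw.zero, rad_zero hw.pos]; linarith) hy.2).trans (arccos_le_pi _)⟩
  obtain ⟨C, hC⟩ := key
  exact ⟨C, by rintro _ ⟨f, rfl⟩; exact hC f.1 f.2⟩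

lemma le_confDist {f : RS → ℝ} (hf : Adm ρ f) (x y : RS) : |f x - f y| ≤ confDist ρ x y :=
  le_ciSup (H.bddAbove x y) ⟨f, hf⟩

lemma confDist_le {x y : RS} {C : ℝ} (h : ∀ f, Adm ρ f → |f x - f y| ≤ C) :
    confDist ρ x y ≤ C :=
  haveI : Nonempty {f : RS → ℝ // Adm ρ f} := ⟨⟨_, H.adm_const 0⟩⟩
  ciSup_le fun f => h f.1 f.2

lemma confDist_self (x : RS) : confDist ρ x x = 0 :=
  le_antisymm (H.confDist_le fun f _ => by simp) ((H.le_confDist (H.adm_const 0) x x).trans' (by simp))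

lemma confDist_nonneg (x y : RS) : 0 ≤ confDist ρ x y :=
  (H.le_confDist (H.adm_const 0) x y).trans' (by simp)

omit H in
lemma confDist_comm (x y : RS) : confDist ρ x y = confDist ρ y x := by
  simp only [confDist, abs_sub_comm]

lemma confDist_triangle (x y z : RS) : confDist ρ x z ≤ confDist ρ x y + confDist ρ y z :=
  H.confDist_le fun _ hf => (_root_.abs_sub_le _ _ _).trans
    (add_le_add (H.le_confDist hf _ _) (H.le_confDist hf _ _))

/-- Near the centre of a cone coordinate the length metric is the cone distance. -/
lemma confDist_eq {x : RS} {α : ℝ} {w : OpenPartialHomeomorph RS ℂ} (hw : ConfChart ρ x α w) :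
    ∀ᶠ p : RS × RS in 𝓝 (x, x), confDist ρ p.1 p.2 = coneDist α (w p.1) (w p.2) := by
  obtain ⟨R, hR, hR', hball⟩ := hw.exists_radius
  have h8 := hw.eventually_rad_lt (show 0 < R / 8 by linarith)
  filter_upwards [(continuous_fst.tendsto (x, x)).eventually h8,
    (continuous_snd.tendsto (x, x)).eventually h8] with p ⟨a1, a2⟩ ⟨b1, b2⟩
  refine le_antisymm (H.confDist_le fun f hf => hw.abs_sub_le hf hR' hball a1 b1 (by linarith)
    (by linarith)) ?_
  -- The lower bound comes from testing with the truncated distance to the first point, whose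
  -- truncation is inactive here.
  have h1 := H.le_confDist (hw.adm_bump H.nonneg hR hR' hball a2) p.1 p.2
  have h2 := fb_triangle hw.pos (w p.1) (0 : ℂ) (w p.2)
  rw [fb_comm _ (0 : ℂ) (w p.2 : RS), fb_zero hw.pos, fb_zero hw.pos, fb_coe] at h2
  rw [ConfChart.bump_eq_of_mem a1 (by linarith), ConfChart.bump_eq_of_mem b1 (by linarith),
    min_eq_left (show coneDist α (w p.1) (w p.2) ≤ R / 2 by linarith),
    ← fb_coe α (w p.1) (w p.1), fb_self hw.pos, min_eq_left (by linarith), zero_sub, abs_neg] at h1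
  exact (le_abs_self _).trans h1

lemma tendsto_confDist (x : RS) : Filter.Tendsto (fun y => confDist ρ y x) (𝓝 x) (𝓝 0) := by
  obtain ⟨α, w, hw⟩ := H.exists_chart x
  have h1 : Filter.Tendsto (fun y => (y, x)) (𝓝 x) (𝓝 (x, x)) :=
    Filter.tendsto_id.prodMk_nhds tendsto_const_nhds
  have h2 : Filter.Tendsto (fun y => fb α (w y) (w x)) (𝓝 x) (𝓝 0) :=
    (tendsto_fb_self hw.pos (w x : RS)).comp
      ((OnePoint.continuous_coe.tendsto (w x)).comp (w.continuousAt hw.mem).tendsto)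
  exact h2.congr' ((h1.eventually (H.confDist_eq hw)).mono fun y hy => hy.symm)

lemma continuous_confDist : Continuous fun p : RS × RS => confDist ρ p.1 p.2 :=
  continuous_of_triangle confDist_comm H.confDist_triangle H.tendsto_confDist

lemma eq_of_confDist_eq_zero {x y : RS} (h : confDist ρ x y = 0) : x = y := by
  obtain ⟨α, w, hw⟩ := H.exists_chart x
  obtain ⟨R, hR, hR', hball⟩ := hw.exists_radius
  have h0 : rad α (w x : RS) = 0 := by rw [hw.zero, rad_zero hw.pos]
  have h1 := H.le_confDist (hw.adm_bump H.nonneg hR hR' hball (a := x) (by linarith)) x y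
  rw [h, ConfChart.bump_eq_of_mem hw.mem (by linarith), ← fb_coe, fb_self hw.pos,
    min_eq_left (by linarith), zero_sub, abs_neg] at h1
  have h2 := abs_nonpos_iff.1 h1
  rw [ConfChart.bump] at h2
  split_ifs at h2 with h3
  · have h4 : fb α (w x) (w y) = 0 := by
      rcases min_choice (fb α (w x) (w y)) (R / 2) with h | h
      · rwa [h] at h2
      · rw [h] at h2; linarith
    exact w.injOn hw.mem h3.1 (OnePoint.coe_injective (fb_eq_zero hw.pos h4))
  · linarith

lemma leNear_confDist {u : ℂ} (hu : u ≠ 0) :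
    LeNear (fun a b : ℂ => confDist ρ a b) (fun a b : ℂ => ρ u * ‖a - b‖) u := by
  obtain ⟨α, w, hw⟩ := H.exists_chart u
  have h1 : Filter.Tendsto (fun p : ℂ × ℂ => ((p.1 : RS), (p.2 : RS))) (𝓝 (u, u))
      (𝓝 ((u : RS), (u : RS))) :=
    ((OnePoint.continuous_coe.tendsto u).comp (continuous_fst.tendsto (u, u))).prodMk_nhds
      ((OnePoint.continuous_coe.tendsto u).comp (continuous_snd.tendsto (u, u)))
  exact (hw.leNear hu hw.mem).2.congr
    ((h1.eventually (H.confDist_eq hw)).mono fun p hp => hp.symm) (.of_forall fun _ => rfl)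

/-- The length metric is infinitesimally bounded by its own density, so functions that are locally
1-Lipschitz for it are again admissible. -/
lemma adm_of_locally_lipschitz {f : RS → ℝ} (h : ∀ x, ∀ᶠ p : RS × RS in 𝓝 (x, x),
    |f p.1 - f p.2| ≤ confDist ρ p.1 p.2) : Adm ρ f := by
  refine ⟨continuous_iff_continuousAt.2 fun x => ?_, fun u hu => ?_⟩
  · refine tendsto_iff_dist_tendsto_zero.2 (squeeze_zero' (.of_forall fun _ => dist_nonneg) ?_
      (H.tendsto_confDist x))
    have h1 : Filter.Tendsto (fun y => (y, x)) (𝓝 x) (𝓝 (x, x)) :=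
      Filter.tendsto_id.prodMk_nhds tendsto_const_nhds
    exact h1.eventually (h x)
  · have h1 : Filter.Tendsto (fun p : ℂ × ℂ => ((p.1 : RS), (p.2 : RS))) (𝓝 (u, u))
        (𝓝 ((u : RS), (u : RS))) :=
      ((OnePoint.continuous_coe.tendsto u).comp (continuous_fst.tendsto (u, u))).prodMk_nhds
        ((OnePoint.continuous_coe.tendsto u).comp (continuous_snd.tendsto (u, u)))
    refine LeNear.trans (G := fun a b : ℂ => confDist ρ a b) (LeNear.of_le (h1.eventually (h u))
      (.of_forall fun p => H.confDist_nonneg _ _)) (H.leNear_confDist hu)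

/-- Duality: suppose that no point lies within L/2 + η of both `x` and `y`, and put r = L/2 + η/2.
Near each point one of the truncated distances min(d(x, ·), r) and min(d(y, ·), r) is constant, so
their difference is admissible. Between `x` and `y` it changes by 2 min(L, r), which exceeds L when
L > 0. Compactness turns approximate midpoints into a midpoint. -/
lemma confDist_midpoint (x y : RS) :
    ∃ z, confDist ρ x z = confDist ρ x y / 2 ∧ confDist ρ z y = confDist ρ x y / 2 := by
  set L := confDist ρ x y with hL
  have hcx : Continuous fun z => confDist ρ x z :=
    H.continuous_confDist.comp (continuous_const.prodMk continuous_id)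
  have hcy : Continuous fun z => confDist ρ y z :=
    H.continuous_confDist.comp (continuous_const.prodMk continuous_id)
  have happrox : ∀ η > 0, ∃ z, confDist ρ x z < L / 2 + η ∧ confDist ρ y z < L / 2 + η := by
    intro η hη
    by_contra! hno
    have hL0 := H.confDist_nonneg x y
    set r := L / 2 + η / 2 with hr
    have hlip : ∀ c (a b : RS), |min (confDist ρ c a) r - min (confDist ρ c b) r| ≤
        confDist ρ a b := fun c a b => by
      refine (abs_min_sub_min_le_max _ _ _ _).trans ?_
      rw [sub_self, abs_zero, max_eq_left (abs_nonneg _), abs_le]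
      have a1 := H.confDist_triangle c a b
      have a2 := H.confDist_triangle c b a
      rw [confDist_comm b a] at a2
      constructor <;> linarith
    have hadm : Adm ρ fun z => min (confDist ρ x z) r - min (confDist ρ y z) r := by
      refine H.adm_of_locally_lipschitz fun z => ?_
      have hev : ∀ {c}, r < confDist ρ c z → ∀ᶠ p : RS × RS in 𝓝 (z, z),
          min (confDist ρ c p.1) r = r ∧ min (confDist ρ c p.2) r = r := fun {c} hc => by
        have hcc : Continuous fun z => confDist ρ c z :=
          H.continuous_confDist.comp (continuous_const.prodMk continuous_id)
        have h1 := hcc.continuousAt.eventually (lt_mem_nhds hc)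
        filter_upwards [(continuous_fst.tendsto (z, z)).eventually h1,
          (continuous_snd.tendsto (z, z)).eventually h1] with p h2 h3
        exact ⟨min_eq_right h2.le, min_eq_right h3.le⟩
      rcases lt_or_ge (confDist ρ x z) (L / 2 + η) with h | h
      · filter_upwards [hev (c := y) (by have := hno z h; linarith)] with p ⟨h1, h2⟩
        rw [h1, h2, sub_sub_sub_cancel_right]
        exact hlip x _ _
      · filter_upwards [hev (c := x) (by linarith)] with p ⟨h1, h2⟩
        rw [h1, h2, sub_sub_sub_cancel_left, abs_sub_comm]
        exact hlip y _ _
    have h1 := H.le_confDist hadm x y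
    rw [H.confDist_self, H.confDist_self, confDist_comm y x, ← hL, min_eq_left (by linarith)] at h1
    rcases hL0.eq_or_lt with h0 | h0
    · have := hno x (by rw [H.confDist_self]; linarith)
      rw [confDist_comm, ← hL] at this
      linarith
    · have hr0 : 0 < min L r := lt_min h0 (by linarith)
      rw [zero_sub, sub_zero, abs_sub_comm, sub_neg_eq_add, abs_of_pos (by linarith)] at h1
      rcases min_choice L r with h | h <;> rw [h] at h1 hr0 <;> linarith
  obtain ⟨z, -, hz⟩ := isCompact_univ.exists_isMinOn (Set.univ_nonempty (α := RS))
    (hcx.max hcy).continuousOn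
  have hmax : max (confDist ρ x z) (confDist ρ y z) ≤ L / 2 := by
    refine le_of_forall_pos_le_add fun η hη => ?_
    obtain ⟨z', h1, h2⟩ := happrox η hη
    exact (hz (Set.mem_univ z')).trans (max_le h1.le h2.le)
  have h1 := (le_max_left _ _).trans hmax
  have h2 := (le_max_right _ _).trans hmax
  have h3 := H.confDist_triangle x z y
  rw [confDist_comm z y, ← hL] at h3
  exact ⟨z, by linarith, by rw [confDist_comm]; linarith⟩

/-- The Riemann sphere with the length metric of a conformal metric. -/
@[reducible]
def metric : MetricSpace RS :=
  letI m : MetricSpace RS :=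
    { dist := confDist ρ
      dist_self := H.confDist_self
      dist_comm := confDist_comm
      dist_triangle := H.confDist_triangle
      eq_of_dist_eq_zero := H.eq_of_confDist_eq_zero }
  -- The charts live on the one-point compactification, so the metric has to carry literally that
  -- topology.
  m.replaceTopology (by
    refine TopologicalSpace.ext_nhds fun x => le_antisymm ?_ ?_
    · rw [(@Metric.nhds_basis_ball RS m.toPseudoMetricSpace x).ge_iff]
      intro ε hε
      exact (H.tendsto_confDist x).eventually (gt_mem_nhds hε)
    · have h : Filter.Tendsto (fun y => confDist ρ y x)
          (@nhds RS m.toUniformSpace.toTopologicalSpace x) (𝓝 0) := by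
        refine tendsto_order.2 ⟨fun a ha => .of_forall fun y => ha.trans_le (H.confDist_nonneg y x),
          fun a ha => ?_⟩
        exact @Metric.ball_mem_nhds RS m.toPseudoMetricSpace x a ha
      exact tendsto_of_sep H.continuous_confDist H.confDist_nonneg
        (fun _ _ => H.eq_of_confDist_eq_zero) h)

end IsConf

/-! ### The Riemann sphere as a Riemann surface -/

/-- Inversion on the Riemann sphere. -/
def invFun (x : RS) : RS :=
  open Classical in
  x.elim ((0 : ℂ) : RS) fun u => if u = 0 then OnePoint.infty else ((u⁻¹ : ℂ) : RS)

@[simp] lemma invFun_infty : invFun OnePoint.infty = (0 : ℂ) := rfl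
@[simp] lemma invFun_zero : invFun ((0 : ℂ) : RS) = OnePoint.infty := if_pos rfl
lemma invFun_coe {u : ℂ} (hu : u ≠ 0) : invFun (u : RS) = (u⁻¹ : ℂ) := if_neg hu

lemma invFun_invFun (x : RS) : invFun (invFun x) = x := by
  induction x using OnePoint.rec with
  | infty => simp
  | coe u =>
    by_cases hu : u = 0
    · simp [hu]
    · rw [invFun_coe hu, invFun_coe (inv_ne_zero hu), inv_inv]

lemma continuous_invFun : Continuous invFun := by
  rw [OnePoint.continuous_iff]
  constructor
  · rw [Filter.coclosedCompact_eq_cocompact, invFun_infty]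
    have h1 : Filter.Tendsto (fun u : ℂ => ((u⁻¹ : ℂ) : RS)) (Filter.cocompact ℂ) (𝓝 ((0 : ℂ) : RS)) :=
      (OnePoint.continuous_coe.tendsto 0).comp (Filter.tendsto_inv₀_cobounded (α := ℂ) |>.mono_left
        (by rw [← Metric.cobounded_eq_cocompact]))
    refine h1.congr' ?_
    have : ∀ᶠ u in Filter.cocompact ℂ, u ≠ 0 := by
      have := (isCompact_singleton (x := (0 : ℂ))).compl_mem_cocompact
      exact this
    filter_upwards [this] with u hu using (invFun_coe hu).symm
  · rw [continuous_iff_continuousAt]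
    intro u
    by_cases hu : u = 0
    · subst hu
      rw [continuousAt_iff_punctured_nhds]
      simp only [invFun_zero]
      have h1 : Filter.Tendsto (fun u : ℂ => ((u⁻¹ : ℂ) : RS)) (𝓝[≠] 0) (𝓝 OnePoint.infty) := by
        refine (OnePoint.tendsto_coe_infty (X := ℂ)).comp ?_
        rw [Filter.coclosedCompact_eq_cocompact, ← Metric.cobounded_eq_cocompact]
        exact Filter.tendsto_inv₀_nhdsNE_zero
      refine h1.congr' ?_
      filter_upwards [self_mem_nhdsWithin] with u hu using (invFun_coe hu).symm
    · have h1 : ContinuousAt (fun u : ℂ => ((u⁻¹ : ℂ) : RS)) u :=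
        OnePoint.continuous_coe.continuousAt.comp (continuousAt_inv₀ hu)
      refine h1.congr ?_
      filter_upwards [eventually_ne_nhds hu] with v hv using (invFun_coe hv).symm

/-- Inversion as a homeomorphism. -/
def invHomeo : RS ≃ₜ RS where
  toFun := invFun
  invFun := invFun
  left_inv := invFun_invFun
  right_inv := invFun_invFun
  continuous_toFun := continuous_invFun
  continuous_invFun := continuous_invFun

/-- The affine coordinate on the finite part. -/
def chartZero : OpenPartialHomeomorph RS ℂ :=
  (OnePoint.isOpenEmbedding_coe (X := ℂ)).toOpenPartialHomeomorph.symm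

/-- The affine coordinate at infinity. -/
def chartInfty : OpenPartialHomeomorph RS ℂ :=
  invHomeo.toOpenPartialHomeomorph.trans chartZero

lemma chartZero_source : chartZero.source = Set.range ((↑) : ℂ → RS) := by simp [chartZero]

lemma chartZero_target : chartZero.target = Set.univ := by simp [chartZero]

lemma chartZero_symm (u : ℂ) : chartZero.symm u = (u : RS) := rfl

@[simp] lemma coe_mem_chartZero (u : ℂ) : (u : RS) ∈ chartZero.source := by
  rw [chartZero_source]; exact ⟨u, rfl⟩

@[simp] lemma chartZero_coe (u : ℂ) : chartZero (u : RS) = u := by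
  rw [← chartZero_symm, chartZero.right_inv (by simp [chartZero_target])]

lemma mem_chartInfty {x : RS} : x ∈ chartInfty.source ↔ x ≠ ((0 : ℂ) : RS) := by
  simp only [chartInfty, OpenPartialHomeomorph.trans_source, Homeomorph.toOpenPartialHomeomorph_source,
    Set.univ_inter, Set.mem_preimage, chartZero_source]
  change invFun x ∈ _ ↔ _
  rw [← not_iff_not, OnePoint.notMem_range_coe_iff, not_not]
  constructor
  · intro h; rw [← invFun_invFun x, h, invFun_infty]
  · rintro rfl; simp

lemma chartInfty_apply (x : RS) : chartInfty x = chartZero (invFun x) := rfl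

@[simp] lemma chartInfty_infty : chartInfty OnePoint.infty = 0 := by simp [chartInfty_apply]

lemma chartInfty_coe {u : ℂ} (hu : u ≠ 0) : chartInfty (u : RS) = u⁻¹ := by
  simp [chartInfty_apply, invFun_coe hu]

lemma chartInfty_symm (u : ℂ) : chartInfty.symm u = invFun (u : RS) := rfl

lemma chartInfty_target : chartInfty.target = Set.univ := by
  simp [chartInfty, chartZero_target]

instance : ChartedSpace ℂ RS where
  atlas := {chartZero, chartInfty}
  chartAt x := open Classical in if x = OnePoint.infty then chartInfty else chartZero
  mem_chart_source x := by
    split_ifs with h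
    · rw [h, mem_chartInfty]; exact OnePoint.infty_ne_coe _
    · rw [chartZero_source]
      exact OnePoint.ne_infty_iff_exists.1 h
  chart_mem_atlas x := by
    split_ifs <;> simp

lemma mem_contDiffGroupoid {e : OpenPartialHomeomorph ℂ ℂ} :
    e ∈ contDiffGroupoid ω 𝓘(ℂ) ↔ ContDiffOn ℂ ω e e.source ∧ ContDiffOn ℂ ω e.symm e.target := by
  rw [contDiffGroupoid, mem_groupoid_of_pregroupoid]
  simp [contDiffPregroupoid]

instance : IsManifold 𝓘(ℂ) ω RS := by
  have hc : ContDiffOn ℂ ω (fun u : ℂ => u⁻¹) {0}ᶜ := fun u hu =>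
    (contDiffAt_inv ℂ hu).contDiffWithinAt
  refine isManifold_of_contDiffOn _ _ _ ?_
  have key : ∀ e ∈ atlas ℂ RS, ∀ e' ∈ atlas ℂ RS,
      ContDiffOn ℂ ω (fun u => e' (e.symm u)) (e.symm.trans e').source := by
    rintro e (rfl | rfl) e' (rfl | rfl)
    · refine contDiffOn_id.congr fun u _ => ?_
      simp [chartZero_symm]
    · have : ∀ u ∈ (chartZero.symm.trans chartInfty).source, u ≠ 0 := by
        rintro u ⟨-, hu⟩ rfl
        exact mem_chartInfty.1 hu (by simp [chartZero_symm])
      refine (hc.mono this).congr fun u hu => ?_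
      rw [chartZero_symm, chartInfty_coe (this u hu)]
    · have : ∀ u ∈ (chartInfty.symm.trans chartZero).source, u ≠ 0 := by
        rintro u ⟨-, hu⟩ rfl
        change invFun ((0 : ℂ) : RS) ∈ chartZero.source at hu
        rw [invFun_zero, chartZero_source] at hu
        exact OnePoint.infty_notMem_range_coe hu
      refine (hc.mono this).congr fun u hu => ?_
      rw [chartInfty_symm, invFun_coe (this u hu), chartZero_coe]
    · refine contDiffOn_id.congr fun u _ => ?_
      exact chartInfty.right_inv (by simp [chartInfty_target])
  intro e e' he he'
  simpa [Function.comp_def] using key e he e' he'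

lemma chartZero_mem : chartZero ∈ IsManifold.maximalAtlas 𝓘(ℂ) ω RS :=
  IsManifold.subset_maximalAtlas (Set.mem_insert _ _)

lemma chartInfty_mem : chartInfty ∈ IsManifold.maximalAtlas 𝓘(ℂ) ω RS :=
  IsManifold.subset_maximalAtlas (Set.mem_insert_of_mem _ rfl)

lemma trans_mem_maximalAtlas {X : Type*} [TopologicalSpace X] [ChartedSpace ℂ X]
    {e : OpenPartialHomeomorph X ℂ} {g : OpenPartialHomeomorph ℂ ℂ}
    (he : e ∈ IsManifold.maximalAtlas 𝓘(ℂ) ω X) (hg : g ∈ contDiffGroupoid ω 𝓘(ℂ)) :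
    e.trans g ∈ IsManifold.maximalAtlas 𝓘(ℂ) ω X := by
  intro e' he'
  obtain ⟨h1, h2⟩ := he e' he'
  constructor
  · rw [OpenPartialHomeomorph.trans_symm_eq_symm_trans_symm, OpenPartialHomeomorph.trans_assoc]
    exact (contDiffGroupoid ω 𝓘(ℂ)).trans ((contDiffGroupoid ω 𝓘(ℂ)).symm hg) h1
  · rw [← OpenPartialHomeomorph.trans_assoc]
    exact (contDiffGroupoid ω 𝓘(ℂ)).trans h2 hg

/-- The holomorphic inverse function theorem. -/
lemma exists_holomorphic_chart {f : ℂ → ℂ} {x : ℂ} {U : Set ℂ} (hU : U ∈ 𝓝 x)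
    (hf : AnalyticAt ℂ f x) (hf' : deriv f x ≠ 0) :
    ∃ e : OpenPartialHomeomorph ℂ ℂ, x ∈ e.source ∧ e.source ⊆ U ∧ (∀ y, e y = f y) ∧
      (∀ y ∈ e.source, AnalyticAt ℂ f y ∧ deriv f y ≠ 0) ∧ e ∈ contDiffGroupoid ω 𝓘(ℂ) := by
  set e₀ := (hf.hasStrictDerivAt.hasStrictFDerivAt_equiv hf').toOpenPartialHomeomorph f with he₀
  have hx₀ : x ∈ e₀.source :=
    (hf.hasStrictDerivAt.hasStrictFDerivAt_equiv hf').mem_toOpenPartialHomeomorph_source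
  have hev : ∀ᶠ y in 𝓝 x, AnalyticAt ℂ f y ∧ deriv f y ≠ 0 ∧ y ∈ U :=
    hf.eventually_analyticAt.and ((hf.deriv.continuousAt.eventually_ne hf').and hU)
  obtain ⟨V, hV, hVo, hxV⟩ := eventually_nhds_iff.1 hev
  refine ⟨e₀.restrOpen V hVo, ⟨hx₀, hxV⟩, fun y hy => (hV y hy.2).2.2, fun y => rfl,
    fun y hy => ⟨(hV y hy.2).1, (hV y hy.2).2.1⟩, ?_⟩
  rw [mem_contDiffGroupoid]
  refine ⟨fun y hy => ((hV y hy.2).1.contDiffAt).contDiffWithinAt, fun z hz => ?_⟩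
  have hy := (e₀.restrOpen V hVo).map_target hz
  refine ContDiffAt.contDiffWithinAt ?_
  exact (e₀.restrOpen V hVo).contDiffAt_symm_deriv (hV _ hy.2).2.1 hz
    (hV _ hy.2).1.differentiableAt.hasDerivAt (hV _ hy.2).1.contDiffAt

lemma exists_confChart {ρ : ℂ → ℝ} {u₀ : ℂ} {α : ℝ} {f : ℂ → ℂ} (hα : 0 < α)
    (hf : AnalyticAt ℂ f u₀) (h0 : f u₀ = 0) (hf' : deriv f u₀ ≠ 0)
    (hconf : ∀ᶠ u in 𝓝 u₀, u ≠ 0 →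
      (f u ≠ 0 ∨ α = 1) ∧ coneFactor α (f u) * ‖deriv f u‖ = ρ u) :
    ∃ w ∈ IsManifold.maximalAtlas 𝓘(ℂ) ω RS, ConfChart ρ u₀ α w ∧ ∀ u : ℂ, w u = f u := by
  have hU : ∀ᶠ u in 𝓝 u₀, (u ≠ u₀ → u ≠ 0) ∧ (u ≠ 0 →
      (f u ≠ 0 ∨ α = 1) ∧ coneFactor α (f u) * ‖deriv f u‖ = ρ u) := by
    refine Filter.Eventually.and ?_ hconf
    by_cases h : u₀ = 0
    · exact .of_forall fun u hu => h ▸ hu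
    · filter_upwards [eventually_ne_nhds h] with u hu _ using hu
  obtain ⟨e, hxe, heU, hef, hed, heg⟩ := exists_holomorphic_chart hU hf hf'
  have hw : ∀ u : ℂ, (chartZero.trans e) u = f u := fun u => by
    simp [hef]
  have hs : ∀ u : ℂ, (u : RS) ∈ (chartZero.trans e).source → u ∈ e.source := fun u hu => by
    simpa using hu.2
  refine ⟨chartZero.trans e, trans_mem_maximalAtlas chartZero_mem heg, ⟨hα, ?_, ?_, ?_, ?_⟩, hw⟩
  · exact ⟨coe_mem_chartZero _, by simpa using hxe⟩
  · rw [hw, h0]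
  · intro y hy hne
    have hy' : y ∈ chartZero.source := hy.1
    rw [chartZero_source] at hy'
    obtain ⟨u, rfl⟩ := hy'
    exact ⟨u, (heU (hs u hy)).1 fun h => hne (by rw [h]), rfl⟩
  · intro u hu hus
    obtain ⟨h1, h2⟩ := (heU (hs u hus)).2 hu
    obtain ⟨h3, h4⟩ := hed u (hs u hus)
    simp only [hw]
    exact ⟨h1, _, h4, h3.hasStrictDerivAt, h2⟩

/-- The coordinate at infinity is v = 1/u, and |dv| = |v| ^ 2 |du| accounts for the extra factor. -/
lemma exists_confChart_infty {ρ : ℂ → ℝ} {α : ℝ} {f : ℂ → ℂ} (hα : 0 < α)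
    (hf : AnalyticAt ℂ f 0) (h0 : f 0 = 0) (hf' : deriv f 0 ≠ 0)
    (hconf : ∀ᶠ v in 𝓝 (0 : ℂ), v ≠ 0 →
      (f v ≠ 0 ∨ α = 1) ∧ coneFactor α (f v) * ‖deriv f v‖ * ‖v‖ ^ 2 = ρ v⁻¹) :
    ∃ w ∈ IsManifold.maximalAtlas 𝓘(ℂ) ω RS, ConfChart ρ OnePoint.infty α w ∧
      ∀ u : ℂ, u ≠ 0 → w u = f u⁻¹ := by
  obtain ⟨e, hxe, heU, hef, hed, heg⟩ := exists_holomorphic_chart hconf hf hf'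
  have hw : ∀ u : ℂ, u ≠ 0 → (chartInfty.trans e) u = f u⁻¹ := fun u hu => by
    simp [hef, chartInfty_coe hu]
  have hne : ∀ u : ℂ, (u : RS) ∈ (chartInfty.trans e).source → u ≠ 0 := fun u hu h =>
    mem_chartInfty.1 hu.1 (by rw [h])
  have hs : ∀ u : ℂ, (u : RS) ∈ (chartInfty.trans e).source → u⁻¹ ∈ e.source := fun u hu => by
    have h : chartInfty (u : RS) ∈ e.source := hu.2
    rwa [chartInfty_coe (hne u hu)] at h
  refine ⟨chartInfty.trans e, trans_mem_maximalAtlas chartInfty_mem heg, ⟨hα, ?_, ?_, ?_, ?_⟩, hw⟩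
  · exact ⟨mem_chartInfty.2 (OnePoint.infty_ne_coe _), by simpa using hxe⟩
  · simp [hef, h0]
  · intro y hy hy'
    obtain ⟨u, rfl⟩ := OnePoint.ne_infty_iff_exists.1 hy'
    exact ⟨u, hne u hy, rfl⟩
  · intro u hu hus
    obtain ⟨h1, h2⟩ := heU (hs u hus) (inv_ne_zero hu)
    obtain ⟨h3, h4⟩ := hed _ (hs u hus)
    rw [inv_inv] at h2
    rw [hw u hu]
    have hd : HasStrictDerivAt (fun v : ℂ => f v⁻¹) (deriv f u⁻¹ * -(u ^ 2)⁻¹) u :=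
      h3.hasStrictDerivAt.comp u (hasStrictDerivAt_inv hu)
    refine ⟨h1, _, ?_, hd.congr_of_eventuallyEq ?_, ?_⟩
    · exact mul_ne_zero h4 (neg_ne_zero.2 (inv_ne_zero (pow_ne_zero 2 hu)))
    · filter_upwards [eventually_ne_nhds hu] with v hv using (hw v hv).symm
    · rw [← h2, norm_mul, norm_neg, norm_inv, norm_inv, norm_pow, inv_pow, mul_assoc]

/-! ### The Riemann sphere and the unit sphere -/

lemma sph_ext_iff {a b c d : ℝ} : sph a b = sph c d ↔
    cos a * sin b = cos c * sin d ∧ sin a * sin b = sin c * sin d ∧ cos b = cos d := by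
  rw [Subtype.ext_iff, sph, sph]
  constructor
  · intro h
    have h' := fun i : Fin 3 => congrArg (fun v : EuclideanSpace ℝ (Fin 3) => v i) h
    refine ⟨?_, ?_, ?_⟩
    · simpa using h' 0
    · simpa using h' 1
    · simpa using h' 2
  · rintro ⟨h1, h2, h3⟩
    simp only [h1, h2, h3]

lemma exists_sph (u : S2) : ∃ ψ φ : ℝ, φ ∈ Set.Icc 0 π ∧ u = sph ψ φ := by
  obtain ⟨u, hu⟩ := u
  have h1 : u 0 ^ 2 + u 1 ^ 2 + u 2 ^ 2 = 1 := by
    rw [mem_sphere_zero_iff_norm, EuclideanSpace.norm_eq, Real.sqrt_eq_one] at hu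
    simpa [Fin.sum_univ_three] using hu
  set z : ℂ := ⟨u 0, u 1⟩ with hz
  have h2 : sin (arccos (u 2)) = ‖z‖ := by
    rw [sin_arccos, Complex.norm_eq_sqrt_sq_add_sq]
    congr 1
    simp only [hz]; linarith
  have hm1 : -1 ≤ u 2 := by nlinarith [sq_nonneg (u 0), sq_nonneg (u 1)]
  have hm2 : u 2 ≤ 1 := by nlinarith [sq_nonneg (u 0), sq_nonneg (u 1)]
  refine ⟨z.arg, arccos (u 2), ⟨arccos_nonneg _, arccos_le_pi _⟩, Subtype.ext ?_⟩
  have e0 : u 0 = cos z.arg * ‖z‖ := by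
    rw [mul_comm, Complex.norm_mul_cos_arg]
  have e1 : u 1 = sin z.arg * ‖z‖ := by
    rw [mul_comm, Complex.norm_mul_sin_arg]
  ext i
  fin_cases i
  · simpa [sph, h2] using e0
  · simpa [sph, h2] using e1
  · simp [sph, cos_arccos hm1 hm2]

/-- The identification of the Riemann sphere with the unit sphere that has colatitude `rad θ`. -/
def foot (θ : ℝ) (x : RS) : S2 := sph (toC x).arg (rad θ x)

lemma cos_sin_angle {z w : ℂ} (hz : z ≠ 0) (hw : w ≠ 0) :
    cos (z.arg - w.arg) = cos (InnerProductGeometry.angle z w) := by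
  rw [InnerProductGeometry.cos_angle, cos_sub, Complex.cos_arg hz, Complex.cos_arg hw,
    Complex.sin_arg, Complex.sin_arg, Complex.inner]
  simp only [Complex.mul_re, Complex.conj_re, Complex.conj_im]
  have := norm_pos_iff.2 hz
  have := norm_pos_iff.2 hw
  field_simp
  ring

lemma sphDist_foot_one (x y : RS) : sphDist (foot 1 x) (foot 1 y) = fb 1 x y := by
  rw [foot, foot, sphDist_sph, fb_eq, one_mul,
    min_eq_left (InnerProductGeometry.angle_le_pi _ _), sideOf, sideOf]
  by_cases hx : toC x = 0
  · rw [sin_rad_eq_zero hx one_pos]; simp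
  by_cases hy : toC y = 0
  · rw [sin_rad_eq_zero hy one_pos]; simp
  rw [cos_sin_angle hx hy]

lemma footballDist_foot {θ : ℝ} (hθ : 0 < θ) (x y : RS) :
    footballDist θ (foot θ x) (foot θ y) = fb θ x y := by
  have h2 : ∀ x : RS, arccos ((foot θ x).1 2) = rad θ x := fun x => by
    simp [foot, sph, arccos_cos (rad_nonneg θ x) (rad_le_pi θ x)]
  have h01 : ∀ x : RS, (⟨(foot θ x).1 0, (foot θ x).1 1⟩ : ℂ) =
      (sin (rad θ x) : ℝ) * Complex.exp ((toC x).arg * Complex.I) := fun x => by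
    apply Complex.ext
    · rw [Complex.re_ofReal_mul, Complex.exp_ofReal_mul_I_re, mul_comm]
      simp [foot, sph]
    · rw [Complex.im_ofReal_mul, Complex.exp_ofReal_mul_I_im, mul_comm]
      simp [foot, sph]
  rw [footballDist, h2, h2, h01, h01, fb_eq, polarConeDist_eq]
  by_cases hx : toC x = 0
  · rw [sideOf, sideOf, sin_rad_eq_zero hx hθ]; simp
  by_cases hy : toC y = 0
  · rw [sideOf, sideOf, sin_rad_eq_zero hy hθ]; simp
  have hs : ∀ x : RS, toC x ≠ 0 → 0 < sin (rad θ x) := fun x hx => by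
    induction x using OnePoint.rec with
    | infty => simp at hx
    | coe u =>
      have : u ≠ 0 := hx
      refine sin_pos_of_pos_of_lt_pi ?_ (rad_coe_lt θ u)
      have := arctan_pos.2 (rpow_pos_of_pos (norm_pos_iff.2 this) θ)
      rw [rad_coe]; linarith
  have hang : ∀ z : ℂ, z = ‖z‖ * Complex.exp (z.arg * Complex.I) := fun z =>
    (Complex.norm_mul_exp_arg_mul_I z).symm
  congr 3
  have hsm : ∀ {r s : ℝ} {z w : ℂ}, 0 < r → 0 < s →
      InnerProductGeometry.angle ((r : ℂ) * z) ((s : ℂ) * w) = InnerProductGeometry.angle z w := by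
    intro r s z w hr hs
    rw [← Complex.real_smul, ← Complex.real_smul,
      InnerProductGeometry.angle_smul_left_of_pos _ _ hr,
      InnerProductGeometry.angle_smul_right_of_pos _ _ hs]
  rw [hsm (hs x hx) (hs y hy)]
  conv_rhs => rw [hang (toC x), hang (toC y)]
  rw [hsm (norm_pos_iff.2 hx) (norm_pos_iff.2 hy)]

lemma continuous_sph_of {X : Type*} [TopologicalSpace X] {ψ φ : X → ℝ}
    (h1 : Continuous fun x => cos (ψ x) * sin (φ x)) (h2 : Continuous fun x => sin (ψ x) * sin (φ x))
    (h3 : Continuous fun x => cos (φ x)) : Continuous fun x => sph (ψ x) (φ x) := by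
  refine Continuous.subtype_mk ?_ _
  refine (PiLp.continuous_toLp 2 _).comp (continuous_pi fun i => ?_)
  fin_cases i
  · simpa using h1
  · simpa using h2
  · simpa using h3

/-- The argument enters only through its cosine and sine, which are continuous away from 0 and ∞; at
these two points the sine of the colatitude, by which they are multiplied, vanishes. -/
lemma continuous_foot {θ : ℝ} (hθ : 0 < θ) : Continuous (foot θ) := by
  have hsin : Continuous fun x => sin (rad θ x) := continuous_sin.comp (continuous_rad hθ)
  have key : ∀ f : ℂ → ℝ, (∀ z, |f z| ≤ 1) → (∀ z ≠ 0, ContinuousAt f z) →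
      Continuous fun x : RS => f (toC x) * sin (rad θ x) := by
    intro f hf hc
    rw [continuous_iff_continuousAt]
    intro x
    by_cases hx : toC x = 0
    · have h0 : sin (rad θ x) = 0 := sin_rad_eq_zero hx hθ
      rw [ContinuousAt, h0, mul_zero]
      refine squeeze_zero_norm (a := fun x => |sin (rad θ x)|) (fun y => ?_) ?_
      · rw [norm_mul, Real.norm_eq_abs, Real.norm_eq_abs]
        exact mul_le_of_le_one_left (abs_nonneg _) (hf _)
      · simpa [h0] using (hsin.tendsto x).abs
    · obtain ⟨u, rfl⟩ : ∃ u : ℂ, (u : RS) = x := by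
        refine OnePoint.ne_infty_iff_exists.1 ?_
        rintro rfl; simp at hx
      refine ContinuousAt.mul ?_ hsin.continuousAt
      rw [OnePoint.continuousAt_coe]
      exact hc u hx
  refine continuous_sph_of ?_ ?_ (continuous_cos.comp (continuous_rad hθ))
  · refine key (fun z => cos z.arg) (fun z => abs_cos_le_one _) fun z hz => ?_
    have : (fun z : ℂ => z.re / ‖z‖) =ᶠ[𝓝 z] fun z => cos z.arg := by
      filter_upwards [eventually_ne_nhds hz] with w hw using (Complex.cos_arg hw).symm
    exact (Complex.continuous_re.continuousAt.div continuous_norm.continuousAt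
      (norm_ne_zero_iff.2 hz)).congr this
  · refine key (fun z => sin z.arg) (fun z => abs_sin_le_one _) fun z hz => ?_
    simp only [Complex.sin_arg]
    exact Complex.continuous_im.continuousAt.div continuous_norm.continuousAt
      (norm_ne_zero_iff.2 hz)

lemma foot_pol {θ φ : ℝ} (hθ : 0 < θ) (hφ : φ ∈ Set.Icc 0 π) (ψ : ℝ) :
    foot θ (pol θ φ ψ) = sph ψ φ := by
  rw [foot, rad_pol hθ hφ, sph_ext_iff]
  obtain ⟨r, hr, hr', h⟩ := toC_pol (α := θ) hφ ψ
  rcases hφ.1.eq_or_lt with h0 | h0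
  · simp [← h0]
  rcases hφ.2.eq_or_lt with h1 | h1
  · simp [h1]
  have hr0 := hr' h0 h1
  have h2 : (cos (toC (pol θ φ ψ)).arg = cos ψ) ∧ sin (toC (pol θ φ ψ)).arg = sin ψ := by
    have hn : ‖toC (pol θ φ ψ)‖ = r := by
      rw [h, norm_mul, Complex.norm_exp_ofReal_mul_I, mul_one, Complex.norm_real,
        Real.norm_of_nonneg hr]
    have hne : toC (pol θ φ ψ) ≠ 0 := norm_pos_iff.1 (hn ▸ hr0)
    rw [Complex.cos_arg hne, Complex.sin_arg, hn, h]
    simp [Complex.exp_ofReal_mul_I_re, Complex.exp_ofReal_mul_I_im, hr0.ne']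
  rw [h2.1, h2.2]
  simp

lemma foot_injective {θ : ℝ} (hθ : 0 < θ) : Function.Injective (foot θ) := fun x y h =>
  fb_eq_zero hθ (by rw [← footballDist_foot hθ, h, footballDist_foot hθ, fb_self hθ])

lemma foot_surjective {θ : ℝ} (hθ : 0 < θ) : Function.Surjective (foot θ) := fun u => by
  obtain ⟨ψ, φ, hφ, rfl⟩ := exists_sph u
  exact ⟨_, foot_pol hθ hφ ψ⟩

/-- `foot θ` as a homeomorphism. -/
def footHomeo {θ : ℝ} (hθ : 0 < θ) : RS ≃ₜ S2 :=
  (continuous_foot hθ).homeoOfEquivCompactToT2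
    (f := Equiv.ofBijective _ ⟨foot_injective hθ, foot_surjective hθ⟩)

@[simp] lemma footHomeo_apply {θ : ℝ} (hθ : 0 < θ) (x : RS) : footHomeo hθ x = foot θ x := rfl

lemma foot_zero {θ : ℝ} (hθ : 0 < θ) : foot θ ((0 : ℂ) : RS) = sph 0 0 := by
  rw [foot, toC_coe, rad_zero hθ, Complex.arg_zero]

lemma foot_infty (θ : ℝ) : foot θ OnePoint.infty = sph 0 π := by
  rw [foot, toC_infty, rad_infty, Complex.arg_zero]

/-! ### Model metrics -/

/-- The quadratic form whose inverse is the density of the spherical metric in the coordinate `ζ`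
related to the standard coordinate by `ζ / (1 + c ζ)`. -/
def hh (c : ℝ) (ζ : ℂ) : ℝ := ‖1 + c * ζ‖ ^ 2 + ‖ζ‖ ^ 2

lemma hh_pos (c : ℝ) (ζ : ℂ) : 0 < hh c ζ := by
  by_cases h : ζ = 0
  · simp [hh, h]
  · have := norm_pos_iff.2 h
    rw [hh]; positivity

lemma hh_eq (c : ℝ) (ζ : ℂ) :
    hh c ζ = (1 + c * ζ.re) ^ 2 + (c * ζ.im) ^ 2 + ζ.re ^ 2 + ζ.im ^ 2 := by
  rw [hh, ← Complex.normSq_eq_norm_sq, ← Complex.normSq_eq_norm_sq, Complex.normSq_apply,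
    Complex.normSq_apply]
  simp
  ring

/-- `ζ` is a value of the power `u ^ θ`, as far as a metric with parameters `θ, c` can tell. -/
def Compat (θ c : ℝ) (u ζ : ℂ) : Prop := ‖ζ‖ = ‖u‖ ^ θ ∧ (c = 0 ∨ ∃ m : ℕ, θ = m ∧ ζ = u ^ m)

/-- Admissible parameters of the model metrics. -/
structure ModelPar (θ c : ℝ) : Prop where
  pos : 0 < θ
  nonneg : 0 ≤ c
  int : c = 0 ∨ ∃ m : ℕ, θ = m

lemma hh_compat {θ c : ℝ} {u ζ ζ' : ℂ} (h : Compat θ c u ζ) (h' : Compat θ c u ζ') :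
    hh c ζ = hh c ζ' := by
  obtain ⟨h1, h2⟩ := h
  obtain ⟨h1', h2'⟩ := h'
  by_cases hc : c = 0
  · simp [hh, hc, h1, h1']
  · obtain ⟨m, hm, rfl⟩ := h2.resolve_left hc
    obtain ⟨m', hm', rfl⟩ := h2'.resolve_left hc
    obtain rfl : m = m' := by exact_mod_cast hm.symm.trans hm'
    rfl

lemma compat_cpow {θ c : ℝ} (h : ModelPar θ c) {u : ℂ} (hu : u ≠ 0) :
    Compat θ c u (u ^ (θ : ℂ)) := by
  refine ⟨?_, h.int.imp id fun ⟨m, hm⟩ => ⟨m, hm, by simp [hm]⟩⟩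
  rw [Complex.norm_cpow_of_ne_zero hu]; simp

lemma branch_nat (m : ℕ) (κ : ℂ) {w a : ℂ} (hw : w ≠ 0) (ha : a ≠ 0) :
    branch m κ w a = κ * (a / w) ^ m := by
  rw [branch, Complex.ofReal_natCast, Complex.exp_nat_mul, Complex.exp_log (div_ne_zero ha hw)]

lemma norm_branch (α : ℝ) (κ : ℂ) {w a : ℂ} (hw : w ≠ 0) (ha : a ≠ 0) :
    ‖branch α κ w a‖ = ‖κ‖ * (‖a‖ / ‖w‖) ^ α := by
  have h1 : 0 < ‖a / w‖ := norm_pos_iff.2 (div_ne_zero ha hw)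
  rw [branch, norm_mul, Complex.norm_exp, ← norm_div, rpow_def_of_pos h1]
  congr 2
  simp [Complex.log_re, mul_comm]

lemma compat_branch {θ c : ℝ} {w κ u : ℂ} (h : Compat θ c w κ) (hw : w ≠ 0) (hu : u ≠ 0) :
    Compat θ c u (branch θ κ w u) := by
  have hn := norm_pos_iff.2 hw
  refine ⟨?_, h.2.imp id ?_⟩
  · rw [norm_branch θ κ hw hu, h.1, div_rpow (norm_nonneg _) hn.le]
    field_simp [(rpow_pos_of_pos hn θ).ne']
  · rintro ⟨m, rfl, rfl⟩
    refine ⟨m, rfl, ?_⟩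
    rw [branch_nat m _ hw hu, div_pow]
    field_simp

lemma Compat.ne_zero {θ c : ℝ} {u ζ : ℂ} (h : Compat θ c u ζ) (hu : u ≠ 0) : ζ ≠ 0 := by
  rw [← norm_pos_iff, h.1]; exact rpow_pos_of_pos (norm_pos_iff.2 hu) θ

/-- The conformal density of the model metric. -/
def density (θ c : ℝ) (u : ℂ) : ℝ := 2 * θ * ‖u‖ ^ θ / (‖u‖ * hh c (u ^ (θ : ℂ)))

lemma density_eq {θ c : ℝ} (h : ModelPar θ c) {u ζ : ℂ} (hu : u ≠ 0) (hζ : Compat θ c u ζ) :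
    density θ c u = 2 * θ * ‖ζ‖ / (‖u‖ * hh c ζ) := by
  rw [density, hh_compat (compat_cpow h hu) hζ, hζ.1]

lemma analyticAt_branch (α : ℝ) (κ : ℂ) {w a : ℂ} (h : a / w ∈ Complex.slitPlane) :
    AnalyticAt ℂ (branch α κ w) a := by
  unfold branch
  have h1 : AnalyticAt ℂ (fun a : ℂ => a / w) a := analyticAt_id.div_const
  exact analyticAt_const.mul ((analyticAt_const.mul (h1.clog h)).cexp)

lemma eventually_div_mem_slitPlane {w : ℂ} (hw : w ≠ 0) :
    ∀ᶠ a in 𝓝 w, a / w ∈ Complex.slitPlane := by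
  have h1 : ContinuousAt (fun a : ℂ => a / w) w := continuousAt_id.div_const w
  exact h1.eventually (Complex.isOpen_slitPlane.mem_nhds (by simp [div_self hw]))

/-- A coordinate `f` with `f ^ θ = u ^ θ / (1 + b u ^ θ)`. -/
lemma exists_root_chart {θ c : ℝ} (hθ : 0 < θ) (hi : c = 0 ∨ ∃ m : ℕ, θ = m) {b : ℂ}
    (hb : c = 0 → b = 0) :
    ∃ f : ℂ → ℂ, AnalyticAt ℂ f 0 ∧ f 0 = 0 ∧ deriv f 0 ≠ 0 ∧ ∀ᶠ u in 𝓝 (0 : ℂ), u ≠ 0 →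
      f u ≠ 0 ∧ AnalyticAt ℂ f u ∧ ∀ κ, Compat θ c u κ → 1 + b * κ ≠ 0 ∧
        ‖κ / (1 + b * κ)‖ = ‖f u‖ ^ θ ∧ ∀ᶠ a in 𝓝 u,
          branch θ (κ / (1 + b * κ)) (f u) (f a) = branch θ κ u a / (1 + b * branch θ κ u a) := by
  by_cases hc : c = 0
  · rw [hb hc]
    refine ⟨id, analyticAt_id, rfl, by simp, .of_forall fun u hu => ⟨hu, analyticAt_id,
      fun κ hκ => ⟨by simp, by simpa using hκ.1, .of_forall fun a => by simp⟩⟩⟩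
  obtain ⟨m, rfl⟩ := hi.resolve_left hc
  have hm : m ≠ 0 := by rintro rfl; simp at hθ
  have hm' : (m : ℂ) ≠ 0 := by exact_mod_cast hm
  set q : ℂ → ℂ := fun u => 1 + b * u ^ m with hq
  have hqa : ∀ u, AnalyticAt ℂ q u := fun u =>
    analyticAt_const.add (analyticAt_const.mul (analyticAt_id.pow m))
  have hq0 : q 0 = 1 := by simp [hq, hm]
  have hqs : ∀ᶠ u in 𝓝 (0 : ℂ), q u ∈ Complex.slitPlane :=
    (hqa 0).continuousAt.eventually (Complex.isOpen_slitPlane.mem_nhds (by simp [hq0]))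
  -- The principal branch of q ^ (−1/m), available because q is near 1.
  set g : ℂ → ℂ := fun u => Complex.exp (-(Complex.log (q u) / m)) with hg
  have hga : ∀ u, q u ∈ Complex.slitPlane → AnalyticAt ℂ g u := fun u hu =>
    (((hqa u).clog hu).div_const).neg.cexp
  have hgm : ∀ u, q u ≠ 0 → g u ^ m = (q u)⁻¹ := fun u hu => by
    rw [hg, ← Complex.exp_nat_mul, mul_neg, mul_div_cancel₀ _ hm', Complex.exp_neg,
      Complex.exp_log hu]
  have hg0 : g 0 = 1 := by simp [hg, hq0]
  have hfm : ∀ u, q u ≠ 0 → (u * g u) ^ m = u ^ m / (1 + b * u ^ m) := fun u hu => by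
    rw [mul_pow, hgm u hu, div_eq_mul_inv]
  refine ⟨fun u => u * g u, analyticAt_id.mul (hga 0 (by simp [hq0])), by simp, ?_, ?_⟩
  · have := (hasDerivAt_id (0 : ℂ)).mul (hga 0 (by simp [hq0])).differentiableAt.hasDerivAt
    have h2 := this.deriv
    simp only [hg0, id, one_mul, zero_mul, add_zero] at h2
    exact h2.trans_ne one_ne_zero
  filter_upwards [hqs.eventually_nhds] with u hu hu0
  have hus := hu.self_of_nhds
  have hqu : q u ≠ 0 := Complex.slitPlane_ne_zero hus
  have hfu : u * g u ≠ 0 := mul_ne_zero hu0 (Complex.exp_ne_zero _)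
  refine ⟨hfu, analyticAt_id.mul (hga u hus), fun κ hκ => ?_⟩
  obtain ⟨m', hmm, rfl⟩ := hκ.2.resolve_left hc
  obtain rfl : m = m' := by exact_mod_cast hmm
  refine ⟨hqu, ?_, ?_⟩
  · rw [← hfm u hqu, norm_pow, rpow_natCast]
  filter_upwards [hu, eventually_ne_nhds hu0] with a ha ha0
  have hqa : q a ≠ 0 := Complex.slitPlane_ne_zero ha
  rw [branch_nat m _ hu0 ha0, branch_nat m _ hfu (mul_ne_zero ha0 (Complex.exp_ne_zero _)),
    ← hfm u hqu, div_pow, div_pow, mul_div_cancel₀ _ (pow_ne_zero m hfu),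
    mul_div_cancel₀ _ (pow_ne_zero m hu0), hfm a hqa]

/-- The Möbius coordinate centred at `κ` of the spherical metric with form `hh c`. -/
def mob (c : ℝ) (κ ζ : ℂ) : ℂ :=
  (ζ - κ) / ((1 + c * ζ) * (starRingEnd ℂ) (1 + c * κ) + ζ * (starRingEnd ℂ) κ)

/-- Lagrange's identity for the vectors (ζ, 1 + cζ) and (κ, 1 + cκ), whose squared norms are `hh c
ζ` and `hh c κ`. -/
lemma mob_den (c : ℝ) (κ ζ : ℂ) : ‖ζ - κ‖ ^ 2 +
    ‖(1 + c * ζ) * (starRingEnd ℂ) (1 + c * κ) + ζ * (starRingEnd ℂ) κ‖ ^ 2 = hh c ζ * hh c κ := by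
  rw [hh_eq, hh_eq, ← Complex.normSq_eq_norm_sq, ← Complex.normSq_eq_norm_sq, Complex.normSq_apply,
    Complex.normSq_apply]
  simp
  ring

lemma mob_den_self (c : ℝ) (κ : ℂ) :
    (1 + c * κ) * (starRingEnd ℂ) (1 + c * κ) + κ * (starRingEnd ℂ) κ = hh c κ := by
  rw [Complex.mul_conj, Complex.mul_conj, hh, Complex.normSq_eq_norm_sq, Complex.normSq_eq_norm_sq]
  push_cast
  rfl

lemma analyticAt_mob {c : ℝ} {κ ζ : ℂ}
    (h : (1 + c * ζ) * (starRingEnd ℂ) (1 + c * κ) + ζ * (starRingEnd ℂ) κ ≠ 0) :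
    AnalyticAt ℂ (mob c κ) ζ := by
  unfold mob
  exact AnalyticAt.div (by fun_prop) (by fun_prop) h

lemma hasStrictDerivAt_mob {c : ℝ} {κ ζ : ℂ}
    (h : (1 + c * ζ) * (starRingEnd ℂ) (1 + c * κ) + ζ * (starRingEnd ℂ) κ ≠ 0) :
    HasStrictDerivAt (mob c κ) (hh c κ /
      ((1 + c * ζ) * (starRingEnd ℂ) (1 + c * κ) + ζ * (starRingEnd ℂ) κ) ^ 2) ζ := by
  have hid := hasStrictDerivAt_id ζ
  have h1 := (analyticAt_mob h).hasStrictDerivAt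
  refine h1.congr_deriv ?_
  have hid := hasDerivAt_id ζ
  have h2 := ((hid.sub_const κ).div ((((hid.const_mul (c : ℂ)).const_add 1).mul_const
    ((starRingEnd ℂ) (1 + c * κ))).add (hid.mul_const ((starRingEnd ℂ) κ))) h).deriv
  refine h2.trans ?_
  rw [← mob_den_self]
  simp only [id, Pi.add_apply]
  ring

lemma one_add_norm_mob {c : ℝ} {κ ζ : ℂ}
    (h : (1 + c * ζ) * (starRingEnd ℂ) (1 + c * κ) + ζ * (starRingEnd ℂ) κ ≠ 0) :
    1 + ‖mob c κ ζ‖ ^ 2 = hh c ζ * hh c κ /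
      ‖(1 + c * ζ) * (starRingEnd ℂ) (1 + c * κ) + ζ * (starRingEnd ℂ) κ‖ ^ 2 := by
  rw [← mob_den, mob, norm_div, div_pow, add_div, div_self, add_comm]
  exact pow_ne_zero 2 (norm_ne_zero_iff.2 h)

/-- The spherical distance in the coordinate with form `hh c`. -/
def chord (c : ℝ) (ζ ζ' : ℂ) : ℝ := arccos (1 - 2 * ‖ζ - ζ'‖ ^ 2 / (hh c ζ * hh c ζ'))

lemma coneDist_mob {c : ℝ} {κ ζ ζ' : ℂ}
    (h : (1 + c * ζ) * (starRingEnd ℂ) (1 + c * κ) + ζ * (starRingEnd ℂ) κ ≠ 0)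
    (h' : (1 + c * ζ') * (starRingEnd ℂ) (1 + c * κ) + ζ' * (starRingEnd ℂ) κ ≠ 0) :
    coneDist 1 (mob c κ ζ) (mob c κ ζ') = chord c ζ ζ' := by
  rw [coneDist_one, one_add_norm_mob h, one_add_norm_mob h', chord]
  have hd : mob c κ ζ - mob c κ ζ' = hh c κ * (ζ - ζ') /
      (((1 + c * ζ) * (starRingEnd ℂ) (1 + c * κ) + ζ * (starRingEnd ℂ) κ) *
      ((1 + c * ζ') * (starRingEnd ℂ) (1 + c * κ) + ζ' * (starRingEnd ℂ) κ)) := by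
    rw [mob, mob, div_sub_div _ _ h h', ← mob_den_self]
    congr 1
    ring
  rw [hd, norm_div, norm_mul, norm_mul, Complex.norm_real, Real.norm_of_nonneg (hh_pos c κ).le]
  have := norm_pos_iff.2 h
  have := norm_pos_iff.2 h'
  have := hh_pos c κ
  have := hh_pos c ζ
  have := hh_pos c ζ'
  generalize ‖(1 + c * ζ) * (starRingEnd ℂ) (1 + c * κ) + ζ * (starRingEnd ℂ) κ‖ = d at *
  generalize ‖(1 + c * ζ') * (starRingEnd ℂ) (1 + c * κ) + ζ' * (starRingEnd ℂ) κ‖ = d' at *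
  congr 2
  field_simp

lemma eventually_mob_den {c : ℝ} (κ : ℂ) : ∀ᶠ ζ in 𝓝 κ,
    (1 + c * ζ) * (starRingEnd ℂ) (1 + c * κ) + ζ * (starRingEnd ℂ) κ ≠ 0 := by
  refine ContinuousAt.eventually_ne ?_ ?_
  · fun_prop
  · rw [mob_den_self]; exact_mod_cast (hh_pos c κ).ne'

section model

variable {θ c : ℝ} (h : ModelPar θ c)
include h

/-- A branch of u ^ θ, followed by a Möbius map that carries the spherical metric with form `hh c`
to the standard one and the value `κ` to the origin. -/
lemma ModelPar.exists_chart_smooth {u₀ κ : ℂ} (hu₀ : u₀ ≠ 0) (hκ : Compat θ c u₀ κ) :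
    ∃ w ∈ IsManifold.maximalAtlas 𝓘(ℂ) ω RS, ConfChart (density θ c) u₀ 1 w ∧
      ∀ u : ℂ, w u = mob c κ (branch θ κ u₀ u) := by
  have hb := branch_self θ κ hu₀
  have hba : ∀ᶠ u in 𝓝 u₀, u / u₀ ∈ Complex.slitPlane ∧ u ≠ 0 :=
    (eventually_div_mem_slitPlane hu₀).and (eventually_ne_nhds hu₀)
  have hbc := (analyticAt_branch θ κ hba.self_of_nhds.1).continuousAt
  have hden : ∀ᶠ u in 𝓝 u₀, (1 + c * branch θ κ u₀ u) * (starRingEnd ℂ) (1 + c * κ) +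
      branch θ κ u₀ u * (starRingEnd ℂ) κ ≠ 0 := by
    have := eventually_mob_den (c := c) κ
    rw [← hb] at this
    have := hbc.eventually this
    rwa [hb] at this
  have hder : ∀ u, u / u₀ ∈ Complex.slitPlane → (1 + c * branch θ κ u₀ u) *
      (starRingEnd ℂ) (1 + c * κ) + branch θ κ u₀ u * (starRingEnd ℂ) κ ≠ 0 →
      deriv (fun u => mob c κ (branch θ κ u₀ u)) u = hh c κ / ((1 + c * branch θ κ u₀ u) *
      (starRingEnd ℂ) (1 + c * κ) + branch θ κ u₀ u * (starRingEnd ℂ) κ) ^ 2 *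
      (θ * branch θ κ u₀ u / u) := fun u h1 h2 =>
    ((hasStrictDerivAt_mob h2).comp u (hasStrictDerivAt_branch θ κ hu₀ h1)).hasDerivAt.deriv
  have hhκ : (hh c κ : ℂ) ≠ 0 := by exact_mod_cast (hh_pos c κ).ne'
  have hθ : (θ : ℂ) ≠ 0 := by exact_mod_cast h.pos.ne'
  refine exists_confChart (ρ := density θ c) one_pos ?_ ?_ ?_ ?_
  · exact (analyticAt_mob hden.self_of_nhds).comp (analyticAt_branch θ κ hba.self_of_nhds.1)
  · rw [hb, mob, sub_self, zero_div]
  · rw [hder u₀ hba.self_of_nhds.1 hden.self_of_nhds, hb]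
    have := hκ.ne_zero hu₀
    have := hden.self_of_nhds
    rw [hb] at this
    exact mul_ne_zero (div_ne_zero hhκ (pow_ne_zero 2 this))
      (div_ne_zero (mul_ne_zero hθ ‹_›) hu₀)
  · filter_upwards [hba, hden] with u h1 h2 _
    refine ⟨Or.inr rfl, ?_⟩
    have hcu := compat_branch hκ hu₀ h1.2
    rw [hder u h1.1 h2, coneFactor, rpow_one, one_add_norm_mob h2, sub_self, rpow_zero,
      density_eq h h1.2 hcu, norm_mul, norm_div, norm_div, norm_mul, norm_pow, Complex.norm_real,
      Complex.norm_real, Real.norm_of_nonneg (hh_pos c κ).le, Real.norm_of_nonneg h.pos.le]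
    have := norm_pos_iff.2 h1.2
    have := norm_pos_iff.2 h2
    have := hh_pos c κ
    have := hh_pos c (branch θ κ u₀ u)
    field_simp

omit h in
lemma norm_one_add_div {ζ : ℂ} (h0 : 1 + c * ζ ≠ 0) :
    1 + ‖ζ / (1 + c * ζ)‖ ^ 2 = hh c ζ / ‖1 + c * ζ‖ ^ 2 := by
  have := norm_pos_iff.2 h0
  rw [hh, norm_div]
  field_simp

/-- A coordinate centred at `0` in which the model metric is that of a cone. -/
lemma ModelPar.exists_coord : ∃ f : ℂ → ℂ, AnalyticAt ℂ f 0 ∧ f 0 = 0 ∧ deriv f 0 ≠ 0 ∧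
    ∀ᶠ u in 𝓝 (0 : ℂ), u ≠ 0 → (f u ≠ 0 ∨ θ = 1) ∧ coneFactor θ (f u) * ‖deriv f u‖ =
      density θ c u := by
  obtain ⟨f, hf, hf0, hf', hev⟩ := exists_root_chart h.pos h.int (b := c) (by simp)
  refine ⟨f, hf, hf0, hf', ?_⟩
  filter_upwards [hev] with u hu hu0
  obtain ⟨hfu, hfa, hκ⟩ := hu hu0
  refine ⟨Or.inl hfu, ?_⟩
  obtain ⟨h1, h2, h3⟩ := hκ _ (compat_cpow h hu0)
  have hc := compat_cpow h hu0
  set κ := u ^ (θ : ℂ) with hκd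
  have hκ0 := hc.ne_zero hu0
  have hslit : ∀ {w : ℂ}, w ≠ 0 → w / w ∈ Complex.slitPlane := fun hw => by simp [div_self hw]
  have d1 := ((hasStrictDerivAt_branch θ (κ / (1 + c * κ)) hfu (hslit hfu)).comp u
    hfa.hasStrictDerivAt).hasDerivAt
  have d2 := (hasStrictDerivAt_branch θ κ hu0 (hslit hu0)).hasDerivAt
  have d3 := d2.div ((d2.const_mul (c : ℂ)).const_add 1) (by rwa [branch_self θ κ hu0])
  -- Differentiating f ^ θ = κ / (1 + cκ) in two ways yields the logarithmic derivative of `f`.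
  have heq := d1.unique (d3.congr_of_eventuallyEq h3)
  rw [branch_self _ _ hfu, branch_self _ _ hu0] at heq
  have hnorm : ‖κ / (1 + c * κ)‖ * ‖deriv f u‖ / ‖f u‖ = ‖κ‖ / (‖u‖ * ‖1 + c * κ‖ ^ 2) := by
    have hθ : (θ : ℂ) ≠ 0 := by exact_mod_cast h.pos.ne'
    have : κ / (1 + c * κ) * deriv f u / f u = κ / (u * (1 + c * κ) ^ 2) := by
      apply mul_left_cancel₀ hθ
      calc _ = θ * (κ / (1 + c * κ)) / f u * deriv f u := by ring
        _ = _ := heq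
        _ = _ := by field_simp; ring
    rw [← norm_mul, ← norm_div, this]
    simp
  rw [density_eq h hu0 hc, coneFactor, ← h2, norm_one_add_div h1,
    rpow_sub_one (norm_ne_zero_iff.2 hfu), ← h2]
  have p1 := norm_pos_iff.2 hfu
  have p2 := norm_pos_iff.2 h1
  have p3 := norm_pos_iff.2 hu0
  have p4 := hh_pos c κ
  calc _ = 2 * θ * (‖κ / (1 + c * κ)‖ * ‖deriv f u‖ / ‖f u‖) * ‖1 + c * κ‖ ^ 2 / hh c κ := by
        field_simp
    _ = _ := by rw [hnorm]; field_simp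

lemma ModelPar.exists_chart_zero :
    ∃ w ∈ IsManifold.maximalAtlas 𝓘(ℂ) ω RS, ConfChart (density θ c) ((0 : ℂ) : RS) θ w := by
  obtain ⟨f, h1, h2, h3, h4⟩ := h.exists_coord
  obtain ⟨w, hw, hw', -⟩ := exists_confChart h.pos h1 h2 h3 h4
  exact ⟨w, hw, hw'⟩

-- The map ζ ↦ 1 / ((1 + c²) ζ) preserves the spherical metric with form `hh c` and exchanges 0 and
-- ∞. Its lift u ↦ 1 / (κu) exchanges the two cone points, so that the chart at infinity can be
-- copied from the chart at 0.
omit h in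
lemma hh_inv {u : ℂ} (hu : u ≠ 0) {ζ ζ' : ℂ} (hζ : Compat θ c u⁻¹ ζ)
    {κ : ℝ} (hκ : 0 < κ) (hκ' : κ ^ θ = (1 + c ^ 2)⁻¹) (hζ' : Compat θ c (κ * u) ζ') :
    hh c ζ' = hh c ζ / ((1 + c ^ 2) * ‖ζ‖ ^ 2) := by
  have hζ0 := hζ.ne_zero (inv_ne_zero hu)
  have hn := norm_pos_iff.2 hu
  by_cases hc : c = 0
  · have h1 : ‖ζ'‖ = ‖ζ‖⁻¹ := by
      rw [hζ.1, hζ'.1, norm_mul, Complex.norm_real, Real.norm_of_nonneg hκ.le,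
        mul_rpow hκ.le hn.le, hκ', norm_inv, inv_rpow hn.le, inv_inv, hc]
      simp
    have := norm_pos_iff.2 hζ0
    simp only [hh, hc, h1]
    simp
    field_simp
    ring
  · obtain ⟨m, hm, rfl⟩ := hζ.2.resolve_left hc
    obtain ⟨m', hm', rfl⟩ := hζ'.2.resolve_left hc
    obtain rfl : m = m' := by exact_mod_cast hm.symm.trans hm'
    have h2 : ((κ : ℂ) * u) ^ m = ((1 + c ^ 2 : ℝ) : ℂ)⁻¹ * (u⁻¹ ^ m)⁻¹ := by
      rw [mul_pow, inv_pow, inv_inv, ← Complex.ofReal_pow, ← rpow_natCast, ← hm, hκ']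
      push_cast
      rfl
    rw [h2]
    set ξ := u⁻¹ ^ m with hξ
    have hne : ((1 + c ^ 2 : ℝ) : ℂ) ≠ 0 := by exact_mod_cast (by positivity : 1 + c ^ 2 ≠ 0)
    have e1 : 1 + (c : ℂ) * (((1 + c ^ 2 : ℝ) : ℂ)⁻¹ * ξ⁻¹) =
        (((1 + c ^ 2 : ℝ) : ℂ) * ξ + c) / (((1 + c ^ 2 : ℝ) : ℂ) * ξ) := by
      field_simp
    have hp := norm_pos_iff.2 hζ0
    rw [hh, e1, norm_div, norm_mul, norm_mul, norm_inv, norm_inv, Complex.norm_real,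
      Real.norm_of_nonneg (by positivity)]
    have e2 : ‖((1 + c ^ 2 : ℝ) : ℂ) * ξ + c‖ ^ 2 + 1 = (1 + c ^ 2) * hh c ξ := by
      rw [hh_eq, ← Complex.normSq_eq_norm_sq, Complex.normSq_apply]
      simp only [Complex.add_re, Complex.add_im, Complex.re_ofReal_mul, Complex.im_ofReal_mul,
        Complex.ofReal_re, Complex.ofReal_im]
      ring
    have e3 : (‖((1 + c ^ 2 : ℝ) : ℂ) * ξ + c‖ / ((1 + c ^ 2) * ‖ξ‖)) ^ 2 +
        ((1 + c ^ 2)⁻¹ * ‖ξ‖⁻¹) ^ 2 =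
        (‖((1 + c ^ 2 : ℝ) : ℂ) * ξ + c‖ ^ 2 + 1) / ((1 + c ^ 2) * ‖ξ‖) ^ 2 := by
      field_simp
    rw [e3, e2]
    field_simp

lemma ModelPar.exists_kappa : ∃ κ : ℝ, 0 < κ ∧ κ ^ θ = (1 + c ^ 2)⁻¹ := by
  refine ⟨(1 + c ^ 2)⁻¹ ^ θ⁻¹, by positivity, ?_⟩
  rw [← rpow_mul (by positivity), inv_mul_cancel₀ h.pos.ne', rpow_one]

lemma ModelPar.density_inv {u : ℂ} (hu : u ≠ 0) {κ : ℝ} (hκ : 0 < κ)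
    (hκ' : κ ^ θ = (1 + c ^ 2)⁻¹) :
    density θ c (κ * u) * κ * ‖u‖ ^ 2 = density θ c u⁻¹ := by
  have hκ0 : (κ : ℂ) * u ≠ 0 := mul_ne_zero (by exact_mod_cast hκ.ne') hu
  have c1 := compat_cpow h hκ0
  have c2 := compat_cpow h (inv_ne_zero hu)
  rw [density_eq h hκ0 c1, density_eq h (inv_ne_zero hu) c2, hh_inv hu c2 hκ hκ' c1, c1.1]
  have hn := norm_pos_iff.2 hu
  have e1 : ‖(κ : ℂ) * u‖ ^ θ = (1 + c ^ 2)⁻¹ * ‖u⁻¹ ^ (θ : ℂ)‖⁻¹ := by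
    rw [c2.1, norm_mul, Complex.norm_real, Real.norm_of_nonneg hκ.le, mul_rpow hκ.le hn.le, hκ',
      norm_inv, inv_rpow hn.le, inv_inv]
  have hp := norm_pos_iff.2 (c2.ne_zero (inv_ne_zero hu))
  have := hh_pos c (u⁻¹ ^ (θ : ℂ))
  rw [e1, norm_mul, Complex.norm_real, Real.norm_of_nonneg hκ.le, norm_inv]
  field_simp

lemma ModelPar.exists_chart_infty :
    ∃ w ∈ IsManifold.maximalAtlas 𝓘(ℂ) ω RS, ConfChart (density θ c) OnePoint.infty θ w := by
  obtain ⟨f, h1, h2, h3, h4⟩ := h.exists_coord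
  obtain ⟨κ, hκ, hκ'⟩ := h.exists_kappa
  have hκc : (κ : ℂ) ≠ 0 := by exact_mod_cast hκ.ne'
  have hc : Continuous fun v : ℂ => (κ : ℂ) * v := by fun_prop
  have hev := (hc.tendsto 0).eventually (p := fun u => u ≠ 0 → (f u ≠ 0 ∨ θ = 1) ∧
    coneFactor θ (f u) * ‖deriv f u‖ = density θ c u) (by simpa using h4)
  have h1' : AnalyticAt ℂ f (κ * 0) := by simpa using h1
  have hd : ∀ v, AnalyticAt ℂ f (κ * v) →
      deriv (fun v : ℂ => f (κ * v)) v = deriv f (κ * v) * κ := fun v hv => by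
    have := hv.differentiableAt.hasDerivAt.comp v ((hasDerivAt_id v).const_mul (κ : ℂ))
    rw [mul_one] at this
    exact this.deriv
  obtain ⟨w, hw, hw', -⟩ := exists_confChart_infty (ρ := density θ c)
    (f := fun v => f (κ * v)) h.pos (h1'.comp (by fun_prop)) (by simpa using h2)
    (by rw [hd 0 h1']; simpa [hκc] using h3) (by
      have h5 := (hc.tendsto 0).eventually (p := fun u => AnalyticAt ℂ f u)
        (by simpa using h1.eventually_analyticAt)
      filter_upwards [hev, h5] with v hv hva hv0
      obtain ⟨h6, h7⟩ := hv (mul_ne_zero hκc hv0)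
      refine ⟨h6, ?_⟩
      rw [hd v hva, ← h.density_inv hv0 hκ hκ', ← h7, norm_mul, Complex.norm_real,
        Real.norm_of_nonneg hκ.le]
      ring)
  exact ⟨w, hw, hw'⟩

lemma ModelPar.density_nonneg (u : ℂ) : 0 ≤ density θ c u := by
  have := hh_pos c (u ^ (θ : ℂ))
  have := h.pos
  have := rpow_nonneg (norm_nonneg u) θ
  rw [density]; positivity

lemma ModelPar.isConf : IsConf (density θ c) where
  nonneg := h.density_nonneg
  exists_chart x := by
    induction x using OnePoint.rec with
    | infty => obtain ⟨w, -, hw⟩ := h.exists_chart_infty; exact ⟨_, w, hw⟩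
    | coe u =>
      by_cases hu : u = 0
      · obtain ⟨w, -, hw⟩ := h.exists_chart_zero; exact ⟨_, w, hu ▸ hw⟩
      · obtain ⟨w, -, hw, -⟩ := h.exists_chart_smooth hu (compat_cpow h hu)
        exact ⟨_, w, hw⟩

end model

/-! ### Local isometries and model surfaces -/

/-- A map out of a geodesic space that is locally distance-nonincreasing off a finite set is
distance-nonincreasing. -/
lemma dist_le_of_local {X Y : Type*} [TopologicalSpace X] [CompactSpace X] [TopologicalSpace Y]
    {d : X → X → ℝ} {d' : Y → Y → ℝ} (hd : Continuous fun p : X × X => d p.1 p.2)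
    (hnn : ∀ x y, 0 ≤ d x y) (hsep : ∀ x y, d x y = 0 → x = y)
    (hgeo : ∀ x y, ∃ γ : ℝ → X, γ 0 = x ∧ γ (d x y) = y ∧
      ∀ s ∈ Set.Icc 0 (d x y), ∀ t ∈ Set.Icc 0 (d x y), d (γ s) (γ t) = |s - t|)
    (hd' : Continuous fun p : Y × Y => d' p.1 p.2) (h0 : ∀ y, d' y y = 0)
    (hsymm : ∀ x y, d' x y = d' y x) (htri : ∀ x y z, d' x z ≤ d' x y + d' y z)
    {f : X → Y} (hf : Continuous f) {F : Set X} (hF : F.Finite)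
    (hloc : ∀ x, x ∉ F → LeNear (fun a b => d' (f a) (f b)) d x) (x y : X) :
    d' (f x) (f y) ≤ d x y := by
  obtain ⟨γ, g0, g1, hγ⟩ := hgeo x y
  set L := d x y with hL
  have hL0 : 0 ≤ L := hnn x y
  have hγc : ContinuousOn γ (Set.Icc 0 L) := fun s hs => by
    refine tendsto_of_sep hd hnn hsep ?_
    have h1 : Filter.Tendsto (fun s' : ℝ => |s' - s|) (𝓝[Set.Icc 0 L] s) (𝓝 0) := by
      have : Continuous fun s' : ℝ => |s' - s| := by fun_prop
      simpa using (this.tendsto s).mono_left nhdsWithin_le_nhds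
    refine h1.congr' ?_
    filter_upwards [self_mem_nhdsWithin] with s' hs' using (hγ s' hs' s hs).symm
  have hinj : Set.InjOn γ (Set.Icc 0 L) := fun s hs t ht h => by
    have h1 := hγ s hs t ht
    have h2 := hγ s hs s hs
    rw [h] at h1 h2
    rw [h2, sub_self, abs_zero] at h1
    linarith [abs_eq_zero.1 h1.symm]
  set F' : Set ℝ := {s | s ∈ Set.Icc 0 L ∧ γ s ∈ F} with hF'
  -- A geodesic is injective, so it meets the exceptional set only finitely often.
  have hfin : F'.Finite := Set.Finite.of_finite_image (f := γ)
    (hF.subset (by rintro _ ⟨s, hs, rfl⟩; exact hs.2)) fun s hs t ht h => hinj hs.1 ht.1 h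
  have key := abs_sub_le_of_local hfin (g := fun s => d' (f x) (f (γ s))) hL0 ?_ ?_
  · simp only [g0, g1, h0, sub_zero] at key
    exact (le_abs_self _).trans key
  · exact hd'.comp_continuousOn (continuousOn_const.prodMk (hf.comp_continuousOn hγc))
  · intro s hs hsF K hK
    have hsI := Set.Ioo_subset_Icc_self hs
    have hn : ∀ᶠ s' in 𝓝 s, s' ∈ Set.Icc 0 L := Icc_mem_nhds hs.1 hs.2
    have hc : ContinuousAt γ s := (hγc s hsI).continuousAt hn
    have h1 := (hc.tendsto.prodMk_nhds (tendsto_const_nhds (x := γ s))).eventually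
      (hloc (γ s) (fun h => hsF ⟨hsI, h⟩) K hK)
    filter_upwards [hn, h1] with s' hs' h2
    rw [← hγ s' hs' s hsI]
    refine (abs_le.2 ⟨?_, ?_⟩).trans h2
    · have := htri (f x) (f (γ s')) (f (γ s)); linarith
    · have := htri (f x) (f (γ s)) (f (γ s')); rw [hsymm (f (γ s))] at this; linarith

section conf

variable {ρ : ℂ → ℝ} (H : IsConf ρ)
include H

lemma IsConf.hasConeAngle {x : RS} {α : ℝ} {w : OpenPartialHomeomorph RS ℂ}
    (hw : w ∈ IsManifold.maximalAtlas 𝓘(ℂ) ω RS) (hc : ConfChart ρ x α w) :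
    letI := H.metric; HasConeAngle x α := by
  let := H.metric
  refine ⟨w, hw, hc.mem, hc.zero, ?_⟩
  obtain ⟨r, hr, h1⟩ := Metric.nhds_basis_ball.mem_iff.1 (w.open_source.mem_nhds hc.mem)
  have h2 := H.confDist_eq hc
  rw [nhds_prod_eq, Filter.eventually_prod_self_iff'] at h2
  obtain ⟨U, hU, h2⟩ := h2
  obtain ⟨s, hs, h3⟩ := Metric.nhds_basis_ball.mem_iff.1 hU
  refine ⟨min r s, lt_min hr hs, (Metric.ball_subset_ball (min_le_left r s)).trans h1,
    fun a ha b hb => ?_⟩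
  exact h2 a (h3 (Metric.ball_subset_ball (min_le_right r s) ha)) b
    (h3 (Metric.ball_subset_ball (min_le_right r s) hb))

lemma IsConf.exists_geodesic (x y : RS) : ∃ γ : ℝ → RS, γ 0 = x ∧ γ (confDist ρ x y) = y ∧
    ∀ s ∈ Set.Icc 0 (confDist ρ x y), ∀ t ∈ Set.Icc 0 (confDist ρ x y),
      confDist ρ (γ s) (γ t) = |s - t| :=
  exists_geodesic_of_midpoints H.continuous_confDist H.confDist_self IsConf.confDist_comm
    H.confDist_triangle (fun _ _ => H.eq_of_confDist_eq_zero) H.confDist_midpoint x y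

-- In the dual description a comparison of densities is at once one of distances: if f is admissible
-- for ρ', then K⁻¹ f is admissible for ρ.
omit H in
lemma IsConf.confDist_le_mul {ρ' : ℂ → ℝ} (H : IsConf ρ) (H' : IsConf ρ') {K : ℝ} (hK : 0 < K)
    (h : ∀ u ≠ 0, ρ' u ≤ K * ρ u) (x y : RS) : confDist ρ' x y ≤ K * confDist ρ x y := by
  refine H'.confDist_le fun f hf => ?_
  have hf' : Adm ρ fun x => K⁻¹ * f x := by
    refine ⟨continuous_const.mul hf.cont, fun u hu L hL => ?_⟩
    filter_upwards [hf.near u hu L hL] with p hp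
    rw [← mul_sub, abs_mul, abs_of_pos (inv_pos.2 hK), inv_mul_le_iff₀ hK]
    refine hp.trans ?_
    have := mul_le_mul_of_nonneg_right (h u hu) (norm_nonneg (p.1 - p.2))
    calc _ ≤ L * (K * ρ u * ‖p.1 - p.2‖) := mul_le_mul_of_nonneg_left this (by linarith)
      _ = _ := by ring
  have h1 := H.le_confDist hf' x y
  rwa [← mul_sub, abs_mul, abs_of_pos (inv_pos.2 hK), inv_mul_le_iff₀ hK] at h1

end conf

/-- The model surface with density `density θ c`. -/
def modelSurface {θ c : ℝ} (h : ModelPar θ c) : Surface ![θ, θ] where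
  carrier := RS
  metricSpace := h.isConf.metric
  genus_zero := ⟨footHomeo one_pos⟩
  geodesic := h.isConf.exists_geodesic
  p := ![((0 : ℂ) : RS), OnePoint.infty]
  p_injective := by
    intro i j
    fin_cases i <;> fin_cases j <;> simp
  cone i := by
    fin_cases i
    · obtain ⟨w, hw, hc⟩ := h.exists_chart_zero
      exact h.isConf.hasConeAngle hw hc
    · obtain ⟨w, hw, hc⟩ := h.exists_chart_infty
      exact h.isConf.hasConeAngle hw hc
  smooth x hx := by
    have hx' : x ≠ ((0 : ℂ) : RS) ∧ x ≠ OnePoint.infty :=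
      ⟨fun h => hx ⟨0, h.symm⟩, fun h => hx ⟨1, h.symm⟩⟩
    obtain ⟨u, rfl⟩ := OnePoint.ne_infty_iff_exists.1 hx'.2
    have hu : u ≠ 0 := fun h => hx'.1 (by rw [h])
    obtain ⟨w, hw, hc, -⟩ := h.exists_chart_smooth hu (compat_cpow h hu)
    exact h.isConf.hasConeAngle hw hc

section model

variable {θ c : ℝ} (h : ModelPar θ c)
include h

lemma ModelPar.confDist_near {u₀ κ : ℂ} (hu₀ : u₀ ≠ 0) (hκ : Compat θ c u₀ κ) :
    ∀ᶠ p : ℂ × ℂ in 𝓝 (u₀, u₀), confDist (density θ c) p.1 p.2 =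
      chord c (branch θ κ u₀ p.1) (branch θ κ u₀ p.2) := by
  obtain ⟨w, -, hc, hw⟩ := h.exists_chart_smooth hu₀ hκ
  have h1 : Filter.Tendsto (fun p : ℂ × ℂ => ((p.1 : RS), (p.2 : RS))) (𝓝 (u₀, u₀))
      (𝓝 ((u₀ : RS), (u₀ : RS))) :=
    ((OnePoint.continuous_coe.tendsto u₀).comp (continuous_fst.tendsto (u₀, u₀))).prodMk_nhds
      ((OnePoint.continuous_coe.tendsto u₀).comp (continuous_snd.tendsto (u₀, u₀)))
  have hden : ∀ᶠ u in 𝓝 u₀, (1 + c * branch θ κ u₀ u) * (starRingEnd ℂ) (1 + c * κ) +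
      branch θ κ u₀ u * (starRingEnd ℂ) κ ≠ 0 := by
    have h2 := (analyticAt_branch θ κ
      (eventually_div_mem_slitPlane hu₀).self_of_nhds).continuousAt
    have h3 := eventually_mob_den (c := c) κ
    rw [ContinuousAt, branch_self θ κ hu₀] at h2
    exact h2.eventually h3
  filter_upwards [h1.eventually (h.isConf.confDist_eq hc),
    (continuous_fst.tendsto (u₀, u₀)).eventually hden,
    (continuous_snd.tendsto (u₀, u₀)).eventually hden] with p h2 h3 h4
  rw [h2, hw, hw, coneDist_mob h3 h4]

omit h in
lemma chord_zero (z w : ℂ) : chord 0 z w = coneDist 1 z w := by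
  rw [coneDist_one, chord, hh, hh]
  simp

omit h in
/-- The model with `c = 0` is the football. -/
lemma ModelPar.confDist_zero (h0 : ModelPar θ 0) (x y : RS) :
    confDist (density θ 0) x y = fb θ x y := by
  have H := h0.isConf
  have hθ := h0.pos
  have hloc : ∀ u : ℂ, u ≠ 0 → ∀ᶠ p : RS × RS in 𝓝 ((u : RS), (u : RS)),
      confDist (density θ 0) p.1 p.2 = fb θ p.1 p.2 := by
    intro u hu
    rw [nhds_prod_eq, OnePoint.nhds_coe_eq, Filter.prod_map_map_eq, Filter.eventually_map,
      ← nhds_prod_eq]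
    filter_upwards [h0.confDist_near hu (compat_cpow h0 hu),
      coneDist_branch hθ hu (compat_cpow h0 hu).1] with p h1 h2
    rw [h1, chord_zero, ← h2, fb_coe]
  have hpt : ∀ x : RS, x ∉ ({((0 : ℂ) : RS), OnePoint.infty} : Set RS) →
      ∃ u : ℂ, u ≠ 0 ∧ x = u := fun x hx => by
    simp only [Set.mem_insert_iff, Set.mem_singleton_iff, not_or] at hx
    obtain ⟨u, rfl⟩ := OnePoint.ne_infty_iff_exists.1 hx.2
    exact ⟨u, fun h => hx.1 (by rw [h]), rfl⟩
  have hfin : ({((0 : ℂ) : RS), OnePoint.infty} : Set RS).Finite := Set.toFinite _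
  refine le_antisymm ?_ ?_
  · refine dist_le_of_local (f := id) (continuous_fb hθ) (fb_nonneg θ)
      (fun _ _ => fb_eq_zero hθ) (exists_fb_geodesic hθ) H.continuous_confDist H.confDist_self
      IsConf.confDist_comm H.confDist_triangle continuous_id hfin (fun x hx => ?_) x y
    obtain ⟨u, hu, rfl⟩ := hpt x hx
    exact LeNear.of_le ((hloc u hu).mono fun p hp => hp.le) (.of_forall fun p => fb_nonneg θ _ _)
  · refine dist_le_of_local (f := id) H.continuous_confDist H.confDist_nonneg
      (fun _ _ => H.eq_of_confDist_eq_zero) H.exists_geodesic (continuous_fb hθ) (fb_self hθ)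
      (fb_comm θ) (fb_triangle hθ) continuous_id hfin (fun x hx => ?_) x y
    obtain ⟨u, hu, rfl⟩ := hpt x hx
    exact LeNear.of_le ((hloc u hu).mono fun p hp => hp.ge)
      (.of_forall fun p => H.confDist_nonneg _ _)

/-! ### Dependence of the model metric on the parameter -/

omit h in
lemma hh_le (c c' : ℝ) (ζ : ℂ) : hh c' ζ ≤ (1 + |c' - c|) ^ 2 * hh c ζ := by
  have h1 : ‖1 + (c' : ℂ) * ζ‖ ≤ ‖1 + (c : ℂ) * ζ‖ + |c' - c| * ‖ζ‖ := by
    have : 1 + (c' : ℂ) * ζ = (1 + c * ζ) + ((c' - c : ℝ) : ℂ) * ζ := by push_cast; ring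
    rw [this]
    refine (norm_add_le _ _).trans_eq ?_
    rw [norm_mul, Complex.norm_real, Real.norm_eq_abs]
  rw [hh, hh]
  set a := ‖1 + (c : ℂ) * ζ‖
  set b := ‖ζ‖
  set d := |c' - c|
  have ha : 0 ≤ a := norm_nonneg _
  have hb : 0 ≤ b := norm_nonneg _
  have hd : 0 ≤ d := abs_nonneg _
  -- What remains is the elementary inequality (a + d b)² + b² ≤ (1 + d)² (a² + b²).
  have h2 : ‖1 + (c' : ℂ) * ζ‖ ^ 2 ≤ (a + d * b) ^ 2 := by gcongr
  have h3 := mul_nonneg hd (sq_nonneg (a - b))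
  have h4 := mul_nonneg (sq_nonneg d) (sq_nonneg a)
  have h5 := mul_nonneg hd (add_nonneg (sq_nonneg a) (sq_nonneg b))
  nlinarith

lemma ModelPar.density_le {c' : ℝ} (u : ℂ) :
    density θ c u ≤ (1 + |c' - c|) ^ 2 * density θ c' u := by
  rw [density, density]
  set ζ := u ^ (θ : ℂ)
  have p1 := hh_pos c ζ
  have p2 := hh_pos c' ζ
  have h1 := hh_le c c' ζ
  have hθ := h.pos
  by_cases hu : u = 0
  · simp [hu]
  have hn := norm_pos_iff.2 hu
  have hr := rpow_nonneg hn.le θ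
  rw [← mul_div_assoc, div_le_div_iff₀ (by positivity) (by positivity)]
  calc 2 * θ * ‖u‖ ^ θ * (‖u‖ * hh c' ζ)
      ≤ 2 * θ * ‖u‖ ^ θ * (‖u‖ * ((1 + |c' - c|) ^ 2 * hh c ζ)) := by gcongr
    _ = _ := by ring

lemma ModelPar.confDist_le {c' : ℝ} (h' : ModelPar θ c') (x y : RS) :
    confDist (density θ c) x y ≤ exp (2 * |c' - c|) * confDist (density θ c') x y := by
  refine (h'.isConf.confDist_le_mul h.isConf (K := (1 + |c' - c|) ^ 2) (by positivity)
    (fun u _ => h.density_le u) x y).trans ?_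
  refine mul_le_mul_of_nonneg_right ?_ (h'.isConf.confDist_nonneg x y)
  have h1 := add_one_le_exp (|c' - c|)
  rw [two_mul, exp_add, ← sq]
  gcongr
  linarith

omit h in
lemma localDegreeOne_of_eq {g : ℂ → ℂ} (hg : ∀ z, g z = z) (z : ℂ) : LocalDegreeOne g z := by
  filter_upwards [self_mem_nhdsWithin] with ε hε
  exact ⟨fun _ => ε, fun t => t, continuous_const, continuous_id, fun _ => hε, fun _ => rfl,
    fun t => by rw [hg, hg]⟩

omit h in
lemma orientationPreserving_id : OrientationPreserving (id : RS → RS) := fun x => by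
  refine localDegreeOne_of_eq (fun z => ?_) _
  refine (chartAt ℂ x).right_inv ?_
  change z ∈ (open Classical in if x = OnePoint.infty then chartInfty else chartZero).target
  split_ifs <;> simp [chartInfty_target, chartZero_target]

/-- The identity of the Riemann sphere is the comparison map: it fixes the labels, and the densities
differ by a factor of at most exp(2 |c' − c|). -/
lemma ModelPar.lipClose {c' : ℝ} (h' : ModelPar θ c') {ε : ℝ} (hε : 2 * |c' - c| ≤ ε) :
    (modelSurface h).LipClose ε (modelSurface h') := by
  refine ⟨Homeomorph.refl RS, orientationPreserving_id, fun i => rfl, fun x y => ⟨?_, ?_⟩⟩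
  · refine (h'.confDist_le h x y).trans ?_
    rw [abs_sub_comm]
    exact mul_le_mul_of_nonneg_right (exp_le_exp.2 hε) (h.isConf.confDist_nonneg x y)
  · exact (h.confDist_le h' x y).trans
      (mul_le_mul_of_nonneg_right (exp_le_exp.2 hε) (h'.isConf.confDist_nonneg x y))

omit h in
lemma modelSurface_isFootball (h0 : ModelPar θ 0) : (modelSurface h0).IsFootball θ := by
  refine ⟨footHomeo h0.pos, foot_zero h0.pos, foot_infty θ, fun x y => ?_⟩
  exact (ModelPar.confDist_zero h0 x y).trans (footballDist_foot h0.pos x y).symm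

end model

/-! ### The developing map of a model surface -/

/-- The Möbius map `ζ / (1 + c ζ)`. -/
def mobN (c : ℝ) : RS ≃ₜ RS :=
  invHomeo.trans ((Homeomorph.addRight (c : ℂ)).onePointCongr.trans invHomeo)

lemma mobN_apply (c : ℝ) (x : RS) :
    mobN c x = invFun (OnePoint.map (fun z => z + (c : ℂ)) (invFun x)) := rfl

lemma mobN_zero (c : ℝ) : mobN c ((0 : ℂ) : RS) = ((0 : ℂ) : RS) := by
  rw [mobN_apply, invFun_zero, OnePoint.map_infty, invFun_infty]

lemma mobN_coe {c : ℝ} {ζ : ℂ} (h : 1 + c * ζ ≠ 0) :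
    mobN c (ζ : RS) = ((ζ / (1 + c * ζ) : ℂ) : RS) := by
  by_cases hζ : ζ = 0
  · subst hζ; rw [mobN_zero]; simp
  have h1 : ζ⁻¹ + (c : ℂ) = (1 + c * ζ) / ζ := by field_simp
  rw [mobN_apply, invFun_coe hζ, OnePoint.map_some, h1, invFun_coe (div_ne_zero h hζ), inv_div]

lemma mobN_pole {c : ℝ} {ζ : ℂ} (h : 1 + c * ζ = 0) : mobN c (ζ : RS) = OnePoint.infty := by
  have hζ : ζ ≠ 0 := by rintro rfl; simp at h
  have h1 : ζ⁻¹ + (c : ℂ) = 0 := by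
    field_simp
    linear_combination h
  rw [mobN_apply, invFun_coe hζ, OnePoint.map_some, h1, invFun_zero]

lemma fb_one_coe_infty (z : ℂ) :
    fb 1 (z : RS) OnePoint.infty = arccos (1 - 2 / (1 + ‖z‖ ^ 2)) := by
  have h1 : fb 1 (z : RS) OnePoint.infty ∈ Set.Icc 0 π := ⟨fb_nonneg _ _ _, fb_le_pi _ _ _⟩
  rw [← arccos_cos h1.1 h1.2, fb_infty, cos_pi_sub, rad_coe, cos_two_arctan, rpow_one]
  congr 1
  field_simp
  ring

/-- `mobN c` carries the spherical metric with form `hh c` to the standard one. Its pole is treated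
separately, since the value there is ∞. -/
lemma fb_mobN (c : ℝ) (ζ ζ' : ℂ) : fb 1 (mobN c ζ) (mobN c ζ') = chord c ζ ζ' := by
  have key : ∀ ζ ζ' : ℂ, 1 + c * ζ ≠ 0 → 1 + c * ζ' = 0 →
      fb 1 (mobN c ζ) (mobN c ζ') = chord c ζ ζ' := by
    intro ζ ζ' h h'
    rw [mobN_coe h, mobN_pole h', fb_one_coe_infty, norm_one_add_div h, chord]
    have hζ : ζ' ≠ 0 := by rintro rfl; simp at h'
    have h1 : 1 + c * ζ = (1 - ζ / ζ') := by
      have : (c : ℂ) = -ζ'⁻¹ := by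
        field_simp
        linear_combination h'
      rw [this]; ring
    have h2 : ‖1 + c * ζ‖ * ‖ζ'‖ = ‖ζ - ζ'‖ := by
      rw [h1, ← norm_mul, ← norm_neg (ζ - ζ')]
      congr 1
      field_simp
      ring
    have p1 := hh_pos c ζ
    have p2 := norm_pos_iff.2 h
    have p3 := norm_pos_iff.2 hζ
    rw [← h2, hh.eq_1 c ζ', h']
    congr 2
    simp
    field_simp
  by_cases h : 1 + c * ζ = 0 <;> by_cases h' : 1 + c * ζ' = 0
  · have hc : (c : ℂ) ≠ 0 := by rintro hc; simp [hc] at h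
    have : ζ = ζ' := mul_left_cancel₀ hc (by linear_combination h - h')
    rw [this, fb_self one_pos, chord]
    simp
  · rw [fb_comm, key ζ' ζ h' h, chord, chord, norm_sub_rev, mul_comm (hh c ζ')]
  · exact key ζ ζ' h h'
  · rw [mobN_coe h, mobN_coe h', fb_coe, coneDist_one, norm_one_add_div h, norm_one_add_div h',
      chord]
    have h1 : ζ / (1 + c * ζ) - ζ' / (1 + c * ζ') = (ζ - ζ') / ((1 + c * ζ) * (1 + c * ζ')) := by
      rw [div_sub_div _ _ h h']
      congr 1
      ring
    rw [h1, norm_div, norm_mul]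
    have p1 := hh_pos c ζ
    have p1' := hh_pos c ζ'
    have p2 := norm_pos_iff.2 h
    have p2' := norm_pos_iff.2 h'
    generalize ‖1 + (c : ℂ) * ζ‖ = a at *
    generalize ‖1 + (c : ℂ) * ζ'‖ = b at *
    congr 2
    field_simp

/-- The power map of the Riemann sphere. -/
def powRS (m : ℕ) : RS → RS := OnePoint.map fun z => z ^ m

@[simp] lemma powRS_coe (m : ℕ) (u : ℂ) : powRS m (u : RS) = ((u ^ m : ℂ) : RS) := rfl
@[simp] lemma powRS_infty (m : ℕ) : powRS m OnePoint.infty = OnePoint.infty := rfl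

lemma continuous_powRS {m : ℕ} (hm : m ≠ 0) : Continuous (powRS m) := by
  refine OnePoint.continuous_map (continuous_pow m) ?_
  rw [Filter.coclosedCompact_eq_cocompact, ← Metric.cobounded_eq_cocompact,
    ← tendsto_norm_atTop_iff_cobounded]
  simp only [norm_pow]
  exact (Filter.tendsto_pow_atTop hm).comp tendsto_norm_cobounded_atTop

/-- The developing map of the model surface. -/
def dev (m : ℕ) (c : ℝ) (x : RS) : S2 := foot 1 (mobN c (powRS m x))

lemma continuous_dev {m : ℕ} (hm : m ≠ 0) (c : ℝ) : Continuous (dev m c) :=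
  (continuous_foot one_pos).comp ((mobN c).continuous.comp (continuous_powRS hm))

lemma sphDist_dev (m : ℕ) (c : ℝ) (u v : ℂ) :
    sphDist (dev m c u) (dev m c v) = chord c (u ^ m) (v ^ m) := by
  rw [dev, dev, sphDist_foot_one, powRS_coe, powRS_coe, fb_mobN]

lemma dev_zero {m : ℕ} (hm : m ≠ 0) (c : ℝ) : dev m c ((0 : ℂ) : RS) = sph 0 0 := by
  rw [dev, powRS_coe, zero_pow hm, mobN_zero, foot_zero one_pos]

/-- This is the reason for the parameter c = cot(l/2): the point ∞ is sent to 1/c = tan(l/2), which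
has colatitude `l`. -/
lemma dev_infty (m : ℕ) {l : ℝ} (hl : 0 < l) (hl' : l ≤ π) :
    dev m (cot (l / 2)) OnePoint.infty = sph 0 l := by
  rw [dev, powRS_infty, mobN_apply, invFun_infty, OnePoint.map_some, zero_add]
  have hs : 0 < sin (l / 2) := sin_pos_of_pos_of_lt_pi (by linarith) (by linarith)
  rcases hl'.eq_or_lt with rfl | hl''
  · rw [cot_eq_cos_div_sin, cos_pi_div_two, zero_div, Complex.ofReal_zero, invFun_zero, foot_infty]
  · have hc : 0 < cos (l / 2) := cos_pos_of_mem_Ioo ⟨by linarith, by linarith⟩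
    have h1 : cot (l / 2) = (tan (l / 2))⁻¹ := by
      rw [cot_eq_cos_div_sin, tan_eq_sin_div_cos, inv_div]
    have h2 : 0 < tan (l / 2) := tan_pos_of_pos_of_lt_pi_div_two (by linarith) (by linarith)
    rw [h1, Complex.ofReal_inv, invFun_coe (inv_ne_zero (by exact_mod_cast h2.ne')), inv_inv, foot,
      toC_coe, Complex.arg_ofReal_of_nonneg h2.le, rad_coe, rpow_one, Complex.norm_real,
      Real.norm_of_nonneg h2.le, arctan_tan (by linarith) (by linarith)]
    congr 1
    ring

section model

variable {m : ℕ} {c : ℝ} (h : ModelPar m c)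
include h

lemma ModelPar.ne_zero : m ≠ 0 := by
  have := h.pos
  rintro rfl
  simp at this

lemma ModelPar.sphDist_dev_near {u₀ : ℂ} (hu₀ : u₀ ≠ 0) :
    ∀ᶠ p : RS × RS in 𝓝 ((u₀ : RS), (u₀ : RS)),
      sphDist (dev m c p.1) (dev m c p.2) = confDist (density m c) p.1 p.2 := by
  rw [nhds_prod_eq, OnePoint.nhds_coe_eq, Filter.prod_map_map_eq, Filter.eventually_map,
    ← nhds_prod_eq]
  have hκ : Compat m c u₀ (u₀ ^ m) := ⟨by rw [norm_pow, rpow_natCast], Or.inr ⟨m, rfl, rfl⟩⟩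
  have hne := eventually_ne_nhds hu₀
  filter_upwards [h.confDist_near hu₀ hκ, (continuous_fst.tendsto (u₀, u₀)).eventually hne,
    (continuous_snd.tendsto (u₀, u₀)).eventually hne] with p h1 h2 h3
  rw [h1, branch_nat m _ hu₀ h2, branch_nat m _ hu₀ h3, sphDist_dev, div_pow, div_pow,
    mul_div_cancel₀ _ (pow_ne_zero m hu₀), mul_div_cancel₀ _ (pow_ne_zero m hu₀)]

lemma ModelPar.sphDist_dev_le (x y : RS) :
    sphDist (dev m c x) (dev m c y) ≤ confDist (density m c) x y := by
  have H := h.isConf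
  have hfin : ({((0 : ℂ) : RS), OnePoint.infty} : Set RS).Finite := Set.toFinite _
  have h1 := dist_le_of_local (d' := fb 1) (f := fun x => mobN c (powRS m x)) H.continuous_confDist
    H.confDist_nonneg (fun _ _ => H.eq_of_confDist_eq_zero) H.exists_geodesic
    (continuous_fb one_pos) (fb_self one_pos) (fb_comm 1) (fb_triangle one_pos)
    ((mobN c).continuous.comp (continuous_powRS h.ne_zero)) hfin (fun x hx => ?_) x y
  · rwa [← sphDist_foot_one] at h1
  simp only [Set.mem_insert_iff, Set.mem_singleton_iff, not_or] at hx
  obtain ⟨u, rfl⟩ := OnePoint.ne_infty_iff_exists.1 hx.2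
  refine LeNear.of_le ((h.sphDist_dev_near fun h => hx.1 (by rw [h])).mono fun p hp => ?_)
    (.of_forall fun p => H.confDist_nonneg _ _)
  rw [← sphDist_foot_one]
  exact hp.le

end model

/-- The power of a point at distance `s` from the apex on the ray towards the other apex. -/
def rayPow (l s : ℝ) : ℝ := sin (s / 2) * sin (l / 2) / sin ((l - s) / 2)

lemma rayPow_nonneg {l s : ℝ} (hl : l ≤ π) (hs : 0 ≤ s) (hsl : s < l) : 0 ≤ rayPow l s :=
  div_nonneg (mul_nonneg (sin_nonneg_of_nonneg_of_le_pi (by linarith) (by linarith))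
    (sin_nonneg_of_nonneg_of_le_pi (by linarith) (by linarith)))
    (sin_nonneg_of_nonneg_of_le_pi (by linarith) (by linarith))

/-- `rayPow l s` solves ζ / (1 + cot(l/2) ζ) = tan(s/2), and tan(s/2) is the stereographic
coordinate of colatitude `s`. -/
lemma foot_mobN_rayPow {l s : ℝ} (hl : l ≤ π) (hs : 0 ≤ s) (hsl : s < l) :
    foot 1 (mobN (cot (l / 2)) ((rayPow l s : ℂ) : RS)) = sph 0 s := by
  have h1 : 0 < sin ((l - s) / 2) := sin_pos_of_pos_of_lt_pi (by linarith) (by linarith)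
  have h2 : 0 < sin (l / 2) := sin_pos_of_pos_of_lt_pi (by linarith) (by linarith)
  have h3 : 0 < cos (s / 2) := cos_pos_of_mem_Ioo ⟨by linarith, by linarith⟩
  have h4 : 1 + cot (l / 2) * rayPow l s = sin (l / 2) * cos (s / 2) / sin ((l - s) / 2) := by
    rw [rayPow, cot_eq_cos_div_sin]
    have : sin ((l - s) / 2) = sin (l / 2) * cos (s / 2) - cos (l / 2) * sin (s / 2) := by
      rw [← sin_sub]; congr 1; ring
    field_simp
    linarith
  have h5 : rayPow l s / (1 + cot (l / 2) * rayPow l s) = tan (s / 2) := by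
    rw [h4, rayPow, tan_eq_sin_div_cos]
    field_simp
  have h6 : (1 + (cot (l / 2) : ℂ) * (rayPow l s : ℂ)) ≠ 0 := by
    have : 1 + cot (l / 2) * rayPow l s ≠ 0 := by rw [h4]; positivity
    exact_mod_cast this
  rw [mobN_coe h6]
  have h7 : (rayPow l s : ℂ) / (1 + (cot (l / 2) : ℂ) * (rayPow l s : ℂ)) = (tan (s / 2) : ℝ) := by
    rw [← h5]; push_cast; rfl
  have h8 : 0 ≤ tan (s / 2) := tan_nonneg_of_nonneg_of_le_pi_div_two (by linarith) (by linarith)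
  rw [h7, foot, toC_coe, Complex.arg_ofReal_of_nonneg h8, rad_coe, rpow_one, Complex.norm_real,
    Real.norm_of_nonneg h8, arctan_tan (by linarith) (by linarith)]
  congr 1
  ring

section model

variable {m : ℕ} {l : ℝ} (h : ModelPar m (cot (l / 2))) (hl : 0 < l) (hl' : l ≤ π)
include h hl hl'

/-- The developing map does not increase distances and sends the cone points to points at distance
`l`, which is the lower bound. For the upper bound the meridian arc of length `l` is lifted: the
lift is given by real m-th roots for s < l, moves with unit speed where the developing map is a
local isometry, and tends to ∞ as s tends to `l`. -/
lemma ModelPar.confDist_zero_infty :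
    confDist (density m (cot (l / 2))) ((0 : ℂ) : RS) OnePoint.infty = l := by
  have H := h.isConf
  have hm := h.ne_zero
  have hm0 : (0 : ℝ) < 1 / m := by have := h.pos; positivity
  refine le_antisymm ?_ ?_
  · set γ : ℝ → RS := fun s => ((rayPow l s ^ (1 / (m : ℝ)) : ℝ) : ℂ) with hγ
    have hpow : ∀ s, 0 ≤ s → s < l → (((rayPow l s ^ (1 / (m : ℝ)) : ℝ) : ℂ)) ^ m = rayPow l s := by
      intro s h0 h1
      rw [← Complex.ofReal_pow, ← rpow_natCast, ← rpow_mul (rayPow_nonneg hl' h0 h1),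
        one_div_mul_cancel (by exact_mod_cast hm), rpow_one]
    have hdev : ∀ s, 0 ≤ s → s < l → dev m (cot (l / 2)) (γ s) = sph 0 s := fun s h0 h1 => by
      rw [dev, hγ, powRS_coe, hpow s h0 h1, foot_mobN_rayPow hl' h0 h1]
    have hsin : ∀ s, 0 ≤ s → s < l → sin ((l - s) / 2) ≠ 0 := fun s h0 h1 =>
      (sin_pos_of_pos_of_lt_pi (by linarith) (by linarith)).ne'
    have hrc : ∀ s, 0 ≤ s → s < l → ContinuousAt (rayPow l) s := fun s h0 h1 => by
      unfold rayPow
      exact ContinuousAt.div (by fun_prop) (by fun_prop) (hsin s h0 h1)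
    have hγc : ∀ s, 0 ≤ s → s < l → ContinuousAt γ s := fun s h0 h1 =>
      OnePoint.continuous_coe.continuousAt.comp (Complex.continuous_ofReal.continuousAt.comp
        ((hrc s h0 h1).rpow_const (Or.inr hm0.le)))
    have hγ0 : γ 0 = ((0 : ℂ) : RS) := by
      simp [hγ, rayPow, hm]
    have hle : ∀ s, 0 ≤ s → s < l → confDist (density m (cot (l / 2))) ((0 : ℂ) : RS) (γ s) ≤ s := by
      intro s h0 h1
      have key := abs_sub_le_of_local Set.finite_empty
        (g := fun s => confDist (density m (cot (l / 2))) ((0 : ℂ) : RS) (γ s)) h0 ?_ ?_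
      · simp only [hγ0, H.confDist_self, sub_zero] at key
        exact (le_abs_self _).trans key
      · intro s' hs'
        refine ContinuousAt.continuousWithinAt ?_
        exact H.continuous_confDist.continuousAt.comp
          (continuousAt_const.prodMk (hγc s' hs'.1 (hs'.2.trans_lt h1)))
      · intro s' hs' _ K hK
        have hs'l := hs'.2.trans h1
        have hpos : 0 < rayPow l s' := by
          refine div_pos (mul_pos ?_ ?_) ?_ <;>
            exact sin_pos_of_pos_of_lt_pi (by linarith [hs'.1]) (by linarith [hs'.1])
        have hne : (((rayPow l s' ^ (1 / (m : ℝ)) : ℝ) : ℂ)) ≠ 0 := by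
          exact_mod_cast (rpow_pos_of_pos hpos _).ne'
        have hc := hγc s' hs'.1.le hs'l
        have h2 := (hc.tendsto.prodMk_nhds (tendsto_const_nhds (x := γ s'))).eventually
          (h.sphDist_dev_near hne)
        filter_upwards [h2, Ioo_mem_nhds hs'.1 hs'l] with t ht htl
        rw [hdev t htl.1.le htl.2, hdev s' hs'.1.le hs'l, sphDist_sph, sub_self,
          sideOf_zero_angle ⟨htl.1.le, by linarith [htl.2]⟩ ⟨hs'.1.le, by linarith⟩] at ht
        have h3 := H.confDist_triangle ((0 : ℂ) : RS) (γ t) (γ s')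
        have h4 := H.confDist_triangle ((0 : ℂ) : RS) (γ s') (γ t)
        rw [IsConf.confDist_comm (γ s') (γ t)] at h4
        rw [← ht] at h3 h4
        have h5 : |t - s'| ≤ K * |t - s'| := le_mul_of_one_le_left (abs_nonneg _) hK.le
        exact (abs_le.2 ⟨by linarith, by linarith⟩).trans h5
    have hlim : Filter.Tendsto γ (𝓝[<] l) (𝓝 OnePoint.infty) := by
      have h1 : Filter.Tendsto (rayPow l) (𝓝[<] l) Filter.atTop := by
        have h2 : Filter.Tendsto (fun s => sin (s / 2) * sin (l / 2)) (𝓝[<] l)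
            (𝓝 (sin (l / 2) * sin (l / 2))) :=
          (Continuous.tendsto (by fun_prop) l).mono_left nhdsWithin_le_nhds
        have h3 : Filter.Tendsto (fun s => (sin ((l - s) / 2))⁻¹) (𝓝[<] l) Filter.atTop := by
          refine Filter.Tendsto.inv_tendsto_nhdsGT_zero ?_
          refine tendsto_nhdsWithin_iff.2 ⟨?_, ?_⟩
          · have : Filter.Tendsto (fun s => sin ((l - s) / 2)) (𝓝 l) (𝓝 (sin ((l - l) / 2))) :=
              Continuous.tendsto (by fun_prop) l
            simp only [sub_self, zero_div, sin_zero] at this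
            exact this.mono_left nhdsWithin_le_nhds
          · filter_upwards [Ioo_mem_nhdsLT hl] with s hs
            exact sin_pos_of_pos_of_lt_pi (by linarith [hs.2]) (by linarith [hs.1])
        have hs : 0 < sin (l / 2) := sin_pos_of_pos_of_lt_pi (by linarith) (by linarith)
        exact h2.pos_mul_atTop (mul_pos hs hs) h3
      have h2 := (tendsto_rpow_atTop hm0).comp h1
      refine (OnePoint.tendsto_coe_infty (X := ℂ)).comp ?_
      rw [Filter.coclosedCompact_eq_cocompact, ← Metric.cobounded_eq_cocompact,
        ← tendsto_norm_atTop_iff_cobounded]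
      refine Filter.tendsto_atTop_mono (fun s => ?_) h2
      rw [Complex.norm_real]
      exact le_abs_self _
    have h1 := ((H.continuous_confDist.tendsto (((0 : ℂ) : RS), OnePoint.infty)).comp
      ((tendsto_const_nhds (x := ((0 : ℂ) : RS))).prodMk_nhds hlim))
    refine le_of_tendsto h1 ?_
    filter_upwards [Ioo_mem_nhdsLT hl] with s hs
    exact (hle s hs.1.le hs.2).trans hs.2.le
  · refine (h.sphDist_dev_le _ _).trans' ?_
    rw [dev_zero hm, dev_infty m hl hl', sphDist_sph, sub_self,
      sideOf_zero_angle ⟨le_rfl, pi_pos.le⟩ ⟨hl.le, hl'⟩, zero_sub, abs_neg, abs_of_pos hl]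

omit h hl hl' in
lemma dev_eq_iff {x : RS} {z : RS} :
    dev m (cot (l / 2)) x = foot 1 (mobN (cot (l / 2)) z) ↔ powRS m x = z := by
  rw [dev, (foot_injective one_pos).eq_iff, (mobN (cot (l / 2))).injective.eq_iff]

/-- The developing map is the power map followed by a homeomorphism, so its fibres are sets of m-th
roots. Off the branch values it is a local homeomorphism defined on a compact space, hence a
covering. -/
lemma modelSurface_isBranchedCover :
    (modelSurface h).IsBranchedCover m l (dev m (cot (l / 2))) := by
  have hm := h.ne_zero
  have h0 : sph 0 0 = foot 1 (mobN (cot (l / 2)) ((0 : ℂ) : RS)) := by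
    rw [mobN_zero, foot_zero one_pos]
  have h1 : sph 0 l = foot 1 (mobN (cot (l / 2)) OnePoint.infty) := by
    rw [← dev_infty m hl hl', dev, powRS_infty]
  have hz : ∀ x : RS, powRS m x = ((0 : ℂ) : RS) ↔ x = ((0 : ℂ) : RS) := fun x => by
    induction x using OnePoint.rec with
    | infty => simp
    | coe u => simp [hm]
  have hi : ∀ x : RS, powRS m x = OnePoint.infty ↔ x = OnePoint.infty := fun x => by
    induction x using OnePoint.rec with
    | infty => simp
    | coe u => simp
  have hc := continuous_dev hm (cot (l / 2))
  have hpre : ∀ x : RS, dev m (cot (l / 2)) x ∈ ({sph 0 0, sph 0 l}ᶜ : Set S2) →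
      ∃ u : ℂ, u ≠ 0 ∧ x = u := fun x hx => by
    simp only [Set.mem_compl_iff, Set.mem_insert_iff, Set.mem_singleton_iff, not_or, h0, h1,
      dev_eq_iff, hz, hi] at hx
    obtain ⟨u, rfl⟩ := OnePoint.ne_infty_iff_exists.1 hx.2
    exact ⟨u, fun h => hx.1 (by rw [h]), rfl⟩
  have hloc : IsLocalHomeomorphOn (dev m (cot (l / 2)))
      (dev m (cot (l / 2)) ⁻¹' {sph 0 0, sph 0 l}ᶜ) := by
    have a1 : IsLocalHomeomorphOn (fun u : ℂ => u ^ m) ({0}ᶜ : Set ℂ) :=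
      (isCoveringMapOn_npow (𝕜 := ℂ) m (by exact_mod_cast hm)).isLocalHomeomorphOn.mono
        fun u hu => pow_ne_zero m hu
    have a2 : IsLocalHomeomorph fun u : ℂ => foot 1 (mobN (cot (l / 2)) (u : RS)) :=
      (footHomeo one_pos).isLocalHomeomorph.comp ((mobN (cot (l / 2))).isLocalHomeomorph.comp
        (OnePoint.isOpenEmbedding_coe (X := ℂ)).isLocalHomeomorph)
    have a3 : IsLocalHomeomorphOn (dev m (cot (l / 2)) ∘ ((↑) : ℂ → RS)) ({0}ᶜ : Set ℂ) :=
      (a2.isLocalHomeomorphOn (s := Set.univ)).comp a1 fun _ _ => trivial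
    refine (a3.of_comp_right ((OnePoint.isOpenEmbedding_coe
      (X := ℂ)).isLocalHomeomorph.isLocalHomeomorphOn)).mono fun x hx => ?_
    obtain ⟨u, hu, rfl⟩ := hpre x hx
    exact ⟨u, hu, rfl⟩
  have hcov := IsCoveringMapOn.of_isLocalHomeomorphOn hc hloc
  refine ⟨hc, ?_, ?_, hcov, fun y hy => ?_,
    fun x hx => ?_⟩
  · ext x
    exact (h0 ▸ dev_eq_iff).trans (hz x)
  · ext x
    exact (h1 ▸ dev_eq_iff).trans (hi x)
  · obtain ⟨z, rfl⟩ := foot_surjective one_pos y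
    obtain ⟨z, rfl⟩ := (mobN (cot (l / 2))).surjective z
    simp only [Set.mem_compl_iff, Set.mem_insert_iff, Set.mem_singleton_iff, not_or, h0, h1,
      (foot_injective one_pos).eq_iff, (mobN (cot (l / 2))).injective.eq_iff] at hy
    obtain ⟨ζ, rfl⟩ := OnePoint.ne_infty_iff_exists.1 hy.2
    have hζ : ζ ≠ 0 := fun h => hy.1 (by rw [h])
    have hset : dev m (cot (l / 2)) ⁻¹' {foot 1 (mobN (cot (l / 2)) ζ)} =
        ((↑) : ℂ → RS) '' {u | u ^ m = ζ} := by
      ext x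
      refine dev_eq_iff.trans ?_
      induction x using OnePoint.rec with
      | infty => simp
      | coe u => simp
    change ((dev m (cot (l / 2)) : RS → S2) ⁻¹' {foot 1 (mobN (cot (l / 2)) ζ)}).ncard = m
    rw [hset, Set.ncard_image_of_injective _ OnePoint.coe_injective]
    have hprim := Complex.isPrimitiveRoot_exp m hm
    have hroots : {u : ℂ | u ^ m = ζ} = ((Polynomial.nthRoots m ζ).toFinset : Set ℂ) := by
      ext u; simp [Polynomial.mem_nthRoots (Nat.pos_of_ne_zero hm)]
    have hex : ∃ α : ℂ, α ^ m = ζ := IsAlgClosed.exists_pow_nat_eq ζ (Nat.pos_of_ne_zero hm)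
    rw [hroots, Set.ncard_coe_finset, Multiset.toFinset_card_of_nodup (hprim.nthRoots_nodup hζ),
      hprim.card_nthRoots, if_pos hex]
  · have hx' : x ≠ ((0 : ℂ) : RS) ∧ x ≠ OnePoint.infty :=
      ⟨fun h => hx ⟨0, h.symm⟩, fun h => hx ⟨1, h.symm⟩⟩
    obtain ⟨u, rfl⟩ := OnePoint.ne_infty_iff_exists.1 hx'.2
    have h2 := h.sphDist_dev_near (u₀ := u) fun h => hx'.1 (by rw [h])
    rw [nhds_prod_eq, Filter.eventually_prod_self_iff'] at h2
    obtain ⟨U, hU, h2⟩ := h2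
    let _ := h.isConf.metric
    obtain ⟨s, hs, h3⟩ := Metric.nhds_basis_ball.mem_iff.1 hU
    exact ⟨s, hs, fun a ha b hb => h2 a (h3 ha) b (h3 hb)⟩

end model

/-! ### Model surfaces as cyclic gluings of slit spheres -/

/-- The branch of the `m`-th root on the closed upper half plane with argument in `[0, π / m]`. -/
def rootUp (m : ℕ) (ζ : ℂ) : ℂ :=
  Complex.exp (π / (2 * m) * Complex.I) * (-Complex.I * ζ) ^ (1 / (m : ℂ))

/-- The branch of the `m`-th root on the closed lower half plane with argument in
`[π / m, 2 π / m]`. -/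
def rootDown (m : ℕ) (ζ : ℂ) : ℂ :=
  Complex.exp (3 * π / (2 * m) * Complex.I) * (Complex.I * ζ) ^ (1 / (m : ℂ))

section root

variable {m : ℕ} (hm : m ≠ 0)
include hm

lemma cpow_inv_pow (z : ℂ) : (z ^ (1 / (m : ℂ))) ^ m = z := by
  rw [one_div, Complex.cpow_nat_inv_pow z hm]

lemma rootUp_pow (ζ : ℂ) : rootUp m ζ ^ m = ζ := by
  have hm' : (m : ℂ) ≠ 0 := by exact_mod_cast hm
  have h1 : (m : ℂ) * (π / (2 * m) * Complex.I) = π / 2 * Complex.I := by field_simp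
  rw [rootUp, mul_pow, cpow_inv_pow hm, ← Complex.exp_nat_mul, h1, Complex.exp_pi_div_two_mul_I]
  linear_combination (-ζ) * Complex.I_mul_I

omit hm in
lemma exp_three_pi_div_two : Complex.exp (3 * π / 2 * Complex.I) = -Complex.I := by
  have : (3 * π / 2 * Complex.I : ℂ) = π * Complex.I + π / 2 * Complex.I := by ring
  rw [this, Complex.exp_add, Complex.exp_pi_mul_I, Complex.exp_pi_div_two_mul_I]
  ring

lemma rootDown_pow (ζ : ℂ) : rootDown m ζ ^ m = ζ := by
  have hm' : (m : ℂ) ≠ 0 := by exact_mod_cast hm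
  have h1 : (m : ℂ) * (3 * π / (2 * m) * Complex.I) = 3 * π / 2 * Complex.I := by field_simp
  rw [rootDown, mul_pow, cpow_inv_pow hm, ← Complex.exp_nat_mul, h1, exp_three_pi_div_two]
  linear_combination (-ζ) * Complex.I_mul_I

lemma norm_of_pow_eq {u ζ : ℂ} (h : u ^ m = ζ) : ‖u‖ = ‖ζ‖ ^ (1 / (m : ℝ)) := by
  rw [← h, norm_pow, ← rpow_natCast, ← rpow_mul (norm_nonneg _),
    mul_one_div_cancel (by exact_mod_cast hm), rpow_one]

/-- On the negative axis both branches have argument π/m, so they continue each other there. -/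
lemma rootUp_neg {r : ℝ} (hr : 0 < r) : rootUp m (-r : ℝ) =
    (r ^ (1 / (m : ℝ)) : ℝ) * Complex.exp (π / m * Complex.I) := by
  have hm' : (m : ℂ) ≠ 0 := by exact_mod_cast hm
  have h1 : -Complex.I * ((-r : ℝ) : ℂ) = r * Complex.I := by push_cast; ring
  rw [rootUp, h1, Complex.cpow_def_of_ne_zero (by simp [hr.ne']), Complex.log_ofReal_mul hr (by simp),
    Complex.log_I, rpow_def_of_pos hr, ← Complex.exp_add, Complex.ofReal_exp, ← Complex.exp_add]
  congr 1
  push_cast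
  field_simp
  ring

lemma rootDown_neg {r : ℝ} (hr : 0 < r) : rootDown m (-r : ℝ) =
    (r ^ (1 / (m : ℝ)) : ℝ) * Complex.exp (π / m * Complex.I) := by
  have hm' : (m : ℂ) ≠ 0 := by exact_mod_cast hm
  have h1 : Complex.I * ((-r : ℝ) : ℂ) = r * -Complex.I := by push_cast; ring
  rw [rootDown, h1, Complex.cpow_def_of_ne_zero (by simp [hr.ne']), Complex.log_ofReal_mul hr (by simp),
    Complex.log_neg_I, rpow_def_of_pos hr, ← Complex.exp_add, Complex.ofReal_exp, ← Complex.exp_add]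
  congr 1
  push_cast
  field_simp
  ring

/-- On the positive axis the lower branch arrives with argument 2π/m, where the upper one starts
with 0; the factor is the passage from one copy of the sphere to the next. -/
lemma rootDown_eq_rootUp {r : ℝ} (hr : 0 < r) : rootDown m r =
    Complex.exp (2 * π * Complex.I / m) * rootUp m r := by
  have hm' : (m : ℂ) ≠ 0 := by exact_mod_cast hm
  have h1 : Complex.I * (r : ℂ) = r * Complex.I := by ring
  have h2 : -Complex.I * (r : ℂ) = r * -Complex.I := by ring
  rw [rootDown, rootUp, h1, h2, Complex.cpow_def_of_ne_zero (by simp [hr.ne']),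
    Complex.cpow_def_of_ne_zero (by simp [hr.ne']), Complex.log_ofReal_mul hr (by simp),
    Complex.log_ofReal_mul hr (by simp), Complex.log_I, Complex.log_neg_I, ← Complex.exp_add,
    ← Complex.exp_add, ← Complex.exp_add]
  congr 1
  field_simp
  ring

/-- The factors −i and i inside the two roots turn the half planes into the right half plane, where
the principal root is continuous up to the boundary, including 0. -/
lemma continuousAt_cpow_inv {z : ℂ} (hz : 0 ≤ z.re) :
    ContinuousAt (fun z : ℂ => z ^ (1 / (m : ℂ))) z := by
  refine Complex.continuousAt_cpow_const_of_re_pos (Or.inl hz) ?_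
  have : (1 / (m : ℂ)) = ((1 / (m : ℝ) : ℝ) : ℂ) := by push_cast; rfl
  rw [this, Complex.ofReal_re]
  positivity

/-- At infinity the choice of the root is irrelevant, since its modulus is determined by the power.
-/
lemma continuousAt_map_root {f : ℂ → ℂ} (hf : ∀ ζ, f ζ ^ m = ζ) {S : Set ℂ}
    (hc : ∀ ζ ∈ S, ContinuousAt f ζ) {x : RS} (hx : ∀ ζ : ℂ, x = ζ → ζ ∈ S) :
    ContinuousAt (OnePoint.map f : RS → RS) x := by
  induction x using OnePoint.rec with
  | infty =>
    rw [OnePoint.continuousAt_infty', Filter.coclosedCompact_eq_cocompact]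
    refine (OnePoint.tendsto_coe_infty (X := ℂ)).comp ?_
    rw [Filter.coclosedCompact_eq_cocompact, ← Metric.cobounded_eq_cocompact,
      ← tendsto_norm_atTop_iff_cobounded]
    have hpos : 0 < 1 / (m : ℝ) := by positivity
    exact ((tendsto_rpow_atTop hpos).comp tendsto_norm_cobounded_atTop).congr
      fun z => (norm_of_pow_eq hm (hf z)).symm
  | coe u =>
    rw [OnePoint.continuousAt_coe]
    exact OnePoint.continuous_coe.continuousAt.comp (hc u (hx u rfl))

end root

lemma sph_eq_of_sin_pos {a b c d : ℝ} (hb : b ∈ Set.Icc 0 π) (hd : d ∈ Set.Icc 0 π)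
    (h : sph a b = sph c d) : b = d ∧ (sin b ≠ 0 → cos a = cos c ∧ sin a = sin c) := by
  obtain ⟨h1, h2, h3⟩ := sph_ext_iff.1 h
  have hbd : b = d := injOn_cos hb hd h3
  subst hbd
  exact ⟨rfl, fun hs => ⟨mul_right_cancel₀ hs h1, mul_right_cancel₀ hs h2⟩⟩

lemma eq_of_cos_sin_eq {a b : ℝ} (ha : a ∈ Set.Icc 0 (2 * π)) (hb : b ∈ Set.Icc 0 (2 * π))
    (h : cos a = cos b ∧ sin a = sin b) : a = b ∨ (a = 2 * π ∧ b = 0) ∨ (a = 0 ∧ b = 2 * π) := by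
  have h1 : cos (a - b) = 1 := by
    rw [cos_sub, h.1, h.2]; nlinarith [sin_sq_add_cos_sq b]
  obtain ⟨n, hn⟩ := (cos_eq_one_iff _).1 h1
  have hp := pi_pos
  have u1 : (n : ℝ) < 2 := by
    by_contra hc; push Not at hc; nlinarith [ha.1, ha.2, hb.1, hb.2]
  have u2 : (-2 : ℝ) < n := by
    by_contra hc; push Not at hc; nlinarith [ha.1, ha.2, hb.1, hb.2]
  have u1' : n < 2 := by exact_mod_cast u1
  have u2' : -2 < n := by exact_mod_cast u2
  have : n = -1 ∨ n = 0 ∨ n = 1 := by omega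
  rcases this with rfl | rfl | rfl
  · right; right; push_cast at hn; constructor <;> linarith [ha.1, ha.2, hb.1, hb.2]
  · left; push_cast at hn; linarith
  · right; left; push_cast at hn; constructor <;> linarith [ha.1, ha.2, hb.1, hb.2]

/-! ### The cut sphere in the power coordinate -/

/-- The power coordinate of the point of the sphere with longitude `ψ` and colatitude `φ`. -/
def cutPow (l ψ φ : ℝ) : RS := (mobN (cot (l / 2))).symm ((footHomeo one_pos).symm (sph ψ φ))

lemma foot_mobN_cutPow (l ψ φ : ℝ) : foot 1 (mobN (cot (l / 2)) (cutPow l ψ φ)) = sph ψ φ := by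
  rw [cutPow, Homeomorph.apply_symm_apply, ← footHomeo_apply one_pos, Homeomorph.apply_symm_apply]

lemma cutPow_eq_iff {l ψ φ : ℝ} {x : RS} :
    cutPow l ψ φ = x ↔ foot 1 (mobN (cot (l / 2)) x) = sph ψ φ := by
  rw [← foot_mobN_cutPow l ψ φ, (foot_injective one_pos).eq_iff, (mobN _).injective.eq_iff, eq_comm]

lemma cutPow_congr_iff {l ψ φ ψ' φ' : ℝ} :
    cutPow l ψ φ = cutPow l ψ' φ' ↔ sph ψ φ = sph ψ' φ' := by
  rw [cutPow_eq_iff, foot_mobN_cutPow, eq_comm]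

lemma continuous_sph : Continuous fun p : ℝ × ℝ => sph p.1 p.2 :=
  continuous_sph_of (by fun_prop) (by fun_prop) (by fun_prop)

lemma continuous_cutPow (l : ℝ) : Continuous fun p : ℝ × ℝ => cutPow l p.1 p.2 := by
  have h1 := (footHomeo one_pos).symm.continuous.comp continuous_sph
  exact (mobN (cot (l / 2))).symm.continuous.comp h1

section cut

variable {l : ℝ} (hl : 0 < l) (hl' : l < π)
include hl hl'

lemma cot_pos_half : 0 < cot (l / 2) := by
  rw [cot_eq_cos_div_sin]
  exact div_pos (cos_pos_of_mem_Ioo ⟨by linarith, by linarith⟩)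
    (sin_pos_of_pos_of_lt_pi (by linarith) (by linarith))

omit hl hl' in
lemma cutPow_zero (ψ : ℝ) : cutPow l ψ 0 = ((0 : ℂ) : RS) := by
  rw [cutPow_eq_iff, mobN_zero, foot_zero one_pos, sph_ext_iff]
  simp

lemma cutPow_tip : cutPow l 0 l = OnePoint.infty := by
  rw [cutPow_eq_iff, ← dev_infty 1 hl hl'.le, dev, powRS_infty]

omit hl in
lemma cutPow_ray {φ : ℝ} (h0 : 0 ≤ φ) (h1 : φ < l) : cutPow l 0 φ = (rayPow l φ : ℂ) := by
  rw [cutPow_eq_iff, foot_mobN_rayPow hl'.le h0 h1]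

omit hl in
lemma rayPow_pos {φ : ℝ} (h0 : 0 < φ) (h1 : φ < l) : 0 < rayPow l φ := by
  refine div_pos (mul_pos ?_ ?_) ?_ <;>
    exact sin_pos_of_pos_of_lt_pi (by linarith) (by linarith)

lemma cutPow_south (ψ : ℝ) : cutPow l ψ π = ((-(cot (l / 2))⁻¹ : ℝ) : ℂ) := by
  have hc := cot_pos_half hl hl'
  rw [cutPow_eq_iff, mobN_pole, foot_infty, sph_ext_iff]
  · simp
  · have : 1 + cot (l / 2) * (-(cot (l / 2))⁻¹) = 0 := by field_simp; ring
    exact_mod_cast this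

omit hl hl' in
lemma cutPow_coe {ψ φ : ℝ} (h0 : 0 ≤ φ) (h1 : φ < π) {ζ : ℂ} (h : cutPow l ψ φ = ζ) :
    1 + cot (l / 2) * ζ ≠ 0 ∧
      ζ / (1 + cot (l / 2) * ζ) = tan (φ / 2) * Complex.exp (ψ * Complex.I) := by
  rw [cutPow_eq_iff, ← foot_pol one_pos ⟨h0, h1.le⟩, (foot_injective one_pos).eq_iff, pol,
    if_neg h1.ne] at h
  have hne : 1 + cot (l / 2) * ζ ≠ 0 := fun h' => by
    rw [mobN_pole h'] at h
    exact OnePoint.infty_ne_coe _ h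
  rw [mobN_coe hne, OnePoint.coe_eq_coe] at h
  refine ⟨hne, ?_⟩
  rw [h]
  simp

/-- The Möbius map has real coefficients and determinant 1, so it preserves both half planes; the
longitude therefore decides which of the two roots applies. -/
lemma cutPow_im {ψ φ : ℝ} (h0 : 0 ≤ φ) (h1 : φ ≤ π) {ζ : ℂ} (h : cutPow l ψ φ = ζ) :
    ∃ K : ℝ, 0 ≤ K ∧ ζ.im = K * sin ψ := by
  rcases h1.eq_or_lt with rfl | h1
  · rw [cutPow_south hl hl', OnePoint.coe_eq_coe] at h
    exact ⟨0, le_rfl, by rw [← h, Complex.ofReal_im, zero_mul]⟩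
  obtain ⟨hne, h2⟩ := cutPow_coe h0 h1 h
  set c := cot (l / 2)
  have h3 : (ζ / (1 + c * ζ)).im = ζ.im / Complex.normSq (1 + c * ζ) := by
    rw [Complex.div_im]
    simp
    ring
  have hpos : 0 < Complex.normSq (1 + c * ζ) := Complex.normSq_pos.2 hne
  rw [h2, Complex.im_ofReal_mul, Complex.exp_ofReal_mul_I_im] at h3
  refine ⟨tan (φ / 2) * Complex.normSq (1 + c * ζ), mul_nonneg
    (tan_nonneg_of_nonneg_of_le_pi_div_two (by linarith) (by linarith)) hpos.le, ?_⟩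
  field_simp at h3
  linarith

/-- The meridian of the slit is real in the power coordinate. Beyond the slit tan(φ/2) exceeds
tan(l/2) = 1/c, while ζ / (1 + cζ) < 1/c for all ζ ≥ 0; so this part is on the negative axis, where
no sheet is cut. -/
lemma cutPow_beyond {φ : ℝ} (h0 : l < φ) (h1 : φ ≤ π) :
    ∃ r : ℝ, 0 < r ∧ cutPow l 0 φ = ((-r : ℝ) : ℂ) := by
  have hc := cot_pos_half hl hl'
  rcases h1.eq_or_lt with rfl | h1
  · exact ⟨_, inv_pos.2 hc, cutPow_south hl hl' 0⟩
  have hne : cutPow l 0 φ ≠ OnePoint.infty := by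
    rw [← cutPow_tip hl hl', Ne, cutPow_congr_iff]
    intro h
    have := (sph_eq_of_sin_pos ⟨by linarith, h1.le⟩ ⟨hl.le, hl'.le⟩ h).1
    linarith
  obtain ⟨ζ, hζ⟩ := OnePoint.ne_infty_iff_exists.1 hne
  obtain ⟨K, -, him⟩ := cutPow_im hl hl' (by linarith) h1.le hζ.symm
  rw [sin_zero, mul_zero] at him
  obtain ⟨x, rfl⟩ : ∃ x : ℝ, ζ = x := ⟨ζ.re, Complex.ext rfl him⟩
  obtain ⟨h2, h3⟩ := cutPow_coe (by linarith) h1 hζ.symm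
  have h2' : 1 + cot (l / 2) * x ≠ 0 := by exact_mod_cast h2
  have h3' : x / (1 + cot (l / 2) * x) = tan (φ / 2) := by
    have : ((x / (1 + cot (l / 2) * x) : ℝ) : ℂ) = (tan (φ / 2) : ℝ) := by
      rw [Complex.ofReal_zero, zero_mul, Complex.exp_zero, mul_one] at h3
      rw [← h3]; push_cast; rfl
    exact_mod_cast this
  have h4 : tan (l / 2) < tan (φ / 2) :=
    tan_lt_tan_of_lt_of_lt_pi_div_two (by linarith) (by linarith) (by linarith)
  have h5 : cot (l / 2) = (tan (l / 2))⁻¹ := by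
    rw [cot_eq_cos_div_sin, tan_eq_sin_div_cos, inv_div]
  have h6 : 0 < tan (l / 2) := tan_pos_of_pos_of_lt_pi_div_two (by linarith) (by linarith)
  refine ⟨-x, ?_, by rw [← hζ]; simp⟩
  by_contra hx
  push Not at hx
  have hx' : 0 ≤ x := by linarith
  rw [← h3', h5, lt_div_iff₀ (by positivity)] at h4
  have : tan (l / 2) * (1 + (tan (l / 2))⁻¹ * x) = tan (l / 2) + x := by field_simp
  linarith

end cut


/-! ### The sheets of the gluing and their identifications -/

section gluing

variable {m : ℕ} [NeZero m] {l : ℝ}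

/-- The parametrization of the `k`-th sheet by the slit sphere. -/
def sheet (l : ℝ) (k : ZMod m) (x : CutSphere) : RS :=
  open Classical in
  if (x.1 : ℝ) ≤ π then
    OnePoint.map (fun ζ => ZMod.stdAddChar k * rootUp m ζ) (cutPow l x.1 x.2)
  else OnePoint.map (fun ζ => ZMod.stdAddChar k * rootDown m ζ) (cutPow l x.1 x.2)

lemma stdAddChar_pow (k : ZMod m) : (ZMod.stdAddChar k : ℂ) ^ m = 1 := by
  rw [← AddChar.map_nsmul_eq_pow, nsmul_eq_mul, ZMod.natCast_self, zero_mul, AddChar.map_zero_eq_one]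

lemma stdAddChar_one : (ZMod.stdAddChar (1 : ZMod m) : ℂ) = Complex.exp (2 * π * Complex.I / m) := by
  have := ZMod.stdAddChar_coe (N := m) 1
  simpa using this

lemma mul_rootUp_pow (k : ZMod m) (ζ : ℂ) : ((ZMod.stdAddChar k : ℂ) * rootUp m ζ) ^ m = ζ := by
  rw [mul_pow, stdAddChar_pow, one_mul, rootUp_pow (NeZero.ne m)]

lemma mul_rootDown_pow (k : ZMod m) (ζ : ℂ) : ((ZMod.stdAddChar k : ℂ) * rootDown m ζ) ^ m = ζ := by
  rw [mul_pow, stdAddChar_pow, one_mul, rootDown_pow (NeZero.ne m)]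

lemma powRS_sheet (k : ZMod m) (x : CutSphere) : powRS m (sheet l k x) = cutPow l x.1 x.2 := by
  rw [sheet]
  split_ifs
  · generalize cutPow l x.1 x.2 = z
    induction z using OnePoint.rec with
    | infty => rfl
    | coe u => rw [OnePoint.map_some, powRS_coe, mul_rootUp_pow]
  · generalize cutPow l x.1 x.2 = z
    induction z using OnePoint.rec with
    | infty => rfl
    | coe u => rw [OnePoint.map_some, powRS_coe, mul_rootDown_pow]

lemma dev_sheet (k : ZMod m) (x : CutSphere) :
    dev m (cot (l / 2)) (sheet l k x) = sph x.1 x.2 := by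
  rw [dev, powRS_sheet, foot_mobN_cutPow]

/-- The two roots agree on the negative axis, where the half planes meet. -/
lemma sheet_of_neg {k : ZMod m} {x : CutSphere} {r : ℝ} (hr : 0 < r)
    (h : cutPow l x.1 x.2 = ((-r : ℝ) : ℂ)) : sheet l k x =
      ((ZMod.stdAddChar k * ((r ^ (1 / (m : ℝ)) : ℝ) * Complex.exp (π / m * Complex.I)) : ℂ) : RS) := by
  rw [sheet, h]
  split_ifs
  · rw [OnePoint.map_some, rootUp_neg (NeZero.ne m) hr]
  · rw [OnePoint.map_some, rootDown_neg (NeZero.ne m) hr]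

lemma sheet_of_zero {k : ZMod m} {x : CutSphere} (h : cutPow l x.1 x.2 = ((0 : ℂ) : RS)) :
    sheet l k x = ((0 : ℂ) : RS) := by
  have h1 := powRS_sheet (l := l) k x
  rw [h] at h1
  induction hz : sheet l k x using OnePoint.rec with
  | infty => rw [hz] at h1; simp at h1
  | coe u =>
    rw [hz, powRS_coe, OnePoint.coe_eq_coe] at h1
    rw [pow_eq_zero_iff (NeZero.ne m)] at h1
    rw [h1]

lemma sheet_of_infty {k : ZMod m} {x : CutSphere} (h : cutPow l x.1 x.2 = OnePoint.infty) :
    sheet l k x = OnePoint.infty := by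
  rw [sheet, h]; simp

variable (hl : 0 < l) (hl' : l < π)
include hl hl'

lemma continuousAt_up {a : ℂ} (ha : a ^ m = 1) {x : CutSphere} (hx : (x.1 : ℝ) ≤ π) :
    ContinuousAt (fun x : CutSphere =>
      (OnePoint.map (fun ζ => a * rootUp m ζ) (cutPow l x.1 x.2) : RS)) x := by
  have hm := NeZero.ne m
  have hcut : Continuous fun x : CutSphere => cutPow l x.1 x.2 :=
    Continuous.comp (g := fun p : ℝ × ℝ => cutPow l p.1 p.2)
      (f := fun x : CutSphere => ((x.1 : ℝ), (x.2 : ℝ))) (continuous_cutPow l) (by fun_prop)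
  have h0 : ContinuousAt (OnePoint.map (fun ζ => a * rootUp m ζ) : RS → RS)
      (cutPow l x.1 x.2) := by
    refine continuousAt_map_root hm (fun ζ => by rw [mul_pow, ha, one_mul, rootUp_pow hm])
      (S := {ζ | 0 ≤ ζ.im}) (fun ζ hζ => ?_) fun ζ hζ => ?_
    · have h1 : ContinuousAt (fun ζ : ℂ => -Complex.I * ζ) ζ := by fun_prop
      exact continuousAt_const.mul (continuousAt_const.mul
        (ContinuousAt.comp (f := fun ζ : ℂ => -Complex.I * ζ)
          (continuousAt_cpow_inv hm (le_of_le_of_eq hζ (by simp))) h1))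
    · obtain ⟨K, hK, h⟩ := cutPow_im hl hl' x.2.2.1 x.2.2.2 hζ
      change 0 ≤ ζ.im
      rw [h]
      exact mul_nonneg hK (sin_nonneg_of_nonneg_of_le_pi x.1.2.1 hx)
  exact ContinuousAt.comp (f := fun x : CutSphere => cutPow l x.1 x.2) h0 hcut.continuousAt

lemma continuousAt_down {a : ℂ} (ha : a ^ m = 1) {x : CutSphere} (hx : π ≤ (x.1 : ℝ)) :
    ContinuousAt (fun x : CutSphere =>
      (OnePoint.map (fun ζ => a * rootDown m ζ) (cutPow l x.1 x.2) : RS)) x := by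
  have hm := NeZero.ne m
  have hcut : Continuous fun x : CutSphere => cutPow l x.1 x.2 :=
    Continuous.comp (g := fun p : ℝ × ℝ => cutPow l p.1 p.2)
      (f := fun x : CutSphere => ((x.1 : ℝ), (x.2 : ℝ))) (continuous_cutPow l) (by fun_prop)
  have h0 : ContinuousAt (OnePoint.map (fun ζ => a * rootDown m ζ) : RS → RS)
      (cutPow l x.1 x.2) := by
    refine continuousAt_map_root hm (fun ζ => by rw [mul_pow, ha, one_mul, rootDown_pow hm])
      (S := {ζ | ζ.im ≤ 0}) (fun ζ hζ => ?_) fun ζ hζ => ?_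
    · have h1 : ContinuousAt (fun ζ : ℂ => Complex.I * ζ) ζ := by fun_prop
      exact continuousAt_const.mul (continuousAt_const.mul
        (ContinuousAt.comp (f := fun ζ : ℂ => Complex.I * ζ)
          (continuousAt_cpow_inv hm (le_of_le_of_eq (neg_nonneg.2 hζ) (by simp))) h1))
    · obtain ⟨K, hK, h⟩ := cutPow_im hl hl' x.2.2.1 x.2.2.2 hζ
      have h1 : sin (x.1 : ℝ) ≤ 0 := by
        have := sin_nonneg_of_nonneg_of_le_pi (x := x.1 - π) (by linarith) (by linarith [x.1.2.2])
        rw [sin_sub_pi] at this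
        linarith
      change ζ.im ≤ 0
      rw [h]
      exact mul_nonpos_of_nonneg_of_nonpos hK h1
  exact ContinuousAt.comp (f := fun x : CutSphere => cutPow l x.1 x.2) h0 hcut.continuousAt

omit [NeZero m] in
lemma cutPow_pi {φ : ℝ} (h0 : 0 ≤ φ) (h1 : φ ≤ π) {ζ : ℂ} (h : cutPow l π φ = ζ) :
    ∃ r : ℝ, 0 ≤ r ∧ ζ = (-r : ℝ) := by
  obtain ⟨K, -, him⟩ := cutPow_im hl hl' h0 h1 h
  rw [sin_pi, mul_zero] at him
  obtain ⟨r, rfl⟩ : ∃ r : ℝ, ζ = (-r : ℝ) :=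
    ⟨-ζ.re, Complex.ext (by simp) (by simpa using him)⟩
  refine ⟨r, ?_, rfl⟩
  by_contra hr
  push Not at hr
  rcases h1.eq_or_lt with rfl | h2
  · rw [cutPow_south hl hl', OnePoint.coe_eq_coe] at h
    have hz' : -(cot (l / 2))⁻¹ = -r := by exact_mod_cast h
    have := inv_pos.2 (cot_pos_half hl hl')
    linarith
  · obtain ⟨h3, h4⟩ := cutPow_coe h0 h2 h
    have hden : 0 < 1 + cot (l / 2) * (-r) := by
      have := mul_pos (cot_pos_half hl hl') (neg_pos.2 hr); linarith
    rw [Complex.exp_pi_mul_I] at h4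
    have h5 : -r / (1 + cot (l / 2) * (-r)) = -tan (φ / 2) := by
      have : ((-r / (1 + cot (l / 2) * (-r)) : ℝ) : ℂ) = ((-tan (φ / 2) : ℝ) : ℂ) := by
        rw [Complex.ofReal_neg, ← mul_neg_one ((tan (φ / 2) : ℝ) : ℂ), ← h4]
        push_cast; rfl
      exact_mod_cast this
    have h6 : 0 ≤ tan (φ / 2) :=
      tan_nonneg_of_nonneg_of_le_pi_div_two (by linarith) (by linarith)
    have := div_pos (neg_pos.2 hr) hden
    linarith

lemma map_up_eq_map_down {a : ℂ} {φ : ℝ} (h0 : 0 ≤ φ) (h1 : φ ≤ π) :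
    (OnePoint.map (fun ζ => a * rootUp m ζ) (cutPow l π φ) : RS) =
      OnePoint.map (fun ζ => a * rootDown m ζ) (cutPow l π φ) := by
  have hm := NeZero.ne m
  induction hz : cutPow l π φ using OnePoint.rec with
  | infty => rfl
  | coe ζ =>
    obtain ⟨r, hr, rfl⟩ := cutPow_pi hl hl' h0 h1 hz
    rcases hr.eq_or_lt with rfl | hr
    · have h1 := rootUp_pow hm 0
      have h2 := rootDown_pow hm 0
      rw [pow_eq_zero_iff hm] at h1 h2
      rw [OnePoint.map_some, OnePoint.map_some, neg_zero, Complex.ofReal_zero, h1, h2]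
    · rw [OnePoint.map_some, OnePoint.map_some, rootUp_neg hm hr, rootDown_neg hm hr]

lemma continuous_sheet (k : ZMod m) : Continuous (sheet l k) := by
  have hA : IsClosed {x : CutSphere | (x.1 : ℝ) ≤ π} :=
    isClosed_le (continuous_subtype_val.comp continuous_fst) continuous_const
  have hB : IsClosed {x : CutSphere | π ≤ (x.1 : ℝ)} :=
    isClosed_le continuous_const (continuous_subtype_val.comp continuous_fst)
  rw [← continuousOn_univ]
  have hU : {x : CutSphere | (x.1 : ℝ) ≤ π} ∪ {x : CutSphere | π ≤ (x.1 : ℝ)} = Set.univ :=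
    Set.eq_univ_of_forall fun x => le_total (x.1 : ℝ) π
  rw [← hU]
  refine ContinuousOn.union_of_isClosed ?_ ?_ hA hB
  · exact ContinuousOn.congr (fun x hx => (continuousAt_up hl hl' (stdAddChar_pow k)
      hx).continuousWithinAt) fun x hx => if_pos hx
  · refine ContinuousOn.congr (fun x hx => (continuousAt_down hl hl' (stdAddChar_pow k)
      hx).continuousWithinAt) fun x hx => ?_
    by_cases h : (x.1 : ℝ) ≤ π
    · refine (if_pos h).trans ?_
      have := le_antisymm h hx
      rw [this]
      exact map_up_eq_map_down hl hl' x.2.2.1 x.2.2.2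
    · exact if_neg h

end gluing

section gluing

variable {m : ℕ} [NeZero m] {l : ℝ}

lemma cutPow_two_pi (φ : ℝ) : cutPow l (2 * π) φ = cutPow l 0 φ := by
  rw [cutPow_congr_iff, sph_ext_iff]; simp

lemma sheet_of_up {k : ZMod m} {x : CutSphere} (hx : (x.1 : ℝ) ≤ π) {ζ : ℂ}
    (h : cutPow l x.1 x.2 = ζ) :
    sheet l k x = ((ZMod.stdAddChar k * rootUp m ζ : ℂ) : RS) := by
  rw [sheet, if_pos hx, h, OnePoint.map_some]

lemma sheet_of_down {k : ZMod m} {x : CutSphere} (hx : ¬ (x.1 : ℝ) ≤ π) {ζ : ℂ}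
    (h : cutPow l x.1 x.2 = ζ) :
    sheet l k x = ((ZMod.stdAddChar k * rootDown m ζ : ℂ) : RS) := by
  rw [sheet, if_neg hx, h, OnePoint.map_some]

lemma sheet_injective {k k' : ZMod m} {x : CutSphere} {ζ : ℂ} (h : cutPow l x.1 x.2 = ζ)
    (hζ : ζ ≠ 0) (he : sheet l k x = sheet l k' x) : k = k' := by
  have key : ∀ {r : ℂ}, r ^ m = ζ → ((ZMod.stdAddChar k * r : ℂ) : RS) =
      ((ZMod.stdAddChar k' * r : ℂ) : RS) → k = k' := fun {r} hr he => by
    have hr0 : r ≠ 0 := by rintro rfl; exact hζ (by rw [← hr, zero_pow (NeZero.ne m)])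
    rw [OnePoint.coe_eq_coe] at he
    exact ZMod.injective_stdAddChar (mul_right_cancel₀ hr0 he)
  by_cases hx : (x.1 : ℝ) ≤ π
  · rw [sheet_of_up hx h, sheet_of_up hx h] at he
    exact key (rootUp_pow (NeZero.ne m) ζ) he
  · rw [sheet_of_down hx h, sheet_of_down hx h] at he
    exact key (rootDown_pow (NeZero.ne m) ζ) he

lemma sheet_glue {k : ZMod m} {x y : CutSphere} (hx : (x.1 : ℝ) = 2 * π) (hy : (y.1 : ℝ) = 0)
    {r : ℝ} (hr : 0 < r) (hcx : cutPow l x.1 x.2 = (r : ℂ)) (hcy : cutPow l y.1 y.2 = (r : ℂ)) :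
    sheet l k x = sheet l (k + 1) y := by
  rw [sheet_of_down (by rw [hx]; linarith [pi_pos]) hcx, sheet_of_up (by rw [hy]; exact pi_pos.le)
    hcy, rootDown_eq_rootUp (NeZero.ne m) hr, AddChar.map_add_eq_mul, stdAddChar_one]
  congr 1
  ring

variable (hl : 0 < l) (hl' : l < π)
include hl hl'

lemma sheet_eq_of_step {a b : ZMod m × CutSphere} (h : SlitStep m l a b) :
    sheet l a.1 a.2 = sheet l b.1 b.2 := by
  cases h with
  | north k x y hx hy =>
    exact (sheet_of_zero (by rw [hx, cutPow_zero])).trans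
      (sheet_of_zero (by rw [hy, cutPow_zero])).symm
  | south k x y hx hy =>
    have hc := inv_pos.2 (cot_pos_half hl hl')
    exact (sheet_of_neg hc (by rw [hx, cutPow_south hl hl'])).trans
      (sheet_of_neg hc (by rw [hy, cutPow_south hl hl'])).symm
  | close k x y hx hy hxy hll =>
    have hcx : cutPow l x.1 x.2 = cutPow l 0 x.2 := by rw [hx, cutPow_two_pi]
    have hcy : cutPow l y.1 y.2 = cutPow l 0 x.2 := by rw [hy, hxy]
    rcases hll.eq_or_lt with he | hlt
    · have h1 : cutPow l 0 x.2 = OnePoint.infty := by rw [← he, cutPow_tip hl hl']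
      exact (sheet_of_infty (hcx.trans h1)).trans (sheet_of_infty (hcy.trans h1)).symm
    · obtain ⟨r, hr, h1⟩ := cutPow_beyond hl hl' hlt x.2.2.2
      exact (sheet_of_neg hr (hcx.trans h1)).trans (sheet_of_neg hr (hcy.trans h1)).symm
  | glue k x y hx hy hxy hll =>
    have hcx : cutPow l x.1 x.2 = cutPow l 0 x.2 := by rw [hx, cutPow_two_pi]
    have hcy : cutPow l y.1 y.2 = cutPow l 0 x.2 := by rw [hy, hxy]
    rcases hll.eq_or_lt with he | hlt
    · have h1 : cutPow l 0 x.2 = OnePoint.infty := by rw [he, cutPow_tip hl hl']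
      exact (sheet_of_infty (hcx.trans h1)).trans (sheet_of_infty (hcy.trans h1)).symm
    rcases x.2.2.1.eq_or_lt with h0 | h0
    · have h1 : cutPow l 0 x.2 = ((0 : ℂ) : RS) := by rw [← h0, cutPow_zero]
      exact (sheet_of_zero (hcx.trans h1)).trans (sheet_of_zero (hcy.trans h1)).symm
    · have h1 := cutPow_ray hl' x.2.2.1 hlt
      exact sheet_glue hx hy (rayPow_pos hl' h0 hlt) (hcx.trans h1) (hcy.trans h1)

omit hl hl' in
/-- Points related to all copies: the ends of the slits. -/
lemma eqvGen_of_banks {z z' : CutSphere} (h : ∀ k : ZMod m,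
    Relation.EqvGen (SlitStep m l) (k, z) (k, z')) (h' : ∀ k : ZMod m,
    Relation.EqvGen (SlitStep m l) (k, z) (k + 1, z')) (k k' : ZMod m) :
    Relation.EqvGen (SlitStep m l) (k, z) (k', z) := by
  have key : ∀ n : ℕ, Relation.EqvGen (SlitStep m l) (k, z) (k + n, z) := by
    intro n
    induction n with
    | zero => simpa using Relation.EqvGen.refl _
    | succ n ih =>
      refine ih.trans _ _ _ ?_
      have h1 := (h' (k + n)).trans _ _ _ ((h (k + n + 1)).symm _ _)
      rwa [add_assoc k, ← Nat.cast_succ] at h1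
  have h1 := key (k' - k).val
  rwa [ZMod.natCast_zmod_val, add_sub_cancel] at h1

/-- The point of the slit sphere with the given coordinates. -/
def cutPt {ψ φ : ℝ} (hψ : ψ ∈ Set.Icc 0 (2 * π)) (hφ : φ ∈ Set.Icc 0 π) : CutSphere :=
  (⟨ψ, hψ⟩, ⟨φ, hφ⟩)

/-- Equal images project to the same point of the sphere, so the two points of the cut sphere
coincide, lie over a common pole, or are the two banks of one meridian point. Where the power
coordinate is neither 0 nor ∞, the root of unity separates the sheets (`sheet_injective`). At the
north pole and at the tip of the slit all sheets meet, and the relation is generated by going around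
the copies. -/
lemma eqvGen_of_sheet_eq {k k' : ZMod m} {x x' : CutSphere} (he : sheet l k x = sheet l k' x') :
    Relation.EqvGen (SlitStep m l) (k, x) (k', x') := by
  have hp := pi_pos
  have m0 : (0 : ℝ) ∈ Set.Icc 0 (2 * π) := ⟨le_rfl, by linarith⟩
  have m1 : 2 * π ∈ Set.Icc 0 (2 * π) := ⟨by linarith, le_rfl⟩
  have hsph : sph x.1 x.2 = sph x'.1 x'.2 := by rw [← dev_sheet k x, he, dev_sheet]
  obtain ⟨hφ, hψ⟩ := sph_eq_of_sin_pos x.2.2 x'.2.2 hsph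
  rcases x.2.2.1.eq_or_lt with h0 | h0
  · have hz : (0 : ℝ) ∈ Set.Icc 0 π := ⟨le_rfl, hp.le⟩
    have h1 := eqvGen_of_banks (m := m) (l := l) (z := cutPt m1 hz) (z' := cutPt m0 hz)
      (fun k => .rel _ _ (.north k _ _ rfl rfl)) (fun k => .rel _ _ (.glue k _ _ rfl rfl rfl hl.le))
      k k'
    exact (Relation.EqvGen.rel _ _ (.north k x _ h0.symm rfl)).trans _ _ _
      (h1.trans _ _ _ (.rel _ _ (.north k' _ x' rfl (by rw [← hφ, ← h0]))))
  have hfin : ∀ x : CutSphere, 0 < (x.2 : ℝ) → ∀ ζ : ℂ, cutPow l x.1 x.2 = ζ → ζ ≠ 0 := by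
    rintro x hx ζ hζ rfl
    rw [← cutPow_zero 0, cutPow_congr_iff] at hζ
    have := (sph_eq_of_sin_pos x.2.2 ⟨le_rfl, hp.le⟩ hζ).1
    linarith
  rcases x.2.2.2.eq_or_lt with h1 | h1
  · have hcx : cutPow l x.1 x.2 = ((-(cot (l / 2))⁻¹ : ℝ) : ℂ) := by rw [h1, cutPow_south hl hl']
    have hcx' : cutPow l x'.1 x'.2 = ((-(cot (l / 2))⁻¹ : ℝ) : ℂ) := by
      rw [← hφ, h1, cutPow_south hl hl']
    have hc := inv_pos.2 (cot_pos_half hl hl')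
    have he' : sheet l k' x' = sheet l k' x := by
      rw [sheet_of_neg hc hcx, sheet_of_neg hc hcx']
    obtain rfl := sheet_injective hcx (hfin x h0 _ hcx) (he.trans he')
    exact .rel _ _ (.south k x x' h1 (by rw [← hφ, h1]))
  have hψ' := eq_of_cos_sin_eq x.1.2 x'.1.2 (hψ (sin_pos_of_pos_of_lt_pi h0 h1).ne')
  by_cases htip : (x.2 : ℝ) = l ∧ ((x.1 : ℝ) = 0 ∨ (x.1 : ℝ) = 2 * π)
  · obtain ⟨h2, h3⟩ := htip
    have hz : l ∈ Set.Icc 0 π := ⟨hl.le, hl'.le⟩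
    have h5 := eqvGen_of_banks (m := m) (l := l) (z := cutPt m1 hz) (z' := cutPt m0 hz)
      (fun k => .rel _ _ (.close k _ _ rfl rfl rfl le_rfl))
      (fun k => .rel _ _ (.glue k _ _ rfl rfl rfl le_rfl))
    have h6 : ∀ (k : ZMod m) (y : CutSphere), (y.2 : ℝ) = l → ((y.1 : ℝ) = 0 ∨ (y.1 : ℝ) = 2 * π) →
        Relation.EqvGen (SlitStep m l) (k, y) (k, cutPt m1 hz) := by
      rintro k y h7 (h8 | h8)
      · exact (Relation.EqvGen.rel _ _ (.close k (cutPt m1 hz) y rfl h8 (Subtype.ext h7.symm)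
          le_rfl)).symm
      · have : y = cutPt m1 hz := Prod.ext (Subtype.ext h8) (Subtype.ext h7)
        rw [this]
        exact .refl _
    have h9 : (x'.1 : ℝ) = 0 ∨ (x'.1 : ℝ) = 2 * π := by
      rcases hψ' with h | h | h
      · rwa [← h]
      · exact Or.inl h.2
      · exact Or.inr h.2
    exact (h6 k x h2 h3).trans _ _ _ ((h5 k k').trans _ _ _ ((h6 k' x' (hφ ▸ h2) h9).symm))
  have hne : cutPow l x.1 x.2 ≠ OnePoint.infty := by
    rw [← cutPow_tip hl hl', Ne, cutPow_congr_iff]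
    intro h
    obtain ⟨h2, h3⟩ := sph_eq_of_sin_pos x.2.2 ⟨hl.le, hl'.le⟩ h
    refine htip ⟨h2, ?_⟩
    rcases eq_of_cos_sin_eq x.1.2 m0 (h3 (sin_pos_of_pos_of_lt_pi h0 h1).ne') with h | h | h
    · exact Or.inl h
    · exact Or.inr h.1
    · exact Or.inl h.1
  obtain ⟨ζ, hζ⟩ := OnePoint.ne_infty_iff_exists.1 hne
  have hζ0 := hfin x h0 ζ hζ.symm
  -- Opposite banks: before the tip the last bank of copy `k` meets the first bank of copy `k + 1`;
  -- beyond the tip the copy is the same.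
  have seam : ∀ {k k' : ZMod m} {x x' : CutSphere}, (x.2 : ℝ) = (x'.2 : ℝ) → 0 < (x.2 : ℝ) →
      (x.2 : ℝ) ≠ l → (x.1 : ℝ) = 2 * π → (x'.1 : ℝ) = 0 → sheet l k x = sheet l k' x' →
      Relation.EqvGen (SlitStep m l) (k, x) (k', x') := by
    intro k k' x x' hφ h0 hxl a1 a2 he
    have hcx : cutPow l x.1 x.2 = cutPow l 0 x.2 := by rw [a1, cutPow_two_pi]
    have hcx' : cutPow l x'.1 x'.2 = cutPow l 0 x.2 := by rw [a2, hφ]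
    rcases lt_or_gt_of_ne hxl with hlt | hgt
    · have h2 := cutPow_ray hl' h0.le hlt
      have h3 := sheet_glue (k := k) a1 a2 (rayPow_pos hl' h0 hlt) (hcx.trans h2) (hcx'.trans h2)
      obtain rfl := sheet_injective (hcx'.trans h2) (hfin x' (hφ ▸ h0) _ (hcx'.trans h2))
        (h3.symm.trans he)
      exact .rel _ _ (.glue k x x' a1 a2 (Subtype.ext hφ) hlt.le)
    · obtain ⟨r, hr, h2⟩ := cutPow_beyond hl hl' hgt x.2.2.2
      have h3 : sheet l k x = sheet l k x' := by
        rw [sheet_of_neg hr (hcx.trans h2), sheet_of_neg hr (hcx'.trans h2)]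
      obtain rfl := sheet_injective (hcx'.trans h2) (hfin x' (hφ ▸ h0) _ (hcx'.trans h2))
        (h3.symm.trans he)
      exact .rel _ _ (.close k x x' a1 a2 (Subtype.ext hφ) hgt.le)
  rcases hψ' with h2 | ⟨h2, h3⟩ | ⟨h2, h3⟩
  · obtain rfl : x = x' := Prod.ext (Subtype.ext h2) (Subtype.ext hφ)
    obtain rfl := sheet_injective hζ.symm hζ0 he
    exact .refl _
  · exact seam hφ h0 (fun h => htip ⟨h, Or.inr h2⟩) h2 h3 he
  · exact (seam hφ.symm (hφ ▸ h0) (fun h => htip ⟨hφ.trans h, Or.inl h2⟩) h3 h2 he.symm).symm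

omit hl hl' in
lemma exists_cutPt (u : S2) : ∃ x : CutSphere, u = sph x.1 x.2 := by
  obtain ⟨ψ, φ, hφ, rfl⟩ := exists_sph u
  have h2 := toIcoMod_mem_Ico' (two_pi_pos) ψ
  refine ⟨cutPt ⟨h2.1, h2.2.le⟩ hφ, ?_⟩
  rw [sph_ext_iff]
  have h3 : ψ - toIcoDiv two_pi_pos 0 ψ • (2 * π) = toIcoMod two_pi_pos 0 ψ :=
    self_sub_toIcoDiv_zsmul _ _ _
  have hc : cos (toIcoMod two_pi_pos 0 ψ) = cos ψ := by rw [← h3, zsmul_eq_mul, cos_sub_int_mul_two_pi]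
  have hs : sin (toIcoMod two_pi_pos 0 ψ) = sin ψ := by rw [← h3, zsmul_eq_mul, sin_sub_int_mul_two_pi]
  simp [cutPt, hc, hs]

omit hl hl' in
-- Two m-th roots of the same nonzero number differ by an m-th root of unity, which is a value of
-- the standard additive character.
lemma exists_sheet (a : RS) : ∃ (k : ZMod m) (x : CutSphere), sheet l k x = a := by
  obtain ⟨x, hx⟩ := exists_cutPt (dev m (cot (l / 2)) a)
  have h1 : cutPow l x.1 x.2 = powRS m a := by rw [cutPow_eq_iff, ← hx, dev]
  induction a using OnePoint.rec with
  | infty => exact ⟨0, x, sheet_of_infty h1⟩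
  | coe u =>
    rw [powRS_coe] at h1
    have key : ∀ r : ℂ, r ^ m = u ^ m → ∃ k : ZMod m, ZMod.stdAddChar k * r = u := by
      intro r hr
      by_cases hu : u = 0
      · subst hu
        rw [zero_pow (NeZero.ne m), pow_eq_zero_iff (NeZero.ne m)] at hr
        exact ⟨0, by simp [hr]⟩
      have hr0 : r ≠ 0 := by
        rintro rfl
        rw [zero_pow (NeZero.ne m)] at hr
        exact pow_ne_zero m hu hr.symm
      have h2 : (u / r) ^ m = 1 := by rw [div_pow, ← hr, div_self (pow_ne_zero m hr0)]
      obtain ⟨i, -, hi⟩ := (Complex.isPrimitiveRoot_exp m (NeZero.ne m)).eq_pow_of_pow_eq_one h2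
      refine ⟨i, ?_⟩
      have h3 : (ZMod.stdAddChar (i : ZMod m) : ℂ) = u / r := by
        rw [← hi, ← stdAddChar_one, ← AddChar.map_nsmul_eq_pow, nsmul_eq_mul, mul_one]
      rw [h3, div_mul_cancel₀ _ hr0]
    by_cases hx1 : (x.1 : ℝ) ≤ π
    · obtain ⟨k, hk⟩ := key _ (rootUp_pow (NeZero.ne m) (u ^ m))
      exact ⟨k, x, by rw [sheet_of_up hx1 h1, hk]⟩
    · obtain ⟨k, hk⟩ := key _ (rootDown_pow (NeZero.ne m) (u ^ m))
      exact ⟨k, x, by rw [sheet_of_down hx1 h1, hk]⟩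

omit [NeZero m] in
lemma modelSurface_isCyclicSlitGluing (h : ModelPar m (cot (l / 2))) :
    (modelSurface h).IsCyclicSlitGluing m l (dev m (cot (l / 2))) := by
  have : NeZero m := ⟨h.ne_zero⟩
  refine ⟨⟨sheet l, continuous_sheet hl hl', exists_sheet, fun k x k' x' =>
    ⟨eqvGen_of_sheet_eq hl hl', fun he => ?_⟩, fun k x hx => ?_, fun k x hx hx' => ?_, dev_sheet⟩,
    (modelSurface_isBranchedCover h hl hl'.le).isometric⟩
  · have key : ∀ a b : ZMod m × CutSphere, Relation.EqvGen (SlitStep m l) a b →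
        sheet l a.1 a.2 = sheet l b.1 b.2 := fun a b hab => by
      induction hab with
      | rel a b hab => exact sheet_eq_of_step hl hl' hab
      | refl a => rfl
      | symm a b _ ih => exact ih.symm
      | trans a b c _ _ ih ih' => exact ih.trans ih'
    exact key _ _ he
  · exact sheet_of_zero (by rw [hx, cutPow_zero])
  · exact sheet_of_infty (by rw [hx, hx', cutPow_tip hl hl'])

end gluing

/-! ### Möbius transformations and rotations of the Riemann sphere -/

/-- Möbius transformations. -/
def IsMob (r : Equiv.Perm RS) : Prop := ∃ g : GL (Fin 2) ℂ, ∀ x : RS, r x = g • x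

/-- Rotations: Möbius transformations that preserve the spherical distance. -/
def IsRot (r : Equiv.Perm RS) : Prop := IsMob r ∧ ∀ x y, fb 1 (r x) (r y) = fb 1 x y

lemma IsMob.one : IsMob 1 := ⟨1, fun x => by simp⟩

lemma IsMob.mul {r s : Equiv.Perm RS} (hr : IsMob r) (hs : IsMob s) : IsMob (r * s) := by
  obtain ⟨g, hg⟩ := hr
  obtain ⟨h, hh⟩ := hs
  exact ⟨g * h, fun x => by rw [Equiv.Perm.mul_apply, hh, hg, mul_smul]⟩

lemma IsMob.inv {r : Equiv.Perm RS} (hr : IsMob r) : IsMob r⁻¹ := by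
  obtain ⟨g, hg⟩ := hr
  exact ⟨g⁻¹, fun x => by rw [Equiv.Perm.inv_eq_iff_eq, hg, smul_inv_smul]⟩

lemma IsRot.one : IsRot 1 := ⟨.one, fun _ _ => rfl⟩

lemma IsRot.mul {r s : Equiv.Perm RS} (hr : IsRot r) (hs : IsRot s) : IsRot (r * s) :=
  ⟨hr.1.mul hs.1, fun x y => by rw [Equiv.Perm.mul_apply, Equiv.Perm.mul_apply, hr.2, hs.2]⟩

lemma IsRot.inv {r : Equiv.Perm RS} (hr : IsRot r) : IsRot r⁻¹ :=
  ⟨hr.1.inv, fun x y => by rw [← hr.2]; simp⟩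

/-- The rotation subgroup. -/
def rot : Subgroup (Equiv.Perm RS) where
  carrier := {r | IsRot r}
  mul_mem' := IsRot.mul
  one_mem' := IsRot.one
  inv_mem' := IsRot.inv

/-- A Möbius transformation in coordinates. -/
lemma IsMob.exists_coeff {r : Equiv.Perm RS} (hr : IsMob r) : ∃ a b c d : ℂ, a * d - b * c ≠ 0 ∧
    (∀ z : ℂ, c * z + d = 0 → r (z : RS) = OnePoint.infty) ∧
    (∀ z : ℂ, c * z + d ≠ 0 → r (z : RS) = ((a * z + b) / (c * z + d) : ℂ)) ∧
    (c = 0 → r OnePoint.infty = OnePoint.infty) ∧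
    (c ≠ 0 → r OnePoint.infty = (a / c : ℂ)) := by
  obtain ⟨g, hg⟩ := hr
  refine ⟨g 0 0, g 0 1, g 1 0, g 1 1, ?_, fun z hz => ?_, fun z hz => ?_, fun h => ?_, fun h => ?_⟩
  · rw [← Matrix.det_fin_two]
    exact g.det_ne_zero
  · rw [hg, OnePoint.smul_some_eq_ite, if_pos hz]
  · rw [hg, OnePoint.smul_some_eq_ite, if_neg hz]
  · rw [hg, OnePoint.smul_infty_eq_ite, if_pos h]
  · rw [hg, OnePoint.smul_infty_eq_ite, if_neg h]

/-- Conversely, coefficients define a Möbius transformation. -/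
lemma exists_mob {a b c d : ℂ} (h : a * d - b * c ≠ 0) : ∃ r : Equiv.Perm RS, IsMob r ∧
    (∀ z : ℂ, c * z + d = 0 → r (z : RS) = OnePoint.infty) ∧
    (∀ z : ℂ, c * z + d ≠ 0 → r (z : RS) = ((a * z + b) / (c * z + d) : ℂ)) ∧
    (c = 0 → r OnePoint.infty = OnePoint.infty) ∧
    (c ≠ 0 → r OnePoint.infty = (a / c : ℂ)) := by
  have hdet : (!![a, b; c, d] : Matrix (Fin 2) (Fin 2) ℂ).det ≠ 0 := by
    rwa [Matrix.det_fin_two_of]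
  set g : GL (Fin 2) ℂ := Matrix.GeneralLinearGroup.mkOfDetNeZero _ hdet with hg
  have e1 : g 0 0 = a := rfl
  have e2 : g 0 1 = b := rfl
  have e3 : g 1 0 = c := rfl
  have e4 : g 1 1 = d := rfl
  have ht : ∀ x : RS, MulAction.toPermHom (GL (Fin 2) ℂ) RS g x = g • x := fun x => rfl
  refine ⟨MulAction.toPermHom _ RS g, ⟨g, ht⟩, fun z hz => ?_, fun z hz => ?_, fun h => ?_,
    fun h => ?_⟩
  · rw [ht, OnePoint.smul_some_eq_ite, e1, e2, e3, e4, if_pos hz]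
  · rw [ht, OnePoint.smul_some_eq_ite, e1, e2, e3, e4, if_neg hz]
  · rw [ht, OnePoint.smul_infty_eq_ite, e1, e3, if_pos h]
  · rw [ht, OnePoint.smul_infty_eq_ite, e1, e3, if_neg h]

/-- Finite fixed points are roots of c z² + (d − a) z − b; differences over three nearby points show
that all its coefficients vanish. -/
lemma IsMob.eq_one {r : Equiv.Perm RS} (hr : IsMob r) {z₀ : ℂ}
    (h : ∀ᶠ z : ℂ in 𝓝 z₀, r (z : RS) = z) : r = 1 := by
  obtain ⟨a, b, c, d, hdet, h1, h2, h3, h4⟩ := hr.exists_coeff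
  have hp : ∀ᶠ z : ℂ in 𝓝 z₀, c * z ^ 2 + (d - a) * z - b = 0 := by
    filter_upwards [h] with z hz
    have hne : c * z + d ≠ 0 := fun h' => by
      rw [h1 z h'] at hz; exact OnePoint.infty_ne_coe _ hz
    rw [h2 z hne, OnePoint.coe_eq_coe, div_eq_iff hne] at hz
    linear_combination -hz
  obtain ⟨ε, hε, hb⟩ := Metric.eventually_nhds_iff_ball.1 hp
  have hε0 : ((ε / 2 : ℝ) : ℂ) ≠ 0 := by exact_mod_cast (half_pos hε).ne'
  have hn : ‖((ε / 2 : ℝ) : ℂ)‖ < ε := by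
    rw [Complex.norm_real, Real.norm_of_nonneg (half_pos hε).le]; linarith
  have p0 := hb z₀ (Metric.mem_ball_self hε)
  have p1 := hb (z₀ + (ε / 2 : ℝ)) (by rw [mem_ball_iff_norm, add_sub_cancel_left]; exact hn)
  have p2 := hb (z₀ - (ε / 2 : ℝ)) (by
    rw [mem_ball_iff_norm, sub_sub_cancel_left, norm_neg]; exact hn)
  set t := ((ε / 2 : ℝ) : ℂ)
  have hc : c = 0 := by
    have : c * t ^ 2 = 0 := by linear_combination (p1 + p2 - 2 * p0) / 2
    exact (mul_eq_zero.1 this).resolve_right (pow_ne_zero 2 hε0)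
  subst hc
  have hda : d - a = 0 := by
    have : (d - a) * t = 0 := by linear_combination p1 - p0
    exact (mul_eq_zero.1 this).resolve_right hε0
  have hb0 : b = 0 := by linear_combination z₀ * hda - p0
  have hd : d ≠ 0 := by rintro rfl; simp at hdet
  obtain rfl : d = a := sub_eq_zero.1 hda
  ext x
  rw [Equiv.Perm.one_apply]
  induction x using OnePoint.rec with
  | infty => exact h3 rfl
  | coe u =>
    rw [h2 u (by simpa using hd), hb0, add_zero, zero_mul, zero_add, mul_div_cancel_left₀ _ hd]

lemma IsMob.eq_of_eventuallyEq {r s : Equiv.Perm RS} (hr : IsMob r) (hs : IsMob s) {z₀ : ℂ}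
    (h : ∀ᶠ z : ℂ in 𝓝 z₀, r (z : RS) = s z) : r = s := by
  have := (hs.inv.mul hr).eq_one (z₀ := z₀) (by
    filter_upwards [h] with z hz
    rw [Equiv.Perm.mul_apply, hz]
    exact s.symm_apply_apply _)
  exact (inv_mul_eq_one.1 this).symm

/-! ### Homogeneous coordinates and rotations -/

/-- Homogeneous coordinates. -/
def hom0 (x : RS) : ℂ := x.elim 1 id
/-- Homogeneous coordinates. -/
def hom1 (x : RS) : ℂ := x.elim 0 fun _ => 1

lemma hom_pos (x : RS) : 0 < ‖hom0 x‖ ^ 2 + ‖hom1 x‖ ^ 2 := by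
  induction x using OnePoint.rec with
  | infty => simp [hom0, hom1]
  | coe u => simp only [hom0, hom1, OnePoint.elim_some, norm_one]; positivity

lemma fb_one_hom (x y : RS) : fb 1 x y = arccos (1 - 2 * ‖hom0 x * hom1 y - hom1 x * hom0 y‖ ^ 2 /
    ((‖hom0 x‖ ^ 2 + ‖hom1 x‖ ^ 2) * (‖hom0 y‖ ^ 2 + ‖hom1 y‖ ^ 2))) := by
  induction x using OnePoint.rec with
  | infty =>
    induction y using OnePoint.rec with
    | infty => rw [fb_self one_pos]; simp [hom0, hom1]
    | coe v => rw [fb_comm, fb_one_coe_infty]; simp [hom0, hom1, add_comm]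
  | coe u =>
    induction y using OnePoint.rec with
    | infty => rw [fb_one_coe_infty]; simp [hom0, hom1, add_comm]
    | coe v => rw [fb_coe, coneDist_one]; simp [hom0, hom1, add_comm]

/-- Special unitary coefficients define rotations. -/
lemma isRot_of_coeff {a b : ℂ} (hn : ‖a‖ ^ 2 + ‖b‖ ^ 2 ≠ 0) {r : Equiv.Perm RS} (hr : IsMob r)
    (h1 : ∀ z : ℂ, -(starRingEnd ℂ) b * z + (starRingEnd ℂ) a = 0 → r (z : RS) = OnePoint.infty)
    (h2 : ∀ z : ℂ, -(starRingEnd ℂ) b * z + (starRingEnd ℂ) a ≠ 0 →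
      r (z : RS) = ((a * z + b) / (-(starRingEnd ℂ) b * z + (starRingEnd ℂ) a) : ℂ))
    (h3 : -(starRingEnd ℂ) b = 0 → r OnePoint.infty = OnePoint.infty)
    (h4 : -(starRingEnd ℂ) b ≠ 0 → r OnePoint.infty = (a / (-(starRingEnd ℂ) b) : ℂ)) :
    IsRot r := by
  -- In homogeneous coordinates the map is linear up to a scalar `t`, and the linear map is a
  -- multiple of a unitary one; the chordal formula is not affected by scalars.
  have key : ∀ x : RS, ∃ t : ℂ, t ≠ 0 ∧ t * hom0 (r x) = a * hom0 x + b * hom1 x ∧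
      t * hom1 (r x) = -(starRingEnd ℂ) b * hom0 x + (starRingEnd ℂ) a * hom1 x := by
    have hconj : a * (starRingEnd ℂ) a + b * (starRingEnd ℂ) b ≠ 0 := by
      rw [Complex.mul_conj, Complex.mul_conj, Complex.normSq_eq_norm_sq, Complex.normSq_eq_norm_sq]
      exact_mod_cast hn
    intro x
    induction x using OnePoint.rec with
    | infty =>
      by_cases hb : -(starRingEnd ℂ) b = 0
      · rw [h3 hb]
        have hb' : b = 0 := by simpa using hb
        refine ⟨a, ?_, ?_, ?_⟩
        · rintro rfl; simp [hb'] at hconj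
        · simp [hom0, hom1]
        · simp [hom0, hom1, hb']
      · rw [h4 hb]
        refine ⟨-(starRingEnd ℂ) b, hb, ?_, ?_⟩
        · simp only [hom0, hom1, OnePoint.elim_some, OnePoint.elim_infty, id]
          rw [mul_div_cancel₀ _ hb]; ring
        · simp [hom0, hom1]
    | coe z =>
      by_cases hz : -(starRingEnd ℂ) b * z + (starRingEnd ℂ) a = 0
      · rw [h1 z hz]
        refine ⟨a * z + b, fun h => ?_, ?_, ?_⟩
        · refine hconj ?_
          linear_combination a * hz + (starRingEnd ℂ) b * h
        · simp [hom0, hom1]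
        · simp only [hom0, hom1, OnePoint.elim_some, OnePoint.elim_infty, id]
          rw [mul_zero, mul_one, hz]
      · rw [h2 z hz]
        refine ⟨_, hz, ?_, ?_⟩
        · simp only [hom0, hom1, OnePoint.elim_some, id]
          rw [mul_div_cancel₀ _ hz, mul_one]
        · simp only [hom0, hom1, OnePoint.elim_some, id]
          rw [mul_one, mul_one]
  have hnorm : ∀ u v : ℂ, ‖a * u + b * v‖ ^ 2 +
      ‖-(starRingEnd ℂ) b * u + (starRingEnd ℂ) a * v‖ ^ 2 =
      (‖a‖ ^ 2 + ‖b‖ ^ 2) * (‖u‖ ^ 2 + ‖v‖ ^ 2) := by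
    intro u v
    simp only [← Complex.normSq_eq_norm_sq, Complex.normSq_apply]
    simp
    ring
  refine ⟨hr, fun x y => ?_⟩
  obtain ⟨s, hs, s0, s1⟩ := key x
  obtain ⟨t, ht, t0, t1⟩ := key y
  have e1 := hnorm (hom0 x) (hom1 x)
  have e2 := hnorm (hom0 y) (hom1 y)
  rw [← s0, ← s1, norm_mul, norm_mul] at e1
  rw [← t0, ← t1, norm_mul, norm_mul] at e2
  have e3 : s * t * (hom0 (r x) * hom1 (r y) - hom1 (r x) * hom0 (r y)) =
      (a * (starRingEnd ℂ) a + b * (starRingEnd ℂ) b) *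
        (hom0 x * hom1 y - hom1 x * hom0 y) := by
    calc _ = (s * hom0 (r x)) * (t * hom1 (r y)) - (s * hom1 (r x)) * (t * hom0 (r y)) := by ring
      _ = _ := by rw [s0, s1, t0, t1]; ring
  have e4 : a * (starRingEnd ℂ) a + b * (starRingEnd ℂ) b = ((‖a‖ ^ 2 + ‖b‖ ^ 2 : ℝ) : ℂ) := by
    rw [Complex.mul_conj, Complex.mul_conj, Complex.normSq_eq_norm_sq, Complex.normSq_eq_norm_sq]
    push_cast; rfl
  have hpos : 0 < ‖a‖ ^ 2 + ‖b‖ ^ 2 := lt_of_le_of_ne (by positivity) hn.symm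
  have e5 := congrArg norm e3
  rw [e4, norm_mul, norm_mul, norm_mul, Complex.norm_real, Real.norm_of_nonneg hpos.le] at e5
  have p1 := norm_pos_iff.2 hs
  have p2 := norm_pos_iff.2 ht
  have q1 := hom_pos x
  have q2 := hom_pos y
  have q3 := hom_pos (r x)
  have q4 := hom_pos (r y)
  rw [fb_one_hom, fb_one_hom]
  congr 2
  rw [div_eq_div_iff (by positivity) (by positivity)]
  set n := ‖a‖ ^ 2 + ‖b‖ ^ 2
  set A := ‖hom0 (r x) * hom1 (r y) - hom1 (r x) * hom0 (r y)‖
  set B := ‖hom0 x * hom1 y - hom1 x * hom0 y‖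
  set X := ‖hom0 x‖ ^ 2 + ‖hom1 x‖ ^ 2
  set Y := ‖hom0 y‖ ^ 2 + ‖hom1 y‖ ^ 2
  set X' := ‖hom0 (r x)‖ ^ 2 + ‖hom1 (r x)‖ ^ 2 with hX'
  set Y' := ‖hom0 (r y)‖ ^ 2 + ‖hom1 (r y)‖ ^ 2 with hY'
  have f1 : ‖s‖ ^ 2 * X' = n * X := by rw [← e1, hX']; ring
  have f2 : ‖t‖ ^ 2 * Y' = n * Y := by rw [← e2, hY']; ring
  have hst : (‖s‖ * ‖t‖ * n) ^ 2 ≠ 0 := by positivity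
  refine mul_left_cancel₀ hst ?_
  calc (‖s‖ * ‖t‖ * n) ^ 2 * (2 * A ^ 2 * (X * Y)) =
        2 * (‖s‖ * ‖t‖ * A) ^ 2 * (n * X) * (n * Y) := by ring
    _ = 2 * (n * B) ^ 2 * (‖s‖ ^ 2 * X') * (‖t‖ ^ 2 * Y') := by rw [e5, f1, f2]
    _ = _ := by ring

/-- Every point can be rotated to `0`. -/
lemma exists_rot_to_zero (P : RS) : ∃ r, IsRot r ∧ r P = ((0 : ℂ) : RS) := by
  induction P using OnePoint.rec with
  | infty =>
    obtain ⟨r, hr, h1, h2, h3, h4⟩ := exists_mob (a := 0) (b := 1) (c := -(starRingEnd ℂ) 1)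
      (d := (starRingEnd ℂ) 0) (by simp)
    exact ⟨r, isRot_of_coeff (by simp) hr h1 h2 h3 h4, by rw [h4 (by simp)]; simp⟩
  | coe p =>
    have hn : ‖(1 : ℂ)‖ ^ 2 + ‖-p‖ ^ 2 ≠ 0 := by
      have : 0 < ‖(1 : ℂ)‖ ^ 2 + ‖-p‖ ^ 2 := by rw [norm_one]; positivity
      exact this.ne'
    have hd : -(starRingEnd ℂ) (-p) * p + (starRingEnd ℂ) 1 = ((‖p‖ ^ 2 + 1 : ℝ) : ℂ) := by
      rw [map_neg, neg_neg, mul_comm, Complex.mul_conj, Complex.normSq_eq_norm_sq, map_one]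
      push_cast; rfl
    have hd0 : -(starRingEnd ℂ) (-p) * p + (starRingEnd ℂ) 1 ≠ 0 := by
      rw [hd]; exact_mod_cast (by positivity : ‖p‖ ^ 2 + 1 ≠ 0)
    obtain ⟨r, hr, h1, h2, h3, h4⟩ := exists_mob (a := 1) (b := -p) (c := -(starRingEnd ℂ) (-p))
      (d := (starRingEnd ℂ) 1) (by
        intro h
        apply hd0
        rw [← h]; simp; ring)
    refine ⟨r, isRot_of_coeff hn hr h1 h2 h3 h4, ?_⟩
    rw [h2 p hd0]
    simp

lemma exists_rot_mul {u : ℂ} (hu : ‖u‖ = 1) : ∃ r, IsRot r ∧ ∀ z : ℂ, r (z : RS) = (u * z : ℂ) := by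
  have hu0 : u ≠ 0 := by rintro rfl; simp at hu
  -- Multiplication by `u` is induced by the unitary matrix diag(s, conj s) with s² = u.
  obtain ⟨s, hs⟩ : ∃ s : ℂ, s ^ 2 = u := IsAlgClosed.exists_pow_nat_eq u (by norm_num)
  have hs1 : ‖s‖ = 1 := by
    have : ‖s‖ ^ 2 = 1 := by rw [← norm_pow, hs, hu]
    exact (pow_eq_one_iff_of_nonneg (norm_nonneg s) two_ne_zero).1 this
  have hc : s * (starRingEnd ℂ) s = 1 := by
    rw [Complex.mul_conj, Complex.normSq_eq_norm_sq, hs1]; simp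
  obtain ⟨r, hr, h1, h2, h3, h4⟩ := exists_mob (a := s) (b := 0) (c := -(starRingEnd ℂ) 0)
    (d := (starRingEnd ℂ) s) (by simp [hc])
  have hcs : (starRingEnd ℂ) s ≠ 0 := right_ne_zero_of_mul_eq_one hc
  refine ⟨r, isRot_of_coeff (by simp [hs1]) hr h1 h2 h3 h4, fun z => ?_⟩
  rw [h2 z (by simpa using hcs), ← hs]
  congr 1
  rw [div_eq_iff (by simpa using hcs)]
  simp only [map_zero, neg_zero, zero_mul, zero_add, add_zero]
  linear_combination (-s * z) * hc

lemma IsMob.exists_of_fix_zero {A : Equiv.Perm RS} (hA : IsMob A) (h0 : A ((0 : ℂ) : RS) = ((0 : ℂ) : RS)) :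
    ∃ a b : ℂ, a ≠ 0 ∧ (∀ v, 1 + b * v ≠ 0 → A (v : RS) = (a * v / (1 + b * v) : ℂ)) ∧
      (A OnePoint.infty = OnePoint.infty → b = 0) := by
  obtain ⟨a, b, c, d, hdet, h1, h2, h3, h4⟩ := hA.exists_coeff
  have hd : d ≠ 0 := fun hd => by
    rw [h1 0 (by simp [hd])] at h0; exact OnePoint.infty_ne_coe _ h0
  have hb : b = 0 := by
    rw [h2 0 (by simpa using hd), OnePoint.coe_eq_coe] at h0
    simpa [hd] using h0
  subst hb
  have ha : a ≠ 0 := by rintro rfl; simp at hdet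
  refine ⟨a / d, c / d, div_ne_zero ha hd, fun v hv => ?_, fun h => ?_⟩
  · have e : 1 + c / d * v = (c * v + d) / d := by field_simp; ring
    rw [e] at hv ⊢
    have hcd : c * v + d ≠ 0 := fun h => hv (by rw [h, zero_div])
    rw [h2 v hcd, add_zero]
    congr 1
    field_simp
  · by_contra hc
    have hc' : c ≠ 0 := fun h => hc (by rw [h, zero_div])
    rw [h4 hc'] at h
    exact OnePoint.coe_ne_infty _ h

/-- A Möbius transformation that preserves the distance to the fixed point `0` near `0` is a
rotation about `0`. -/
lemma IsMob.eq_mul_of_rad {A : Equiv.Perm RS} (hA : IsMob A) (h0 : A ((0 : ℂ) : RS) = ((0 : ℂ) : RS))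
    (h : ∀ᶠ z : ℂ in 𝓝 0, fb 1 (A z) (A ((0 : ℂ) : RS)) = fb 1 (z : RS) ((0 : ℂ) : RS)) :
    ∃ u : ℂ, ‖u‖ = 1 ∧ IsRot A ∧ ∀ z : ℂ, A (z : RS) = (u * z : ℂ) := by
  obtain ⟨a, b, ha, h1, -⟩ := hA.exists_of_fix_zero h0
  have hc : ContinuousAt (fun z : ℂ => 1 + b * z) 0 := by fun_prop
  have hne : ∀ᶠ z : ℂ in 𝓝 0, 1 + b * z ≠ 0 := hc.eventually_ne (by simp)
  have hn : ∀ᶠ z : ℂ in 𝓝 0, z ≠ 0 → ‖a‖ = ‖1 + b * z‖ := by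
    filter_upwards [h, hne] with z hz hz' hz0
    rw [h0, fb_zero one_pos, fb_zero one_pos, h1 z hz', rad_coe, rad_coe, rpow_one, rpow_one] at hz
    have h2 := arctan_injective (mul_left_cancel₀ two_ne_zero hz)
    rw [norm_div, norm_mul] at h2
    have p1 := norm_pos_iff.2 hz0
    have p2 := norm_pos_iff.2 hz'
    field_simp at h2
    exact h2
  have hsq : ∀ᶠ z : ℂ in 𝓝 0, z ≠ 0 → ‖a‖ ^ 2 = 1 + 2 * (b * z).re + ‖b * z‖ ^ 2 := by
    filter_upwards [hn] with z hz hz0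
    rw [hz hz0, ← Complex.normSq_eq_norm_sq, ← Complex.normSq_eq_norm_sq, Complex.normSq_apply,
      Complex.normSq_apply]
    simp
    ring
  -- Opposite points on two circles eliminate the linear term and the constant, which leaves |b|² ε²
  -- = 0.
  have hb : b = 0 := by
    obtain ⟨ε, hε, hball⟩ := Metric.eventually_nhds_iff_ball.1 hsq
    have hr : ∀ r : ℝ, 0 < r → r < ε → ∀ z : ℂ, ‖z‖ = r →
        ‖a‖ ^ 2 = 1 + 2 * (b * z).re + ‖b * z‖ ^ 2 := fun r hr hr' z hz =>
      hball z (by simpa [hz] using hr') (by rintro rfl; simp at hz; linarith)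
    have hcast : ∀ r : ℝ, 0 < r → ‖(r : ℂ)‖ = r := fun r hr => by
      rw [Complex.norm_real, Real.norm_of_nonneg hr.le]
    have q1 := hr (ε / 2) (by linarith) (by linarith) ((ε / 2 : ℝ) : ℂ) (hcast _ (by linarith))
    have q2 := hr (ε / 2) (by linarith) (by linarith) (-((ε / 2 : ℝ) : ℂ))
      (by rw [norm_neg]; exact hcast _ (by linarith))
    have q3 := hr (ε / 4) (by linarith) (by linarith) ((ε / 4 : ℝ) : ℂ) (hcast _ (by linarith))
    have q4 := hr (ε / 4) (by linarith) (by linarith) (-((ε / 4 : ℝ) : ℂ))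
      (by rw [norm_neg]; exact hcast _ (by linarith))
    rw [mul_neg, norm_neg, Complex.neg_re, norm_mul, hcast _ (by linarith)] at q2 q4
    rw [norm_mul, hcast _ (by linarith)] at q1 q3
    have : ‖b‖ ^ 2 * ε ^ 2 = 0 := by nlinarith
    have h3 : ‖b‖ ^ 2 = 0 := (mul_eq_zero.1 this).resolve_right (by positivity)
    simpa using h3
  subst hb
  have ha1 : ‖a‖ = 1 := by
    obtain ⟨z, hz, hz0⟩ := (hn.filter_mono nhdsWithin_le_nhds |>.and
      (self_mem_nhdsWithin (s := ({0}ᶜ : Set ℂ)))).exists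
    simpa using hz hz0
  have hA' : ∀ z : ℂ, A (z : RS) = (a * z : ℂ) := fun z => by simpa using h1 z (by simp)
  obtain ⟨r, hr, hr'⟩ := exists_rot_mul ha1
  have : A = r := hA.eq_of_eventuallyEq hr.1 (z₀ := 0) (.of_forall fun z => by rw [hA', hr'])
  exact ⟨a, ha1, this ▸ hr, hA'⟩

/-- A rotation fixing `0` is multiplication by a unit complex number. -/
lemma IsRot.eq_mul {A : Equiv.Perm RS} (hA : IsRot A) (h0 : A ((0 : ℂ) : RS) = ((0 : ℂ) : RS)) :
    ∃ u : ℂ, ‖u‖ = 1 ∧ ∀ z : ℂ, A (z : RS) = (u * z : ℂ) := by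
  obtain ⟨u, hu, -, h⟩ := hA.1.eq_mul_of_rad h0 (.of_forall fun z => hA.2 _ _)
  exact ⟨u, hu, h⟩

lemma fix_infty_of_mul {A : Equiv.Perm RS} {u : ℂ} (hu : u ≠ 0) (h : ∀ z : ℂ, A (z : RS) = (u * z : ℂ)) :
    A OnePoint.infty = OnePoint.infty := by
  by_contra hne
  obtain ⟨v, hv⟩ := OnePoint.ne_infty_iff_exists.1 hne
  have h1 : A ((u⁻¹ * v : ℂ) : RS) = A OnePoint.infty := by
    rw [h, ← hv, mul_inv_cancel_left₀ hu]
  exact OnePoint.coe_ne_infty _ (A.injective h1)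

/-- Rigidity: a holomorphic local isometry of the sphere is a rotation. -/
lemma exists_rot_of_isometric {f : ℂ → ℂ} (hf : AnalyticAt ℂ f 0)
    (h : ∀ᶠ u in 𝓝 (0 : ℂ), coneDist 1 (f u) (f 0) = coneDist 1 u 0) :
    ∃ r, IsRot r ∧ ∀ᶠ u : ℂ in 𝓝 0, r (u : RS) = f u := by
  set a := f 0 with ha
  have hden := eventually_mob_den (c := 0) a
  have hden' := hf.continuousAt.eventually hden
  have hga : AnalyticAt ℂ (fun u => mob 0 a (f u)) 0 := by
    exact (analyticAt_mob hden.self_of_nhds).comp_of_eq hf rfl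
  set g : ℂ → ℂ := fun u => mob 0 a (f u) with hg
  have hg0 : g 0 = 0 := by simp [hg, mob, ← ha]
  -- Once `f 0` is moved to the origin, preserving distances to it means preserving the modulus.
  have hnorm : ∀ᶠ u in 𝓝 (0 : ℂ), ‖g u‖ = ‖u‖ := by
    filter_upwards [h, hden'] with u hu hu'
    have h1 := coneDist_mob hu' hden.self_of_nhds
    rw [chord_zero, hu] at h1
    have h2 : mob 0 a a = 0 := by simp [mob]
    rw [h2, ← fb_coe, ← fb_coe, fb_zero one_pos, fb_zero one_pos, rad_coe, rad_coe, rpow_one,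
      rpow_one] at h1
    exact arctan_injective (mul_left_cancel₀ two_ne_zero h1)
  have hds : AnalyticAt ℂ (dslope g 0) 0 := by
    obtain ⟨p, hp⟩ := hga
    exact ⟨_, hp.has_fpower_series_dslope_fslope⟩
  have hds1 : ∀ᶠ u in 𝓝[≠] (0 : ℂ), ‖dslope g 0 u‖ = 1 := by
    filter_upwards [hnorm.filter_mono nhdsWithin_le_nhds, self_mem_nhdsWithin] with u hu hu0
    have hu0' : u ≠ 0 := hu0
    rw [dslope_of_ne _ hu0', slope_def_field, hg0, sub_zero, sub_zero, norm_div, hu,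
      div_self (norm_ne_zero_iff.2 hu0')]
  have hds0 : ‖dslope g 0 0‖ = 1 := by
    have h1 := (hds.continuousAt.norm.tendsto).mono_left (nhdsWithin_le_nhds (s := {0}ᶜ))
    exact tendsto_nhds_unique h1 (tendsto_const_nhds.congr' (hds1.mono fun u hu => hu.symm))
  -- As in the Schwarz lemma, the quotient g(u)/u has modulus 1, so the maximum principle makes it
  -- constant.
  have hconst : ∀ᶠ u in 𝓝 (0 : ℂ), dslope g 0 u = dslope g 0 0 := by
    refine Complex.eventually_eq_of_isLocalMax_norm ?_ ?_
    · exact hds.eventually_analyticAt.mono fun u hu => hu.differentiableAt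
    · rw [eventually_nhdsWithin_iff] at hds1
      filter_upwards [hds1] with u hu
      by_cases hu0 : u = 0
      · rw [hu0]
      · exact (hu hu0).trans hds0.symm |>.le
  obtain ⟨s, hs, hs'⟩ := exists_rot_mul hds0
  have hn : ‖(1 : ℂ)‖ ^ 2 + ‖-a‖ ^ 2 ≠ 0 := by
    have : 0 < ‖(1 : ℂ)‖ ^ 2 + ‖-a‖ ^ 2 := by rw [norm_one]; positivity
    exact this.ne'
  have hq : ∀ ζ : ℂ, (1 + (0 : ℝ) * ζ) * (starRingEnd ℂ) (1 + (0 : ℝ) * a) + ζ * (starRingEnd ℂ) a =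
      -(starRingEnd ℂ) (-a) * ζ + (starRingEnd ℂ) 1 := fun ζ => by simp; ring
  obtain ⟨r, hr, h1, h2, h3, h4⟩ := exists_mob (a := 1) (b := -a) (c := -(starRingEnd ℂ) (-a))
    (d := (starRingEnd ℂ) 1) (by
      have := hden.self_of_nhds
      rw [hq] at this
      intro h
      apply this
      rw [← h]; simp; ring)
  have hr' := isRot_of_coeff hn hr h1 h2 h3 h4
  refine ⟨r⁻¹ * s, hr'.inv.mul hs, ?_⟩
  filter_upwards [hconst, hden'] with u hu hu'
  rw [Equiv.Perm.mul_apply, hs', Equiv.Perm.inv_eq_iff_eq]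
  rw [hq] at hu'
  rw [h2 _ hu']
  have e1 : g u = dslope g 0 0 * u := by
    by_cases hu0 : u = 0
    · rw [hu0, hg0, mul_zero]
    · rw [← hu, dslope_of_ne _ hu0, slope_def_field, hg0, sub_zero, sub_zero, div_mul_cancel₀ _ hu0]
  rw [← e1]
  have e2 : g u = (f u - a) / (-(starRingEnd ℂ) (-a) * f u + (starRingEnd ℂ) 1) := by
    rw [← hq]
    rfl
  rw [e2, one_mul, sub_eq_add_neg]

lemma isMob_mobN (c : ℝ) : IsMob (mobN c).toEquiv := by
  obtain ⟨r, hr, h1, h2, h3, h4⟩ := exists_mob (a := 1) (b := 0) (c := c) (d := 1) (by simp)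
  have : (mobN c).toEquiv = r := by
    ext x
    induction x using OnePoint.rec with
    | infty =>
      by_cases hc : (c : ℂ) = 0
      · rw [h3 hc]
        change mobN c _ = _
        rw [mobN_apply, invFun_infty, OnePoint.map_some, hc, zero_add, invFun_zero]
      · rw [h4 hc]
        change mobN c _ = _
        rw [mobN_apply, invFun_infty, OnePoint.map_some, zero_add, invFun_coe hc, one_div]
    | coe z =>
      change mobN c _ = _
      by_cases hz : 1 + c * z = 0
      · rw [mobN_pole hz, h1 z (by rw [add_comm]; exact hz)]
      · rw [mobN_coe hz, h2 z (by rw [add_comm]; exact hz)]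
        congr 1
        rw [one_mul, add_zero, add_comm]
  exact this ▸ hr

/-- Any two different points can be rotated to `0` and to a point of the positive real axis. -/
lemma exists_rot_pair {P Q : RS} (h : P ≠ Q) : ∃ c : ℝ, 0 ≤ c ∧ ∃ r, IsRot r ∧
    r P = ((0 : ℂ) : RS) ∧ r Q = mobN c OnePoint.infty := by
  obtain ⟨r, hr, hP⟩ := exists_rot_to_zero P
  have hQ : r Q ≠ ((0 : ℂ) : RS) := fun hQ => h (r.injective (hP.trans hQ.symm))
  have hi : ∀ c : ℝ, mobN c OnePoint.infty = invFun ((c : ℂ) : RS) := fun c => by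
    rw [mobN_apply, invFun_infty, OnePoint.map_some, zero_add]
  by_cases hq : r Q = OnePoint.infty
  · exact ⟨0, le_rfl, r, hr, hP, by rw [hq, hi]; simp⟩
  obtain ⟨q, hq'⟩ := OnePoint.ne_infty_iff_exists.1 hq
  have hq0 : q ≠ 0 := by rintro rfl; exact hQ hq'.symm
  have hn := norm_pos_iff.2 hq0
  have hnc : (‖q‖ : ℂ) ≠ 0 := by exact_mod_cast hn.ne'
  obtain ⟨s, hs, hs'⟩ := exists_rot_mul (u := ‖q‖ / q) (by
    rw [norm_div, Complex.norm_real, norm_norm, div_self hn.ne'])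
  refine ⟨‖q‖⁻¹, inv_nonneg.2 hn.le, s * r, hs.mul hr, ?_, ?_⟩
  · rw [Equiv.Perm.mul_apply, hP, hs', mul_zero]
  · rw [Equiv.Perm.mul_apply, ← hq', hs', hi, Complex.ofReal_inv, invFun_coe (inv_ne_zero hnc),
      inv_inv, div_mul_cancel₀ _ hq0]

/-- A logarithm of a Möbius transformation where it avoids `0` and `∞`. -/
lemma IsMob.exists_log {A : Equiv.Perm RS} (hA : IsMob A) (h0 : A ((0 : ℂ) : RS) ≠ ((0 : ℂ) : RS))
    (hi : A ((0 : ℂ) : RS) ≠ OnePoint.infty) : ∃ f : ℂ → ℂ, AnalyticAt ℂ f 0 ∧ deriv f 0 ≠ 0 ∧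
      ∀ᶠ v : ℂ in 𝓝 0, A (v : RS) = (Complex.exp (f v) : ℂ) := by
  obtain ⟨a, b, c, d, hdet, h1, h2, h3, h4⟩ := hA.exists_coeff
  have hd : d ≠ 0 := fun hd => hi (h1 0 (by simp [hd]))
  have hb : b ≠ 0 := fun hb => h0 (by rw [h2 0 (by simpa using hd)]; simp [hb])
  -- Dividing by the value b/d at the origin brings the argument near 1, inside the domain of the
  -- principal logarithm.
  set q : ℂ → ℂ := fun v => (a * v + b) / (c * v + d) * (d / b) with hq
  have hqa : AnalyticAt ℂ q 0 :=
    (AnalyticAt.div (by fun_prop) (by fun_prop) (by simpa using hd)).mul analyticAt_const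
  have hq0 : q 0 = 1 := by simp only [hq, mul_zero, zero_add]; field_simp
  have hslit : q 0 ∈ Complex.slitPlane := by simp [hq0]
  have hfa : AnalyticAt ℂ (fun v => Complex.log (b / d) + Complex.log (q v)) 0 :=
    analyticAt_const.add (hqa.clog hslit)
  refine ⟨fun v => Complex.log (b / d) + Complex.log (q v), hfa, ?_, ?_⟩
  · have e1 : HasDerivAt (fun v : ℂ => a * v + b) a 0 := by
      simpa using ((hasDerivAt_id (0 : ℂ)).const_mul a).add_const b
    have e2 : HasDerivAt (fun v : ℂ => c * v + d) c 0 := by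
      simpa using ((hasDerivAt_id (0 : ℂ)).const_mul c).add_const d
    have e3 := ((e1.fun_div e2 (by simpa using hd)).mul_const (d / b))
    have e4 := (e3.clog hslit).const_add (Complex.log (b / d))
    rw [e4.deriv]
    simp only [mul_zero, zero_add]
    refine div_ne_zero (mul_ne_zero (div_ne_zero hdet
      (pow_ne_zero 2 hd)) (div_ne_zero hd hb)) (mul_ne_zero (div_ne_zero hb hd) (div_ne_zero hd hb))
  · have hc1 : ContinuousAt (fun v : ℂ => c * v + d) 0 := by fun_prop
    filter_upwards [hqa.continuousAt.eventually (Complex.isOpen_slitPlane.mem_nhds hslit),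
      hc1.eventually_ne (show c * 0 + d ≠ 0 by simpa using hd)] with v hv hv'
    rw [h2 v hv', Complex.exp_add, Complex.exp_log (div_ne_zero hb hd),
      Complex.exp_log (Complex.slitPlane_ne_zero hv)]
    congr 1
    simp only [hq]
    field_simp

/-! ### Translation structures and their flows -/

section Flow

variable {X : Type} [TopologicalSpace X]

/-- The domain of a family of charts. -/
def chartDom (L : Set (OpenPartialHomeomorph X ℂ)) : Set X := {x | ∃ l ∈ L, x ∈ l.source}

/-- The transition maps are translations. -/
def IsTranslationAtlas (L : Set (OpenPartialHomeomorph X ℂ)) : Prop :=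
  ∀ l ∈ L, ∀ l' ∈ L, ∀ x, x ∈ l.source → x ∈ l'.source →
    ∀ᶠ x' in 𝓝 x, l x' - l' x' = l x - l' x

/-- The curve `e` moves with unit speed in the charts. -/
def FlowAt (L : Set (OpenPartialHomeomorph X ℂ)) (e : ℂ → X) (s : ℂ) : Prop :=
  ∃ l ∈ L, e s ∈ l.source ∧ ∀ᶠ s' in 𝓝 s, e s' ∈ l.source ∧ l (e s') = l (e s) + (s' - s)

/-- A simple pole of the translation structure. -/
structure IsPole (L : Set (OpenPartialHomeomorph X ℂ)) (p : X) (z : OpenPartialHomeomorph X ℂ)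
    (a : ℝ) : Prop where
  ne_zero : a ≠ 0
  mem : p ∈ z.source
  zero : z p = 0
  exp : ∀ y ∈ z.source, y ≠ p → ∃ l ∈ L, y ∈ l.source ∧
    ∃ C : ℂ, ∀ᶠ y' in 𝓝 y, Complex.exp (a * l y') = C * z y'

variable {L : Set (OpenPartialHomeomorph X ℂ)}

lemma FlowAt.congr {e e' : ℂ → X} {s : ℂ} (h : FlowAt L e s) (he : ∀ᶠ s' in 𝓝 s, e' s' = e s') :
    FlowAt L e' s := by
  obtain ⟨l, hl, hs, h⟩ := h
  refine ⟨l, hl, by rwa [he.self_of_nhds], ?_⟩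
  filter_upwards [h, he] with s' h1 h2
  rwa [h2, he.self_of_nhds]

lemma FlowAt.mem_chartDom {e : ℂ → X} {s : ℂ} (h : FlowAt L e s) : e s ∈ chartDom L := by
  obtain ⟨l, hl, hs, -⟩ := h
  exact ⟨l, hl, hs⟩

lemma FlowAt.continuousAt {e : ℂ → X} {s : ℂ} (h : FlowAt L e s) : ContinuousAt e s := by
  obtain ⟨l, hl, hs, h⟩ := h
  have h1 : ContinuousAt (fun s' => l.symm (l (e s) + (s' - s))) s := by
    refine ContinuousAt.comp (g := l.symm) ?_ (by fun_prop)
    rw [sub_self, add_zero]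
    exact l.symm.continuousAt (l.map_source hs)
  refine h1.congr ?_
  filter_upwards [h] with s' h'
  rw [← h'.2, l.left_inv h'.1]

lemma FlowAt.chart (hL : IsTranslationAtlas L) {e : ℂ → X} {s : ℂ} (h : FlowAt L e s)
    {l : OpenPartialHomeomorph X ℂ} (hl : l ∈ L) (hs : e s ∈ l.source) :
    ∀ᶠ s' in 𝓝 s, e s' ∈ l.source ∧ l (e s') = l (e s) + (s' - s) := by
  have hc := h.continuousAt
  obtain ⟨l', hl', hs', h'⟩ := h
  filter_upwards [h', hc.eventually (hL l hl l' hl' _ hs hs'),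
    hc.eventually (l.open_source.mem_nhds hs)] with s' h1 h2 h3
  refine ⟨h3, ?_⟩
  rw [h1.2] at h2
  linear_combination h2

lemma FlowAt.shift {e : ℂ → X} {s t : ℂ} (h : FlowAt L e (s + t)) :
    FlowAt L (fun s' => e (s' + t)) s := by
  obtain ⟨l, hl, hs, h⟩ := h
  refine ⟨l, hl, hs, ?_⟩
  have hc : ContinuousAt (fun s' : ℂ => s' + t) s := by fun_prop
  filter_upwards [hc.eventually h] with s' h'
  exact ⟨h'.1, by rw [h'.2]; ring⟩

/-- Two flow curves that agree at a point agree. -/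
lemma FlowAt.eqOn [T2Space X] (hL : IsTranslationAtlas L) {e e' : ℂ → X} {U : Set ℂ}
    (hc : IsPreconnected U) (h : ∀ s ∈ U, FlowAt L e s)
    (h' : ∀ s ∈ U, FlowAt L e' s) {s₀ : ℂ} (hs₀ : s₀ ∈ U) (he : e s₀ = e' s₀) :
    ∀ s ∈ U, e s = e' s := by
  have hsub : U ⊆ {s | ∀ᶠ s' in 𝓝 s, e s' = e' s'} := by
    have key : ∀ s ∈ U, e s = e' s → ∀ᶠ s' in 𝓝 s, e s' = e' s' := by
      intro s hs heq
      obtain ⟨l, hl, hs', hl'⟩ := h s hs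
      filter_upwards [hl', (h' s hs).chart hL hl (heq ▸ hs')] with s' h1 h2
      exact l.injOn h1.1 h2.1 (by rw [h1.2, h2.2, heq])
    refine hc.subset_of_closure_inter_subset ?_ ⟨s₀, hs₀, key s₀ hs₀ he⟩ ?_
    · rw [isOpen_iff_mem_nhds]
      intro s hs
      exact eventually_eventually_nhds.2 hs
    · rintro s ⟨hs, hsU⟩
      refine key s hsU ?_
      rw [mem_closure_iff_frequently] at hs
      by_contra hne
      obtain ⟨s', h1, h2⟩ := (hs.and_eventually
        (((h s hsU).continuousAt.prodMk (h' s hsU).continuousAt).eventually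
          (isClosed_diagonal.isOpen_compl.mem_nhds hne))).exists
      exact h2 h1.self_of_nhds
  exact fun s hs => (hsub hs).self_of_nhds

lemma flowAt_regular {l : OpenPartialHomeomorph X ℂ} (hl : l ∈ L) {w s : ℂ}
    (hs : w + s ∈ l.target) : FlowAt L (fun s => l.symm (w + s)) s := by
  refine ⟨l, hl, l.map_target hs, ?_⟩
  have hc : ContinuousAt (fun s' : ℂ => w + s') s := by fun_prop
  filter_upwards [hc.eventually (l.open_target.mem_nhds hs)] with s' hs'
  exact ⟨l.map_target hs', by rw [l.right_inv hs', l.right_inv hs]; ring⟩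

-- The solutions of exp = 1 are isolated: 0 is the only one of norm below 1.
omit [TopologicalSpace X] in
lemma eventually_eq_zero_of_exp {Y : Type} [TopologicalSpace Y] {f : Y → ℂ} {s : Y} (hf : ContinuousAt f s) (h0 : f s = 0)
    (h : ∀ᶠ s' in 𝓝 s, Complex.exp (f s') = 1) : ∀ᶠ s' in 𝓝 s, f s' = 0 := by
  have h1 : ∀ᶠ s' in 𝓝 s, ‖f s'‖ < 1 := by
    have := hf.norm
    exact this.eventually_lt_const (by simp [h0])
  filter_upwards [h, h1] with s' h2 h3
  obtain ⟨n, hn⟩ := Complex.exp_eq_one_iff.1 h2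
  rw [hn] at h3 ⊢
  have hn0 : n = 0 := by
    by_contra hne
    have h4 : (1 : ℝ) ≤ |(n : ℝ)| := by exact_mod_cast Int.one_le_abs hne
    have h5 : ‖(n : ℂ) * (2 * π * Complex.I)‖ = |(n : ℝ)| * (2 * π) := by
      rw [norm_mul, norm_mul, norm_mul, Complex.norm_I, Complex.norm_intCast, Complex.norm_real,
        Real.norm_of_nonneg pi_pos.le]
      simp
    rw [h5] at h3
    nlinarith [pi_gt_three]
  simp [hn0]

/-- Near a pole exp(a l) is a multiple of `z`, so unit speed in `l` is the linear motion z ↦ exp(a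
s) z. The number `a` is the inverse of the residue of dl. -/
lemma IsPole.flowAt {p : X} {z : OpenPartialHomeomorph X ℂ} {a : ℝ} (h : IsPole L p z a) {w s : ℂ}
    (hw : w ≠ 0) (hs : Complex.exp (a * s) * w ∈ z.target) :
    FlowAt L (fun s => z.symm (Complex.exp (a * s) * w)) s := by
  have hne : z.symm (Complex.exp (a * s) * w) ≠ p := fun hp => by
    have := z.right_inv hs
    rw [hp, h.zero] at this
    exact mul_ne_zero (Complex.exp_ne_zero _) hw this.symm
  obtain ⟨l, hl, hsl, C, hC⟩ := h.exp _ (z.map_target hs) hne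
  refine ⟨l, hl, hsl, ?_⟩
  have hc : ContinuousAt (fun s' : ℂ => Complex.exp (a * s') * w) s := by fun_prop
  have hc' : ContinuousAt (fun s' : ℂ => z.symm (Complex.exp (a * s') * w)) s :=
    ContinuousAt.comp (g := z.symm) (z.symm.continuousAt hs) hc
  have hl' : ContinuousAt (fun s' : ℂ => l (z.symm (Complex.exp (a * s') * w))) s :=
    ContinuousAt.comp (g := l) (l.continuousAt hsl) hc'
  have ha : (a : ℂ) ≠ 0 := by exact_mod_cast h.ne_zero
  have key := eventually_eq_zero_of_exp
    (f := fun s' => a * (l (z.symm (Complex.exp (a * s') * w)) -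
      l (z.symm (Complex.exp (a * s) * w)) - (s' - s))) (s := s)
    (continuousAt_const.mul ((hl'.sub continuousAt_const).sub (by fun_prop))) (by simp) (by
      filter_upwards [hc'.eventually hC, hc.eventually (z.open_target.mem_nhds hs)] with s' h1 h2
      have h3 := hC.self_of_nhds
      rw [z.right_inv h2] at h1
      rw [z.right_inv hs] at h3
      have hC0 : C ≠ 0 := by
        rintro rfl
        exact Complex.exp_ne_zero _ (by rw [h3, zero_mul])
      have e1 : a * (l (z.symm (Complex.exp (a * s') * w)) -
          l (z.symm (Complex.exp (a * s) * w)) - (s' - s)) =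
          a * l (z.symm (Complex.exp (a * s') * w)) -
          a * l (z.symm (Complex.exp (a * s) * w)) - (a * s' - a * s) := by ring
      rw [e1, Complex.exp_sub, Complex.exp_sub, Complex.exp_sub, h1, h3]
      have := Complex.exp_ne_zero (a * s)
      have := Complex.exp_ne_zero (a * s')
      field_simp)
  filter_upwards [key, hc'.eventually (l.open_source.mem_nhds hsl)] with s' h1 h2
  exact ⟨h2, by linear_combination (mul_eq_zero.1 h1).resolve_left ha⟩

lemma exists_ball_target {z : OpenPartialHomeomorph X ℂ} {p : X} (hp : p ∈ z.source) :
    ∃ r > 0, Metric.ball (z p) r ⊆ z.target :=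
  Metric.mem_nhds_iff.1 (z.open_target.mem_nhds (z.map_source hp))

/-- Flow curves exist for a uniform time. -/
lemma exists_local_flow [CompactSpace X]
    (hs : ∀ x, x ∉ chartDom L → ∃ z a, IsPole L x z a) :
    ∃ δ > 0, ∀ y ∈ chartDom L, ∃ e : ℂ → X, e 0 = y ∧ ∀ s ∈ Metric.ball (0 : ℂ) δ, FlowAt L e s := by
  have hloc : ∀ x : X, ∃ N ∈ 𝓝 x, ∃ δ > 0, ∀ y ∈ N, y ∈ chartDom L →
      ∃ e : ℂ → X, e 0 = y ∧ ∀ s ∈ Metric.ball (0 : ℂ) δ, FlowAt L e s := by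
    intro x
    by_cases hx : x ∈ chartDom L
    · obtain ⟨l, hl, hxl⟩ := hx
      obtain ⟨r, hr, hball⟩ := exists_ball_target hxl
      refine ⟨l.source ∩ l ⁻¹' Metric.ball (l x) (r / 2), Filter.inter_mem
        (l.open_source.mem_nhds hxl) ((l.continuousAt hxl).preimage_mem_nhds
          (Metric.ball_mem_nhds _ (half_pos hr))), r / 2, half_pos hr, fun y hy _ =>
        ⟨fun s => l.symm (l y + s), by simp [l.left_inv hy.1], fun s hs =>
          flowAt_regular hl (hball ?_)⟩⟩
      have h1 := mem_ball_iff_norm.1 hy.2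
      have h2 := mem_ball_zero_iff.1 hs
      rw [mem_ball_iff_norm]
      calc ‖l y + s - l x‖ = ‖(l y - l x) + s‖ := by ring_nf
        _ ≤ ‖l y - l x‖ + ‖s‖ := norm_add_le _ _
        _ < r := by linarith
    · obtain ⟨z, a, hz⟩ := hs x hx
      obtain ⟨r, hr, hball⟩ := exists_ball_target hz.mem
      rw [hz.zero] at hball
      -- For |s| < 1 the factor exp(a s) has modulus at most exp |a|, so a curve that starts within
      -- radius r exp(−|a|) stays in the chart.
      refine ⟨z.source ∩ z ⁻¹' Metric.ball (z x) (r * Real.exp (-|a|)), Filter.inter_mem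
        (z.open_source.mem_nhds hz.mem) ((z.continuousAt hz.mem).preimage_mem_nhds
          (Metric.ball_mem_nhds _ (by positivity))), 1, one_pos, fun y hy hyd =>
        ⟨fun s => z.symm (Complex.exp (a * s) * z y), by simp [z.left_inv hy.1], fun s hs =>
          hz.flowAt (fun h0 => ?_) (hball ?_)⟩⟩
      · have : y = x := z.injOn hy.1 hz.mem (by rw [h0, hz.zero])
        exact hx (this ▸ hyd)
      · have h1 := mem_ball_iff_norm.1 hy.2
        rw [hz.zero, sub_zero] at h1
        have h2 := mem_ball_zero_iff.1 hs
        rw [mem_ball_zero_iff, norm_mul, Complex.norm_exp]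
        have h3 : (a * s : ℂ).re ≤ |a| := by
          refine (Complex.re_le_norm _).trans ?_
          rw [norm_mul, Complex.norm_real, Real.norm_eq_abs]
          exact mul_le_of_le_one_right (abs_nonneg a) h2.le
        calc Real.exp (a * s : ℂ).re * ‖z y‖ ≤ Real.exp |a| * ‖z y‖ := by gcongr
          _ < Real.exp |a| * (r * Real.exp (-|a|)) := by gcongr
          _ = r := by rw [mul_left_comm, ← Real.exp_add, add_neg_cancel, Real.exp_zero, mul_one]
  choose N hN δ hδ h using hloc
  obtain ⟨t, ht⟩ := CompactSpace.elim_nhds_subcover N hN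
  rcases isEmpty_or_nonempty X with hX | hX
  · exact ⟨1, one_pos, fun y => isEmptyElim y⟩
  have hne : t.Nonempty := by
    by_contra hne
    rw [Finset.not_nonempty_iff_eq_empty] at hne
    subst hne
    have : hX.some ∈ (⊤ : Set X) := trivial
    rw [← ht] at this
    simp at this
  refine ⟨t.inf' hne δ, (Finset.lt_inf'_iff hne).2 fun x _ => hδ x, fun y hy => ?_⟩
  have : y ∈ (⊤ : Set X) := trivial
  rw [← ht] at this
  obtain ⟨x, hx, hyx⟩ := Set.mem_iUnion₂.1 this
  obtain ⟨e, he, hf⟩ := h x y hyx hy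
  exact ⟨e, he, fun s hs => hf s (Metric.ball_subset_ball (Finset.inf'_le δ hx) hs)⟩

/-- Doubling the time of existence. -/
lemma flow_double [T2Space X] (hL : IsTranslationAtlas L) {δ : ℝ} (hδ : 0 < δ)
    (h : ∀ y ∈ chartDom L, ∃ e : ℂ → X, e 0 = y ∧ ∀ s ∈ Metric.ball (0 : ℂ) δ, FlowAt L e s) :
    ∀ y ∈ chartDom L, ∃ e : ℂ → X, e 0 = y ∧
      ∀ s ∈ Metric.ball (0 : ℂ) (2 * δ), FlowAt L e s := by
  have h' : ∀ y : X, ∃ e : ℂ → X, y ∈ chartDom L → e 0 = y ∧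
      ∀ s ∈ Metric.ball (0 : ℂ) δ, FlowAt L e s := fun y => by
    by_cases hy : y ∈ chartDom L
    · obtain ⟨e, he⟩ := h y hy
      exact ⟨e, fun _ => he⟩
    · exact ⟨fun _ => y, fun h => absurd h hy⟩
  choose E hE using h'
  have h0 : (0 : ℂ) ∈ Metric.ball (0 : ℂ) δ := Metric.mem_ball_self hδ
  -- two flow curves on the ball, shifted
  have hshift : ∀ y ∈ chartDom L, ∀ t ∈ Metric.ball (0 : ℂ) δ, ∀ s ∈ Metric.ball (0 : ℂ) δ,
      s + t ∈ Metric.ball (0 : ℂ) δ → E (E y t) s = E y (s + t) := by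
    intro y hy t ht s hs hst
    have hyt := ((hE y hy).2 t ht).mem_chartDom
    set U := Metric.ball (0 : ℂ) δ ∩ (fun s => s + t) ⁻¹' Metric.ball (0 : ℂ) δ
    have hc : IsPreconnected U := by
      refine ((convex_ball _ _).inter ?_).isPreconnected
      exact (convex_ball _ _).translate_preimage_left t
    refine FlowAt.eqOn hL hc (e' := fun s => E y (s + t))
      (fun s hs => (hE _ hyt).2 s hs.1) (fun s hs => ((hE y hy).2 _ hs.2).shift)
      (s₀ := 0) ⟨h0, by simpa using ht⟩ ?_ s ⟨hs, hst⟩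
    rw [(hE _ hyt).1, zero_add]
  intro y hy
  -- The curve of double length follows the flow for time s/2 twice; near a given `s` the
  -- composition law `hshift` identifies it with a shifted flow curve.
  refine ⟨fun s => E (E y (s / 2)) (s / 2), ?_, fun s hs => ?_⟩
  · simp only [zero_div]
    rw [(hE y hy).1, (hE y hy).1]
  · have hs2 : s / 2 ∈ Metric.ball (0 : ℂ) δ := by
      rw [mem_ball_zero_iff] at hs ⊢
      rw [norm_div, Complex.norm_ofNat]; linarith
    have hy0 := ((hE y hy).2 _ hs2).mem_chartDom
    have h1 : FlowAt L (fun s' => E (E y (s / 2)) (s' + -(s / 2))) s := by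
      refine FlowAt.shift ?_
      rw [← sub_eq_add_neg, sub_half]
      exact (hE _ hy0).2 _ hs2
    refine h1.congr ?_
    have c1 : ContinuousAt (fun s' : ℂ => s' / 2) s := by fun_prop
    have c2 : ContinuousAt (fun s' : ℂ => s' / 2 - s / 2) s := by fun_prop
    have c3 : ContinuousAt (fun s' : ℂ => s' - s / 2) s := by fun_prop
    have c4 : s - s / 2 = s / 2 := sub_half s
    filter_upwards [c1.eventually (Metric.isOpen_ball.mem_nhds hs2),
      c2.eventually (Metric.isOpen_ball.mem_nhds
        (show s / 2 - s / 2 ∈ Metric.ball (0 : ℂ) δ by simpa using hδ)),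
      c3.eventually (Metric.isOpen_ball.mem_nhds (c4 ▸ hs2))] with s' h2 h3 h4
    have e1 : E y (s' / 2) = E (E y (s / 2)) (s' / 2 - s / 2) := by
      rw [hshift y hy _ hs2 _ h3 (by simpa using h2), sub_add_cancel]
    have e2 : s' / 2 + (s' / 2 - s / 2) = s' + -(s / 2) := by ring
    rw [e1, hshift _ hy0 _ h3 _ h2 (by rw [e2, ← sub_eq_add_neg]; exact h4), e2]

/-- Complete flow curves. -/
theorem exists_flow [CompactSpace X] [T2Space X] (hL : IsTranslationAtlas L)
    (hs : ∀ x, x ∉ chartDom L → ∃ z a, IsPole L x z a) {y : X} (hy : y ∈ chartDom L) :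
    ∃ e : ℂ → X, e 0 = y ∧ ∀ s, FlowAt L e s := by
  obtain ⟨δ, hδ, h⟩ := exists_local_flow hs
  have hn : ∀ n : ℕ, ∀ y ∈ chartDom L, ∃ e : ℂ → X, e 0 = y ∧
      ∀ s ∈ Metric.ball (0 : ℂ) (2 ^ n * δ), FlowAt L e s := by
    intro n
    induction n with
    | zero => simpa using h
    | succ n ih =>
      have := flow_double hL (by positivity) ih
      rwa [← mul_assoc, ← pow_succ'] at this
  have hn' := fun n => hn n y hy
  choose E hE0 hE using hn'
  have hmono : ∀ m n, m ≤ n → ∀ s ∈ Metric.ball (0 : ℂ) (2 ^ m * δ), E m s = E n s := by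
    intro m n hmn
    have hsub : Metric.ball (0 : ℂ) (2 ^ m * δ) ⊆ Metric.ball (0 : ℂ) (2 ^ n * δ) :=
      Metric.ball_subset_ball (by gcongr; norm_num)
    exact FlowAt.eqOn hL (convex_ball _ _).isPreconnected (hE m)
      (fun s hs => hE n s (hsub hs)) (Metric.mem_ball_self (by positivity)) (by rw [hE0, hE0])
  have hex : ∀ s : ℂ, ∃ n : ℕ, s ∈ Metric.ball (0 : ℂ) (2 ^ n * δ) := fun s => by
    obtain ⟨n, hn⟩ := pow_unbounded_of_one_lt (‖s‖ / δ) one_lt_two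
    exact ⟨n, by rw [mem_ball_zero_iff]; rwa [div_lt_iff₀ hδ] at hn⟩
  choose N hN using hex
  have heq : ∀ n, ∀ s ∈ Metric.ball (0 : ℂ) (2 ^ n * δ), E (N s) s = E n s := by
    intro n s hs
    rcases le_total (N s) n with h1 | h1
    · exact hmono _ _ h1 s (hN s)
    · exact (hmono _ _ h1 s hs).symm
  refine ⟨fun s => E (N s) s, hE0 _, fun s => ?_⟩
  refine (hE (N s) s (hN s)).congr ?_
  filter_upwards [Metric.isOpen_ball.mem_nhds (hN s)] with s' hs'
  exact heq _ _ hs'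

end Flow

/-! ### Orbits, periods and residues of the flow -/

section FlowGlobal

variable {X : Type} [TopologicalSpace X] [T2Space X] {L : Set (OpenPartialHomeomorph X ℂ)}

lemma flow_shift_eq (hL : IsTranslationAtlas L) {e e' : ℂ → X} (he : ∀ s, FlowAt L e s)
    (he' : ∀ s, FlowAt L e' s) {s s' : ℂ} (h : e s = e' s') (t : ℂ) : e (s + t) = e' (s' + t) := by
  have := FlowAt.eqOn hL (U := Set.univ) isPreconnected_univ (e := fun t => e (t + s))
    (e' := fun t => e' (t + s')) (fun t _ => (he _).shift) (fun t _ => (he' _).shift)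
    (Set.mem_univ 0) (by simpa using h) t trivial
  simpa [add_comm] using this

/-- An orbit contains a neighbourhood of each of its points, and orbits that meet coincide up to a
shift; connectedness leaves only one. -/
lemma flow_range [CompactSpace X] (hL : IsTranslationAtlas L)
    (hs : ∀ x, x ∉ chartDom L → ∃ z a, IsPole L x z a) (hc : IsPreconnected (chartDom L))
    {e : ℂ → X} (he : ∀ s, FlowAt L e s) : Set.range e = chartDom L := by
  refine subset_antisymm (Set.range_subset_iff.2 fun s => (he s).mem_chartDom) ?_
  have key : ∀ (f : ℂ → X), (∀ s, FlowAt L f s) → Set.range f ∈ 𝓝 (f 0) := by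
    intro f hf
    obtain ⟨l, hl, hl0, h⟩ := hf 0
    have hc : ContinuousAt (fun x => l x - l (f 0)) (f 0) :=
      (l.continuousAt hl0).sub continuousAt_const
    have hc' := hc.tendsto
    rw [sub_self] at hc'
    filter_upwards [hc'.eventually h, l.open_source.mem_nhds hl0] with x hx hx'
    refine ⟨_, l.injOn hx.1 hx' ?_⟩
    rw [hx.2]
    ring
  refine hc.subset_of_closure_inter_subset ?_ ⟨e 0, (he 0).mem_chartDom, 0, rfl⟩ ?_
  · rw [isOpen_iff_mem_nhds]
    rintro _ ⟨s, rfl⟩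
    have := key (fun t => e (t + s)) fun t => (he _).shift
    rw [zero_add] at this
    exact Filter.mem_of_superset this (by rintro _ ⟨t, rfl⟩; exact ⟨_, rfl⟩)
  · rintro y ⟨hy, hyd⟩
    obtain ⟨f, hf0, hf⟩ := exists_flow hL hs hyd
    have := key f hf
    rw [hf0] at this
    obtain ⟨x, ⟨t, ht⟩, ⟨s, hs⟩⟩ := mem_closure_iff_nhds.1 hy _ this
    refine ⟨s + -t, ?_⟩
    rw [flow_shift_eq hL he hf (s' := t) (by rw [hs, ht]), add_neg_cancel, hf0]

/-- The flow near a pole. -/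
lemma IsPole.flow_eq (hL : IsTranslationAtlas L) {e : ℂ → X} (he : ∀ s, FlowAt L e s)
    (hr : Set.range e = chartDom L) {p : X} {z : OpenPartialHomeomorph X ℂ} {a : ℝ}
    (hp : IsPole L p z a) : ∃ C : ℂ, C ≠ 0 ∧ ∃ r > 0, Metric.ball 0 r ⊆ z.target ∧
      ∀ s, ‖C * Complex.exp (a * s)‖ < r → e s = z.symm (C * Complex.exp (a * s)) := by
  obtain ⟨r, hr0, hball⟩ := exists_ball_target hp.mem
  rw [hp.zero] at hball
  have hw0 : ((r / 2 : ℝ) : ℂ) ≠ 0 := by exact_mod_cast (half_pos hr0).ne'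
  have hw : ‖((r / 2 : ℝ) : ℂ)‖ < r := by
    rw [Complex.norm_real, Real.norm_of_nonneg (half_pos hr0).le]; linarith
  set w := ((r / 2 : ℝ) : ℂ)
  have hwt : w ∈ z.target := hball (by simpa using hw)
  have hf : ∀ s, ‖Complex.exp (a * s) * w‖ < r →
      FlowAt L (fun s => z.symm (Complex.exp (a * s) * w)) s := fun s hs =>
    hp.flowAt hw0 (hball (by simpa using hs))
  have h0 := (hf 0 (by simpa using hw)).mem_chartDom
  rw [← hr] at h0
  obtain ⟨s₁, hs₁⟩ := h0
  set U : Set ℂ := {s | ‖Complex.exp (a * s) * w‖ < r}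
  -- The times at which the linear motion stays in the disc form a half plane; being connected, it
  -- allows uniqueness of flow curves to be applied on all of it.
  have hUc : Convex ℝ U := by
    have : U = {s : ℂ | (a * s.re : ℝ) < Real.log (r / ‖w‖)} := by
      ext s
      have hwn := norm_pos_iff.2 hw0
      simp only [U, Set.mem_ofPred_eq, norm_mul, Complex.norm_exp]
      rw [Real.lt_log_iff_exp_lt (by positivity), lt_div_iff₀ hwn]
      simp
    rw [this]
    exact convex_halfSpace_lt (IsLinearMap.mk (fun x y => by simp [mul_add])
      (fun c x => by simp [mul_left_comm])) _
  have heq := FlowAt.eqOn hL (U := U) hUc.isPreconnected (e := fun s => e (s + s₁))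
    (fun s _ => (he _).shift) (fun s hs => hf s hs) (s₀ := 0) (by simpa [U] using hw)
    (by simpa using hs₁)
  have e1 : ∀ s, w * Complex.exp (-(a * s₁)) * Complex.exp (a * s) =
      Complex.exp (a * (s - s₁)) * w := fun s => by
    rw [mul_assoc, ← Complex.exp_add, mul_comm]
    ring_nf
  refine ⟨w * Complex.exp (-(a * s₁)), mul_ne_zero hw0 (Complex.exp_ne_zero _), r, hr0, hball,
    fun s hs => ?_⟩
  rw [e1] at hs ⊢
  have := heq (s - s₁) hs
  simpa using this

lemma exists_norm_exp_lt {a : ℝ} (ha : a ≠ 0) (C : ℂ) {r : ℝ} (hr : 0 < r) :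
    ∃ x : ℝ, ‖C * Complex.exp (a * x)‖ < r := by
  refine ⟨(Real.log (r / (‖C‖ + 1))) / a, ?_⟩
  have h1 : (a : ℂ) * ((Real.log (r / (‖C‖ + 1)) / a : ℝ) : ℂ) = (Real.log (r / (‖C‖ + 1)) : ℝ) := by
    rw [← Complex.ofReal_mul, mul_div_cancel₀ _ ha]
  have hC := norm_nonneg C
  rw [h1, norm_mul, ← Complex.ofReal_exp, Real.exp_log (by positivity), Complex.norm_real,
    Real.norm_of_nonneg (by positivity), ← mul_div_assoc, div_lt_iff₀ (by positivity)]
  nlinarith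

/-- The flow is periodic under the period of a pole. -/
lemma IsPole.flow_eq_iff (hL : IsTranslationAtlas L) {e : ℂ → X} (he : ∀ s, FlowAt L e s)
    (hr : Set.range e = chartDom L) {p : X} {z : OpenPartialHomeomorph X ℂ} {a : ℝ}
    (hp : IsPole L p z a) (s s' : ℂ) :
    e s = e s' ↔ Complex.exp (a * s) = Complex.exp (a * s') := by
  obtain ⟨C, hC, r, hr0, hball, h⟩ := hp.flow_eq hL he hr
  obtain ⟨x, hx⟩ := exists_norm_exp_lt hp.ne_zero (C * Complex.exp (a * s)) hr0
  obtain ⟨x', hx'⟩ := exists_norm_exp_lt hp.ne_zero (C * Complex.exp (a * s')) hr0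
  have key : ∀ t : ℂ, ‖C * Complex.exp (a * (s + t))‖ < r → ‖C * Complex.exp (a * (s' + t))‖ < r →
      (e (s + t) = e (s' + t) ↔ Complex.exp (a * s) = Complex.exp (a * s')) := by
    intro t h1 h2
    rw [h _ h1, h _ h2, z.symm.injOn.eq_iff (hball (by simpa using h1)) (hball (by simpa using h2)),
      mul_right_inj' hC, mul_add, mul_add, Complex.exp_add, Complex.exp_add,
      mul_left_inj' (Complex.exp_ne_zero _)]
  have hmono : ∀ (u : ℂ) (y y' : ℝ), a * y' ≤ a * y → ‖C * Complex.exp (a * u) * Complex.exp (a * y)‖ < r →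
      ‖C * Complex.exp (a * (u + y'))‖ < r := by
    intro u y y' hy h1
    rw [mul_add, Complex.exp_add, ← mul_assoc]
    refine lt_of_le_of_lt ?_ h1
    rw [norm_mul, norm_mul _ (Complex.exp (a * y)), Complex.norm_exp (a * y'),
      Complex.norm_exp (a * y)]
    refine mul_le_mul_of_nonneg_left (Real.exp_le_exp.2 ?_) (norm_nonneg _)
    rw [← Complex.ofReal_mul, ← Complex.ofReal_mul, Complex.ofReal_re, Complex.ofReal_re]
    exact hy
  -- Flowing far enough towards the pole brings both points into its chart, which is injective;
  -- flowing back by the same time recovers them.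
  obtain ⟨t, h1, h2⟩ : ∃ t : ℝ, a * t ≤ a * x ∧ a * t ≤ a * x' := by
    rcases le_total (a * x) (a * x') with h | h
    · exact ⟨x, le_rfl, h⟩
    · exact ⟨x', h, le_rfl⟩
  rw [← key t (hmono _ _ _ h1 hx) (hmono _ _ _ h2 hx')]
  refine ⟨fun h' => flow_shift_eq hL he he h' t, fun h' => ?_⟩
  simpa using flow_shift_eq hL he he h' (-t)

lemma exists_int_of_period {a b : ℝ} (ha : a ≠ 0)
    (h : ∀ s s' : ℂ, Complex.exp (a * s) = Complex.exp (a * s') →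
      Complex.exp (b * s) = Complex.exp (b * s')) : ∃ n : ℤ, b = n * a := by
  have ha' : (a : ℂ) ≠ 0 := by exact_mod_cast ha
  have h1 := h (2 * π * Complex.I / a) 0 (by
    rw [mul_div_cancel₀ _ ha', Complex.exp_two_pi_mul_I, mul_zero, Complex.exp_zero])
  rw [mul_zero, Complex.exp_zero, Complex.exp_eq_one_iff] at h1
  obtain ⟨n, hn⟩ := h1
  refine ⟨n, ?_⟩
  have h2 : (b : ℂ) * (2 * π * Complex.I) = n * a * (2 * π * Complex.I) := by
    rw [← mul_div_assoc, div_eq_iff ha'] at hn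
    linear_combination hn
  exact_mod_cast mul_right_cancel₀ Complex.two_pi_I_ne_zero h2

/-- Two different poles have opposite residues. -/
lemma IsPole.eq_neg (hL : IsTranslationAtlas L) {e : ℂ → X} (he : ∀ s, FlowAt L e s)
    (hr : Set.range e = chartDom L) {p q : X} {z z' : OpenPartialHomeomorph X ℂ} {a b : ℝ}
    (hp : IsPole L p z a) (hq : IsPole L q z' b) (hpq : p ≠ q) : b = -a := by
  obtain ⟨n, hn⟩ := exists_int_of_period hp.ne_zero fun s s' h =>
    (hq.flow_eq_iff hL he hr s s').1 ((hp.flow_eq_iff hL he hr s s').2 h)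
  obtain ⟨m, hm⟩ := exists_int_of_period hq.ne_zero fun s s' h =>
    (hp.flow_eq_iff hL he hr s s').1 ((hq.flow_eq_iff hL he hr s s').2 h)
  have hnm : n * m = 1 := by
    have : ((n * m : ℤ) : ℝ) * b = 1 * b := by
      push_cast
      rw [one_mul, mul_assoc, ← hm, ← hn]
    exact_mod_cast mul_right_cancel₀ hq.ne_zero this
  rcases Int.eq_one_or_neg_one_of_mul_eq_one hnm with h1 | h1
  -- With equal residues, `e` would converge to both poles along the same real times, against the
  -- Hausdorff property.
  · exfalso
    rw [h1, Int.cast_one, one_mul] at hn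
    subst hn
    obtain ⟨C, hC, r, hr0, hball, h⟩ := hp.flow_eq hL he hr
    obtain ⟨C', hC', r', hr0', hball', h'⟩ := hq.flow_eq hL he hr
    obtain ⟨N, N', hN, hN', hpN, hqN', hd⟩ := t2_separation hpq
    have aux : ∀ {p : X} {z : OpenPartialHomeomorph X ℂ} {C : ℂ} {r : ℝ}, IsPole L p z b → 0 < r →
        (∀ s, ‖C * Complex.exp (b * s)‖ < r → e s = z.symm (C * Complex.exp (b * s))) →
        ∀ N : Set X, IsOpen N → p ∈ N → ∃ ε > 0, ∀ s : ℂ, ‖C * Complex.exp (b * s)‖ < ε → e s ∈ N := by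
      intro p z C r hp hr0 h N hN hpN
      have hz0 : z.symm 0 = p := by rw [← hp.zero, z.left_inv hp.mem]
      have hct : ContinuousAt z.symm 0 := by
        rw [← hp.zero]; exact z.symm.continuousAt (z.map_source hp.mem)
      have := hct.preimage_mem_nhds (hN.mem_nhds (by rwa [hz0]))
      obtain ⟨ε, hε, hb⟩ := Metric.mem_nhds_iff.1 this
      refine ⟨min ε r, lt_min hε hr0, fun s hs => ?_⟩
      rw [h s (hs.trans_le (min_le_right _ _))]
      exact hb (by simpa using hs.trans_le (min_le_left _ _))
    obtain ⟨ε, hε, h2⟩ := aux hp hr0 h N hN hpN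
    obtain ⟨ε', hε', h2'⟩ := aux hq hr0' h' N' hN' hqN'
    obtain ⟨x, hx⟩ := exists_norm_exp_lt hp.ne_zero ((‖C‖ + ‖C'‖ : ℝ) : ℂ) (lt_min hε hε')
    rw [norm_mul, Complex.norm_real, Real.norm_of_nonneg (by positivity)] at hx
    refine Set.disjoint_left.1 hd (h2 x ?_) (h2' x ?_)
    · refine lt_of_le_of_lt ?_ (hx.trans_le (min_le_left _ _))
      rw [norm_mul]
      gcongr
      linarith [norm_nonneg C']
    · refine lt_of_le_of_lt ?_ (hx.trans_le (min_le_right _ _))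
      rw [norm_mul]
      gcongr
      linarith [norm_nonneg C]
  · rw [hn, h1]; simp

/-- A compact surface with a translation structure with two poles is a sphere. -/
theorem exists_sphere_homeo [CompactSpace X] (hL : IsTranslationAtlas L)
    (hs : ∀ x, x ∉ chartDom L → ∃ z a, IsPole L x z a)
    {e : ℂ → X} (he : ∀ s, FlowAt L e s) (hr : Set.range e = chartDom L)
    {p q : X} {z z' : OpenPartialHomeomorph X ℂ} {a : ℝ}
    (hp : IsPole L p z a) (hq : IsPole L q z' (-a)) (hpq : p ≠ q) (hpd : p ∉ chartDom L)
    (hqd : q ∉ chartDom L) :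
    ∃ F : RS ≃ₜ X, F ((0 : ℂ) : RS) = p ∧ F OnePoint.infty = q ∧
      (∀ s : ℂ, F (Complex.exp (a * s) : ℂ) = e s) ∧
      (∃ C : ℂ, C ≠ 0 ∧ ∀ᶠ v : ℂ in 𝓝 0, C * v ∈ z.target ∧ F v = z.symm (C * v)) ∧
      (∃ C : ℂ, C ≠ 0 ∧ ∀ᶠ v : ℂ in 𝓝 0, C * v ∈ z'.target ∧
        F (invFun v) = z'.symm (C * v)) := by
  have ha : (a : ℂ) ≠ 0 := by exact_mod_cast hp.ne_zero
  obtain ⟨C, hC, r, hr0, hball, h⟩ := hp.flow_eq hL he hr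
  obtain ⟨C', hC', r', hr0', hball', h'⟩ := hq.flow_eq hL he hr
  -- The choice of the logarithm does not matter, because 2πi/a is a period of the flow.
  set F₀ : ℂ → X := fun v => if v = 0 then p else e (Complex.log v / a) with hF₀
  set F : RS → X := fun x => x.elim q F₀ with hF
  have F0 : F ((0 : ℂ) : RS) = p := by simp [hF, hF₀]
  have Fi : F OnePoint.infty = q := rfl
  have Fe : ∀ s : ℂ, F (Complex.exp (a * s) : ℂ) = e s := fun s => by
    simp only [hF, hF₀, OnePoint.elim_some, if_neg (Complex.exp_ne_zero _)]
    rw [hp.flow_eq_iff hL he hr, mul_div_cancel₀ _ ha, Complex.exp_log (Complex.exp_ne_zero _)]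
  have hsurj : ∀ v : ℂ, v ≠ 0 → ∃ s : ℂ, Complex.exp (a * s) = v := fun v hv =>
    ⟨Complex.log v / a, by rw [mul_div_cancel₀ _ ha, Complex.exp_log hv]⟩
  have near : ∀ v : ℂ, ‖C * v‖ < r → F v = z.symm (C * v) := by
    intro v hv
    by_cases hv0 : v = 0
    · rw [hv0, F0, mul_zero, ← hp.zero, z.left_inv hp.mem]
    · obtain ⟨s, rfl⟩ := hsurj v hv0
      rw [Fe, h s hv]
  have near' : ∀ v : ℂ, ‖C' * v‖ < r' → F (invFun v) = z'.symm (C' * v) := by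
    intro v hv
    by_cases hv0 : v = 0
    · rw [hv0, invFun_zero, Fi, mul_zero, ← hq.zero, z'.left_inv hq.mem]
    · obtain ⟨s, hs⟩ := hsurj v⁻¹ (inv_ne_zero hv0)
      have hs' : v = Complex.exp ((-a : ℝ) * s) := by
        rw [Complex.ofReal_neg, neg_mul, Complex.exp_neg, hs, inv_inv]
      rw [invFun_coe hv0, ← hs, Fe, h' s (by rwa [← hs']), ← hs']
  have ev : ∀ (C : ℂ) {r : ℝ}, 0 < r → ∀ᶠ v : ℂ in 𝓝 0, ‖C * v‖ < r := fun C r hr => by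
    have : ContinuousAt (fun v : ℂ => ‖C * v‖) 0 := by fun_prop
    exact this.eventually_lt_const (by simpa using hr)
  have hcs : ∀ {p : X} {z : OpenPartialHomeomorph X ℂ} {a : ℝ} (C : ℂ), IsPole L p z a →
      ContinuousAt (fun v => z.symm (C * v)) 0 := by
    intro p z a C hp
    refine ContinuousAt.comp (g := z.symm) ?_ (by fun_prop)
    rw [mul_zero, ← hp.zero]
    exact z.symm.continuousAt (z.map_source hp.mem)
  have hcont : Continuous F := by
    rw [continuous_iff_continuousAt]
    intro x
    induction x using OnePoint.rec with
    | infty =>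
      have h1 : ContinuousAt (fun v : ℂ => F (invFun v)) 0 :=
        (hcs C' hq).congr ((ev C' hr0').mono fun v hv => (near' v hv).symm)
      have h2 : ContinuousAt (fun x : RS => F (invFun x)) ((0 : ℂ) : RS) := by
        rw [OnePoint.continuousAt_coe]; exact h1
      have h3 : ContinuousAt (fun x : RS => F (invFun (invFun x))) OnePoint.infty := by
        refine ContinuousAt.comp (g := fun x => F (invFun x)) (f := invFun) ?_
          invHomeo.continuous.continuousAt
        rw [invFun_infty]; exact h2
      simpa only [invFun_invFun] using h3
    | coe v =>
      rw [OnePoint.continuousAt_coe]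
      by_cases hv : v = 0
      · subst hv
        exact (hcs C hp).congr ((ev C hr0).mono fun v hv => (near v hv).symm)
      · have h1 : ContinuousAt (fun u : ℂ => e ((Complex.log (u / v) + Complex.log v) / a)) v := by
          refine ContinuousAt.comp (g := e) (he _).continuousAt ?_
          have : ContinuousAt (fun u : ℂ => Complex.log (u / v)) v :=
            ContinuousAt.clog (by fun_prop) (by simp [hv])
          fun_prop
        refine h1.congr ?_
        filter_upwards [isOpen_ne.mem_nhds hv] with u hu
        rw [← Fe, mul_div_cancel₀ _ ha, Complex.exp_add, Complex.exp_log (div_ne_zero hu hv),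
          Complex.exp_log hv, div_mul_cancel₀ _ hv]
        rfl
  have hin : ∀ v : ℂ, v ≠ 0 → F v ∈ chartDom L := fun v hv => by
    obtain ⟨s, rfl⟩ := hsurj v hv
    rw [Fe, ← hr]; exact ⟨s, rfl⟩
  have hinj : Function.Injective F := by
    intro x y hxy
    induction x using OnePoint.rec with
    | infty =>
      induction y using OnePoint.rec with
      | infty => rfl
      | coe v =>
        exfalso
        by_cases hv : v = 0
        · rw [hv, F0, Fi] at hxy; exact hpq hxy.symm
        · exact hqd (by rw [← Fi, hxy]; exact hin v hv)
    | coe u =>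
      induction y using OnePoint.rec with
      | infty =>
        exfalso
        by_cases hu : u = 0
        · rw [hu, F0, Fi] at hxy; exact hpq hxy
        · exact hqd (by rw [← Fi, ← hxy]; exact hin u hu)
      | coe v =>
        by_cases hu : u = 0
        · by_cases hv : v = 0
          · rw [hu, hv]
          · exact absurd (hin v hv) (by rw [← hxy, hu, F0]; exact hpd)
        · by_cases hv : v = 0
          · exact absurd (hin u hu) (by rw [hxy, hv, F0]; exact hpd)
          · obtain ⟨s, rfl⟩ := hsurj u hu
            obtain ⟨t, rfl⟩ := hsurj v hv
            rw [Fe, Fe, hp.flow_eq_iff hL he hr] at hxy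
            rw [hxy]
  have hsur : Function.Surjective F := by
    intro x
    by_cases hx : x ∈ chartDom L
    · rw [← hr] at hx
      obtain ⟨s, rfl⟩ := hx
      exact ⟨_, Fe s⟩
    · obtain ⟨z₁, a₁, h₁⟩ := hs x hx
      by_cases hxp : x = p
      · exact ⟨_, F0.trans hxp.symm⟩
      by_cases hxq : x = q
      · exact ⟨_, Fi.trans hxq.symm⟩
      -- The constant of a third pole would be the opposite of both `a` and `-a`.
      have e1 := hp.eq_neg hL he hr h₁ (Ne.symm hxp)
      have e2 := hq.eq_neg hL he hr h₁ (Ne.symm hxq)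
      exact absurd (by linarith) hp.ne_zero
  refine ⟨(isHomeomorph_iff_continuous_bijective.2 ⟨hcont, hinj, hsur⟩).homeomorph, F0, Fi, Fe,
    ⟨C, hC, ?_⟩, ⟨C', hC', ?_⟩⟩
  · filter_upwards [ev C hr0] with v hv
    exact ⟨hball (by simpa using hv), near v hv⟩
  · filter_upwards [ev C' hr0'] with v hv
    exact ⟨hball' (by simpa using hv), near' v hv⟩

end FlowGlobal

/-! ### Locally defined cocycles on the plane are coboundaries -/

/-- The covering space of `ℂ` defined by a cocycle. -/
def CocycleSpace {G : Type} [Group G] (_ : ℂ → ℂ → G) : Type := ℂ × G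

section Cocycle

variable {G : Type} [Group G] {h : ℂ → ℂ → G}

instance : TopologicalSpace (CocycleSpace h) where
  IsOpen W := ∀ x : ℂ × G, x ∈ (W : Set (ℂ × G)) →
    ∀ᶠ y in 𝓝 x.1, ((y, x.2 * h x.1 y) : ℂ × G) ∈ (W : Set (ℂ × G))
  isOpen_univ := fun _ _ => .of_forall fun _ => trivial
  isOpen_inter := fun U V hU hV x hx => (hU x hx.1).and (hV x hx.2)
  isOpen_sUnion := by
    rintro s hs x ⟨U, hU, hx⟩
    exact (hs U hU x hx).mono fun y hy => ⟨U, hU, hy⟩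

lemma isOpen_cocycleSpace {W : Set (CocycleSpace h)} : IsOpen W ↔ ∀ x : ℂ × G, x ∈ (W : Set (ℂ × G)) →
    ∀ᶠ y in 𝓝 x.1, ((y, x.2 * h x.1 y) : ℂ × G) ∈ (W : Set (ℂ × G)) := Iff.rfl

/-- The projection. -/
def cocycleProj (h : ℂ → ℂ → G) : CocycleSpace h → ℂ := Prod.fst

lemma continuous_cocycleProj : Continuous (cocycleProj h) := by
  refine ⟨fun U hU => isOpen_cocycleSpace.2 fun x hx => ?_⟩
  exact hU.mem_nhds hx

/-- Right multiplication by the inverse of `h y₀` straightens the sheets over a neighbourhood of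
`y₀`; the cocycle identity says that the straightened coordinate is locally constant along them. -/
lemma isCoveringMap_cocycleProj
    (hc : ∀ y, ∀ᶠ y' in 𝓝 y, ∀ᶠ y'' in 𝓝 y', h y y' * h y' y'' = h y y'') :
    IsCoveringMap (cocycleProj h) := by
  intro y₀
  let _ : TopologicalSpace G := ⊥
  have _ : DiscreteTopology G := ⟨rfl⟩
  obtain ⟨U, hU, hUo, hy⟩ := eventually_nhds_iff.1 (hc y₀)
  refine IsEvenlyCovered.to_isEvenlyCovered_preimage (I := G) ⟨inferInstance, U, hy, hUo,
    hUo.preimage continuous_cocycleProj, ?_⟩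
  refine ⟨{ toFun := fun x => (⟨cocycleProj h x.1, x.2⟩, (x.1 : ℂ × G).2 * (h y₀ (x.1 : ℂ × G).1)⁻¹)
            invFun := fun x => ⟨((x.1 : ℂ), x.2 * h y₀ x.1), x.1.2⟩
            left_inv := fun x => Subtype.ext (Prod.ext rfl (inv_mul_cancel_right _ _))
            right_inv := fun x => Prod.ext rfl (mul_inv_cancel_right _ _)
            continuous_toFun := ?_
            continuous_invFun := ?_ }, fun x => rfl⟩
  · refine Continuous.prodMk ((continuous_cocycleProj.comp continuous_subtype_val).subtype_mk _) ?_
    refine ⟨fun S _ => ⟨{x : ℂ × G | x.1 ∈ U ∧ x.2 * (h y₀ x.1)⁻¹ ∈ S}, ?_, ?_⟩⟩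
    · refine isOpen_cocycleSpace.2 fun x hx => ?_
      filter_upwards [hUo.mem_nhds hx.1, hU x.1 hx.1] with y' h2 h3
      refine ⟨h2, ?_⟩
      change x.2 * h x.1 y' * (h y₀ y')⁻¹ ∈ S
      rw [← h3, mul_inv_rev, mul_assoc, mul_inv_cancel_left]
      exact hx.2
    · ext x
      exact ⟨fun hx => hx.2, fun hx => ⟨x.2, hx⟩⟩
  · refine Continuous.subtype_mk ?_ _
    refine continuous_prod_of_discrete_right.2 fun g => ?_
    refine ⟨fun W hW => ⟨{y | y ∈ U ∧ ((y, g * h y₀ y) : ℂ × G) ∈ (W : Set (ℂ × G))}, ?_, ?_⟩⟩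
    · rw [isOpen_iff_eventually]
      intro y hyU
      filter_upwards [hUo.mem_nhds hyU.1, hU y hyU.1, isOpen_cocycleSpace.1 hW _ hyU.2]
        with y' h2 h3 h4
      refine ⟨h2, ?_⟩
      rw [← h3, ← mul_assoc]
      exact h4
    · ext y
      exact ⟨fun hx => hx.2, fun hx => ⟨y.2, hx⟩⟩

/-- Cocycles on the plane are coboundaries. -/
theorem exists_coboundary
    (hc : ∀ y, ∀ᶠ y' in 𝓝 y, ∀ᶠ y'' in 𝓝 y', h y y' * h y' y'' = h y y'') :
    ∃ k : ℂ → G, ∀ y, ∀ᶠ y' in 𝓝 y, k y * h y y' = k y' := by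
  -- The plane is simply connected, so the identity lifts to a global section; its group component
  -- is the required function.
  obtain ⟨F, ⟨-, hF⟩, -⟩ := (isCoveringMap_cocycleProj hc).existsUnique_continuousMap_lifts
    (.id ℂ) 0 ((0, 1) : ℂ × G) rfl
  have hF' : ∀ y, (F y : ℂ × G).1 = y := fun y => congrFun hF y
  refine ⟨fun y => (F y : ℂ × G).2, fun y => ?_⟩
  obtain ⟨U, hU, hUo, hy⟩ := eventually_nhds_iff.1 (hc y)
  have h1 : h y y = 1 := by simpa using (hU y hy).self_of_nhds
  set W : Set (ℂ × G) := {x | x.1 ∈ U ∧ x.2 = (F y : ℂ × G).2 * h y x.1}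
  have hW : IsOpen (X := CocycleSpace h) W := isOpen_cocycleSpace.2 fun x hx => by
    filter_upwards [hUo.mem_nhds hx.1, hU x.1 hx.1] with y' h2 h3
    refine ⟨h2, ?_⟩
    rw [hx.2, mul_assoc, h3]
  have hyW : F y ∈ W := ⟨by rw [hF']; exact hy, by rw [hF', h1, mul_one]⟩
  filter_upwards [F.continuous.continuousAt.preimage_mem_nhds (hW.mem_nhds hyW)] with y' hy'
  have := hy'.2
  rw [hF'] at this
  exact this.symm

end Cocycle

/-! ### The developing map of a cone spherical surface -/

section Charts

variable {X : Type} [MetricSpace X] [ChartedSpace ℂ X]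

/-- A chart in which the distance near `x` is that of a spherical cone. -/
structure IsoChart (φ : OpenPartialHomeomorph X ℂ) (x : X) (α : ℝ) : Prop where
  mem_atlas : φ ∈ IsManifold.maximalAtlas 𝓘(ℂ) ω X
  mem : x ∈ φ.source
  zero : φ x = 0
  isometric : ∀ᶠ P : X × X in 𝓝 (x, x), dist P.1 P.2 = coneDist α (φ P.1) (φ P.2)

lemma HasConeAngle.exists_isoChart {x : X} {α : ℝ} (h : HasConeAngle x α) :
    ∃ φ, IsoChart φ x α := by
  obtain ⟨φ, h1, h2, h3, r, hr, -, h4⟩ := h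
  refine ⟨φ, h1, h2, h3, ?_⟩
  filter_upwards [(Metric.isOpen_ball.prod Metric.isOpen_ball).mem_nhds
    (show (x, x) ∈ Metric.ball x r ×ˢ Metric.ball x r from
      ⟨Metric.mem_ball_self hr, Metric.mem_ball_self hr⟩)] with P hP
  exact h4 _ hP.1 _ hP.2

lemma analyticAt_transition {φ ψ : OpenPartialHomeomorph X ℂ}
    (hφ : φ ∈ IsManifold.maximalAtlas 𝓘(ℂ) ω X) (hψ : ψ ∈ IsManifold.maximalAtlas 𝓘(ℂ) ω X)
    [IsManifold 𝓘(ℂ) ω X] {x : X} (hx : x ∈ φ.source) (hx' : x ∈ ψ.source) :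
    AnalyticAt ℂ (fun u => ψ (φ.symm u)) (φ x) := by
  have h := (mem_contDiffGroupoid.1 (IsManifold.compatible_of_mem_maximalAtlas hφ hψ)).1
  have hm : φ x ∈ (φ.symm.trans ψ).source := by simp [hx, hx']
  have h2 := h.contDiffAt ((φ.symm.trans ψ).open_source.mem_nhds hm)
  exact h2.analyticAt

/-- Two isometric coordinates differ by a rotation. -/
lemma IsoChart.exists_rot {φ : OpenPartialHomeomorph X ℂ} {x : X} (hφ : IsoChart φ x 1) {f : X → ℂ}
    (hf : AnalyticAt ℂ (fun u => f (φ.symm u)) 0)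
    (h : ∀ᶠ P : X × X in 𝓝 (x, x), dist P.1 P.2 = coneDist 1 (f P.1) (f P.2)) :
    ∃ r, IsRot r ∧ ∀ᶠ z in 𝓝 x, r (φ z : RS) = f z := by
  have h0 : φ.symm 0 = x := by rw [← hφ.zero, φ.left_inv hφ.mem]
  have hz : (0 : ℂ) ∈ φ.target := by rw [← hφ.zero]; exact φ.map_source hφ.mem
  have hc : ContinuousAt (fun u : ℂ => (φ.symm u, x)) 0 :=
    (φ.symm.continuousAt hz).prodMk continuousAt_const
  have hc' := hc.tendsto
  rw [h0] at hc'
  obtain ⟨r, hr, hr'⟩ := exists_rot_of_isometric hf (by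
    filter_upwards [hc'.eventually h, hc'.eventually hφ.isometric, φ.open_target.mem_nhds hz]
      with u h1 h2 h3
    rw [h0, ← h1, h2, φ.right_inv h3, hφ.zero])
  have hφc := (φ.continuousAt hφ.mem).tendsto
  rw [hφ.zero] at hφc
  refine ⟨r, hr, ?_⟩
  filter_upwards [hφc.eventually hr', φ.open_source.mem_nhds hφ.mem] with z h1 h2
  rw [h1, φ.left_inv h2]

/-- The image of a chart is open, so Möbius maps are determined by what they do on it. -/
lemma IsoChart.coe_ne {φ : OpenPartialHomeomorph X ℂ} {x : X} (hφ : IsoChart φ x 1)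
    {r s : Equiv.Perm RS} (hr : IsMob r) (hs : IsMob s)
    (h : ∀ᶠ z in 𝓝 x, r (φ z : RS) = s (φ z)) : r = s := by
  have hz : (0 : ℂ) ∈ φ.target := by rw [← hφ.zero]; exact φ.map_source hφ.mem
  have hc := (φ.symm.continuousAt hz).tendsto
  rw [← hφ.zero, φ.left_inv hφ.mem, hφ.zero] at hc
  refine hr.eq_of_eventuallyEq hs (z₀ := 0) ?_
  filter_upwards [hc.eventually h, φ.open_target.mem_nhds hz] with u h1 h2
  rwa [φ.right_inv h2] at h1

end Charts

/-- The developing map of a spherical surface with two cone points, given by its germs: `Π` is the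
universal covering of the complement of `p` and `q`, and `Φ y` is a branch of the developing map
near `Π y`; `g` is the monodromy around `p`. -/
structure IsDeveloping {X : Type} [MetricSpace X] [ChartedSpace ℂ X] (p q : X) (Q : ℂ → X)
    (Φ : ℂ → X → RS) (g : Equiv.Perm RS) : Prop where
  continuous : Continuous Q
  isOpenMap : IsOpenMap Q
  range : Set.range Q = {p, q}ᶜ
  period : ∀ y, Q (y + 2 * π * Complex.I) = Q y
  exists_int : ∀ y y', Q y = Q y' → ∃ n : ℤ, y' = y + n * (2 * π * Complex.I)
  left : ∀ N ∈ 𝓝 p, ∃ ρ : ℝ, ∀ y : ℂ, y.re < ρ → Q y ∈ N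
  right : ∀ N ∈ 𝓝 q, ∃ ρ : ℝ, ∀ y : ℂ, ρ < y.re → Q y ∈ N
  near_left : ∀ ρ : ℝ, ∀ᶠ x in 𝓝 p, ∀ y, Q y = x → y.re < ρ
  near_right : ∀ ρ : ℝ, ∀ᶠ x in 𝓝 q, ∀ y, Q y = x → ρ < y.re
  rot : IsRot g
  chart : ∀ y, ∃ φ A, IsoChart φ (Q y) 1 ∧ IsRot A ∧ ∀ z, Φ y z = A (φ z : RS)
  loc : ∀ y, ∀ᶠ y' in 𝓝 y, ∀ᶠ z in 𝓝 (Q y'), Φ y z = Φ y' z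
  monodromy : ∀ y, ∀ᶠ z in 𝓝 (Q y), Φ (y + 2 * π * Complex.I) z = g (Φ y z)

/-- Rotations are homeomorphisms. -/
lemma IsRot.continuous {r : Equiv.Perm RS} (hr : IsRot r) : Continuous r := by
  -- The model with θ = 1 and c = 0 is the round sphere, of which a rotation is an isometry.
  have h : ModelPar 1 0 := ⟨one_pos, le_rfl, .inl rfl⟩
  let f : (modelSurface h).carrier → (modelSurface h).carrier := r
  have h1 : Isometry f := by
    refine Isometry.of_dist_eq fun x y => ?_
    exact ((h.confDist_zero _ _).trans (hr.2 x y)).trans (h.confDist_zero _ _).symm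
  exact h1.continuous

/-- With the two marked points at 0 and ∞, the exponential map covers their complement. -/
lemma exists_homeo_RS {P Q : RS} (h : P ≠ Q) : ∃ f : RS ≃ₜ RS, f P = ((0 : ℂ) : RS) ∧
    f Q = OnePoint.infty := by
  obtain ⟨c, -, r, hr, hP, hQ⟩ := exists_rot_pair h
  let R : RS ≃ₜ RS := ⟨r, hr.continuous, hr.inv.continuous⟩
  refine ⟨R.trans (mobN c).symm, ?_, ?_⟩
  · change (mobN c).symm (r P) = _
    rw [hP, Homeomorph.symm_apply_eq, mobN_zero]
  · change (mobN c).symm (r Q) = _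
    rw [hQ, Homeomorph.symm_apply_apply]

section Cover

variable {X : Type} [TopologicalSpace X] (j : RS ≃ₜ X)

lemma cover_left {N : Set X} (hN : N ∈ 𝓝 (j ((0 : ℂ) : RS))) : ∃ ρ : ℝ, ∀ y : ℂ, y.re < ρ →
    j (Complex.exp y : ℂ) ∈ N := by
  have h1 : ContinuousAt (fun u : ℂ => j (u : RS)) 0 :=
    (j.continuous.comp OnePoint.continuous_coe).continuousAt
  obtain ⟨ε, hε, hb⟩ := Metric.mem_nhds_iff.1 (h1.preimage_mem_nhds hN)
  refine ⟨Real.log ε, fun y hy => hb ?_⟩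
  rw [mem_ball_zero_iff, Complex.norm_exp, ← Real.lt_log_iff_exp_lt hε]
  exact hy

lemma cover_near_left (ρ : ℝ) : ∀ᶠ x in 𝓝 (j ((0 : ℂ) : RS)), ∀ y : ℂ,
    j (Complex.exp y : ℂ) = x → y.re < ρ := by
  have h1 : IsOpen (j '' ((fun u : ℂ => (u : RS)) '' Metric.ball 0 (Real.exp ρ))) :=
    j.isOpenMap _ (OnePoint.isOpenEmbedding_coe.isOpenMap _ Metric.isOpen_ball)
  filter_upwards [h1.mem_nhds ⟨_, ⟨0, Metric.mem_ball_self (exp_pos ρ), rfl⟩, rfl⟩]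
  rintro _ ⟨_, ⟨u, hu, rfl⟩, rfl⟩ y hy
  rw [j.injective.eq_iff, OnePoint.coe_eq_coe] at hy
  rw [mem_ball_zero_iff, ← hy, Complex.norm_exp] at hu
  exact Real.exp_lt_exp.1 hu

end Cover

open Classical in
/-- Every surface with two marked points has a developing map. -/
theorem Surface.exists_developing {θ : Fin 2 → ℝ} (A : Surface θ) :
    ∃ Q Φ g, IsDeveloping (A.p 0) (A.p 1) Q Φ g := by
  obtain ⟨f₀⟩ := A.genus_zero
  have hne : A.p 0 ≠ A.p 1 := fun h => by simpa using A.p_injective h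
  let j₀ : RS ≃ₜ A.carrier := (footHomeo one_pos).trans f₀.symm
  obtain ⟨f₁, hf0, hf1⟩ := exists_homeo_RS (P := j₀.symm (A.p 0)) (Q := j₀.symm (A.p 1))
    (fun h => hne (j₀.symm.injective h))
  let j : RS ≃ₜ A.carrier := f₁.symm.trans j₀
  have j0 : j ((0 : ℂ) : RS) = A.p 0 := by
    change j₀ (f₁.symm _) = _
    rw [← hf0, f₁.symm_apply_apply, j₀.apply_symm_apply]
  have j1 : j OnePoint.infty = A.p 1 := by
    change j₀ (f₁.symm _) = _
    rw [← hf1, f₁.symm_apply_apply, j₀.apply_symm_apply]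
  set Q : ℂ → A.carrier := fun y => j (Complex.exp y : ℂ) with hQ
  have hQ' : ∀ y, Q y = (invHomeo.trans j) (Complex.exp (-y) : ℂ) := fun y =>
    congrArg j (show ((Complex.exp y : ℂ) : RS) = invFun (Complex.exp (-y) : ℂ) by
      rw [invFun_coe (Complex.exp_ne_zero _), Complex.exp_neg, inv_inv])
  have hQc : Continuous Q := j.continuous.comp (OnePoint.continuous_coe.comp Complex.continuous_exp)
  have hQne : ∀ y, Q y ∉ Set.range A.p := by
    rintro y hi
    rcases Fin.exists_fin_two.1 hi with hi | hi
    · rw [← j0, j.injective.eq_iff, OnePoint.coe_eq_coe] at hi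
      exact Complex.exp_ne_zero _ hi.symm
    · rw [← j1, j.injective.eq_iff] at hi
      exact OnePoint.infty_ne_coe _ hi
  have hper : ∀ y, Q (y + 2 * π * Complex.I) = Q y := fun y => by
    simp only [hQ, Complex.exp_periodic y]
  choose φ hφ using fun y => (A.smooth _ (hQne y)).exists_isoChart
  -- the transition rotations depend on the base points only
  have hφ' : ∃ ψ : A.carrier → OpenPartialHomeomorph A.carrier ℂ, ∀ y, IsoChart (ψ (Q y)) (Q y) 1 :=
    ⟨fun x => if h : ∃ y, Q y = x then φ h.choose else φ 0, fun y => by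
      have h : ∃ y', Q y' = Q y := ⟨y, rfl⟩
      have := hφ h.choose
      rw [h.choose_spec] at this
      simp only [dif_pos h]
      exact this⟩
  obtain ⟨ψ, hψ⟩ := hφ'
  -- The transition rotation is a function of the two points of the surface and not of their lifts,
  -- so the cocycle on the plane is invariant under translation by 2πi.
  have hR : ∃ R : A.carrier → A.carrier → rot, ∀ y, ∀ᶠ y' in 𝓝 y, ∀ᶠ z in 𝓝 (Q y'),
      ((ψ (Q y) z : ℂ) : RS) = (R (Q y) (Q y')).1 (ψ (Q y') z : ℂ) := by
    refine ⟨fun x x' => if h : ∃ r : rot, ∀ᶠ z in 𝓝 x', ((ψ x z : ℂ) : RS) = r.1 (ψ x' z : ℂ)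
      then h.choose else 1, fun y => ?_⟩
    have h1 := (hψ y).isometric.eventually_nhds
    have h2 : Filter.Tendsto (fun y' => (Q y', Q y')) (𝓝 y) (𝓝 (Q y, Q y)) :=
      (hQc.prodMk hQc).continuousAt
    filter_upwards [h2.eventually h1,
      hQc.continuousAt.eventually ((ψ (Q y)).open_source.mem_nhds (hψ y).mem)] with y' h3 h4
    obtain ⟨r, hr, hr'⟩ := (hψ y').exists_rot (f := ψ (Q y)) (by
      have := analyticAt_transition (hψ y').mem_atlas (hψ y).mem_atlas (hψ y').mem h4
      rwa [(hψ y').zero] at this) h3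
    have hex : ∃ r : rot, ∀ᶠ z in 𝓝 (Q y'), ((ψ (Q y) z : ℂ) : RS) = r.1 (ψ (Q y') z : ℂ) :=
      ⟨⟨r, hr⟩, hr'.mono fun z hz => hz.symm⟩
    simp only [dif_pos hex]
    exact hex.choose_spec
  obtain ⟨R, hR⟩ := hR
  obtain ⟨k, hk⟩ := exists_coboundary (h := fun y y' => R (Q y) (Q y')) (by
    intro y
    filter_upwards [hR y, (hR y).eventually_nhds] with y' h1 h2
    filter_upwards [h2, hR y', hQc.continuousAt.eventually h1.eventually_nhds] with y'' h3 h4 h5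
    refine Subtype.ext ((hψ y'').coe_ne (R (Q y) (Q y') * R (Q y') (Q y'')).2.1
      (R (Q y) (Q y'')).2.1 ?_)
    filter_upwards [h3, h4, h5] with z h6 h7 h8
    rw [← h6, h8, h7]
    rfl)
  -- As the cocycle is periodic, the quotient of `k` at y + 2πi and at y is locally constant; its
  -- value is the monodromy.
  have hg : ∃ g : rot, ∀ y, k (y + 2 * π * Complex.I) * (k y)⁻¹ = g := by
    have hlc : IsLocallyConstant fun y => k (y + 2 * π * Complex.I) * (k y)⁻¹ := by
      rw [IsLocallyConstant.iff_eventually_eq]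
      intro y
      have hc : ContinuousAt (fun y : ℂ => y + 2 * π * Complex.I) y := by fun_prop
      filter_upwards [hk y, hc.eventually (hk (y + 2 * π * Complex.I))] with y' h1 h2
      rw [← h1, ← h2, hper, hper]
      group
    exact ⟨_, fun y => hlc.apply_eq_of_isPreconnected isPreconnected_univ
      (Set.mem_univ y) (Set.mem_univ 0)⟩
  obtain ⟨g, hg⟩ := hg
  refine ⟨Q, fun y z => (k y).1 (ψ (Q y) z : ℂ), g.1, hQc, ?_, ?_, hper, ?_, ?_, ?_, ?_, ?_, g.2,
    fun y => ⟨ψ (Q y), (k y).1, hψ y, (k y).2, fun z => rfl⟩, ?_, ?_⟩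
  · exact j.isOpenMap.comp (OnePoint.isOpenEmbedding_coe.isOpenMap.comp Complex.isOpenMap_exp)
  · refine subset_antisymm ?_ fun x hx => ?_
    · rintro _ ⟨y, rfl⟩ (h | h)
      · exact hQne y ⟨0, h.symm⟩
      · exact hQne y ⟨1, (Set.mem_singleton_iff.1 h).symm⟩
    · obtain ⟨v, rfl⟩ := j.surjective x
      have hv : v ≠ OnePoint.infty := fun h => hx (.inr (by rw [h, j1]; rfl))
      obtain ⟨u, rfl⟩ := OnePoint.ne_infty_iff_exists.1 hv
      have hu : u ≠ 0 := fun h => hx (.inl (by rw [h, j0]))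
      exact ⟨Complex.log u, by simp only [hQ, Complex.exp_log hu]⟩
  · intro y y' h
    simp only [hQ, j.injective.eq_iff, OnePoint.coe_eq_coe] at h
    obtain ⟨n, hn⟩ := Complex.exp_eq_exp_iff_exists_int.1 h.symm
    exact ⟨n, hn⟩
  · intro N hN
    rw [← j0] at hN
    exact cover_left j hN
  · intro N hN
    have : (invHomeo.trans j) ((0 : ℂ) : RS) = A.p 1 := by
      rw [← j1, ← invFun_zero]; rfl
    rw [← this] at hN
    obtain ⟨ρ, hρ⟩ := cover_left _ hN
    refine ⟨-ρ, fun y hy => ?_⟩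
    rw [hQ']
    exact hρ _ (by rw [Complex.neg_re]; linarith)
  · intro ρ
    rw [← j0]
    exact cover_near_left j ρ
  · intro ρ
    have : (invHomeo.trans j) ((0 : ℂ) : RS) = A.p 1 := by
      rw [← j1, ← invFun_zero]; rfl
    rw [← this]
    filter_upwards [cover_near_left (invHomeo.trans j) (-ρ)] with x hx y hy
    have := hx (-y) (by rw [← hQ', hy])
    rw [Complex.neg_re] at this
    linarith
  · intro y
    filter_upwards [hR y, hk y] with y' h1 h2
    filter_upwards [h1] with z h3
    rw [h3, ← h2]
    rfl
  · intro y
    refine .of_forall fun z => ?_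
    have : k (y + 2 * π * Complex.I) = g * k y := by rw [← hg y]; group
    change (k (y + 2 * π * Complex.I)).1 (ψ (Q (y + 2 * π * Complex.I)) z : ℂ) = _
    rw [this, hper]
    rfl

/-! ### The developing map near a cone point -/

/-- The logarithms add up without a jump when both arguments are below π/2 in absolute value. -/
lemma branch_branch {α : ℝ} {κ w : ℂ} (hw : w ≠ 0) : ∀ᶠ u in 𝓝 w, ∀ᶠ a in 𝓝 u,
    branch α (branch α κ w u) u a = branch α κ w a := by
  have h1 : ∀ v : ℂ, v ≠ 0 → ∀ᶠ u in 𝓝 v, |(Complex.log (u / v)).im| < π / 2 := by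
    intro v hv
    have := (Complex.continuous_im.tendsto _).comp (tendsto_log_div hv)
    have h2 := this.abs
    simp only [Complex.zero_im, abs_zero] at h2
    exact h2.eventually_lt_const (by positivity)
  filter_upwards [h1 w hw, isOpen_ne.mem_nhds hw] with u hu hu0
  filter_upwards [h1 u hu0, isOpen_ne.mem_nhds hu0] with a ha ha0
  have e1 : a / w = (u / w) * (a / u) := by
    rw [mul_comm, div_mul_div_cancel₀ hu0]
  rw [Complex.log_im] at hu ha
  have e2 : Complex.log (a / w) = Complex.log (u / w) + Complex.log (a / u) := by
    rw [e1, Complex.log_mul (div_ne_zero hu0 hw) (div_ne_zero ha0 hu0)]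
    have := abs_lt.1 hu
    have := abs_lt.1 ha
    constructor <;> linarith
  simp only [branch]
  rw [e2, mul_add, Complex.exp_add, mul_assoc]

lemma branch_mul (α : ℝ) (v κ w a : ℂ) : branch α (v * κ) w a = v * branch α κ w a := mul_assoc _ _ _

lemma eq_of_locally_const {Y : Type*} {T : Set ℂ} (hT : IsPreconnected T) {f : ℂ → Y}
    (h : ∀ y ∈ T, ∀ᶠ y' in 𝓝 y, y' ∈ T → f y' = f y) {y y' : ℂ} (hy : y ∈ T) (hy' : y' ∈ T) :
    f y = f y' := by
  let _ : TopologicalSpace Y := ⊥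
  have _ : DiscreteTopology Y := ⟨rfl⟩
  refine hT.constant (fun y hy => ?_) hy hy'
  refine tendsto_nhds_of_eventually_eq ?_
  exact eventually_nhdsWithin_iff.2 (h y hy)

section Monodromy

variable {X : Type} [MetricSpace X] [ChartedSpace ℂ X] {p q : X} {Q : ℂ → X} {Φ : ℂ → X → RS}
  {g : Equiv.Perm RS} (D : IsDeveloping p q Q Φ g)
include D

lemma IsDeveloping.exists_zpow {y y' : ℂ} (h : Q y = Q y') :
    ∃ n : ℤ, ∀ᶠ z in 𝓝 (Q y), Φ y' z = (g ^ n) (Φ y z) := by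
  obtain ⟨n, rfl⟩ := D.exists_int y y' h
  refine ⟨n, ?_⟩
  have hQ : ∀ (n : ℤ), Q (y + n * (2 * π * Complex.I)) = Q y := by
    intro n
    induction n using Int.induction_on with
    | zero => simp
    | succ n ih =>
      refine Eq.trans (congrArg Q ?_) ((D.period _).trans ih)
      push_cast
      ring
    | pred n ih =>
      rw [← ih, ← D.period (y + ((-(n : ℤ) - 1 : ℤ) : ℂ) * _)]
      congr 1
      push_cast
      ring
  have hm := fun n : ℤ => hQ n ▸ D.monodromy (y + n * (2 * π * Complex.I))
  clear h
  induction n using Int.induction_on with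
  | zero => simp
  | succ n ih =>
    filter_upwards [ih, hm n] with z h1 h2
    rw [h1] at h2
    rw [zpow_add, zpow_one, (Commute.zpow_self g _).eq, Equiv.Perm.mul_apply, ← h2]
    congr 1
    push_cast
    ring
  | pred n ih =>
    filter_upwards [ih, hm (-n - 1)] with z h1 h2
    have e : y + ((-(n : ℤ) - 1 : ℤ) : ℂ) * (2 * π * Complex.I) + 2 * π * Complex.I =
        y + ((-(n : ℤ) : ℤ) : ℂ) * (2 * π * Complex.I) := by push_cast; ring
    rw [e, h1] at h2
    refine g.injective ?_
    rw [← h2, ← Equiv.Perm.mul_apply, ← zpow_one_add]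
    congr 2
    ring

end Monodromy

/-- A neighbourhood of a cone point, seen in the universal covering. -/
structure ConeNbhd {X : Type} [MetricSpace X] [ChartedSpace ℂ X] (Q : ℂ → X)
    (w : OpenPartialHomeomorph X ℂ) (x₀ : X) (θ : ℝ) (T : Set ℂ) : Prop where
  chart : IsoChart w x₀ θ
  pos : 0 < θ
  isOpen : IsOpen T
  preconnected : IsPreconnected T
  add : ∀ y ∈ T, y + 2 * π * Complex.I ∈ T
  mem : ∀ y ∈ T, Q y ∈ w.source ∧ Q y ≠ x₀ ∧
    ∀ᶠ P : X × X in 𝓝 (Q y, Q y), dist P.1 P.2 = coneDist θ (w P.1) (w P.2)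
  cover : ∀ᶠ x in 𝓝 x₀, ∀ y, Q y = x → y ∈ T
  exists_lift : ∀ᶠ x in 𝓝 x₀, x ≠ x₀ → ∃ y, Q y = x
  nonempty : T.Nonempty

/-- The developing map is `K` composed with a branch of the `θ`-th power of the coordinate. -/
def Germ {X : Type} [TopologicalSpace X] (Q : ℂ → X) (Φ : ℂ → X → RS)
    (w : OpenPartialHomeomorph X ℂ) (θ : ℝ) (y κ : ℂ) (K : Equiv.Perm RS) : Prop :=
  ∀ᶠ z in 𝓝 (Q y), Φ y z = K (branch θ κ (w (Q y)) (w z) : ℂ)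

section ConePoint

variable {X : Type} [MetricSpace X] [ChartedSpace ℂ X] [IsManifold 𝓘(ℂ) ω X]
  {p q : X} {Q : ℂ → X} {Φ : ℂ → X → RS}
  {g : Equiv.Perm RS} (D : IsDeveloping p q Q Φ g) {w : OpenPartialHomeomorph X ℂ} {x₀ : X} {θ : ℝ}
  {T : Set ℂ} (N : ConeNbhd Q w x₀ θ T)

include N in
omit [IsManifold 𝓘(ℂ) ω X] in
lemma ConeNbhd.ne_zero {y : ℂ} (hy : y ∈ T) : w (Q y) ≠ 0 := fun h =>
  (N.mem y hy).2.1 (w.injOn (N.mem y hy).1 N.chart.mem (by rw [h, N.chart.zero]))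

include D N

/-- Off the apex a branch of the θ-th power of the cone coordinate is itself an isometric
coordinate, so rigidity compares it with a smooth isometric chart. -/
lemma ConeNbhd.exists_rot {y κ : ℂ} (hy : y ∈ T) (hκ : ‖κ‖ = ‖w (Q y)‖ ^ θ) : ∃ φ A r,
    IsoChart φ (Q y) 1 ∧ IsRot A ∧ IsRot r ∧ (∀ z, Φ y z = A (φ z : RS)) ∧
    ∀ᶠ z in 𝓝 (Q y), r (φ z : RS) = (branch θ κ (w (Q y)) (w z) : ℂ) := by
  obtain ⟨φ, A, hφ, hA, hΦ⟩ := D.chart y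
  obtain ⟨h1, h2, h3⟩ := N.mem y hy
  have h0 := N.ne_zero hy
  have hz : φ.symm 0 = Q y := by rw [← hφ.zero, φ.left_inv hφ.mem]
  have hwc := w.continuousAt h1
  obtain ⟨r, hr, hr'⟩ := hφ.exists_rot (f := fun z => branch θ κ (w (Q y)) (w z)) (by
    have h4 := analyticAt_transition hφ.mem_atlas N.chart.mem_atlas hφ.mem h1
    rw [hφ.zero] at h4
    refine (analyticAt_branch θ κ ?_).comp_of_eq h4 rfl
    simp only [hz]
    exact (eventually_div_mem_slitPlane h0).self_of_nhds) (by
    have h5 : Filter.Tendsto (fun P : X × X => (w P.1, w P.2)) (𝓝 (Q y, Q y))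
        (𝓝 (w (Q y), w (Q y))) :=
      (hwc.tendsto.comp (continuous_fst.tendsto (Q y, Q y))).prodMk_nhds
        (hwc.tendsto.comp (continuous_snd.tendsto (Q y, Q y)))
    filter_upwards [h3, h5.eventually (coneDist_branch N.pos h0 hκ)] with P h6 h7
    rw [h6, h7])
  exact ⟨φ, A, r, hφ, hA, hr, hΦ, hr'⟩

lemma ConeNbhd.exists_germ {y κ : ℂ} (hy : y ∈ T) (hκ : ‖κ‖ = ‖w (Q y)‖ ^ θ) :
    ∃ K, IsRot K ∧ Germ Q Φ w θ y κ K := by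
  obtain ⟨φ, A, r, hφ, hA, hr, hΦ, hr'⟩ := N.exists_rot D hy hκ
  refine ⟨A * r⁻¹, hA.mul hr.inv, ?_⟩
  filter_upwards [hr'] with z hz
  rw [hΦ, ← hz, Equiv.Perm.mul_apply]
  congr 1
  exact (r.symm_apply_apply _).symm

lemma ConeNbhd.germ_unique {y κ : ℂ} (hy : y ∈ T) (hκ : ‖κ‖ = ‖w (Q y)‖ ^ θ)
    {K K' : Equiv.Perm RS} (hK : IsRot K) (hK' : IsRot K') (h : Germ Q Φ w θ y κ K)
    (h' : Germ Q Φ w θ y κ K') : K = K' := by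
  obtain ⟨φ, A, r, hφ, hA, hr, hΦ, hr'⟩ := N.exists_rot D hy hκ
  have : K * r = K' * r := hφ.coe_ne (hK.1.mul hr.1) (hK'.1.mul hr.1) (by
    filter_upwards [h, h', hr'] with z h1 h2 h3
    rw [Equiv.Perm.mul_apply, Equiv.Perm.mul_apply, h3, ← h1, ← h2])
  exact mul_right_cancel this

omit D [IsManifold 𝓘(ℂ) ω X] [ChartedSpace ℂ X] N in
lemma Germ.mul {y κ v : ℂ} {K V : Equiv.Perm RS} (h : Germ Q Φ w θ y κ K)
    (hV : ∀ z : ℂ, V (z : RS) = (v * z : ℂ)) : Germ Q Φ w θ y (v * κ) (K * V⁻¹) := by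
  filter_upwards [h] with z hz
  rw [hz, branch_mul, ← hV, Equiv.Perm.mul_apply]
  congr 1
  exact (V.symm_apply_apply _).symm

omit [IsManifold 𝓘(ℂ) ω X] in
lemma ConeNbhd.germ_near {y κ : ℂ} (hy : y ∈ T) {K : Equiv.Perm RS} (h : Germ Q Φ w θ y κ K) :
    ∀ᶠ y' in 𝓝 y, Germ Q Φ w θ y' (branch θ κ (w (Q y)) (w (Q y'))) K := by
  have hc := D.continuous.continuousAt (x := y)
  have hs := (N.mem y hy).1
  have hwc : ContinuousAt (fun y' => w (Q y')) y :=
    ContinuousAt.comp (g := w) (w.continuousAt hs) hc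
  filter_upwards [hc.eventually h.eventually_nhds, D.loc y,
    hwc.eventually (branch_branch (α := θ) (κ := κ) (N.ne_zero hy)),
    hc.eventually (w.open_source.mem_nhds hs)] with y' h1 h2 h3 h4
  filter_upwards [h1, h2, (w.continuousAt h4).eventually h3] with z h5 h6 h7
  rw [← h6, h5, h7]

/-- The value of the developing map at a cone point and the antipode are well-defined. -/
lemma ConeNbhd.exists_value : ∃ P P' : RS, ∀ y ∈ T, ∀ κ : ℂ, ‖κ‖ = ‖w (Q y)‖ ^ θ →
    ∃ K, IsRot K ∧ Germ Q Φ w θ y κ K ∧ K ((0 : ℂ) : RS) = P ∧ K OnePoint.infty = P' := by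
  obtain ⟨y₀, hy₀⟩ := N.nonempty
  have hex : ∀ y, ∃ K, y ∈ T → IsRot K ∧ Germ Q Φ w θ y ((‖w (Q y)‖ ^ θ : ℝ) : ℂ) K := fun y => by
    by_cases hy : y ∈ T
    · obtain ⟨K, hK⟩ := N.exists_germ D hy (κ := ((‖w (Q y)‖ ^ θ : ℝ) : ℂ)) (by
        rw [Complex.norm_real, Real.norm_of_nonneg (by positivity)])
      exact ⟨K, fun _ => hK⟩
    · exact ⟨1, fun h => absurd h hy⟩
  choose K hK using hex
  -- Another choice of `κ` differs by a unit factor, which changes the rotation by one that fixes 0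
  -- and ∞; the two values are not affected.
  have key : ∀ y ∈ T, ∀ κ : ℂ, ‖κ‖ = ‖w (Q y)‖ ^ θ → ∀ K', IsRot K' → Germ Q Φ w θ y κ K' →
      K' ((0 : ℂ) : RS) = K y ((0 : ℂ) : RS) ∧ K' OnePoint.infty = K y OnePoint.infty := by
    intro y hy κ hκ K' hK' hG
    have hpos : 0 < ‖w (Q y)‖ ^ θ := rpow_pos_of_pos (norm_pos_iff.2 (N.ne_zero hy)) _
    have hne : ((‖w (Q y)‖ ^ θ : ℝ) : ℂ) ≠ 0 := by exact_mod_cast hpos.ne'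
    have hv : ‖κ / ((‖w (Q y)‖ ^ θ : ℝ) : ℂ)‖ = 1 := by
      rw [norm_div, hκ, Complex.norm_real, Real.norm_of_nonneg hpos.le, div_self hpos.ne']
    obtain ⟨V, hV, hV'⟩ := exists_rot_mul hv
    have h1 := (hK y hy).2.mul hV'
    rw [div_mul_cancel₀ _ hne] at h1
    have h2 := N.germ_unique D hy hκ hK' ((hK y hy).1.mul hV.inv) hG h1
    have h3 : V⁻¹ ((0 : ℂ) : RS) = ((0 : ℂ) : RS) := by
      rw [Equiv.Perm.inv_eq_iff_eq, hV', mul_zero]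
    have h4 : V⁻¹ OnePoint.infty = OnePoint.infty := by
      rw [Equiv.Perm.inv_eq_iff_eq]
      exact (fix_infty_of_mul (norm_pos_iff.1 (by rw [hv]; exact one_pos)) hV').symm
    rw [h2, Equiv.Perm.mul_apply, Equiv.Perm.mul_apply, h3, h4]
    exact ⟨rfl, rfl⟩
  have hconst := fun y (hy : y ∈ T) => eq_of_locally_const N.preconnected
    (f := fun y => (K y ((0 : ℂ) : RS), K y OnePoint.infty)) (by
      intro y hy
      filter_upwards [N.germ_near D hy (hK y hy).2] with y' h1 h2
      have h3 := compat_branch (c := 0) ⟨by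
        rw [Complex.norm_real, Real.norm_of_nonneg (by positivity)], .inl rfl⟩
        (N.ne_zero hy) (N.ne_zero h2) (κ := ((‖w (Q y)‖ ^ θ : ℝ) : ℂ)) (θ := θ)
      obtain ⟨h4, h5⟩ := key y' h2 _ h3.1 _ (hK y hy).1 h1
      rw [h4, h5]) hy hy₀
  refine ⟨K y₀ ((0 : ℂ) : RS), K y₀ OnePoint.infty, fun y hy κ hκ => ?_⟩
  obtain ⟨K', h1, h2⟩ := N.exists_germ D hy hκ
  obtain ⟨h3, h4⟩ := key y hy κ hκ K' h1 h2
  have h5 := hconst y hy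
  exact ⟨K', h1, h2, h3.trans (congrArg Prod.fst h5), h4.trans (congrArg Prod.snd h5)⟩

/-- The monodromy fixes the value at a cone point. -/
lemma ConeNbhd.fix_value {P P' : RS} (h : ∀ y ∈ T, ∀ κ : ℂ, ‖κ‖ = ‖w (Q y)‖ ^ θ →
    ∃ K, IsRot K ∧ Germ Q Φ w θ y κ K ∧ K ((0 : ℂ) : RS) = P ∧ K OnePoint.infty = P') :
    g P = P ∧ g P' = P' := by
  obtain ⟨y, hy⟩ := N.nonempty
  have hn : ‖((‖w (Q y)‖ ^ θ : ℝ) : ℂ)‖ = ‖w (Q y)‖ ^ θ := by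
    rw [Complex.norm_real, Real.norm_of_nonneg (by positivity)]
  have hn' := hn
  nth_rw 2 [← D.period] at hn'
  obtain ⟨K, h1, h2, h3, h4⟩ := h y hy _ hn
  obtain ⟨K', h1', h2', h3', h4'⟩ := h _ (N.add y hy) _ hn'
  -- Translation by 2πi keeps the point and multiplies the germ by `g`, so by uniqueness it
  -- multiplies the rotation by `g`.
  have hG : Germ Q Φ w θ (y + 2 * π * Complex.I) ((‖w (Q y)‖ ^ θ : ℝ) : ℂ) (g * K) := by
    rw [Germ, D.period]
    filter_upwards [h2, D.monodromy y] with z h5 h6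
    rw [h6, h5]
    rfl
  have := N.germ_unique D (N.add y hy) hn' h1' (D.rot.mul h1) h2' hG
  rw [this, Equiv.Perm.mul_apply] at h3' h4'
  rw [h3] at h3'
  rw [h4] at h4'
  exact ⟨h3', h4'⟩

/-- For integral angles the developing map is a Möbius transformation of the power of the
coordinate. -/
lemma ConeNbhd.exists_nat {m : ℕ} (hm : θ = m) : ∃ K, IsRot K ∧
    ∀ y ∈ T, Germ Q Φ w θ y (w (Q y) ^ m) K := by
  obtain ⟨y₀, hy₀⟩ := N.nonempty
  have hn : ∀ y, ‖w (Q y) ^ m‖ = ‖w (Q y)‖ ^ θ := fun y => by rw [norm_pow, hm, rpow_natCast]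
  have hex : ∀ y, ∃ K, y ∈ T → IsRot K ∧ Germ Q Φ w θ y (w (Q y) ^ m) K := fun y => by
    by_cases hy : y ∈ T
    · obtain ⟨K, hK⟩ := N.exists_germ D hy (hn y)
      exact ⟨K, fun _ => hK⟩
    · exact ⟨1, fun h => absurd h hy⟩
  choose K hK using hex
  refine ⟨K y₀, (hK y₀ hy₀).1, fun y hy => ?_⟩
  have : K y = K y₀ := eq_of_locally_const N.preconnected (by
    intro y hy
    filter_upwards [N.germ_near D hy (hK y hy).2] with y' h1 h2
    have h0 := N.ne_zero hy
    rw [hm, branch_nat m _ h0 (N.ne_zero h2), div_pow, mul_div_cancel₀ _ (pow_ne_zero m h0),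
      ← hm] at h1
    exact (N.germ_unique D h2 (hn y') (hK y hy).1 (hK y' h2).1 h1 (hK y' h2).2).symm) hy hy₀
  rw [← this]
  exact (hK y hy).2

/-- If the monodromy is trivial then the angle is integral. -/
lemma ConeNbhd.exists_nat_eq (hg : g = 1) : ∃ m : ℕ, θ = m := by
  have hΦ : ∀ {y y' κ K}, Q y = Q y' → Germ Q Φ w θ y κ K → Germ Q Φ w θ y' κ K := by
    intro y y' κ K h hG
    obtain ⟨n, hn⟩ := D.exists_zpow h
    rw [hg, one_zpow] at hn
    rw [Germ, ← h]
    filter_upwards [hn, hG] with z h1 h2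
    rw [h1, ← h2]
    rfl
  have hz : (0 : ℂ) ∈ w.target := by rw [← N.chart.zero]; exact w.map_source N.chart.mem
  have hs := (w.symm.continuousAt hz).tendsto
  rw [← N.chart.zero, w.left_inv N.chart.mem, N.chart.zero] at hs
  obtain ⟨r, hr, hball⟩ := Metric.eventually_nhds_iff_ball.1
    ((hs.eventually (N.cover.and N.exists_lift)).and (w.open_target.mem_nhds hz))
  set ε := r / 2
  have hε : 0 < ε := half_pos hr
  set v : ℝ → ℂ := fun t => ε * Complex.exp (t * Complex.I) with hv
  have hvn : ∀ t, ‖v t‖ = ε := fun t => by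
    rw [hv]
    simp only [norm_mul, Complex.norm_real, Complex.norm_exp_ofReal_mul_I, mul_one]
    exact Real.norm_of_nonneg hε.le
  have hv0 : ∀ t, v t ≠ 0 := fun t => norm_pos_iff.1 (by rw [hvn]; exact hε)
  have hvb : ∀ t, v t ∈ Metric.ball (0 : ℂ) r := fun t => by
    rw [mem_ball_zero_iff, hvn]; exact half_lt_self hr
  have hlift : ∀ t, ∃ y ∈ T, Q y = w.symm (v t) := fun t => by
    obtain ⟨⟨h1, h2⟩, h3⟩ := hball _ (hvb t)
    obtain ⟨y, hy⟩ := h2 fun h => hv0 t (by rw [← w.right_inv h3, h, N.chart.zero])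
    exact ⟨y, h1 y hy, hy⟩
  choose y hyT hy using hlift
  have hw : ∀ t, w (Q (y t)) = v t := fun t => by rw [hy, w.right_inv (hball _ (hvb t)).2]
  -- The θ-th power is continued along a small circle around the cone point.
  set κ : ℝ → ℂ := fun t => (ε ^ θ : ℝ) * Complex.exp (θ * (t * Complex.I)) with hκ
  have hκn : ∀ t, ‖κ t‖ = ‖w (Q (y t))‖ ^ θ := fun t => by
    rw [hw, hvn, hκ]
    simp only [norm_mul, Complex.norm_real, Complex.norm_exp]
    rw [Real.norm_of_nonneg (by positivity)]
    simp
  choose K hK hG using fun t => N.exists_germ D (hyT t) (hκn t)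
  have hconst : ∀ t, ∀ᶠ t' in 𝓝 t, K t' = K t := by
    intro t
    obtain ⟨S, hS, hS'⟩ := (Filter.eventually_iff_exists_mem.1
      ((N.germ_near D (hyT t) (hG t)).and (N.isOpen.mem_nhds (hyT t))))
    have h1 := D.isOpenMap.image_mem_nhds hS
    rw [hy] at h1
    have hvc : ContinuousAt v t := by fun_prop
    have h2 : ContinuousAt (fun t' => w.symm (v t')) t :=
      ContinuousAt.comp (g := w.symm) (w.symm.continuousAt (hball _ (hvb t)).2) hvc
    have h3 : ∀ᶠ t' : ℝ in 𝓝 t, |t' - t| < 1 := by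
      have : ContinuousAt (fun t' : ℝ => |t' - t|) t := by fun_prop
      exact this.eventually_lt_const (by simp)
    filter_upwards [h2.preimage_mem_nhds h1, h3] with t' ⟨y', hyS, h6⟩ h7
    obtain ⟨h4, h5⟩ := hS' y' hyS
    have e1 : Complex.log (v t' / v t) = (t' - t : ℝ) * Complex.I := by
      have : v t' / v t = Complex.exp ((t' - t : ℝ) * Complex.I) := by
        rw [hv]
        simp only
        rw [mul_div_mul_left _ _ (by exact_mod_cast hε.ne'), ← Complex.exp_sub]
        push_cast
        ring_nf
      rw [this, Complex.log_exp]
      · simp only [Complex.mul_im, Complex.ofReal_re, Complex.I_im, mul_one, Complex.ofReal_im,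
          Complex.I_re, mul_zero, add_zero]
        linarith [(abs_lt.1 h7).1, pi_gt_three]
      · simp only [Complex.mul_im, Complex.ofReal_re, Complex.I_im, mul_one, Complex.ofReal_im,
          Complex.I_re, mul_zero, add_zero]
        linarith [(abs_lt.1 h7).2, pi_gt_three]
    have e2 : branch θ (κ t) (w (Q (y t))) (w (Q y')) = κ t' := by
      rw [hw, h6, w.right_inv (hball _ (hvb t')).2, branch, e1, hκ]
      simp only
      rw [mul_assoc, ← Complex.exp_add]
      push_cast
      ring_nf
    have h8 : Germ Q Φ w θ y' (κ t') (K t) := e2 ▸ h4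
    have h9 := hΦ (h6.trans (hy t').symm) h8
    exact N.germ_unique D (hyT t') (hκn t') (hK t') (hK t) (hG t') h9
  -- With trivial monodromy the germ depends on the point only. After a full turn the rotation is
  -- the same, while `κ` has acquired the factor exp(2πiθ); uniqueness makes this factor 1.
  have h0 : K (2 * π) = K 0 := by
    have : IsLocallyConstant K := (IsLocallyConstant.iff_eventually_eq K).2 hconst
    exact this.apply_eq_of_isPreconnected isPreconnected_univ (Set.mem_univ _) (Set.mem_univ _)
  have hQ : Q (y 0) = Q (y (2 * π)) := by
    rw [hy, hy, hv]
    simp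
  obtain ⟨V, hV, hV'⟩ := exists_rot_mul (u := Complex.exp (θ * (2 * π * Complex.I))) (by
    rw [Complex.norm_exp]; simp)
  have h1 := (hΦ hQ (hG 0)).mul hV'
  have e : Complex.exp (θ * (2 * π * Complex.I)) * κ 0 = κ (2 * π) := by
    simp only [hκ]
    push_cast
    rw [mul_comm]
    simp
  rw [e] at h1
  have h2 := N.germ_unique D (hyT _) (hκn _) (hK _) ((hK 0).mul hV.inv) (hG _) h1
  rw [h0, left_eq_mul, inv_eq_one] at h2
  have h3 : Complex.exp (θ * (2 * π * Complex.I)) = 1 := by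
    have := hV' 1
    rw [h2, mul_one, Equiv.Perm.one_apply, OnePoint.coe_eq_coe] at this
    exact this.symm
  obtain ⟨n, hn⟩ := Complex.exp_eq_one_iff.1 h3
  have h4 : (θ : ℂ) = n := mul_right_cancel₀ Complex.two_pi_I_ne_zero hn
  have h5 : θ = n := by exact_mod_cast h4
  have h6 : 0 ≤ n := by
    have := N.pos
    rw [h5] at this
    exact_mod_cast this.le
  exact ⟨n.toNat, by rw [h5]; exact_mod_cast (Int.toNat_of_nonneg h6).symm⟩

end ConePoint

/-! ### Logarithmic coordinates -/

/-- Shrinking the new chart makes properties that hold eventually hold on its whole source. -/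
lemma exists_chart_comp {X : Type} [TopologicalSpace X] [ChartedSpace ℂ X]
    {φ : OpenPartialHomeomorph X ℂ} (hφ : φ ∈ IsManifold.maximalAtlas 𝓘(ℂ) ω X) {x : X}
    (hx : x ∈ φ.source) {u : ℂ} (hu : φ x = u) {f : ℂ → ℂ} (hf : AnalyticAt ℂ f u)
    (hf' : deriv f u ≠ 0) {R : ℂ → Prop} (hR : ∀ᶠ v in 𝓝 u, R v) {S : X → Prop}
    (hS : ∀ᶠ z in 𝓝 x, S z) :
    ∃ ψ ∈ IsManifold.maximalAtlas 𝓘(ℂ) ω X, x ∈ ψ.source ∧ (∀ z, ψ z = f (φ z)) ∧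
      ∀ z ∈ ψ.source, z ∈ φ.source ∧ R (φ z) ∧ S z := by
  subst hu
  have hc := (φ.symm.continuousAt (φ.map_source hx)).tendsto
  rw [φ.left_inv hx] at hc
  obtain ⟨e, h1, h2, h3, -, h4⟩ := exists_holomorphic_chart (hR.and (hc.eventually hS)) hf hf'
  refine ⟨φ.trans e, trans_mem_maximalAtlas hφ h4, ⟨hx, h1⟩, fun z => h3 _, fun z hz => ?_⟩
  have h5 : R (φ z) ∧ S (φ.symm (φ z)) := h2 hz.2
  rw [φ.left_inv hz.1] at h5
  exact ⟨hz.1, h5⟩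

section DevAtlas

variable {X : Type} [MetricSpace X] [ChartedSpace ℂ X]

/-- The logarithmic coordinates defined by the composition of the developing map with a Möbius
transformation. -/
def devAtlas (Q : ℂ → X) (Φ : ℂ → X → RS) (M : Equiv.Perm RS) : Set (OpenPartialHomeomorph X ℂ) :=
  {l | l ∈ IsManifold.maximalAtlas 𝓘(ℂ) ω X ∧ ∀ x ∈ l.source, ∃ y, Q y = x ∧
    ∀ᶠ z in 𝓝 x, M (Φ y z) = (Complex.exp (l z) : ℂ)}

/-- A coordinate whose `θ`-th power is the composition of the developing map with a Möbius
transformation. -/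
structure PoleChart (Q : ℂ → X) (Φ : ℂ → X → RS) (M : Equiv.Perm RS)
    (φ : OpenPartialHomeomorph X ℂ) (x : X) (θ : ℝ) : Prop where
  mem_atlas : φ ∈ IsManifold.maximalAtlas 𝓘(ℂ) ω X
  mem : x ∈ φ.source
  zero : φ x = 0
  eq_branch : ∀ x' ∈ φ.source, x' ≠ x → ∃ y, Q y = x' ∧ ∃ B : ℂ, B ≠ 0 ∧
    ∀ᶠ z in 𝓝 x', M (Φ y z) = (branch θ B (φ x') (φ z) : ℂ)

variable {p q : X} {Q : ℂ → X} {Φ : ℂ → X → RS} {g M M' : Equiv.Perm RS}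

lemma IsDeveloping.near (D : IsDeveloping p q Q Φ g) (y : ℂ) : ∀ᶠ x in 𝓝 (Q y), ∃ y', Q y' = x ∧
    ∀ᶠ z in 𝓝 x, Φ y z = Φ y' z := by
  filter_upwards [D.isOpenMap.image_mem_nhds (D.loc y)]
  rintro _ ⟨y', h, rfl⟩
  exact ⟨y', rfl, h⟩

/-- Two lifts of a point differ by a deck translation, which changes the normalized developing map
by a power of the monodromy, that is, by a power of `u`. -/
lemma IsDeveloping.exp_eq (D : IsDeveloping p q Q Φ g) {u : ℂ}
    (hu : ∀ v : ℂ, (M * g * M⁻¹) (v : RS) = (u * v : ℂ)) {l l' : OpenPartialHomeomorph X ℂ}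
    (hl : l ∈ devAtlas Q Φ M) (hl' : l' ∈ devAtlas Q Φ M) {x : X} (hx : x ∈ l.source)
    (hx' : x ∈ l'.source) : ∃ n : ℤ, ∀ᶠ z in 𝓝 x,
      Complex.exp (l' z) = u ^ n * Complex.exp (l z) := by
  obtain ⟨y, rfl, hy⟩ := hl.2 x hx
  obtain ⟨y', hyy', hy'⟩ := hl'.2 (Q y) hx'
  obtain ⟨n, hn⟩ := D.exists_zpow hyy'.symm
  have hu0 : u ≠ 0 := by
    rintro rfl
    have h1 : (M * g * M⁻¹) ((1 : ℂ) : RS) = (M * g * M⁻¹) ((2 : ℂ) : RS) := by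
      rw [hu, hu, zero_mul, zero_mul]
    have := (M * g * M⁻¹).injective h1
    rw [OnePoint.coe_eq_coe] at this
    norm_num at this
  have hun : ∀ (n : ℤ) (v : ℂ), ((M * g * M⁻¹) ^ n) (v : RS) = (u ^ n * v : ℂ) := by
    intro n
    induction n using Int.induction_on with
    | zero => simp
    | succ n ih =>
      intro v
      rw [zpow_add_one, Equiv.Perm.mul_apply, hu, ih, zpow_add_one₀ hu0, mul_assoc]
    | pred n ih =>
      intro v
      have h1 : (M * g * M⁻¹)⁻¹ (v : RS) = (u⁻¹ * v : ℂ) := by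
        rw [Equiv.Perm.inv_eq_iff_eq, hu, mul_inv_cancel_left₀ hu0]
      rw [zpow_sub_one, Equiv.Perm.mul_apply, h1, ih, zpow_sub_one₀ hu0, mul_assoc]
  refine ⟨n, ?_⟩
  filter_upwards [hy, hy', hn] with z h1 h2 h3
  rw [← OnePoint.coe_eq_coe, ← hun, ← h1, ← h2, h3, conj_zpow]
  simp

/-- Constant factors of the developing map become additive constants of its logarithm: this is the
well-defined one-form d log(M ∘ dev). -/
lemma IsDeveloping.isTranslationAtlas (D : IsDeveloping p q Q Φ g) {u : ℂ}
    (hu : ∀ v : ℂ, (M * g * M⁻¹) (v : RS) = (u * v : ℂ)) : IsTranslationAtlas (devAtlas Q Φ M) := by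
  intro l hl l' hl' x hx hx'
  obtain ⟨n, hn⟩ := D.exp_eq hu hl' hl hx' hx
  have h1 : ContinuousAt (fun z => (l z - l' z) - (l x - l' x)) x :=
    ((l.continuousAt hx).sub (l'.continuousAt hx')).sub continuousAt_const
  filter_upwards [eventually_eq_zero_of_exp h1 (sub_self _) (by
    filter_upwards [hn] with z hz
    rw [Complex.exp_sub, Complex.exp_sub, Complex.exp_sub, hz, hn.self_of_nhds]
    have h2 := hn.self_of_nhds
    have h3 : u ^ n ≠ 0 := fun h0 => Complex.exp_ne_zero (l x) (by rw [h2, h0, zero_mul])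
    have h4 := Complex.exp_ne_zero (l' x)
    have h5 := Complex.exp_ne_zero (l' z)
    field_simp)] with z hz
  exact sub_eq_zero.1 hz

/-- Logarithmic coordinates exist where the map avoids `0` and `∞`. -/
lemma IsDeveloping.mem_chartDom (D : IsDeveloping p q Q Φ g) (hM : IsMob M) {y : ℂ}
    (h0 : M (Φ y (Q y)) ≠ ((0 : ℂ) : RS)) (hi : M (Φ y (Q y)) ≠ OnePoint.infty) :
    Q y ∈ chartDom (devAtlas Q Φ M) := by
  obtain ⟨φ, A, hφ, hA, hΦ⟩ := D.chart y
  rw [hΦ, hφ.zero] at h0 hi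
  obtain ⟨f, hf, hf', hfe⟩ := (hM.mul hA.1).exists_log h0 hi
  obtain ⟨l, hl, hml, hle, hls⟩ := exists_chart_comp hφ.mem_atlas hφ.mem hφ.zero hf hf'
    hfe.eventually_nhds (D.near y)
  refine ⟨l, ⟨hl, fun x hx => ?_⟩, hml⟩
  obtain ⟨h1, h2, y', rfl, h3⟩ := hls x hx
  refine ⟨y', rfl, ?_⟩
  filter_upwards [h3, (φ.continuousAt h1).eventually h2]  with z h4 h5
  rw [← h4, hΦ, hle, ← h5]
  rfl

/-- Simple zeros. -/
lemma IsDeveloping.exists_poleChart (D : IsDeveloping p q Q Φ g) (hM : IsMob M) {y : ℂ}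
    (h0 : M (Φ y (Q y)) = ((0 : ℂ) : RS)) : ∃ φ, PoleChart Q Φ M φ (Q y) 1 := by
  obtain ⟨φ, A, hφ, hA, hΦ⟩ := D.chart y
  rw [hΦ, hφ.zero] at h0
  obtain ⟨a, b, ha, hab, -⟩ := (hM.mul hA.1).exists_of_fix_zero h0
  have hd : HasDerivAt (fun v : ℂ => v / (1 + b * v)) 1 0 := by
    have h1 : HasDerivAt (fun v : ℂ => 1 + b * v) b 0 := by
      simpa using ((hasDerivAt_id (0 : ℂ)).const_mul b).const_add 1
    simpa using (hasDerivAt_id (0 : ℂ)).fun_div h1 (by simp)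
  have hf : AnalyticAt ℂ (fun v : ℂ => v / (1 + b * v)) 0 :=
    analyticAt_id.div (by fun_prop) (by simp)
  have hne : ∀ᶠ v : ℂ in 𝓝 0, 1 + b * v ≠ 0 := by
    have : ContinuousAt (fun v : ℂ => 1 + b * v) 0 := by fun_prop
    exact this.eventually_ne (by simp)
  have hd' : deriv (fun v : ℂ => v / (1 + b * v)) 0 ≠ 0 := by rw [hd.deriv]; exact one_ne_zero
  obtain ⟨ψ, h1, h2, h3, h4⟩ := exists_chart_comp hφ.mem_atlas hφ.mem hφ.zero hf hd'
    hne.eventually_nhds (D.near y)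
  have hz : ψ (Q y) = 0 := by rw [h3, hφ.zero]; simp
  refine ⟨ψ, h1, h2, hz, fun x hx hxy => ?_⟩
  obtain ⟨h5, h6, y', rfl, h7⟩ := h4 x hx
  have hx0 : ψ (Q y') ≠ 0 := fun h => hxy (ψ.injOn hx h2 (h.trans hz.symm))
  refine ⟨y', rfl, a * ψ (Q y'), mul_ne_zero ha hx0, ?_⟩
  filter_upwards [h7, (φ.continuousAt h5).eventually h6, (ψ.continuousAt hx).eventually_ne hx0]
    with z h8 h9 h10
  rw [← h8, hΦ]
  refine (hab _ h9).trans ?_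
  rw [mul_div_assoc, ← h3, branch, Complex.ofReal_one, one_mul, Complex.exp_log (div_ne_zero h10 hx0),
    mul_assoc, mul_div_cancel₀ _ hx0]

/-- The logarithm of the normalized developing map is σ (log B + θ log φ) up to a constant, so its
differential has residue σθ. The sign σ = −1 serves the points over ∞, which become zeros after an
inversion. -/
lemma PoleChart.isPole (D : IsDeveloping p q Q Φ g) {φ : OpenPartialHomeomorph X ℂ} {x : X} {θ : ℝ}
    (h : PoleChart Q Φ M' φ x θ) (hθ : 0 < θ) {σ : ℝ} (hσ : σ * σ = 1)
    (hM : ∀ (v : RS) (ζ : ℂ), M' v = (Complex.exp ζ : ℂ) → M v = (Complex.exp (σ * ζ) : ℂ)) :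
    IsPole (devAtlas Q Φ M) x φ (σ / θ) := by
  have hσ0 : σ ≠ 0 := left_ne_zero_of_mul_eq_one hσ
  refine ⟨div_ne_zero hσ0 hθ.ne', h.mem, h.zero, fun x' hx' hne => ?_⟩
  obtain ⟨y, rfl, B, hB, hy⟩ := h.eq_branch x' hx' hne
  have hv0 : φ (Q y) ≠ 0 := fun h0 => hne (φ.injOn hx' h.mem (by rw [h0, h.zero]))
  set v₀ := φ (Q y) with hv₀
  have hsl := eventually_div_mem_slitPlane hv0
  have hd : HasDerivAt (fun v : ℂ => (σ : ℂ) * (Complex.log B + θ * Complex.log (v / v₀)))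
      (σ * (θ * (1 / v₀ / (v₀ / v₀)))) v₀ :=
    (((((hasDerivAt_id v₀).div_const v₀).clog hsl.self_of_nhds).const_mul (θ : ℂ)).const_add
      (Complex.log B)).const_mul (σ : ℂ)
  have hf : AnalyticAt ℂ (fun v : ℂ => (σ : ℂ) * (Complex.log B + θ * Complex.log (v / v₀))) v₀ := by
    have h1 : AnalyticAt ℂ (fun v : ℂ => v / v₀) v₀ := analyticAt_id.div_const
    exact analyticAt_const.mul (analyticAt_const.add
      (analyticAt_const.mul (h1.clog hsl.self_of_nhds)))
  have hd' : deriv (fun v : ℂ => (σ : ℂ) * (Complex.log B + θ * Complex.log (v / v₀))) v₀ ≠ 0 := by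
    rw [hd.deriv]
    have h1 : (σ : ℂ) ≠ 0 := by exact_mod_cast hσ0
    have h2 : (θ : ℂ) ≠ 0 := by exact_mod_cast hθ.ne'
    exact mul_ne_zero h1 (mul_ne_zero h2 (div_ne_zero (one_div_ne_zero hv0) (div_ne_zero hv0 hv0)))
  obtain ⟨l, hl, hml, hle, hls⟩ := exists_chart_comp h.mem_atlas hx' rfl hf hd' (R := fun _ => True)
    (.of_forall fun _ => trivial) ((D.near y).and hy.eventually_nhds)
  refine ⟨l, ⟨hl, fun x'' hx'' => ?_⟩, hml, Complex.exp (Complex.log B / θ) / v₀, ?_⟩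
  · obtain ⟨-, -, ⟨y', rfl, h3⟩, h4⟩ := hls x'' hx''
    refine ⟨y', rfl, ?_⟩
    filter_upwards [h3, h4] with z h5 h6
    rw [← h5, hle]
    refine hM _ _ ?_
    rw [h6, branch, Complex.exp_add, Complex.exp_log hB]
  · filter_upwards [(φ.continuousAt hx').eventually hsl] with z hz
    have h2 : (θ : ℂ) ≠ 0 := by exact_mod_cast hθ.ne'
    have h3 : (σ : ℂ) * σ = 1 := by exact_mod_cast hσ
    have e : ((σ / θ : ℝ) : ℂ) * l z = Complex.log B / θ + Complex.log (φ z / v₀) := by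
      rw [hle]
      push_cast
      field_simp
      linear_combination (Complex.log B + θ * Complex.log (φ z / v₀)) * h3
    rw [e, Complex.exp_add, Complex.exp_log (Complex.slitPlane_ne_zero hz)]
    ring

end DevAtlas

section ConePole

variable {X : Type} [MetricSpace X] [ChartedSpace ℂ X] [IsManifold 𝓘(ℂ) ω X]
  {p q : X} {Q : ℂ → X} {Φ : ℂ → X → RS}
  {g : Equiv.Perm RS} (D : IsDeveloping p q Q Φ g) {w : OpenPartialHomeomorph X ℂ} {x₀ : X} {θ : ℝ}
  {T : Set ℂ} (N : ConeNbhd Q w x₀ θ T)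
include D N

/-- The composition M K fixes 0, hence is v ↦ a v / (1 + b v), and `exists_root_chart` extracts a
θ-th root. If c = 0, it also fixes ∞, so b = 0 and the branch of the power does not matter.
Otherwise θ is an integer, `K` is common to all lifts, and so is `b`. -/
lemma ConeNbhd.exists_poleChart {P P' : RS} (h : ∀ y ∈ T, ∀ κ : ℂ, ‖κ‖ = ‖w (Q y)‖ ^ θ →
    ∃ K, IsRot K ∧ Germ Q Φ w θ y κ K ∧ K ((0 : ℂ) : RS) = P ∧ K OnePoint.infty = P')
    {M : Equiv.Perm RS} (hM : IsMob M) (h0 : M P = ((0 : ℂ) : RS)) {c : ℝ}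
    (hc : c = 0 → M P' = OnePoint.infty) (hi : c = 0 ∨ ∃ m : ℕ, θ = m) :
    ∃ φ, PoleChart Q Φ M φ x₀ θ := by
  have key : ∃ b : ℂ, (c = 0 → b = 0) ∧ ∀ y ∈ T, ∃ κ K a, Compat θ c (w (Q y)) κ ∧
      Germ Q Φ w θ y κ K ∧ a ≠ 0 ∧
      ∀ v : ℂ, 1 + b * v ≠ 0 → (M * K) (v : RS) = (a * v / (1 + b * v) : ℂ) := by
    by_cases hc0 : c = 0
    · refine ⟨0, fun _ => rfl, fun y hy => ?_⟩
      have hn : ‖((‖w (Q y)‖ ^ θ : ℝ) : ℂ)‖ = ‖w (Q y)‖ ^ θ := by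
        rw [Complex.norm_real, Real.norm_of_nonneg (by positivity)]
      obtain ⟨K, h1, h2, h3, h4⟩ := h y hy _ hn
      obtain ⟨a, b, ha, hab, hb⟩ := (hM.mul h1.1).exists_of_fix_zero (by
        rw [Equiv.Perm.mul_apply, h3, h0])
      rw [hb (by rw [Equiv.Perm.mul_apply, h4, hc hc0])] at hab
      exact ⟨_, K, a, ⟨hn, .inl hc0⟩, h2, ha, hab⟩
    · obtain ⟨m, hm⟩ := hi.resolve_left hc0
      obtain ⟨K, h1, h2⟩ := N.exists_nat D hm
      obtain ⟨y₀, hy₀⟩ := N.nonempty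
      have hn : ∀ y, ‖w (Q y) ^ m‖ = ‖w (Q y)‖ ^ θ := fun y => by rw [norm_pow, hm, rpow_natCast]
      obtain ⟨K', h1', h2', h3, -⟩ := h y₀ hy₀ _ (hn y₀)
      have hKK := N.germ_unique D hy₀ (hn y₀) h1' h1 h2' (h2 y₀ hy₀)
      obtain ⟨a, b, ha, hab, -⟩ := (hM.mul h1.1).exists_of_fix_zero (by
        rw [Equiv.Perm.mul_apply, ← hKK, h3, h0])
      exact ⟨b, fun h => absurd h hc0, fun y hy =>
        ⟨_, K, a, ⟨hn y, .inr ⟨m, hm, rfl⟩⟩, h2 y hy, ha, hab⟩⟩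
  obtain ⟨b, hb, hk⟩ := key
  obtain ⟨f, hf, hf0, hf', hfe⟩ := exists_root_chart N.pos hi hb
  have hw0 := N.chart.zero
  obtain ⟨ψ, h1, h2, h3, h4⟩ := exists_chart_comp N.chart.mem_atlas N.chart.mem N.chart.zero hf hf'
    hfe (N.cover.and N.exists_lift)
  have hz : ψ x₀ = 0 := by rw [h3, hw0, hf0]
  refine ⟨ψ, h1, h2, hz, fun x hx hxy => ?_⟩
  obtain ⟨h5, h6, h7, h8⟩ := h4 x hx
  obtain ⟨y, rfl⟩ := h8 hxy
  have hy := h7 y rfl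
  obtain ⟨κ, K, a, hκ, hG, ha, hab⟩ := hk y hy
  have hu0 := N.ne_zero hy
  obtain ⟨h9, -, h10⟩ := h6 hu0
  obtain ⟨h11, -, h12⟩ := h10 κ hκ
  refine ⟨y, rfl, a * (κ / (1 + b * κ)), mul_ne_zero ha (div_ne_zero (hκ.ne_zero hu0) h11), ?_⟩
  have hbr := (analyticAt_branch θ κ (eventually_div_mem_slitPlane hu0).self_of_nhds).continuousAt
  have hne : ∀ᶠ v in 𝓝 (w (Q y)), 1 + b * branch θ κ (w (Q y)) v ≠ 0 := by
    have : ContinuousAt (fun v => 1 + b * branch θ κ (w (Q y)) v) (w (Q y)) := by fun_prop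
    exact this.eventually_ne (by rwa [branch_self θ κ hu0])
  filter_upwards [hG, (w.continuousAt h5).eventually h12, (w.continuousAt h5).eventually hne]
    with z h13 h14 h15
  rw [h13]
  refine (hab _ h15).trans ?_
  rw [branch_mul, h3, h3, h14, mul_div_assoc]

end ConePole

/-! ### Classification: the flow -/

/-- The inversion as a rotation. -/
lemma isRot_inv : IsRot invHomeo.toEquiv := by
  obtain ⟨r, hr, h1, h2, h3, h4⟩ := exists_mob (a := 0) (b := Complex.I)
    (c := -(starRingEnd ℂ) Complex.I) (d := (starRingEnd ℂ) 0) (by simp)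
  have h := isRot_of_coeff (by simp) hr h1 h2 h3 h4
  have e : invHomeo.toEquiv = r := by
    ext x
    change invFun x = r x
    induction x using OnePoint.rec with
    | infty => rw [h4 (by simp)]; simp
    | coe z =>
      by_cases hz : z = 0
      · rw [h1 z (by simp [hz]), hz, invFun_zero]
      · rw [h2 z (by simp [hz]), invFun_coe hz]
        congr 1
        simp only [map_zero, add_zero, zero_mul, zero_add, Complex.conj_I, neg_neg]
        rw [← div_div, div_self Complex.I_ne_zero, one_div]
  exact e ▸ h

section ConeNbhds

variable {X : Type} [MetricSpace X] [ChartedSpace ℂ X] {p q : X} {Q : ℂ → X} {Φ : ℂ → X → RS}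
  {g : Equiv.Perm RS} (D : IsDeveloping p q Q Φ g)
include D

lemma IsDeveloping.ne (y : ℂ) : Q y ≠ p ∧ Q y ≠ q := by
  have : Q y ∈ ({p, q}ᶜ : Set X) := D.range ▸ ⟨y, rfl⟩
  simpa [not_or] using this

lemma IsDeveloping.coneNbhd_left (hpq : p ≠ q) {w : OpenPartialHomeomorph X ℂ} {θ : ℝ}
    (hw : IsoChart w p θ) (hθ : 0 < θ) : ∃ T, ConeNbhd Q w p θ T := by
  have h1 : Filter.Tendsto (fun x : X => (x, x)) (𝓝 p) (𝓝 (p, p)) :=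
    (Continuous.prodMk continuous_id continuous_id).tendsto p
  obtain ⟨ρ, hρ⟩ := D.left _ (Filter.inter_mem (w.open_source.mem_nhds hw.mem)
    (h1.eventually hw.isometric.eventually_nhds))
  refine ⟨{y | y.re < ρ}, hw, hθ, isOpen_lt Complex.continuous_re continuous_const,
    (convex_halfSpace_re_lt ρ).isPreconnected, fun y hy => ?_, fun y hy => ?_, D.near_left ρ, ?_,
    ⟨((ρ - 1 : ℝ) : ℂ), ?_⟩⟩
  · simpa using hy
  · exact ⟨(hρ y hy).1, (D.ne y).1, (hρ y hy).2⟩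
  · filter_upwards [isOpen_ne.mem_nhds hpq] with x hx hxp
    have : x ∈ Set.range Q := by rw [D.range]; simp [hxp, hx]
    exact this
  · change ((ρ - 1 : ℝ) : ℂ).re < ρ
    rw [Complex.ofReal_re]; linarith

lemma IsDeveloping.coneNbhd_right (hpq : p ≠ q) {w : OpenPartialHomeomorph X ℂ} {θ : ℝ}
    (hw : IsoChart w q θ) (hθ : 0 < θ) : ∃ T, ConeNbhd Q w q θ T := by
  have h1 : Filter.Tendsto (fun x : X => (x, x)) (𝓝 q) (𝓝 (q, q)) :=
    (Continuous.prodMk continuous_id continuous_id).tendsto q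
  obtain ⟨ρ, hρ⟩ := D.right _ (Filter.inter_mem (w.open_source.mem_nhds hw.mem)
    (h1.eventually hw.isometric.eventually_nhds))
  refine ⟨{y | ρ < y.re}, hw, hθ, isOpen_lt continuous_const Complex.continuous_re,
    (convex_halfSpace_re_gt ρ).isPreconnected, fun y hy => ?_, fun y hy => ?_, D.near_right ρ, ?_,
    ⟨((ρ + 1 : ℝ) : ℂ), ?_⟩⟩
  · simpa using hy
  · exact ⟨(hρ y hy).1, (D.ne y).2, (hρ y hy).2⟩
  · filter_upwards [isOpen_ne.mem_nhds hpq.symm] with x hx hxp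
    have : x ∈ Set.range Q := by rw [D.range]; simp [hxp, hx]
    exact this
  · change ρ < ((ρ + 1 : ℝ) : ℂ).re
    rw [Complex.ofReal_re]; linarith

variable {M : Equiv.Perm RS} (hM : IsMob M) {φ ψ : OpenPartialHomeomorph X ℂ} {a b : ℝ}
  (hp : IsPole (devAtlas Q Φ M) p φ a) (hq : IsPole (devAtlas Q Φ M) q ψ b)
include hM hp hq

/-- All points outside the domain of the logarithmic coordinates are poles. -/
lemma IsDeveloping.exists_isPole (x : X) (hx : x ∉ chartDom (devAtlas Q Φ M)) :
    ∃ z c, IsPole (devAtlas Q Φ M) x z c := by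
  by_cases hxp : x = p
  · exact ⟨_, _, hxp ▸ hp⟩
  by_cases hxq : x = q
  · exact ⟨_, _, hxq ▸ hq⟩
  have hxQ : x ∈ Set.range Q := by rw [D.range]; simp [hxp, hxq]
  obtain ⟨y, rfl⟩ := hxQ
  by_cases h0 : M (Φ y (Q y)) = ((0 : ℂ) : RS)
  · obtain ⟨z, hz⟩ := D.exists_poleChart hM h0
    exact ⟨z, _, hz.isPole D one_pos (σ := 1) (one_mul 1) fun v ζ h => by simpa using h⟩
  by_cases hi : M (Φ y (Q y)) = OnePoint.infty
  · obtain ⟨z, hz⟩ := D.exists_poleChart (M := invHomeo.toEquiv * M) (isRot_inv.1.mul hM) (y := y)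
      (by rw [Equiv.Perm.mul_apply, hi]; rfl)
    refine ⟨z, _, hz.isPole D one_pos (σ := -1) (by norm_num) fun v ζ h => ?_⟩
    have h1 : invFun (invFun (M v)) = invFun (Complex.exp ζ : ℂ) := congrArg invFun h
    rw [invFun_invFun, invFun_coe (Complex.exp_ne_zero _)] at h1
    rw [h1, ← Complex.exp_neg]
    simp
  · exact absurd (D.mem_chartDom hM h0 hi) hx

/-- Poles are isolated in a compact space, hence finite in number; their lifts form a countable
subset of the plane, whose complement is connected. -/
lemma IsDeveloping.chartDom_connected [CompactSpace X] :
    IsConnected (chartDom (devAtlas Q Φ M)) := by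
  set L := devAtlas Q Φ M with hL
  have hopen : IsOpen (chartDom L) := by
    have : chartDom L = ⋃ l ∈ L, l.source := by ext x; simp [chartDom]
    rw [this]
    exact isOpen_biUnion fun l _ => l.open_source
  have hfin : (chartDom L)ᶜ.Finite := by
    refine hopen.isClosed_compl.isCompact.finite (isDiscrete_iff_forall_mem_exists_isOpen.2 fun x hx => ?_)
    obtain ⟨z, c, hz⟩ := D.exists_isPole hM hp hq x hx
    refine ⟨z.source, z.open_source, subset_antisymm ?_ (by simpa using ⟨hz.mem, hx⟩)⟩
    rintro y ⟨hy, hyL⟩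
    by_contra hne
    obtain ⟨l, hl, hyl, -⟩ := hz.exp y hy hne
    exact hyL ⟨l, hl, hyl⟩
  have hcount : (Q ⁻¹' (chartDom L)ᶜ).Countable := by
    have : Q ⁻¹' (chartDom L)ᶜ = ⋃ x ∈ (chartDom L)ᶜ, Q ⁻¹' {x} := by ext y; simp
    rw [this]
    refine hfin.countable.biUnion fun x _ => ?_
    by_cases hx : ∃ y, Q y = x
    · obtain ⟨y, rfl⟩ := hx
      refine (Set.countable_range fun n : ℤ => y + n * (2 * π * Complex.I)).mono ?_
      intro y' hy'
      obtain ⟨n, hn⟩ := D.exists_int y y' (Eq.symm hy')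
      exact ⟨n, hn.symm⟩
    · have : Q ⁻¹' {x} = ∅ := Set.eq_empty_of_forall_notMem fun y hy => hx ⟨y, hy⟩
      rw [this]
      exact Set.countable_empty
  have h1 := hcount.isConnected_compl_of_one_lt_rank (by rw [Complex.rank_real_complex]; norm_num)
  have h2 := h1.image Q D.continuous.continuousOn
  have h3 : Q '' (Q ⁻¹' (chartDom L)ᶜ)ᶜ = chartDom L := by
    rw [Set.preimage_compl, compl_compl, Set.image_preimage_eq_iff]
    rintro x ⟨l, hl, hx⟩
    obtain ⟨y, hy, -⟩ := hl.2 x hx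
    exact ⟨y, hy⟩
  rwa [h3] at h2

end ConeNbhds

/-- The distance in logarithmic coordinates. -/
lemma IsDeveloping.dist_eq {X : Type} [MetricSpace X] [ChartedSpace ℂ X] {p q : X} {Q : ℂ → X}
    {Φ : ℂ → X → RS} {g : Equiv.Perm RS} (D : IsDeveloping p q Q Φ g) {M : Equiv.Perm RS} {c : ℝ}
    (hMc : ∀ v v' : ℂ, fb 1 (M⁻¹ v) (M⁻¹ v') = chord c v v') {l : OpenPartialHomeomorph X ℂ}
    (hl : l ∈ devAtlas Q Φ M) {x : X} (hx : x ∈ l.source) : ∀ᶠ P : X × X in 𝓝 (x, x),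
      dist P.1 P.2 = chord c (Complex.exp (l P.1)) (Complex.exp (l P.2)) := by
  obtain ⟨y, rfl, hy⟩ := hl.2 x hx
  obtain ⟨φ, A, hφ, hA, hΦ⟩ := D.chart y
  filter_upwards [hφ.isometric, (continuous_fst.tendsto (Q y, Q y)).eventually hy,
    (continuous_snd.tendsto (Q y, Q y)).eventually hy] with P h1 h2 h3
  rw [h1, ← hMc, ← h2, ← h3, ← fb_coe, ← hA.2, ← hΦ, ← hΦ]
  simp

lemma chord_zero_mul (v ζ ζ' : ℂ) : chord 0 (v * ζ) (v * ζ') = chord 0 ((‖v‖ : ℂ) * ζ) (‖v‖ * ζ') := by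
  simp only [chord, hh, ← mul_sub, norm_mul, Complex.ofReal_zero, zero_mul, Complex.norm_real,
    norm_norm]

/-- A flow curve in which the distance is standard. -/
lemma IsDeveloping.exists_flow_dist {X : Type} [MetricSpace X] [ChartedSpace ℂ X] {p q : X}
    {Q : ℂ → X} {Φ : ℂ → X → RS} {g : Equiv.Perm RS} (D : IsDeveloping p q Q Φ g)
    {M : Equiv.Perm RS} {c : ℝ} (hMc : ∀ v v' : ℂ, fb 1 (M⁻¹ v) (M⁻¹ v') = chord c v v')
    {u : ℂ} (hu1 : ‖u‖ = 1) (huc : c ≠ 0 → u = 1)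
    (hu : ∀ v : ℂ, (M * g * M⁻¹) (v : RS) = (u * v : ℂ))
    {e : ℂ → X} (he : ∀ s, FlowAt (devAtlas Q Φ M) e s) :
    ∃ t : ℂ, ∀ s, ∀ᶠ P : ℂ × ℂ in 𝓝 (s, s), dist (e (P.1 + t)) (e (P.2 + t)) =
      chord c (Complex.exp P.1) (Complex.exp P.2) := by
  set L := devAtlas Q Φ M
  have hTL : IsTranslationAtlas L := D.isTranslationAtlas hu
  choose l hl hls hle using he
  -- For c = 0 a common factor matters only through its modulus, and for c ≠ 0 the factor `u` is 1;
  -- in both cases `J` removes the ambiguity by powers of `u`.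
  set J : ℂ → ℂ := fun v => if c = 0 then (‖v‖ : ℂ) else v with hJ
  have hJc : ∀ v ζ ζ', chord c (v * ζ) (v * ζ') = chord c (J v * ζ) (J v * ζ') := by
    intro v ζ ζ'
    by_cases hc : c = 0
    · rw [hJ, hc]
      simp only [if_true]
      exact chord_zero_mul v ζ ζ'
    · rw [hJ]
      simp only [if_neg hc]
  set I : ℂ → ℂ := fun s => Complex.exp (l s (e s) - s) with hI
  have hconst : ∀ s s', J (I s) = J (I s') := fun s s' => by
    refine eq_of_locally_const (T := Set.univ) isPreconnected_univ (f := fun s => J (I s)) ?_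
      (Set.mem_univ s) (Set.mem_univ s')
    intro s _
    filter_upwards [hle s] with s' h1 _
    obtain ⟨n, hn⟩ := D.exp_eq hu (hl s) (hl s') h1.1 (hls s')
    have h2 : I s' = u ^ n * I s := by
      rw [hI]
      simp only
      rw [Complex.exp_sub, hn.self_of_nhds, h1.2, mul_div_assoc, ← Complex.exp_sub]
      congr 2
      ring
    simp only [h2, hJ]
    by_cases hc : c = 0
    · simp only [if_pos hc, norm_mul, norm_zpow, hu1, one_zpow, one_mul]
    · simp only [if_neg hc, huc hc, one_zpow, one_mul]
  have hJ0 : J (I 0) ≠ 0 := by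
    rw [hJ]
    by_cases hc : c = 0
    · simp [hc, hI]
    · simp [hc, hI]
  -- This shift of time divides the exponential by the integration constant, which is thereby
  -- normalized to 1.
  refine ⟨-Complex.log (J (I 0)), fun s => ?_⟩
  set t := -Complex.log (J (I 0)) with ht
  have hec : ContinuousAt e (s + t) := FlowAt.continuousAt (L := L) ⟨_, hl _, hls _, hle _⟩
  have h1 : Filter.Tendsto (fun P : ℂ × ℂ => P.1 + t) (𝓝 (s, s)) (𝓝 (s + t)) :=
    (continuous_fst.add continuous_const).tendsto (s, s)
  have h2 : Filter.Tendsto (fun P : ℂ × ℂ => P.2 + t) (𝓝 (s, s)) (𝓝 (s + t)) :=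
    (continuous_snd.add continuous_const).tendsto (s, s)
  have h3 := (hec.tendsto.comp h1).prodMk_nhds (hec.tendsto.comp h2)
  filter_upwards [h3.eventually (D.dist_eq hMc (hl (s + t)) (hls (s + t))), h1.eventually (hle (s + t)),
    h2.eventually (hle (s + t))] with P h4 h5 h6
  have e1 : ∀ r : ℂ, l (s + t) (e (r + t)) = l (s + t) (e (s + t)) + (r + t - (s + t)) →
      Complex.exp (l (s + t) (e (r + t))) = I (s + t) * Complex.exp (r + t) := by
    intro r hr
    rw [hr, hI]
    simp only
    rw [← Complex.exp_add]
    congr 1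
    ring
  have e2 : ∀ r : ℂ, J (I 0) * Complex.exp (r + t) = Complex.exp r := fun r => by
    rw [ht, Complex.exp_add, Complex.exp_neg, Complex.exp_log hJ0]
    field_simp
  refine h4.trans ?_
  simp only [Function.comp]
  rw [e1 _ h5.2, e1 _ h6.2, hJc, hconst (s + t) 0, e2, e2]

/-! ### Classification: the isometry with the model -/

lemma mdifferentiableAt_of_charts {X Y : Type} [TopologicalSpace X] [ChartedSpace ℂ X]
    [IsManifold 𝓘(ℂ) ω X] [TopologicalSpace Y] [ChartedSpace ℂ Y] [IsManifold 𝓘(ℂ) ω Y]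
    {φ : OpenPartialHomeomorph X ℂ} (hφ : φ ∈ IsManifold.maximalAtlas 𝓘(ℂ) ω X)
    {ψ : OpenPartialHomeomorph Y ℂ} (hψ : ψ ∈ IsManifold.maximalAtlas 𝓘(ℂ) ω Y)
    {x : X} (hx : x ∈ φ.source) {h : ℂ → ℂ} (hh : DifferentiableAt ℂ h (φ x))
    (hy : h (φ x) ∈ ψ.target) {f : X → Y} (hf : ∀ᶠ z in 𝓝 x, f z = ψ.symm (h (φ z))) :
    MDifferentiableAt 𝓘(ℂ) 𝓘(ℂ) f x := by
  have h1 := (contMDiffAt_of_mem_maximalAtlas hφ hx).mdifferentiableAt (by simp)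
  have h2 := (contMDiffAt_symm_of_mem_maximalAtlas hψ hy).mdifferentiableAt (by simp)
  exact (h2.comp x (hh.mdifferentiableAt.comp x h1)).congr_of_eventuallyEq hf

section Model

variable {X : Type} [MetricSpace X] [ChartedSpace ℂ X] [IsManifold 𝓘(ℂ) ω X] [CompactSpace X]
  (hgeo : ∀ x y : X, ∃ γ : ℝ → X, γ 0 = x ∧ γ (dist x y) = y ∧
    ∀ s ∈ Set.Icc 0 (dist x y), ∀ t ∈ Set.Icc 0 (dist x y), dist (γ s) (γ t) = |s - t|)
  {L : Set (OpenPartialHomeomorph X ℂ)} {p q : X} {φ ψ : OpenPartialHomeomorph X ℂ} {θ c : ℝ}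
  {e : ℂ → X}

include hgeo

/-- A surface with a translation structure with two poles, in which the distance is that of the
model, is isometric to the model. -/
theorem exists_model_isometry (hLA : L ⊆ IsManifold.maximalAtlas 𝓘(ℂ) ω X)
    (hL : IsTranslationAtlas L) (hs : ∀ x, x ∉ chartDom L → ∃ z a, IsPole L x z a)
    (he : ∀ s, FlowAt L e s) (hr : Set.range e = chartDom L)
    (hφ : φ ∈ IsManifold.maximalAtlas 𝓘(ℂ) ω X) (hψ : ψ ∈ IsManifold.maximalAtlas 𝓘(ℂ) ω X)
    (hp : IsPole L p φ (1 / θ)) (hq : IsPole L q ψ (-(1 / θ))) (hpq : p ≠ q)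
    (hpd : p ∉ chartDom L) (hqd : q ∉ chartDom L) (h : ModelPar θ c)
    (hd : ∀ s, ∀ᶠ P : ℂ × ℂ in 𝓝 (s, s), dist (e P.1) (e P.2) =
      chord c (Complex.exp P.1) (Complex.exp P.2)) :
    ∃ F : RS ≃ₜ X, F ((0 : ℂ) : RS) = p ∧ F OnePoint.infty = q ∧
      (∀ x y, dist (F x) (F y) = confDist (density θ c) x y) ∧
      MDifferentiable 𝓘(ℂ) 𝓘(ℂ) F ∧ MDifferentiable 𝓘(ℂ) 𝓘(ℂ) F.symm := by
  obtain ⟨F, F0, Fi, Fe, ⟨C, hC, hFC⟩, C', hC', hFC'⟩ :=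
    exists_sphere_homeo hL hs he hr hp hq hpq hpd hqd
  have hθ : (θ : ℂ) ≠ 0 := by exact_mod_cast h.pos.ne'
  have H := h.isConf
  -- the coordinate near a regular point
  have hu : ∀ {u : ℂ}, u ≠ 0 → ∃ s₀ : ℂ, Complex.exp (s₀ / θ) = u ∧ Compat θ c u (Complex.exp s₀) ∧
      F u = e s₀ ∧ ∀ᶠ v : ℂ in 𝓝 u, F v = e (s₀ + θ * Complex.log (v / u)) := by
    intro u hu
    have e0 : Complex.exp (θ * Complex.log u / θ) = u := by
      rw [mul_div_cancel_left₀ _ hθ, Complex.exp_log hu]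
    have key : ∀ s : ℂ, F (Complex.exp (s / θ) : ℂ) = e s := fun s => by
      rw [← Fe]
      congr 3
      push_cast
      field_simp
    refine ⟨θ * Complex.log u, e0, ?_, ?_, ?_⟩
    · have := compat_cpow h hu
      rwa [Complex.cpow_def_of_ne_zero hu, mul_comm] at this
    · rw [← key, e0]
    · filter_upwards [isOpen_ne.mem_nhds hu] with v hv
      rw [← key]
      congr 2
      rw [add_div, Complex.exp_add, e0, mul_div_cancel_left₀ _ hθ,
        Complex.exp_log (div_ne_zero hv hu), mul_div_cancel₀ _ hu]
  -- With u = exp(s/θ), exp s is a value of u ^ θ, so the distance along the flow and that of the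
  -- model are given by the same chordal formula.
  have hloc : ∀ {u : ℂ}, u ≠ 0 → ∀ᶠ P : RS × RS in 𝓝 ((u : RS), (u : RS)),
      dist (F P.1) (F P.2) = confDist (density θ c) P.1 P.2 := by
    intro u hu0
    obtain ⟨s₀, h1, h2, h3, h4⟩ := hu hu0
    have h5 := h.confDist_near hu0 h2
    have h6 : Filter.Tendsto (fun v : ℂ => s₀ + θ * Complex.log (v / u)) (𝓝 u) (𝓝 s₀) := by
      simpa using (tendsto_const_nhds (x := s₀)).add ((tendsto_log_div hu0).const_mul (θ : ℂ))
    have h7 := (h6.comp (continuous_fst.tendsto (u, u))).prodMk_nhds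
      (h6.comp (continuous_snd.tendsto (u, u)))
    have h8 : ∀ᶠ P : ℂ × ℂ in 𝓝 (u, u), dist (F P.1) (F P.2) =
        confDist (density θ c) P.1 P.2 := by
      filter_upwards [h5, h7.eventually (hd s₀), (continuous_fst.tendsto (u, u)).eventually h4,
        (continuous_snd.tendsto (u, u)).eventually h4] with P h9 h10 h11 h12
      rw [h9, h11, h12]
      simp only [Function.comp, Complex.exp_add] at h10
      exact h10
    have h9 : IsOpenMap (Prod.map ((↑) : ℂ → RS) ((↑) : ℂ → RS)) :=
      OnePoint.isOpenEmbedding_coe.isOpenMap.prodMap OnePoint.isOpenEmbedding_coe.isOpenMap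
    have h10 := h9.image_mem_nhds h8
    filter_upwards [h10]
    rintro _ ⟨P, hP, rfl⟩
    exact hP
  have hFin : ({((0 : ℂ) : RS), OnePoint.infty} : Set RS).Finite := by simp
  have hne : ∀ x : RS, x ∉ ({((0 : ℂ) : RS), OnePoint.infty} : Set RS) → ∃ u : ℂ, u ≠ 0 ∧ ↑u = x := by
    intro x hx
    have hx' : x ≠ OnePoint.infty := fun h => hx (.inr h)
    obtain ⟨u, rfl⟩ := OnePoint.ne_infty_iff_exists.1 hx'
    exact ⟨u, fun h => hx (.inl (by rw [h])), rfl⟩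
  have hdist : ∀ x y, dist (F x) (F y) = confDist (density θ c) x y := by
    intro x y
    refine le_antisymm ?_ ?_
    · refine dist_le_of_local (d := confDist (density θ c)) (d' := dist) H.continuous_confDist
        H.confDist_nonneg (fun _ _ => H.eq_of_confDist_eq_zero) H.exists_geodesic continuous_dist
        dist_self dist_comm dist_triangle F.continuous hFin (fun x hx => ?_) x y
      obtain ⟨u, hu0, rfl⟩ := hne x hx
      exact LeNear.of_le ((hloc hu0).mono fun P hP => hP.le)
        (.of_forall fun P => H.confDist_nonneg _ _)
    -- The reverse inequality runs along geodesics of the given surface; this is where its distance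
    -- has to be intrinsic.
    · have := dist_le_of_local (d := dist) (d' := confDist (density θ c)) continuous_dist
        (fun _ _ => dist_nonneg) (fun _ _ => eq_of_dist_eq_zero) hgeo H.continuous_confDist
        H.confDist_self IsConf.confDist_comm H.confDist_triangle F.symm.continuous (hFin.image F)
        (fun x hx => ?_) (F x) (F y)
      · simpa using this
      · obtain ⟨u, hu0, hu'⟩ := hne (F.symm x) fun h' => hx ⟨_, h', F.apply_symm_apply x⟩
        have h1 : Filter.Tendsto (fun P : X × X => (F.symm P.1, F.symm P.2)) (𝓝 (x, x))
            (𝓝 (F.symm x, F.symm x)) :=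
          ((F.symm.continuous.comp continuous_fst).prodMk
            (F.symm.continuous.comp continuous_snd)).tendsto (x, x)
        rw [← hu'] at h1
        refine LeNear.of_le ((h1.eventually (hloc hu0)).mono fun P hP => ?_)
          (.of_forall fun P => dist_nonneg)
        rw [← hP]
        simp
  have hcz : ∀ u : ℂ, Filter.Tendsto chartZero (𝓝 (u : RS)) (𝓝 u) := fun u => by
    have := (chartZero.continuousAt (coe_mem_chartZero u)).tendsto
    rwa [chartZero_coe] at this
  have hci : Filter.Tendsto chartInfty (𝓝 OnePoint.infty) (𝓝 0) := by
    have := (chartInfty.continuousAt (mem_chartInfty.2 (OnePoint.infty_ne_coe _))).tendsto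
    rwa [chartInfty_infty] at this
  refine ⟨F, F0, Fi, hdist, fun x => ?_, fun x => ?_⟩
  · induction x using OnePoint.rec with
    | infty =>
      have hi : OnePoint.infty ∈ chartInfty.source := mem_chartInfty.2 (OnePoint.infty_ne_coe _)
      refine mdifferentiableAt_of_charts chartInfty_mem hψ hi (h := fun v => C' * v) (by fun_prop)
        (by rw [chartInfty_infty]; exact hFC'.self_of_nhds.1) ?_
      filter_upwards [hci.eventually hFC', chartInfty.open_source.mem_nhds hi] with z h1 h2
      rw [← h1.2, ← chartInfty_symm, chartInfty.left_inv h2]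
    | coe u =>
      by_cases hu0 : u = 0
      · subst hu0
        refine mdifferentiableAt_of_charts chartZero_mem hφ (coe_mem_chartZero 0)
          (h := fun v => C * v) (by fun_prop)
          (by rw [chartZero_coe]; exact hFC.self_of_nhds.1) ?_
        filter_upwards [(hcz 0).eventually hFC,
          chartZero.open_source.mem_nhds (coe_mem_chartZero 0)] with z h1 h2
        rw [← h1.2, ← chartZero_symm, chartZero.left_inv h2]
      · obtain ⟨s₀, h1, h2, h3, h4⟩ := hu hu0
        obtain ⟨l, hl, hls, hle⟩ := he s₀
        have h6 : Filter.Tendsto (fun v : ℂ => s₀ + θ * Complex.log (v / u)) (𝓝 u) (𝓝 s₀) := by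
          simpa using (tendsto_const_nhds (x := s₀)).add ((tendsto_log_div hu0).const_mul (θ : ℂ))
        have hda : DifferentiableAt ℂ (fun v : ℂ => l (e s₀) + θ * Complex.log (v / u)) u := by
          have := (differentiableAt_id.div_const u).clog
            (eventually_div_mem_slitPlane hu0).self_of_nhds
          exact (differentiableAt_const _).add ((differentiableAt_const _).mul this)
        refine mdifferentiableAt_of_charts chartZero_mem (hLA hl) (coe_mem_chartZero u)
          (h := fun v => l (e s₀) + θ * Complex.log (v / u)) (by rwa [chartZero_coe])
          (by rw [chartZero_coe, div_self hu0, Complex.log_one, mul_zero, add_zero]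
              exact l.map_source hls) ?_
        filter_upwards [(hcz u).eventually h4, (hcz u).eventually (h6.eventually hle),
          chartZero.open_source.mem_nhds (coe_mem_chartZero u)] with z h7 h8 h9
        rw [← chartZero_symm, chartZero.left_inv h9] at h7
        rw [h7]
        refine (l.eq_symm_apply h8.1 ?_).2 ?_
        · have := l.map_source h8.1
          rw [h8.2] at this
          simpa using this
        · rw [h8.2]; ring
  · have hxe : x = p ∨ x = q ∨ ∃ s, e s = x := by
      obtain ⟨v, rfl⟩ := F.surjective x
      by_cases hv : v ∈ ({((0 : ℂ) : RS), OnePoint.infty} : Set RS)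
      · rcases hv with rfl | hv
        · exact .inl F0
        · exact .inr (.inl (by rw [Set.mem_singleton_iff.1 hv, Fi]))
      · obtain ⟨u, hu0, rfl⟩ := hne v hv
        obtain ⟨s, -, -, h3, -⟩ := hu hu0
        exact .inr (.inr ⟨s, h3.symm⟩)
    rcases hxe with rfl | rfl | ⟨s, rfl⟩
    · have h1 : Filter.Tendsto (fun z => φ z / C) (𝓝 x) (𝓝 0) := by
        have := ((φ.continuousAt hp.mem).div_const C).tendsto
        rwa [hp.zero, zero_div] at this
      refine mdifferentiableAt_of_charts hφ chartZero_mem hp.mem (h := fun v => v / C) (by fun_prop)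
        (by rw [chartZero_target]; trivial) ?_
      filter_upwards [h1.eventually hFC, φ.open_source.mem_nhds hp.mem] with z h2 h3
      rw [F.symm_apply_eq, chartZero_symm, h2.2, mul_div_cancel₀ _ hC, φ.left_inv h3]
    · have h1 : Filter.Tendsto (fun z => ψ z / C') (𝓝 x) (𝓝 0) := by
        have := ((ψ.continuousAt hq.mem).div_const C').tendsto
        rwa [hq.zero, zero_div] at this
      refine mdifferentiableAt_of_charts hψ chartInfty_mem hq.mem (h := fun v => v / C')
        (by fun_prop) (by rw [chartInfty_target]; trivial) ?_
      filter_upwards [h1.eventually hFC', ψ.open_source.mem_nhds hq.mem] with z h2 h3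
      rw [F.symm_apply_eq, chartInfty_symm, h2.2, mul_div_cancel₀ _ hC', ψ.left_inv h3]
    · obtain ⟨l, hl, hls, hle⟩ := he s
      have h1 : Filter.Tendsto (fun z => s + (l z - l (e s))) (𝓝 (e s)) (𝓝 s) := by
        have h0 : ContinuousAt (fun z => s + (l z - l (e s))) (e s) :=
          continuousAt_const.add ((l.continuousAt hls).sub continuousAt_const)
        simpa only [sub_self, add_zero] using h0.tendsto
      refine mdifferentiableAt_of_charts (hLA hl) chartZero_mem hls
        (h := fun v => Complex.exp (((1 / θ : ℝ) : ℂ) * (s + (v - l (e s))))) (by fun_prop)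
        (by rw [chartZero_target]; trivial) ?_
      filter_upwards [h1.eventually hle, l.open_source.mem_nhds hls] with z h2 h3
      rw [F.symm_apply_eq, chartZero_symm, Fe]
      refine (l.injOn h2.1 h3 ?_).symm
      rw [h2.2]
      ring

end Model

/-! ### Classification -/

lemma IsRot.map_infty {A : Equiv.Perm RS} (hA : IsRot A) (h0 : A ((0 : ℂ) : RS) = ((0 : ℂ) : RS)) :
    A OnePoint.infty = OnePoint.infty := by
  obtain ⟨u, hu, h⟩ := hA.eq_mul h0
  exact fix_infty_of_mul (norm_ne_zero_iff.1 (hu ▸ one_ne_zero)) h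

lemma mobN_zero_eq_one : (mobN 0).toEquiv = 1 := by
  ext x
  change mobN 0 x = x
  rw [mobN_apply]
  simp only [Complex.ofReal_zero, add_zero]
  have : ∀ y : RS, OnePoint.map (fun z : ℂ => z) y = y := fun y => by
    induction y using OnePoint.rec <;> rfl
  rw [this, invFun_invFun]

/-- Normal form for a rotation with two given fixed points. -/
lemma IsRot.exists_conj {g : Equiv.Perm RS} (hg : IsRot g) {P P' : RS} (hP : g P = P)
    (hP' : g P' = P') (hne : P ≠ P') : ∃ c : ℝ, 0 ≤ c ∧ ∃ M : Equiv.Perm RS, IsMob M ∧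
      M P = ((0 : ℂ) : RS) ∧ M P' = OnePoint.infty ∧ (c = 0 → IsRot M) ∧ (c ≠ 0 → g = 1) ∧
      (∀ v v' : ℂ, fb 1 (M⁻¹ v) (M⁻¹ v') = chord c v v') ∧
      ∃ u : ℂ, ‖u‖ = 1 ∧ (c ≠ 0 → u = 1) ∧ ∀ v : ℂ, (M * g * M⁻¹) (v : RS) = (u * v : ℂ) := by
  obtain ⟨c, hc, r, hr, h0, h1⟩ := exists_rot_pair hne
  have hg0 : (r * g * r⁻¹) ((0 : ℂ) : RS) = ((0 : ℂ) : RS) := by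
    rw [← h0]; simp [hP]
  obtain ⟨u, hu1, hu⟩ := ((hr.mul hg).mul hr.inv).eq_mul hg0
  -- A rotation about 0 is multiplication by a unit; if it also fixes the finite point 1/c, the unit
  -- is 1.
  have hg1 : c ≠ 0 → g = 1 := by
    intro hc0
    have e1 : mobN c OnePoint.infty = ((c : ℂ)⁻¹ : ℂ) := by
      rw [mobN_apply, invFun_infty, OnePoint.map_some, zero_add,
        invFun_coe (Complex.ofReal_ne_zero.2 hc0)]
    have e2 : (r * g * r⁻¹) (mobN c OnePoint.infty) = mobN c OnePoint.infty := by
      rw [← h1]; simp [hP']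
    rw [e1, hu] at e2
    have e3 := OnePoint.coe_injective e2
    have e4 : u = 1 := by
      have : (c : ℂ)⁻¹ ≠ 0 := inv_ne_zero (Complex.ofReal_ne_zero.2 hc0)
      exact mul_right_cancel₀ this (by rw [e3, one_mul])
    have e5 : r * g * r⁻¹ = 1 := ((hr.mul hg).mul hr.inv).1.eq_one (z₀ := 0)
      (.of_forall fun z => by rw [hu, e4, one_mul])
    have e6 : g = r⁻¹ * (r * g * r⁻¹) * r := by group
    rw [e6, e5]; group
  have hM0 : c = 0 → ((mobN c).toEquiv)⁻¹ * r = r := by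
    rintro rfl
    rw [mobN_zero_eq_one]; group
  refine ⟨c, hc, ((mobN c).toEquiv)⁻¹ * r, (isMob_mobN c).inv.mul hr.1, ?_, ?_, ?_, hg1, ?_, ?_⟩
  · rw [Equiv.Perm.mul_apply, h0, Equiv.Perm.inv_eq_iff_eq]
    exact (mobN_zero c).symm
  · rw [Equiv.Perm.mul_apply, h1, Equiv.Perm.inv_eq_iff_eq]
    rfl
  · intro h; rw [hM0 h]; exact hr
  · intro v v'
    rw [mul_inv_rev, inv_inv, Equiv.Perm.mul_apply, Equiv.Perm.mul_apply, hr.inv.2]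
    exact fb_mobN c v v'
  · by_cases hc0 : c = 0
    · refine ⟨u, hu1, fun h => absurd hc0 h, fun v => ?_⟩
      rw [hM0 hc0]
      exact hu v
    · refine ⟨1, norm_one, fun _ => rfl, fun v => ?_⟩
      rw [hg1 hc0, mul_one, mul_inv_cancel, one_mul]
      rfl

section Classification

variable {X : Type} [MetricSpace X] [ChartedSpace ℂ X] [IsManifold 𝓘(ℂ) ω X] {p q : X}
  {Q : ℂ → X} {Φ : ℂ → X → RS} {g : Equiv.Perm RS}

omit [IsManifold 𝓘(ℂ) ω X] in
lemma ConeNbhd.map_infty {w : OpenPartialHomeomorph X ℂ} {x₀ : X} {θ : ℝ} {T : Set ℂ}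
    (N : ConeNbhd Q w x₀ θ T) {P P' : RS}
    (hP : ∀ y ∈ T, ∀ κ : ℂ, ‖κ‖ = ‖w (Q y)‖ ^ θ → ∃ K, IsRot K ∧ Germ Q Φ w θ y κ K ∧
      K ((0 : ℂ) : RS) = P ∧ K OnePoint.infty = P') {M : Equiv.Perm RS} (hM : IsRot M)
    (h0 : M P = ((0 : ℂ) : RS)) : M P' = OnePoint.infty := by
  obtain ⟨y, hy⟩ := N.nonempty
  obtain ⟨K, hK, -, rfl, rfl⟩ := hP y hy ((‖w (Q y)‖ ^ θ : ℝ) : ℂ) (by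
    rw [Complex.norm_real, Real.norm_of_nonneg (by positivity)])
  exact (hM.mul hK).map_infty h0

variable (D : IsDeveloping p q Q Φ g) [CompactSpace X]
include D

omit [IsManifold 𝓘(ℂ) ω X] in
/-- The residues of the two poles are opposite. -/
lemma IsDeveloping.exists_range_flow {M : Equiv.Perm RS} (hM : IsMob M)
    {φ ψ : OpenPartialHomeomorph X ℂ} {a b : ℝ} (hp : IsPole (devAtlas Q Φ M) p φ a)
    (hq : IsPole (devAtlas Q Φ M) q ψ b) {u : ℂ}
    (hu : ∀ v : ℂ, (M * g * M⁻¹) (v : RS) = (u * v : ℂ)) (hpq : p ≠ q) :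
    b = -a ∧ ∃ e, (∀ s, FlowAt (devAtlas Q Φ M) e s) ∧
      Set.range e = chartDom (devAtlas Q Φ M) := by
  have hL := D.isTranslationAtlas hu
  have hs := D.exists_isPole hM hp hq
  have hc := D.chartDom_connected hM hp hq
  obtain ⟨y, hy⟩ := hc.nonempty
  obtain ⟨e, -, he⟩ := exists_flow hL hs hy
  have hr := flow_range hL hs hc.isPreconnected he
  exact ⟨IsPole.eq_neg hL he hr hp hq hpq, e, he, hr⟩

/-- The values of the developing map at the cone points are fixed by the monodromy. Moved to 0 and
∞, they make its logarithm a translation structure with poles at the cone points, and the flow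
compares the surface with a model. -/
lemma IsDeveloping.exists_model (hgeo : ∀ x y : X, ∃ γ : ℝ → X, γ 0 = x ∧ γ (dist x y) = y ∧
      ∀ s ∈ Set.Icc 0 (dist x y), ∀ t ∈ Set.Icc 0 (dist x y), dist (γ s) (γ t) = |s - t|)
    (hpq : p ≠ q) {w w' : OpenPartialHomeomorph X ℂ} {θ θ' : ℝ} (hθ : 0 < θ) (hθ' : 0 < θ')
    (hw : IsoChart w p θ) (hw' : IsoChart w' q θ') :
    θ' = θ ∧ ∃ c, ModelPar θ c ∧ ∃ F : RS ≃ₜ X, F ((0 : ℂ) : RS) = p ∧ F OnePoint.infty = q ∧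
      (∀ x y, dist (F x) (F y) = confDist (density θ c) x y) ∧
      MDifferentiable 𝓘(ℂ) 𝓘(ℂ) F ∧ MDifferentiable 𝓘(ℂ) 𝓘(ℂ) F.symm := by
  obtain ⟨T, N⟩ := D.coneNbhd_left hpq hw hθ
  obtain ⟨T', N'⟩ := D.coneNbhd_right hpq hw' hθ'
  obtain ⟨P, R, hP⟩ := N.exists_value D
  obtain ⟨P', R', hP'⟩ := N'.exists_value D
  have hg := (N.fix_value D hP).1
  have hg' := (N'.fix_value D hP').1
  -- If both values were equal, rotating them to 0 would give positive residues at both cone points,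
  -- whereas different poles have opposite residues.
  by_cases hPP : P = P'
  · subst hPP
    exfalso
    obtain ⟨r, hr, h0⟩ := exists_rot_to_zero P
    have hg0 : (r * g * r⁻¹) ((0 : ℂ) : RS) = ((0 : ℂ) : RS) := by
      rw [← h0]; simp [hg]
    obtain ⟨u, hu1, hu⟩ := ((hr.mul D.rot).mul hr.inv).eq_mul hg0
    obtain ⟨φ, hφ⟩ := N.exists_poleChart D hP hr.1 h0 (c := 0)
      (fun _ => N.map_infty hP hr h0) (.inl rfl)
    obtain ⟨ψ, hψ⟩ := N'.exists_poleChart D hP' hr.1 h0 (c := 0)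
      (fun _ => N'.map_infty hP' hr h0) (.inl rfl)
    have h1 := (D.exists_range_flow hr.1
      (hφ.isPole D hθ (σ := 1) (one_mul 1) fun v ζ h => by simpa using h)
      (hψ.isPole D hθ' (σ := 1) (one_mul 1) fun v ζ h => by simpa using h) hu hpq).1
    have h2 : 0 < 1 / θ := by positivity
    have h3 : 0 < 1 / θ' := by positivity
    linarith
  obtain ⟨c, hc, M, hM, h0, hi, hM0, hg1, hMc, u, hu1, huc, hu⟩ := D.rot.exists_conj hg hg' hPP
  have hnat : c = 0 ∨ ∃ m : ℕ, θ = m := by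
    by_cases h : c = 0
    exacts [.inl h, .inr (N.exists_nat_eq D (hg1 h))]
  have hnat' : c = 0 ∨ ∃ m : ℕ, θ' = m := by
    by_cases h : c = 0
    exacts [.inl h, .inr (N'.exists_nat_eq D (hg1 h))]
  obtain ⟨φ, hφ⟩ := N.exists_poleChart D hP hM h0 (fun h => N.map_infty hP (hM0 h) h0) hnat
  -- At the second cone point the normalized developing map has a pole; an inversion makes it a
  -- zero, which is the case σ = −1.
  have h0' : (invHomeo.toEquiv * M) P' = ((0 : ℂ) : RS) := by
    rw [Equiv.Perm.mul_apply, hi]; rfl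
  obtain ⟨ψ, hψ⟩ := N'.exists_poleChart D hP' (isRot_inv.1.mul hM) h0'
    (fun h => N'.map_infty hP' (isRot_inv.mul (hM0 h)) h0') hnat'
  have hp := hφ.isPole D hθ (M := M) (σ := 1) (one_mul 1) fun v ζ h => by simpa using h
  have hq := hψ.isPole D hθ' (M := M) (σ := -1) (by norm_num) fun v ζ h => by
    have h1 : invFun (invFun (M v)) = invFun (Complex.exp ζ : ℂ) := congrArg invFun h
    rw [invFun_invFun, invFun_coe (Complex.exp_ne_zero _)] at h1
    rw [h1, ← Complex.exp_neg]
    simp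
  obtain ⟨h1, e, he, hr⟩ := D.exists_range_flow hM hp hq hu hpq
  have hθθ : θ' = θ := by
    field_simp at h1
    linarith
  refine ⟨hθθ, c, ⟨hθ, hc, hnat⟩, ?_⟩
  rw [hθθ, neg_div] at hq
  obtain ⟨t, ht⟩ := D.exists_flow_dist hMc hu1 huc hu he
  have hr' : Set.range (fun s => e (s + t)) = chartDom (devAtlas Q Φ M) := by
    rw [← hr]
    exact (Equiv.addRight t).surjective.range_comp e
  have hpd : p ∉ chartDom (devAtlas Q Φ M) := by
    rintro ⟨l, hl, hx⟩
    obtain ⟨y, hy, -⟩ := hl.2 p hx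
    exact (D.ne y).1 hy
  have hqd : q ∉ chartDom (devAtlas Q Φ M) := by
    rintro ⟨l, hl, hx⟩
    obtain ⟨y, hy, -⟩ := hl.2 q hx
    exact (D.ne y).2 hy
  exact exists_model_isometry hgeo (fun l hl => hl.1) (D.isTranslationAtlas hu)
    (D.exists_isPole hM hp hq) (fun s => (he (s + t)).shift) hr' hφ.mem_atlas hψ.mem_atlas hp hq
    hpq hpd hqd ⟨hθ, hc, hnat⟩ ht

end Classification

/-- Classification of the surfaces with two cone points. -/
theorem Surface.exists_model {θ : Fin 2 → ℝ} (A : Surface θ) (h0 : 0 < θ 0) (h1 : 0 < θ 1) :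
    θ 1 = θ 0 ∧ ∃ c, ModelPar (θ 0) c ∧ ∃ F : RS ≃ₜ A.carrier, F ((0 : ℂ) : RS) = A.p 0 ∧
      F OnePoint.infty = A.p 1 ∧ (∀ x y, dist (F x) (F y) = confDist (density (θ 0) c) x y) ∧
      MDifferentiable 𝓘(ℂ) 𝓘(ℂ) F ∧ MDifferentiable 𝓘(ℂ) 𝓘(ℂ) F.symm := by
  obtain ⟨f⟩ := A.genus_zero
  have : CompactSpace A.carrier := f.symm.compactSpace
  obtain ⟨Q, Φ, g, D⟩ := A.exists_developing
  obtain ⟨w, hw⟩ := (A.cone 0).exists_isoChart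
  obtain ⟨w', hw'⟩ := (A.cone 1).exists_isoChart
  exact D.exists_model A.geodesic (A.p_injective.ne (by decide)) h0 h1 hw hw'

/-! ### Transport along isometries -/

section Transport

variable {θ : Fin 2 → ℝ} {A B : Surface θ} {m : ℕ} {l : ℝ} {D : A.carrier → S2}
  (f : A.carrier ≃ᵢ B.carrier) (hf : ∀ i, f (A.p i) = B.p i)
include hf

lemma Surface.local_isometry_comp
    (h : ∀ x, x ∉ Set.range A.p → ∃ r > 0, ∀ a ∈ Metric.ball x r, ∀ b ∈ Metric.ball x r,
      sphDist (D a) (D b) = dist a b) (x : B.carrier) (hx : x ∉ Set.range B.p) :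
    ∃ r > 0, ∀ a ∈ Metric.ball x r, ∀ b ∈ Metric.ball x r,
      sphDist ((D ∘ f.symm) a) ((D ∘ f.symm) b) = dist a b := by
  obtain ⟨r, hr, h1⟩ := h (f.symm x) (by
    rintro ⟨i, hi⟩
    exact hx ⟨i, by rw [← hf, hi, f.apply_symm_apply]⟩)
  have h2 : ∀ a ∈ Metric.ball x r, f.symm a ∈ Metric.ball (f.symm x) r := fun a ha => by
    rwa [Metric.mem_ball, f.symm.dist_eq]
  exact ⟨r, hr, fun a ha b hb => (h1 _ (h2 a ha) _ (h2 b hb)).trans (f.symm.dist_eq a b)⟩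

lemma Surface.IsBranchedCover.comp (h : A.IsBranchedCover m l D) :
    B.IsBranchedCover m l (D ∘ f.symm) := by
  have h1 : ∀ S : Set S2, D ∘ f.symm ⁻¹' S = f '' (D ⁻¹' S) := fun S => by
    rw [Set.preimage_comp]
    exact (f.toEquiv.image_eq_preimage_symm _).symm
  refine ⟨h.continuous.comp f.symm.continuous, ?_, ?_, ?_, fun y hy => ?_,
    Surface.local_isometry_comp f hf h.isometric⟩
  · rw [h1, h.fiber_zero, Set.image_singleton, hf]
  · rw [h1, h.fiber_one, Set.image_singleton, hf]
  · exact h.covering.comp_homeomorph f.symm.toHomeomorph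
  · rw [h1, Set.ncard_image_of_injective _ f.injective, h.sheets y hy]

lemma Surface.IsCyclicSlitGluing.comp (h : A.IsCyclicSlitGluing m l D) :
    B.IsCyclicSlitGluing m l (D ∘ f.symm) := by
  obtain ⟨⟨F, h1, h2, h3, h4, h5, h6⟩, h7⟩ := h
  refine ⟨⟨fun k x => f (F k x), fun k => f.continuous.comp (h1 k), fun a => ?_,
    fun k x k' x' => ?_, fun k x hx => ?_, fun k x hx hx' => ?_, fun k x => ?_⟩,
    Surface.local_isometry_comp f hf h7⟩
  · obtain ⟨k, x, h⟩ := h2 (f.symm a)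
    exact ⟨k, x, (congrArg f h).trans (f.apply_symm_apply a)⟩
  · rw [f.injective.eq_iff, h3]
  · exact (congrArg f (h4 k x hx)).trans (hf 0)
  · exact (congrArg f (h5 k x hx hx')).trans (hf 1)
  · rw [Function.comp_apply, f.symm_apply_apply, h6]

lemma Surface.IsFootball.of_isometry {α : ℝ} (h : A.IsFootball α) : B.IsFootball α := by
  obtain ⟨e, h0, h1, h2⟩ := h
  refine ⟨f.symm.toHomeomorph.trans e, ?_, ?_, fun x y => ?_⟩
  · change e (f.symm (B.p 0)) = _
    rw [← hf, f.symm_apply_apply, h0]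
  · change e (f.symm (B.p 1)) = _
    rw [← hf, f.symm_apply_apply, h1]
  · exact (f.symm.dist_eq x y).symm.trans (h2 _ _)

end Transport

/-! ### The moduli space -/

lemma Surface.exists_equivalent_model {θ : ℝ} (hθ : 0 < θ) (A : Surface ![θ, θ]) :
    ∃ c, ∃ h : ModelPar θ c, (modelSurface h).Equivalent A := by
  obtain ⟨-, c, h, F, h0, h1, hd, hF, hF'⟩ := A.exists_model hθ hθ
  exact ⟨c, h, ⟨F.toEquiv, Isometry.of_dist_eq hd⟩, hF, hF', fun i => by
    rcases Fin.exists_fin_two.1 ⟨i, rfl⟩ with rfl | rfl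
    exacts [h0, h1]⟩

lemma ModelPar.cot {m : ℕ} (hm : 2 ≤ m) (t : Set.Ioc (0 : ℝ) (π / 2)) :
    ModelPar m (Real.cot (2 * (t : ℝ) / 2)) := by
  refine ⟨by positivity, ?_, .inr ⟨m, rfl⟩⟩
  rw [mul_div_cancel_left₀ _ two_ne_zero, Real.cot_eq_cos_div_sin]
  exact div_nonneg (cos_nonneg_of_mem_Icc ⟨by linarith [t.2.1, pi_pos], t.2.2⟩)
    (sin_nonneg_of_mem_Icc ⟨t.2.1.le, by linarith [t.2.2, pi_pos]⟩)

lemma dist_of_equivalent_model {m : ℕ} (hm : 2 ≤ m) (t : Set.Ioc (0 : ℝ) (π / 2))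
    {A : Surface ![(m : ℝ), (m : ℝ)]} (h : (modelSurface (ModelPar.cot hm t)).Equivalent A) :
    dist (A.p 0) (A.p 1) = 2 * (t : ℝ) := by
  obtain ⟨f, -, -, hf⟩ := h
  rw [← hf, ← hf, f.dist_eq]
  exact (ModelPar.cot hm t).confDist_zero_infty (by linarith [t.2.1]) (by linarith [t.2.2])

lemma exists_equivalent_cot {m : ℕ} (hm : 2 ≤ m) (A : Surface ![(m : ℝ), (m : ℝ)]) :
    ∃ t : Set.Ioc (0 : ℝ) (π / 2), (modelSurface (ModelPar.cot hm t)).Equivalent A := by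
  obtain ⟨c, h, hA⟩ := A.exists_equivalent_model (by positivity)
  have h1 := arctan_nonneg.2 h.nonneg
  have h2 := arctan_lt_pi_div_two c
  -- The parameter t is the complement of arctan c: at most π/2 because c ≥ 0, and positive because
  -- arctan c < π/2.
  have h3 : c = Real.cot (2 * (π / 2 - arctan c) / 2) := by
    rw [mul_div_cancel_left₀ _ two_ne_zero, Real.cot_eq_cos_div_sin, cos_pi_div_two_sub,
      sin_pi_div_two_sub, ← tan_eq_sin_div_cos, tan_arctan]
  have key : ∀ c' (h' : ModelPar m c'), c = c' → (modelSurface h').Equivalent A := by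
    rintro _ _ rfl
    exact hA
  exact ⟨⟨π / 2 - arctan c, by linarith, by linarith⟩, key _ _ h3⟩

/-- The class of the surface whose cone points have distance `2 * t`. -/
def cotClass {m : ℕ} (hm : 2 ≤ m) (t : Set.Ioc (0 : ℝ) (π / 2)) : Msph ![(m : ℝ), (m : ℝ)] :=
  (modelSurface (ModelPar.cot hm t)).cls

lemma cotClass_eq_iff {m : ℕ} (hm : 2 ≤ m) {t : Set.Ioc (0 : ℝ) (π / 2)}
    {A : Surface ![(m : ℝ), (m : ℝ)]} :
    cotClass hm t = A.cls ↔ (modelSurface (ModelPar.cot hm t)).Equivalent A :=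
  Quotient.eq (r := Surface.setoid _)

/-- The distance of the cone points recovers `t`; surjectivity is the classification, every c ≥ 0
being the cotangent of some t in (0, π/2]. -/
lemma cotClass_bijective {m : ℕ} (hm : 2 ≤ m) : Function.Bijective (cotClass hm) := by
  refine ⟨fun t t' h => ?_, fun a => ?_⟩
  · have h1 := dist_of_equivalent_model hm t ((cotClass_eq_iff hm).1 h)
    have h2 := dist_of_equivalent_model hm t' ((cotClass_eq_iff hm).1 rfl)
    exact Subtype.ext (by linarith)
  · induction a using Quotient.ind with
    | _ A =>
      obtain ⟨t, ht⟩ := exists_equivalent_cot hm A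
      exact ⟨t, (cotClass_eq_iff hm).2 ht⟩

/-- The parameter c = cot t is continuous in t, and nearby parameters give Lipschitz-close models.
-/
lemma continuous_cotClass {m : ℕ} (hm : 2 ≤ m) : Continuous (cotClass hm) := by
  refine continuous_def.2 fun V hV => isOpen_iff_mem_nhds.2 fun t ht => ?_
  obtain ⟨ε, hε, h⟩ := hV _ ht
  have hsin : sin (2 * (t : ℝ) / 2) ≠ 0 :=
    (sin_pos_of_mem_Ioo ⟨by linarith [t.2.1], by linarith [t.2.2, pi_pos]⟩).ne'
  have hc : ContinuousAt (fun t' : Set.Ioc (0 : ℝ) (π / 2) => Real.cot (2 * (t' : ℝ) / 2)) t := by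
    simp only [Real.cot_eq_cos_div_sin]
    exact ContinuousAt.div (by fun_prop) (by fun_prop) hsin
  filter_upwards [Metric.tendsto_nhds.1 hc (ε / 2) (by positivity)] with t' ht'
  rw [Real.dist_eq] at ht'
  exact h _ (ModelPar.lipClose _ _ (by linarith))

/-- A label-preserving bi-Lipschitz map controls the distance 2t of the cone points, hence t. -/
lemma isOpenMap_cotClass {m : ℕ} (hm : 2 ≤ m) : IsOpenMap (cotClass hm) := by
  rintro U hU A ⟨t, ht, htA⟩
  obtain ⟨δ, hδ, hU⟩ := Metric.isOpen_iff.1 hU t ht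
  have h1 : 0 < δ / π := by positivity
  -- As t ≤ π/2, a relative error δ/π changes t by at most δ/2.
  refine ⟨log (1 + δ / π), log_pos (by linarith), fun B ⟨f, _, hf, hd⟩ => ?_⟩
  obtain ⟨t', ht'⟩ := exists_equivalent_cot hm B
  refine ⟨t', hU ?_, (cotClass_eq_iff hm).2 ht'⟩
  have h2 := hd (A.p 0) (A.p 1)
  rw [hf, hf, exp_log (by linarith), dist_of_equivalent_model hm t ((cotClass_eq_iff hm).1 htA),
    dist_of_equivalent_model hm t' ht'] at h2
  have h3 : ∀ s : Set.Ioc (0 : ℝ) (π / 2), δ / π * s ≤ δ / 2 := fun s =>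
    (mul_le_mul_of_nonneg_left s.2.2 h1.le).trans_eq (by field_simp)
  rw [Metric.mem_ball, Subtype.dist_eq, Real.dist_eq, abs_lt]
  constructor <;> linarith [h3 t, h3 t', h2.1, h2.2]

/-- The moduli space of the surfaces of angles `2πm` with two cone points. -/
def cotHomeo {m : ℕ} (hm : 2 ≤ m) : Set.Ioc (0 : ℝ) (π / 2) ≃ₜ Msph ![(m : ℝ), (m : ℝ)] :=
  (Equiv.ofBijective _ (cotClass_bijective hm)).toHomeomorphOfContinuousOpen
    (continuous_cotClass hm) (isOpenMap_cotClass hm)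

lemma modelSurface_isFootball_of_eq {θ c : ℝ} (h : ModelPar θ c) (hc : c = 0) :
    (modelSurface h).IsFootball θ := by
  subst hc
  exact modelSurface_isFootball h

end ConeSpherical

end

theorem mainTheorem7 :
    (∀ θ₁ θ₂ : ℝ, 0 < θ₁ → 0 < θ₂ → θ₁ ≠ 1 → θ₂ ≠ 1 → θ₁ ≠ θ₂ →
      IsEmpty (ConeSpherical.Msph ![θ₁, θ₂])) ∧
    (∀ θ : ℝ, 0 < θ → (∀ k : ℤ, θ ≠ k) →
      Nonempty (ConeSpherical.Msph ![θ, θ]) ∧ Subsingleton (ConeSpherical.Msph ![θ, θ]) ∧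
      ∀ A : ConeSpherical.Surface ![θ, θ], A.IsFootball θ) ∧
    (∀ m : ℕ, 2 ≤ m →
      ∃ Φ : Set.Ioc (0 : ℝ) (Real.pi / 2) ≃ₜ ConeSpherical.Msph ![(m : ℝ), (m : ℝ)],
        ∀ (t : Set.Ioc (0 : ℝ) (Real.pi / 2)) (A : ConeSpherical.Surface ![(m : ℝ), (m : ℝ)]),
          A.cls = Φ t →
            dist (A.p 0) (A.p 1) = 2 * (t : ℝ) ∧
            ∃ D : A.carrier → ConeSpherical.S2,
              A.IsBranchedCover m (2 * (t : ℝ)) D ∧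
              ((t : ℝ) < Real.pi / 2 → A.IsCyclicSlitGluing m (2 * (t : ℝ)) D) ∧
              ((t : ℝ) = Real.pi / 2 → A.IsFootball m)) := by
  refine ⟨fun θ₁ θ₂ h₁ h₂ _ _ hne => ⟨fun a => ?_⟩, fun θ hθ hint => ?_, fun m hm => ?_⟩
  · induction a using Quotient.ind with
    | _ A => exact hne (A.exists_model h₁ h₂).1.symm
  · have h0 : ConeSpherical.ModelPar θ 0 := ⟨hθ, le_rfl, .inl rfl⟩
    have h : ∀ A : ConeSpherical.Surface ![θ, θ],
        (ConeSpherical.modelSurface h0).Equivalent A := fun A => by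
      obtain ⟨c, h, hA⟩ := A.exists_equivalent_model hθ
      -- A nonzero parameter would make θ an integer.
      obtain rfl : c = 0 := h.int.resolve_right fun ⟨k, hk⟩ => hint k (by exact_mod_cast hk)
      exact hA
    refine ⟨⟨(ConeSpherical.modelSurface h0).cls⟩, ⟨fun a b => ?_⟩, fun A => ?_⟩
    · induction a using Quotient.ind with
      | _ A =>
        induction b using Quotient.ind with
        | _ B => exact (Quotient.sound (h A)).symm.trans (Quotient.sound (h B))
    · obtain ⟨f, -, -, hf⟩ := h A
      exact .of_isometry f hf (ConeSpherical.modelSurface_isFootball h0)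
  · refine ⟨ConeSpherical.cotHomeo hm, fun t A hA => ?_⟩
    have hA' := (ConeSpherical.cotClass_eq_iff hm).1 hA.symm
    refine ⟨ConeSpherical.dist_of_equivalent_model hm t hA', ?_⟩
    obtain ⟨f, -, -, hf⟩ := hA'
    have ht : 0 < 2 * (t : ℝ) := by linarith [t.2.1]
    refine ⟨_, .comp f hf (ConeSpherical.modelSurface_isBranchedCover (.cot hm t) ht
      (by linarith [t.2.2])), fun h => ?_, fun h => ?_⟩
    · exact .comp f hf (ConeSpherical.modelSurface_isCyclicSlitGluing ht (by linarith) _)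
    · refine .of_isometry f hf (ConeSpherical.modelSurface_isFootball_of_eq _ ?_)
      rw [h, mul_div_cancel_left₀ _ two_ne_zero, Real.cot_eq_cos_div_sin, Real.cos_pi_div_two,
        zero_div]
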